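/- **Weighted dynamic interval scheduling on multiple machines.** A job $j$ has a starting time $s_j\ge 0$, a length $l_j\ge 1$ and a reward $w_j\in[1,w]$, where $w\ge 1$ (all real numbers); it can only be processed during $[s_j,s_j+l_j)$. A schedule of a finite set $\mathcal J$ of jobs on $M$ machines assigns some of the jobs of $\mathcal J$ to machines so that each machine processes at most one job at any point in time; its reward is the sum of the rewards of the jobs that it processes. A schedule is $\alpha$-approximate if no schedule of $\mathcal J$ on $M$ machines has a reward of more than $\alpha$ times its reward. A fully dynamic $\alpha$-approximation algorithm starts with the empty set of jobs and serves an arbitrary sequence of requests: insertion of a job, deletion of a present job, and queries. After every sequence of requests it maintains an $\alpha$-approximate schedule of the set of present jobs. A query asks either for the total reward of the maintained schedule or whether (and on which machine) a given job is processed in it; queries do not change the maintained schedule and all of them are answered according to it. Running time is counted on a deterministic real RAM, whose unit-cost operations are memory access with indirect addressing, $+,-$ and comparison of natural numbers, and $+,-,\times,/$ and comparison of real numbers (no rounding). There are an absolute constant $C$ and a deterministic algorithm which, for all integers $M\ge 1$ and all reals $w\ge 1$ and $\varepsilon>0$ (given to it as parameters), is a fully dynamic $$\left(\frac{M^M}{M^M-(M-1)^M}\,(1+\varepsilon)\right)\text{-approximation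 algorithm}$$ for weighted interval scheduling on $M$ machines with rewards in $[1,w]$, such that, when $n$ jobs are present before the request, every update takes at most $$C\cdot M\,w\,\log(w+1)\,\log(n+2)\,\max\{1,\varepsilon^{-3}\}$$ steps and every query takes at most $C\log(n+2)$ steps, in the worst case. In particular, for $w\ge 2$, $n\ge 2$ and $\varepsilon\le 1$, the worst-case update time is $O\!\left(\frac{M w\log w\log n}{\varepsilon^{3}}\right)$ and the worst-case query time is $O(\log n)$. -/

import Mathlib

/-! ## Interval scheduling -/

/-- A job: it can only be processed during `[start, start + length)`, for the reward `weight`.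
The label `id` lets distinct jobs carry the same numerical data. -/
@[ext] structure Job where
  id : ℕ
  start : ℝ
  length : ℝ
  weight : ℝ

/-- Standing assumptions on jobs: `start ≥ 0`, `length ≥ 1`, and rewards in `[1, w]`. -/
def Job.Valid (w : ℝ) (j : Job) : Prop :=
  0 ≤ j.start ∧ 1 ≤ j.length ∧ 1 ≤ j.weight ∧ j.weight ≤ w

/-- `σ` schedules some of the jobs of `J` on `M` machines (`σ j = none`: job `j` is not
processed), and each machine processes at most one job at any point in time. -/
def IsSchedule {M : ℕ} (J : Finset Job) (σ : Job → Option (Fin M)) : Prop :=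
  (∀ j, σ j ≠ none → j ∈ J) ∧
  ∀ (m : Fin M) (t : ℝ),
    {j : Job | σ j = some m ∧ t ∈ Set.Ico j.start (j.start + j.length)}.Subsingleton

/-- The total reward of the jobs of `J` that `σ` processes. -/
noncomputable def reward {M : ℕ} (J : Finset Job) (σ : Job → Option (Fin M)) : ℝ :=
  ∑ j ∈ J with (σ j).isSome, j.weight

/-- `σ` is an `α`-approximate schedule: no schedule earns more than `α` times its reward. -/
def IsApproxSchedule {M : ℕ} (α : ℝ) (J : Finset Job) (σ : Job → Option (Fin M)) : Prop :=
  IsSchedule J σ ∧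
  ∀ τ : Job → Option (Fin M), IsSchedule J τ → reward J τ ≤ α * reward J σ

/-! ## Machine model

A real RAM in structured form. The memory has natural number registers and real registers, and
natural number arrays and real arrays (infinitely long, indexed by naturals computed at run time).
A program names finitely many registers and arrays. Naturals (addresses, counters) can be added,
subtracted and compared; reals can be added, subtracted, multiplied, divided and compared, but not
rounded. Each of these operations, each constant, each memory access, each assignment and each
branch costs one step. -/

structure Store where
  natReg : ℕ → ℕ
  realReg : ℕ → ℝ
  natArr : ℕ → ℕ → ℕ
  realArr : ℕ → ℕ → ℝ

inductive NatExpr where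
  | const (c : ℕ)
  | reg (x : ℕ)
  | get (a : ℕ) (i : NatExpr)
  | add (e f : NatExpr)
  /-- truncated subtraction -/
  | sub (e f : NatExpr)

def NatExpr.eval (s : Store) : NatExpr → ℕ
  | const c => c
  | reg x => s.natReg x
  | get a i => s.natArr a (i.eval s)
  | add e f => e.eval s + f.eval s
  | sub e f => e.eval s - f.eval s

def NatExpr.cost : NatExpr → ℕ
  | const _ => 1
  | reg _ => 1
  | get _ i => i.cost + 1
  | add e f => e.cost + f.cost + 1
  | sub e f => e.cost + f.cost + 1

inductive RealExpr where
  /-- a natural number as a real -/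
  | ofNat (e : NatExpr)
  | reg (x : ℕ)
  | get (a : ℕ) (i : NatExpr)
  | add (e f : RealExpr)
  | sub (e f : RealExpr)
  | mul (e f : RealExpr)
  | div (e f : RealExpr)

noncomputable def RealExpr.eval (s : Store) : RealExpr → ℝ
  | ofNat e => (e.eval s : ℝ)
  | reg x => s.realReg x
  | get a i => s.realArr a (i.eval s)
  | add e f => e.eval s + f.eval s
  | sub e f => e.eval s - f.eval s
  | mul e f => e.eval s * f.eval s
  | div e f => e.eval s / f.eval s

def RealExpr.cost : RealExpr → ℕ
  | ofNat e => e.cost + 1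
  | reg _ => 1
  | get _ i => i.cost + 1
  | add e f => e.cost + f.cost + 1
  | sub e f => e.cost + f.cost + 1
  | mul e f => e.cost + f.cost + 1
  | div e f => e.cost + f.cost + 1

inductive Test where
  | natLt (e f : NatExpr)
  | natEq (e f : NatExpr)
  | realLt (e f : RealExpr)
  | realEq (e f : RealExpr)
  | neg (b : Test)
  | conj (b c : Test)
  | disj (b c : Test)

def Test.Holds (s : Store) : Test → Prop
  | natLt e f => e.eval s < f.eval s
  | natEq e f => e.eval s = f.eval s
  | realLt e f => e.eval s < f.eval s
  | realEq e f => e.eval s = f.eval s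
  | neg b => ¬ b.Holds s
  | conj b c => b.Holds s ∧ c.Holds s
  | disj b c => b.Holds s ∨ c.Holds s

def Test.cost : Test → ℕ
  | natLt e f => e.cost + f.cost + 1
  | natEq e f => e.cost + f.cost + 1
  | realLt e f => e.cost + f.cost + 1
  | realEq e f => e.cost + f.cost + 1
  | neg b => b.cost + 1
  | conj b c => b.cost + c.cost + 1
  | disj b c => b.cost + c.cost + 1

inductive Program where
  | skip
  | setNat (x : ℕ) (e : NatExpr)
  | setReal (x : ℕ) (e : RealExpr)
  | putNat (a : ℕ) (i : NatExpr) (e : NatExpr)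
  | putReal (a : ℕ) (i : NatExpr) (e : RealExpr)
  | seq (p q : Program)
  | ite (b : Test) (p q : Program)
  | loop (b : Test) (p : Program)

/-- `Run p s s' t`: started on the memory `s`, the program `p` halts after exactly `t` steps and
leaves the memory `s'`. (`loop b p` repeats `p` as long as `b` holds.) -/
inductive Run : Program → Store → Store → ℕ → Prop
  | skip (s : Store) : Run .skip s s 1
  | setNat (s : Store) (x : ℕ) (e : NatExpr) :
      Run (.setNat x e) s
        { s with natReg := Function.update s.natReg x (e.eval s) } (e.cost + 1)
  | setReal (s : Store) (x : ℕ) (e : RealExpr) :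
      Run (.setReal x e) s
        { s with realReg := Function.update s.realReg x (e.eval s) } (e.cost + 1)
  | putNat (s : Store) (a : ℕ) (i : NatExpr) (e : NatExpr) :
      Run (.putNat a i e) s
        { s with natArr :=
            Function.update s.natArr a (Function.update (s.natArr a) (i.eval s) (e.eval s)) }
        (i.cost + e.cost + 1)
  | putReal (s : Store) (a : ℕ) (i : NatExpr) (e : RealExpr) :
      Run (.putReal a i e) s
        { s with realArr :=
            Function.update s.realArr a (Function.update (s.realArr a) (i.eval s) (e.eval s)) }
        (i.cost + e.cost + 1)
  | seq {p q : Program} {s s₁ s₂ : Store} {t u : ℕ} :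
      Run p s s₁ t → Run q s₁ s₂ u → Run (.seq p q) s s₂ (t + u)
  | iteTrue {b : Test} {p : Program} (q : Program) {s s₁ : Store} {t : ℕ} :
      b.Holds s → Run p s s₁ t → Run (.ite b p q) s s₁ (b.cost + t + 1)
  | iteFalse {b : Test} (p : Program) {q : Program} {s s₁ : Store} {t : ℕ} :
      ¬ b.Holds s → Run q s s₁ t → Run (.ite b p q) s s₁ (b.cost + t + 1)
  | loopDone {b : Test} (p : Program) {s : Store} :
      ¬ b.Holds s → Run (.loop b p) s s (b.cost + 1)
  | loopStep {b : Test} {p : Program} {s s₁ s₂ : Store} {t u : ℕ} :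
      b.Holds s → Run p s s₁ t → Run (.loop b p) s₁ s₂ u →
      Run (.loop b p) s s₂ (b.cost + t + u + 1)

/-- The machine is deterministic: the final memory and the number of steps are unique. -/
theorem Run.unique {p : Program} {s s₁ s₂ : Store} {t₁ t₂ : ℕ}
    (h₁ : Run p s s₁ t₁) (h₂ : Run p s s₂ t₂) : s₁ = s₂ ∧ t₁ = t₂ := by
  induction h₁ generalizing s₂ t₂ with
  | skip | setNat | setReal | putNat | putReal => cases h₂; exact ⟨rfl, rfl⟩
  | seq _ _ ih₁ ih₂ =>
    cases h₂ with
    | seq k₁ k₂ =>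
      obtain ⟨rfl, rfl⟩ := ih₁ k₁
      obtain ⟨rfl, rfl⟩ := ih₂ k₂
      exact ⟨rfl, rfl⟩
  | iteTrue _ hb _ ih =>
    cases h₂ with
    | iteTrue _ _ k => obtain ⟨rfl, rfl⟩ := ih k; exact ⟨rfl, rfl⟩
    | iteFalse _ hb' _ => exact absurd hb hb'
  | iteFalse _ hb _ ih =>
    cases h₂ with
    | iteTrue _ hb' _ => exact absurd hb' hb
    | iteFalse _ _ k => obtain ⟨rfl, rfl⟩ := ih k; exact ⟨rfl, rfl⟩
  | loopDone _ hb =>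
    cases h₂ with
    | loopDone _ _ => exact ⟨rfl, rfl⟩
    | loopStep hb' _ _ => exact absurd hb' hb
  | loopStep hb _ _ ih₁ ih₂ =>
    cases h₂ with
    | loopDone _ hb' => exact absurd hb hb'
    | loopStep _ k₁ k₂ =>
      obtain ⟨rfl, rfl⟩ := ih₁ k₁
      obtain ⟨rfl, rfl⟩ := ih₂ k₂
      exact ⟨rfl, rfl⟩

/-! ## Fully dynamic algorithms for interval scheduling -/

/-- The requests that a dynamic algorithm serves: two kinds of updates, and two kinds of queries
about the maintained schedule (is the job `j` processed, and on which machine; what is the total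
reward). -/
inductive Request where
  | insert (j : Job)
  | delete (j : Job)
  | lookup (j : Job)
  | total

def Request.IsUpdate : Request → Prop
  | insert _ => True
  | delete _ => True
  | lookup _ => False
  | total => False

open Classical in
/-- The set of jobs that is present after the given requests (latest request first), starting from
the empty set. -/
noncomputable def jobsAfter : List Request → Finset Job
  | [] => ∅
  | .insert j :: h => insert j (jobsAfter h)
  | .delete j :: h => (jobsAfter h).erase j
  | .lookup _ :: h => jobsAfter h
  | .total :: h => jobsAfter h

/-- The request is legal when the set of present jobs is `J`. -/
def Request.Legal (w : ℝ) (J : Finset Job) : Request → Prop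
  | insert j => j.Valid w ∧ j ∉ J
  | delete j => j ∈ J
  | lookup _ => True
  | total => True

/-- A sequence of requests (latest first) all of which are legal when they are made. -/
def LegalHistory (w : ℝ) : List Request → Prop
  | [] => True
  | r :: h => r.Legal w (jobsAfter h) ∧ LegalHistory w h

/-- A dynamic algorithm: one program for each kind of request. -/
structure DynamicAlgorithm where
  insertCode : Program
  deleteCode : Program
  lookupCode : Program
  totalCode : Program

def DynamicAlgorithm.code (A : DynamicAlgorithm) : Request → Program
  | .insert _ => A.insertCode
  | .delete _ => A.deleteCode
  | .lookup _ => A.lookupCode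
  | .total => A.totalCode

/-- The initial memory: it contains only the number of machines, the bound on the rewards and the
accuracy parameter. -/
noncomputable def initialStore (M : ℕ) (w ε : ℝ) : Store where
  natReg := Function.update (fun _ => 0) 1 M
  realReg := Function.update (Function.update (fun _ => 0) 3 w) 4 ε
  natArr := fun _ _ => 0
  realArr := fun _ _ => 0

/-- Write the data of a job to the input registers. -/
def Store.loadJob (s : Store) (j : Job) : Store :=
  { s with
    natReg := Function.update s.natReg 0 j.id
    realReg := Function.update (Function.update (Function.update s.realReg
      0 j.start) 1 j.length) 2 j.weight }

/-- The memory in which the program for a request is started. -/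
def Store.load (s : Store) : Request → Store
  | .insert j => s.loadJob j
  | .delete j => s.loadJob j
  | .lookup j => s.loadJob j
  | .total => s

/-- In the final memory `s` of a request, the output registers hold the right answer about the
schedule `σ` of the jobs `J`. The answer to `lookup j` is `0` if `j` is not processed and `m + 1`
if it is processed on machine `m`. -/
def CorrectAnswer {M : ℕ} (J : Finset Job) (σ : Job → Option (Fin M)) (s : Store) :
    Request → Prop
  | .insert _ => True
  | .delete _ => True
  | .lookup j => s.natReg 0 = (σ j).elim 0 (fun m => (m : ℕ) + 1)
  | .total => s.realReg 0 = reward J σ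

/-- Started on the empty set of jobs with parameters `M`, `w`, `ε`, the algorithm `A` maintains an
`α`-approximate schedule on `M` machines under every legal sequence of requests: `mem h` is the
memory and `sched h` is the maintained schedule after the requests `h`; queries do not change the
maintained schedule and are answered according to it. When `n` jobs are present, an update takes at
most `updateTime n` steps and a query at most `queryTime n` steps, in the worst case. -/
def DynamicAlgorithm.Maintains (A : DynamicAlgorithm) (M : ℕ) (w ε α : ℝ)
    (updateTime queryTime : ℕ → ℝ) : Prop :=
  ∃ (mem : List Request → Store) (sched : List Request → Job → Option (Fin M)),
    mem [] = initialStore M w ε ∧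
    (∀ h, LegalHistory w h → IsApproxSchedule α (jobsAfter h) (sched h)) ∧
    ∀ (r : Request) (h : List Request), LegalHistory w (r :: h) →
      (∃ t : ℕ, Run (A.code r) ((mem h).load r) (mem (r :: h)) t ∧
        (r.IsUpdate → (t : ℝ) ≤ updateTime (jobsAfter h).card) ∧
        (¬ r.IsUpdate → (t : ℝ) ≤ queryTime (jobsAfter h).card)) ∧
      (¬ r.IsUpdate → sched (r :: h) = sched h) ∧
      CorrectAnswer (jobsAfter h) (sched h) (mem (r :: h)) r

/-!
The algorithm keeps a set of *borders*, which cut the time axis into regions. No processed job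
crosses a border, so the regions can be treated separately. With `N = ⌈3 / ε⌉` and
`L = N * M * w`, the optimum of every region is at most `16 * L` and, unless it is the only one,
at least `L`.

*Approximation.* Three losses are multiplied.
* Jobs that cross a border cannot be used. At one point in time at most `M` jobs are processed, so
  a border costs at most `M * w`, which is at most a fraction `1 / N` of the optimum of the region
  before it (`opt_win_le_add`, `opt_add_le_of_regions`). This is a factor `1 + 1 / N`.
* Rewards are rounded to *class values*, whose consecutive quotients are at most `1 + 1 / N`
  (`mul_clsVal_succ_le`). This is a second factor `1 + 1 / N`.
* Inside a region the machines are filled one after the other, each with an optimal set (for the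
  rounded rewards) of the jobs that are left. One of the `M` machines of an optimal schedule earns
  at least `1 / M` of what is missing (`opt_le_of_chain`), so after `M` rounds at most the
  fraction `loss M = (1 - 1 / M) ^ M` of the optimum is missing (`wp_greedyProg`).

Together, `(1 + 1 / N) ^ 2 / (1 - loss M)` is at most the required ratio (`Sched.opt_le`,
`ratio_le`).

*One machine.* A dynamic program computes, for every integer `j`, the earliest time `F j` by which
jobs of total rounded reward `j` can be completed. For the last job of such a set there is one
candidate per class, the job that ends first among those that do not start before `F (j - v)`,
where `v` is the class value; it is found in the search tree of the class (`Table`,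
`wp_cellProg`). The table has about `N` times as many cells as the machine earns.

*Updates.* The only region that can contain the job is the one around its start. The two borders
of this region are removed, because its optimum may fall below `L`. The resulting *window*, whose
optimum is at most `51 * L`, is cleared and split into regions again (`Sched.split`,
`wp_splitProg`): the greedy algorithm runs on what is left of the window; if it earns more than
`4 * L`, then this schedule is discarded, and only an initial part is tried again, which is chosen
such that this part and the rest remain worth `L` (`wp_clearProg`); otherwise the schedule is
kept, and a border is put at the end of the part just scheduled. A potential, of the order of the
optimum of the window divided by `L`, shows that there is a bounded number of such steps.

*Time.* There are `O(N * log (w + 1))` classes (`classes_mul_log_le`), a search takes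
`O(log (n + 2))` steps (`EntryTree.height_le`), and the tables of a window have `O(N * L)` cells.
The product is of the order of `N ^ 3 * M * w * log (w + 1) * log (n + 2)` (`update_bound`).

*The program.* Times are stored as `-1 / (1 + t)`, which maps `[0, ∞)` increasingly to `[-1, 0)`.
Thus `0`, the content of memory that was never written, is a time after all others. The present
jobs, the borders, and their mirror images are *entries*, addressed by positive numbers. Sets of
entries are kept in balanced trees whose nodes are never overwritten: an operation allocates new
nodes, so what was stored in the heap stays valid (`Heap.Ext`). The tree `0` holds all jobs, `1`
the processed ones, `2` the borders, `3` the mirrored borders, and `4 + k` the unprocessed jobs of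
the class `k`. The correctness and the running time of a program are stated together by `wp`, and
structures named `…Frame` say which part of the memory a program leaves unchanged.

The memory is used as follows.
* Registers for natural numbers: `0` input and answer; `1` the number `M`; `2` the number of
  entries; `3` the number `N`; `4` the number of classes; `5` the current machine; `6`-`16` local
  variables; `17` and `18` the class and the address of the job of the request; `30`-`36` the
  dynamic program; `40`-`49` the trees (`40` the number of the tree, `41` the address of the
  entry); `50` the number of nodes.
* Registers for real numbers: `0`-`2` input; `3` the number `w`; `4` the number `ε`; `5` the total
  reward; `6` and `7` the part of the window that is treated; `8`-`16` local variables; `18` the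
  number `L`; `20` the start of the job of the request; `40` the time given to a search.
* Arrays of natural numbers: `0`-`4` the children, first entry, earliest ending entry and height
  of a node; `5` and `6` the stack of a descent; `7` the roots; `8`, `9` and `10` the identifier,
  class and machine of an entry; `11` the class values; `12` the choices of the dynamic program.
* Arrays of real numbers: `0`-`2` the start, end and reward of an entry; `3` the table `F`.
-/


set_option autoImplicit false
set_option linter.unusedSimpArgs false

/-! ### Weakest preconditions with time -/

/-- Started on `s`, the program `p` halts, and the final memory and the number of steps
satisfy `Q`. -/
def wp (p : Program) (s : Store) (Q : Store → ℕ → Prop) : Prop :=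
  ∃ s' t, Run p s s' t ∧ Q s' t

infixr:60 " ;; " => Program.seq

theorem wp.mono {p : Program} {s : Store} {Q Q' : Store → ℕ → Prop} (h : wp p s Q)
    (hQ : ∀ s' t, Q s' t → Q' s' t) : wp p s Q' := by
  obtain ⟨s', t, hr, hq⟩ := h
  exact ⟨s', t, hr, hQ _ _ hq⟩

@[simp] theorem wp_skip {s : Store} {Q : Store → ℕ → Prop} : wp .skip s Q ↔ Q s 1 :=
  ⟨fun ⟨_, _, h, hq⟩ => by cases h; exact hq, fun h => ⟨_, _, .skip s, h⟩⟩

@[simp] theorem wp_setNat {x : ℕ} {e : NatExpr} {s : Store} {Q : Store → ℕ → Prop} :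
    wp (.setNat x e) s Q ↔
      Q { s with natReg := Function.update s.natReg x (e.eval s) } (e.cost + 1) :=
  ⟨fun ⟨_, _, h, hq⟩ => by cases h; exact hq, fun h => ⟨_, _, .setNat s x e, h⟩⟩

@[simp] theorem wp_setReal {x : ℕ} {e : RealExpr} {s : Store} {Q : Store → ℕ → Prop} :
    wp (.setReal x e) s Q ↔
      Q { s with realReg := Function.update s.realReg x (e.eval s) } (e.cost + 1) :=
  ⟨fun ⟨_, _, h, hq⟩ => by cases h; exact hq, fun h => ⟨_, _, .setReal s x e, h⟩⟩

@[simp] theorem wp_putNat {a : ℕ} {i e : NatExpr} {s : Store} {Q : Store → ℕ → Prop} :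
    wp (.putNat a i e) s Q ↔
      Q { s with natArr :=
            Function.update s.natArr a (Function.update (s.natArr a) (i.eval s) (e.eval s)) }
        (i.cost + e.cost + 1) :=
  ⟨fun ⟨_, _, h, hq⟩ => by cases h; exact hq, fun h => ⟨_, _, .putNat s a i e, h⟩⟩

@[simp] theorem wp_putReal {a : ℕ} {i : NatExpr} {e : RealExpr} {s : Store}
    {Q : Store → ℕ → Prop} :
    wp (.putReal a i e) s Q ↔
      Q { s with realArr :=
            Function.update s.realArr a (Function.update (s.realArr a) (i.eval s) (e.eval s)) }
        (i.cost + e.cost + 1) :=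
  ⟨fun ⟨_, _, h, hq⟩ => by cases h; exact hq, fun h => ⟨_, _, .putReal s a i e, h⟩⟩

@[simp] theorem wp_seq {p q : Program} {s : Store} {Q : Store → ℕ → Prop} :
    wp (p ;; q) s Q ↔ wp p s fun s₁ t => wp q s₁ fun s₂ u => Q s₂ (t + u) :=
  ⟨fun ⟨_, _, h, hq⟩ => by cases h with | seq h₁ h₂ => exact ⟨_, _, h₁, _, _, h₂, hq⟩,
    fun ⟨_, _, h₁, _, _, h₂, hq⟩ => ⟨_, _, .seq h₁ h₂, hq⟩⟩

@[simp] theorem wp_ite {b : Test} {p q : Program} {s : Store} {Q : Store → ℕ → Prop} :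
    wp (.ite b p q) s Q ↔
      (b.Holds s → wp p s fun s' t => Q s' (b.cost + t + 1)) ∧
      (¬ b.Holds s → wp q s fun s' t => Q s' (b.cost + t + 1)) := by
  constructor
  · rintro ⟨s', t, h, hq⟩
    cases h with
    | iteTrue _ hb h => exact ⟨fun _ => ⟨_, _, h, hq⟩, fun hb' => absurd hb hb'⟩
    | iteFalse _ hb h => exact ⟨fun hb' => absurd hb' hb, fun _ => ⟨_, _, h, hq⟩⟩
  · rintro ⟨h₁, h₂⟩
    by_cases hb : b.Holds s
    · obtain ⟨s', t, h, hq⟩ := h₁ hb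
      exact ⟨_, _, .iteTrue _ hb h, hq⟩
    · obtain ⟨s', t, h, hq⟩ := h₂ hb
      exact ⟨_, _, .iteFalse _ hb h, hq⟩

attribute [simp] NatExpr.eval NatExpr.cost RealExpr.eval RealExpr.cost Test.Holds Test.cost

/-- Rule for loops. In `I n t s`, the number `n` is a variant, which decreases in each iteration,
and `t` is the number of steps since the loop was entered. -/
theorem wp_loop {b : Test} {p : Program} (I : ℕ → ℕ → Store → Prop)
    (hstep : ∀ n t s, I n t s → b.Holds s →
      wp p s fun s' t' => ∃ n' < n, I n' (t + (b.cost + t' + 1)) s')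
    {n : ℕ} {s : Store} (hI : I n 0 s) :
    wp (.loop b p) s fun s' T => ∃ n t, I n t s' ∧ ¬ b.Holds s' ∧ T = t + (b.cost + 1) := by
  suffices H : ∀ n t s, I n t s → ∃ s' u, Run (.loop b p) s s' u ∧
      ∃ n' t', I n' t' s' ∧ ¬ b.Holds s' ∧ t + u = t' + (b.cost + 1) by
    obtain ⟨s', u, hr, n', t', h₁, h₂, h₃⟩ := H n 0 s hI
    exact ⟨s', u, hr, n', t', h₁, h₂, by omega⟩
  intro n
  induction n using Nat.strong_induction_on with
  | _ n ih =>
    intro t s hI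
    by_cases hb : b.Holds s
    · obtain ⟨s₁, t₁, hr₁, n', hn', hI'⟩ := hstep n t s hI hb
      obtain ⟨s₂, u, hr₂, n₂, t₂, h₁, h₂, h₃⟩ := ih n' hn' _ _ hI'
      exact ⟨s₂, _, .loopStep hb hr₁ hr₂, n₂, t₂, h₁, h₂, by omega⟩
    · exact ⟨s, _, .loopDone _ hb, n, t, hI, hb, rfl⟩

/-! ### Height-balanced search trees -/

/-- An entry of the dictionaries: the interval `[s, e)` on an internal time scale, a weight and an
identifier. The number `idx` is the address of the entry in memory. -/
structure Entry where
  idx : ℕ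
  s : ℝ
  e : ℝ
  wt : ℝ
  id : ℕ

/-- Entries are ordered lexicographically; the starting time counts first. -/
noncomputable def Entry.key (r : Entry) : ℝ ×ₗ ℝ ×ₗ ℝ ×ₗ ℕ :=
  toLex (r.s, toLex (r.e, toLex (r.wt, r.id)))

theorem Entry.key_lt {r q : Entry} : r.key < q.key ↔
    r.s < q.s ∨ r.s = q.s ∧ (r.e < q.e ∨ r.e = q.e ∧
      (r.wt < q.wt ∨ r.wt = q.wt ∧ r.id < q.id)) := by
  simp [Entry.key, Prod.Lex.toLex_lt_toLex]

theorem Entry.key_eq {r q : Entry} : r.key = q.key ↔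
    r.s = q.s ∧ r.e = q.e ∧ r.wt = q.wt ∧ r.id = q.id := by
  simp [Entry.key]

theorem Entry.s_le_of_key_lt {r q : Entry} (h : r.key < q.key) : r.s ≤ q.s := by
  rw [Entry.key_lt] at h
  rcases h with h | h
  · exact h.le
  · exact h.1.le

/-- Binary trees with the entries at the leaves. -/
inductive EntryTree where
  | leaf (r : Entry)
  | node (l r : EntryTree)

namespace EntryTree

/-- The leftmost entry. -/
def lo : EntryTree → Entry
  | leaf r => r
  | node l _ => l.lo

open Classical in
/-- An entry that ends first. -/
noncomputable def best : EntryTree → Entry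
  | leaf r => r
  | node l r => if r.best.e < l.best.e then r.best else l.best

/-- The number of edges on a longest path from the root to a leaf. -/
def height : EntryTree → ℕ
  | leaf _ => 0
  | node l r => max l.height r.height + 1

/-- The entries from left to right. -/
def toList : EntryTree → List Entry
  | leaf r => [r]
  | node l r => l.toList ++ r.toList

/-- The height condition of AVL trees. -/
def Balanced : EntryTree → Prop
  | leaf _ => True
  | node l r => l.Balanced ∧ r.Balanced ∧ l.height ≤ r.height + 1 ∧ r.height ≤ l.height + 1

/-- The keys increase strictly from left to right. -/
def Sorted (t : EntryTree) : Prop := t.toList.Pairwise fun r q => r.key < q.key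

theorem sorted_node {l r : EntryTree} : (node l r).Sorted ↔
    l.Sorted ∧ r.Sorted ∧ ∀ x ∈ l.toList, ∀ y ∈ r.toList, x.key < y.key := by
  simp [Sorted, toList, List.pairwise_append]

theorem lo_mem (t : EntryTree) : t.lo ∈ t.toList := by
  induction t with
  | leaf r => simp [lo, toList]
  | node l r ihl _ => simp [lo, toList, ihl]

theorem best_mem (t : EntryTree) : t.best ∈ t.toList := by
  induction t with
  | leaf r => simp [best, toList]
  | node l r ihl ihr =>
    simp only [best, toList, List.mem_append]
    split_ifs
    · exact .inr ihr
    · exact .inl ihl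

theorem best_le {t : EntryTree} {r : Entry} (h : r ∈ t.toList) : t.best.e ≤ r.e := by
  induction t with
  | leaf q => simp [best, toList] at *; simp [h]
  | node l q ihl ihq =>
    simp only [best, toList, List.mem_append] at *
    split_ifs with hc
    · rcases h with h | h
      · exact hc.le.trans (ihl h)
      · exact ihq h
    · rcases h with h | h
      · exact ihl h
      · exact (not_lt.1 hc).trans (ihq h)

theorem lo_key_le {t : EntryTree} (ht : t.Sorted) {r : Entry} (h : r ∈ t.toList) :
    t.lo.key ≤ r.key := by
  induction t with
  | leaf q => simp [lo, toList] at *; simp [h]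
  | node l q ihl ihq =>
    rw [sorted_node] at ht
    simp only [lo, toList, List.mem_append] at *
    rcases h with h | h
    · exact ihl ht.1 h
    · exact (ht.2.2 _ l.lo_mem _ h).le

/-- A tree of height `h` has at least `2 ^ ⌈h / 2⌉` leaves: by the height condition, both subtrees
have a height of at least `h - 2`. -/
theorem two_pow_height_le {t : EntryTree} (h : t.Balanced) :
    2 ^ ((t.height + 1) / 2) ≤ t.toList.length := by
  induction t with
  | leaf r => simp [height, toList]
  | node l r ihl ihr =>
    obtain ⟨hl, hr, h₁, h₂⟩ := h
    have ihl := ihl hl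
    have ihr := ihr hr
    simp only [height, toList, List.length_append]
    have e₁ : 2 ^ ((max l.height r.height + 1 + 1) / 2) =
        2 * 2 ^ (max l.height r.height / 2) := by
      rw [← pow_succ']; congr 1; omega
    have e₂ : 2 ^ (max l.height r.height / 2) ≤ 2 ^ ((l.height + 1) / 2) :=
      Nat.pow_le_pow_right (by norm_num) (by omega)
    have e₃ : 2 ^ (max l.height r.height / 2) ≤ 2 ^ ((r.height + 1) / 2) :=
      Nat.pow_le_pow_right (by norm_num) (by omega)
    omega

theorem height_le {t : EntryTree} (h : t.Balanced) {Λ : ℕ} (hc : t.toList.length < 2 ^ Λ) :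
    t.height ≤ 2 * Λ := by
  have := (Nat.pow_lt_pow_iff_right (by norm_num : 1 < 2)).1 ((two_pow_height_le h).trans_lt hc)
  omega

/-- A node with the subtrees `l` and `r`, after the rotations that are needed when their heights
differ by two. -/
def balance (l r : EntryTree) : EntryTree :=
  if r.height + 1 < l.height then
    match l with
    | node x (node u v) =>
      if x.height < (node u v).height then node (node x u) (node v r)
      else node x (node (node u v) r)
    | node x (leaf y) => node x (node (leaf y) r)
    | leaf x => node (leaf x) r
  else if l.height + 1 < r.height then
    match r with
    | node (node u v) y =>
      if y.height < (node u v).height then node (node l u) (node v y)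
      else node (node l (node u v)) y
    | node (leaf x) y => node (node l (leaf x)) y
    | leaf x => node l (leaf x)
  else node l r

theorem toList_balance (l r : EntryTree) : (balance l r).toList = l.toList ++ r.toList := by
  unfold balance
  split_ifs
  · split
    · split_ifs <;> simp [toList]
    · simp [toList]
    · simp [toList]
  · split
    · split_ifs <;> simp [toList]
    · simp [toList]
    · simp [toList]
  · simp [toList]

/-- A difference of at most two between the heights is repaired, and the height of the result
differs by at most one from that of the plain join. This is what makes the repair along a path work.
-/
theorem balanced_balance {l r : EntryTree} (hl : l.Balanced) (hr : r.Balanced)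
    (h₁ : l.height ≤ r.height + 2) (h₂ : r.height ≤ l.height + 2) :
    (balance l r).Balanced ∧ max l.height r.height ≤ (balance l r).height ∧
      (balance l r).height ≤ max l.height r.height + 1 ∧
      (l.height ≤ r.height + 1 → r.height ≤ l.height + 1 →
        (balance l r).height = max l.height r.height + 1) := by
  unfold balance
  split_ifs with c₁ c₂
  · split
    · split_ifs <;> grind [Balanced, height]
    · grind [Balanced, height]
    · grind [height]
  · split
    · split_ifs <;> grind [Balanced, height]
    · grind [Balanced, height]
    · grind [height]
  · grind [Balanced, height]

/-- A path in a tree, from the bottom to the top. The Boolean tells whether the path turns left,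
and is followed by the other subtree. -/
abbrev Path := List (Bool × EntryTree)

/-- The tree with the path `P` that has `t` at its lower end. -/
def plug : Path → EntryTree → EntryTree
  | [], t => t
  | (true, q) :: P, t => plug P (node t q)
  | (false, q) :: P, t => plug P (node q t)

/-- The same with rebalancing. -/
def rebuild : Path → EntryTree → EntryTree
  | [], t => t
  | (true, q) :: P, t => rebuild P (balance t q)
  | (false, q) :: P, t => rebuild P (balance q t)

/-- The entries to the left of a path. -/
def before : Path → List Entry
  | [] => []
  | (true, _) :: P => before P
  | (false, q) :: P => before P ++ q.toList

/-- The entries to the right of a path. -/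
def after : Path → List Entry
  | [] => []
  | (true, q) :: P => q.toList ++ after P
  | (false, _) :: P => after P

theorem toList_plug (P : Path) (t : EntryTree) :
    (plug P t).toList = before P ++ t.toList ++ after P := by
  induction P generalizing t with
  | nil => simp [plug, before, after]
  | cons a P ih => obtain ⟨b, q⟩ := a; cases b <;> simp [plug, before, after, ih, toList]

theorem toList_rebuild (P : Path) (t : EntryTree) :
    (rebuild P t).toList = before P ++ t.toList ++ after P := by
  induction P generalizing t with
  | nil => simp [rebuild, before, after]
  | cons a P ih =>
    obtain ⟨b, q⟩ := a; cases b <;> simp [rebuild, before, after, ih, toList_balance]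

theorem Balanced.of_plug {P : Path} {t : EntryTree} (h : (plug P t).Balanced) : t.Balanced := by
  induction P generalizing t with
  | nil => exact h
  | cons a P ih =>
    obtain ⟨b, q⟩ := a
    cases b
    · exact (ih h).2.1
    · exact (ih h).1

/-- When the lower end of a path changes its height by at most one, rebalancing along the path
restores the height condition. This covers insertions and deletions alike. -/
theorem balanced_rebuild {P : Path} {t t' : EntryTree} (h : (plug P t).Balanced)
    (ht' : t'.Balanced) (h₁ : t.height ≤ t'.height + 1) (h₂ : t'.height ≤ t.height + 1) :
    (rebuild P t').Balanced := by
  induction P generalizing t t' with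
  | nil => exact ht'
  | cons a P ih =>
    obtain ⟨b, q⟩ := a
    cases b
    · have hb : (node q t).Balanced := Balanced.of_plug (P := P) h
      obtain ⟨k₁, k₂, k₃, k₄⟩ := hb
      -- one level up, the heights again differ by at most one, so the induction goes through
      obtain ⟨b₁, b₂, b₃, b₄⟩ := balanced_balance k₁ ht' (by omega) (by omega)
      refine ih h b₁ ?_ ?_ <;> simp only [height] <;> omega
    · have hb : (node t q).Balanced := Balanced.of_plug (P := P) h
      obtain ⟨k₁, k₂, k₃, k₄⟩ := hb
      obtain ⟨b₁, b₂, b₃, b₄⟩ := balanced_balance ht' k₂ (by omega) (by omega)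
      refine ih h b₁ ?_ ?_ <;> simp only [height] <;> omega

theorem length_path_le (P : Path) (t : EntryTree) : P.length ≤ (plug P t).height := by
  suffices H : P.length + t.height ≤ (plug P t).height by omega
  induction P generalizing t with
  | nil => simp [plug]
  | cons a P ih =>
    obtain ⟨b, q⟩ := a
    cases b
    · have := ih (node q t); simp only [plug, List.length_cons, height] at *; omega
    · have := ih (node t q); simp only [plug, List.length_cons, height] at *; omega

end EntryTree

/-! ### Search trees in memory -/

/-- The part of the memory that holds the entries and the nodes of the search trees. Entries and
nodes are allocated one after the other and never change afterwards: `rnext` and `next` are the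
last addresses in use. The address `0` stands for the empty tree and for no entry. The
array `root` holds the addresses of the roots of the trees. -/
structure Heap where
  next : ℕ
  rnext : ℕ
  left : ℕ → ℕ
  right : ℕ → ℕ
  lo : ℕ → ℕ
  best : ℕ → ℕ
  ht : ℕ → ℕ
  root : ℕ → ℕ
  rid : ℕ → ℕ
  rs : ℕ → ℝ
  re : ℕ → ℝ
  rw : ℕ → ℝ

@[simp] def Store.heap (s : Store) : Heap where
  next := s.natReg 50
  rnext := s.natReg 2
  left := s.natArr 0
  right := s.natArr 1
  lo := s.natArr 2
  best := s.natArr 3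
  ht := s.natArr 4
  root := s.natArr 7
  rid := s.natArr 8
  rs := s.realArr 0
  re := s.realArr 1
  rw := s.realArr 2

/-- The entry `r` is stored at its address. -/
structure EntryAt (H : Heap) (r : Entry) : Prop where
  pos : 1 ≤ r.idx
  le : r.idx ≤ H.rnext
  rs : H.rs r.idx = r.s
  re : H.re r.idx = r.e
  rw : H.rw r.idx = r.wt
  rid : H.rid r.idx = r.id

theorem EntryAt.eq_of_idx {H : Heap} {r q : Entry} (hr : EntryAt H r) (hq : EntryAt H q)
    (h : r.idx = q.idx) : r = q := by
  obtain ⟨_, _, a₁, a₂, a₃, a₄⟩ := hr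
  obtain ⟨_, _, b₁, b₂, b₃, b₄⟩ := hq
  cases r; cases q
  simp_all

/-- The heap `H'` contains all entries and nodes of `H`. -/
structure Heap.Ext (H H' : Heap) : Prop where
  next : H.next ≤ H'.next
  rnext : H.rnext ≤ H'.rnext
  left : ∀ p ≤ H.next, H'.left p = H.left p
  right : ∀ p ≤ H.next, H'.right p = H.right p
  lo : ∀ p ≤ H.next, H'.lo p = H.lo p
  best : ∀ p ≤ H.next, H'.best p = H.best p
  ht : ∀ p ≤ H.next, H'.ht p = H.ht p
  rid : ∀ i ≤ H.rnext, H'.rid i = H.rid i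
  rs : ∀ i ≤ H.rnext, H'.rs i = H.rs i
  re : ∀ i ≤ H.rnext, H'.re i = H.re i
  rw : ∀ i ≤ H.rnext, H'.rw i = H.rw i

theorem Heap.Ext.refl (H : Heap) : H.Ext H := by constructor <;> simp

theorem Heap.Ext.trans {H₁ H₂ H₃ : Heap} (h : H₁.Ext H₂) (k : H₂.Ext H₃) : H₁.Ext H₃ := by
  have h₁ := h.next
  have h₂ := h.rnext
  constructor
  · exact h.next.trans k.next
  · exact h.rnext.trans k.rnext
  · exact fun p hp => (k.left p (by omega)).trans (h.left p hp)
  · exact fun p hp => (k.right p (by omega)).trans (h.right p hp)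
  · exact fun p hp => (k.lo p (by omega)).trans (h.lo p hp)
  · exact fun p hp => (k.best p (by omega)).trans (h.best p hp)
  · exact fun p hp => (k.ht p (by omega)).trans (h.ht p hp)
  · exact fun p hp => (k.rid p (by omega)).trans (h.rid p hp)
  · exact fun p hp => (k.rs p (by omega)).trans (h.rs p hp)
  · exact fun p hp => (k.re p (by omega)).trans (h.re p hp)
  · exact fun p hp => (k.rw p (by omega)).trans (h.rw p hp)

theorem EntryAt.ext {H H' : Heap} {r : Entry} (h : EntryAt H r) (hE : H.Ext H') :
    EntryAt H' r where
  pos := h.pos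
  le := h.le.trans hE.rnext
  rs := (hE.rs _ h.le).trans h.rs
  re := (hE.re _ h.le).trans h.re
  rw := (hE.rw _ h.le).trans h.rw
  rid := (hE.rid _ h.le).trans h.rid

/-- The node at the address `p` is the root of the tree `t`. -/
def TreeAt (H : Heap) : ℕ → EntryTree → Prop
  | p, .leaf r => 1 ≤ p ∧ p ≤ H.next ∧ H.left p = 0 ∧ H.lo p = r.idx ∧ H.best p = r.idx ∧
      H.ht p = 0 ∧ EntryAt H r
  | p, .node l r => 1 ≤ p ∧ p ≤ H.next ∧ H.lo p = l.lo.idx ∧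
      H.best p = (EntryTree.node l r).best.idx ∧ H.ht p = (EntryTree.node l r).height ∧
      TreeAt H (H.left p) l ∧ TreeAt H (H.right p) r

theorem TreeAt.ext {H H' : Heap} (hE : H.Ext H') {p : ℕ} {t : EntryTree} (h : TreeAt H p t) :
    TreeAt H' p t := by
  induction t generalizing p with
  | leaf r =>
    obtain ⟨h₁, h₂, h₃, h₄, h₅, h₆, h₇⟩ := h
    exact ⟨h₁, h₂.trans hE.next, by rw [hE.left p h₂, h₃], by rw [hE.lo p h₂, h₄],
      by rw [hE.best p h₂, h₅], by rw [hE.ht p h₂, h₆], h₇.ext hE⟩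
  | node l r ihl ihr =>
    obtain ⟨h₁, h₂, h₃, h₄, h₅, h₆, h₇⟩ := h
    exact ⟨h₁, h₂.trans hE.next, by rw [hE.lo p h₂, h₃], by rw [hE.best p h₂, h₄],
      by rw [hE.ht p h₂, h₅], by rw [hE.left p h₂]; exact ihl h₆,
      by rw [hE.right p h₂]; exact ihr h₇⟩

namespace TreeAt

variable {H : Heap} {p : ℕ} {t : EntryTree}

theorem pos (h : TreeAt H p t) : 1 ≤ p := by cases t <;> exact h.1

theorem le_next (h : TreeAt H p t) : p ≤ H.next := by cases t <;> exact h.2.1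

theorem lo_eq (h : TreeAt H p t) : H.lo p = t.lo.idx := by
  cases t
  · exact h.2.2.2.1
  · exact h.2.2.1

theorem best_eq (h : TreeAt H p t) : H.best p = t.best.idx := by
  cases t
  · exact h.2.2.2.2.1
  · exact h.2.2.2.1

theorem ht_eq (h : TreeAt H p t) : H.ht p = t.height := by
  cases t
  · exact h.2.2.2.2.2.1
  · exact h.2.2.2.2.1

theorem entryAt (h : TreeAt H p t) {r : Entry} (hr : r ∈ t.toList) : EntryAt H r := by
  induction t generalizing p with
  | leaf q => simp only [EntryTree.toList, List.mem_singleton] at hr; subst hr; exact h.2.2.2.2.2.2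
  | node l q ihl ihq =>
    simp only [EntryTree.toList, List.mem_append] at hr
    rcases hr with hr | hr
    · exact ihl h.2.2.2.2.2.1 hr
    · exact ihq h.2.2.2.2.2.2 hr

theorem lo_at (h : TreeAt H p t) : EntryAt H t.lo := h.entryAt t.lo_mem

theorem best_at (h : TreeAt H p t) : EntryAt H t.best := h.entryAt t.best_mem

end TreeAt

/-- What the programs on trees leave unchanged: the registers below `n`, and all arrays other than
those of the trees. -/
structure Frame (n : ℕ) (s s' : Store) : Prop where
  nat : ∀ x < n, s'.natReg x = s.natReg x
  real : s'.realReg = s.realReg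
  natArr : ∀ a, 8 ≤ a → s'.natArr a = s.natArr a
  realArr : s'.realArr = s.realArr

theorem Frame.refl (n : ℕ) (s : Store) : Frame n s s := ⟨by simp, rfl, by simp, rfl⟩

theorem Frame.trans {n : ℕ} {s₁ s₂ s₃ : Store} (h : Frame n s₁ s₂) (k : Frame n s₂ s₃) :
    Frame n s₁ s₃ :=
  ⟨fun x hx => (k.nat x hx).trans (h.nat x hx), k.real.trans h.real,
    fun a ha => (k.natArr a ha).trans (h.natArr a ha), k.realArr.trans h.realArr⟩

/-- Allocate a node with the subtrees in the registers `a` and `b`; its address goes to `o`. -/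
def mkNode (a b o : ℕ) : Program :=
  .setNat 50 (.add (.reg 50) (.const 1)) ;;
  .putNat 0 (.reg 50) (.reg a) ;;
  .putNat 1 (.reg 50) (.reg b) ;;
  .putNat 2 (.reg 50) (.get 2 (.reg a)) ;;
  .ite (.realLt (.get 1 (.get 3 (.reg b))) (.get 1 (.get 3 (.reg a))))
    (.putNat 3 (.reg 50) (.get 3 (.reg b)))
    (.putNat 3 (.reg 50) (.get 3 (.reg a))) ;;
  .ite (.natLt (.get 4 (.reg a)) (.get 4 (.reg b)))
    (.putNat 4 (.reg 50) (.add (.get 4 (.reg b)) (.const 1)))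
    (.putNat 4 (.reg 50) (.add (.get 4 (.reg a)) (.const 1))) ;;
  .setNat o (.reg 50)

/-- Allocate a leaf for the entry whose address is in register `41`. -/
def mkLeaf (o : ℕ) : Program :=
  .setNat 50 (.add (.reg 50) (.const 1)) ;;
  .putNat 0 (.reg 50) (.const 0) ;;
  .putNat 2 (.reg 50) (.reg 41) ;;
  .putNat 3 (.reg 50) (.reg 41) ;;
  .putNat 4 (.reg 50) (.const 0) ;;
  .setNat o (.reg 50)

/-- The effect of allocating a tree node for the tree `t` and storing its address in `o`. -/
structure Alloc (o : ℕ) (t : EntryTree) (s s' : Store) : Prop where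
  treeAt : TreeAt s'.heap (s'.natReg o) t
  ext : s.heap.Ext s'.heap
  nat : ∀ x, x ≠ o → x ≠ 50 → s'.natReg x = s.natReg x
  real : s'.realReg = s.realReg
  natArr : ∀ a, 5 ≤ a → s'.natArr a = s.natArr a
  realArr : s'.realArr = s.realArr

theorem wp_mkNode {a b o : ℕ} (ha : a ≠ 50) (hb : b ≠ 50) (ho : o ≠ 2) (ho' : o ≠ 50)
    {s : Store} {l r : EntryTree}
    (hl : TreeAt s.heap (s.natReg a) l) (hr : TreeAt s.heap (s.natReg b) r) :
    wp (mkNode a b o) s fun s' t => Alloc o (.node l r) s s' ∧ t ≤ 60 := by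
  have la := hl.le_next
  have lb := hr.le_next
  have na : s.natReg a ≠ s.natReg 50 + 1 := by simp at la; omega
  have nb : s.natReg b ≠ s.natReg 50 + 1 := by simp at lb; omega
  have e₁ := hl.lo_eq
  have e₂ := hl.best_eq
  have e₃ := hl.ht_eq
  have e₄ := hr.best_eq
  have e₅ := hr.ht_eq
  have e₆ := hl.best_at.re
  have e₇ := hr.best_at.re
  simp only [Store.heap] at e₁ e₂ e₃ e₄ e₅ e₆ e₇
  simp only [mkNode, wp_seq, wp_setNat, wp_putNat, wp_ite, NatExpr.eval, NatExpr.cost, Test.Holds,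
    Test.cost, RealExpr.eval, RealExpr.cost, Function.update_self, ne_eq, ha, hb, na, nb,
    not_false_eq_true, Function.update_of_ne, e₁, e₂, e₃, e₄, e₅, e₆, e₇, Nat.reduceEqDiff,
    one_ne_zero, OfNat.ofNat_ne_zero, OfNat.ofNat_ne_one]
  have key : ∀ s' : Store, s'.natReg = Function.update (Function.update s.natReg 50
      (s.natReg 50 + 1)) o (s.natReg 50 + 1) → s'.realReg = s.realReg → s'.realArr = s.realArr →
      (∀ a, 5 ≤ a → s'.natArr a = s.natArr a) →
      s'.natArr 0 = Function.update (s.natArr 0) (s.natReg 50 + 1) (s.natReg a) →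
      s'.natArr 1 = Function.update (s.natArr 1) (s.natReg 50 + 1) (s.natReg b) →
      s'.natArr 2 = Function.update (s.natArr 2) (s.natReg 50 + 1) l.lo.idx →
      s'.natArr 3 = Function.update (s.natArr 3) (s.natReg 50 + 1)
        (EntryTree.node l r).best.idx →
      s'.natArr 4 = Function.update (s.natArr 4) (s.natReg 50 + 1)
        (EntryTree.node l r).height → Alloc o (.node l r) s s' := by
    intro s' h₁ h₂ h₃ h₄ h₅ h₆ h₇ h₈ h₉
    have hE : s.heap.Ext s'.heap := by
      constructor <;> simp only [Store.heap]
      · simp [h₁, Function.update_of_ne ho'.symm]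
      · simp [h₁, Function.update_of_ne ho.symm]
      all_goals intro p hp
      · rw [h₅, Function.update_of_ne (by omega)]
      · rw [h₆, Function.update_of_ne (by omega)]
      · rw [h₇, Function.update_of_ne (by omega)]
      · rw [h₈, Function.update_of_ne (by omega)]
      · rw [h₉, Function.update_of_ne (by omega)]
      · rw [h₄ 8 (by norm_num)]
      all_goals rw [h₃]
    refine ⟨?_, hE, ?_, h₂, h₄, h₃⟩
    · have hn : s'.natReg o = s.natReg 50 + 1 := by simp [h₁]
      rw [hn]
      refine ⟨by simp, ?_, ?_, ?_, ?_, ?_, ?_⟩ <;> simp only [Store.heap]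
      · simp [h₁, Function.update_of_ne ho'.symm]
      · simp [h₇]
      · simp [h₈]
      · simp [h₉]
      · have := hl.ext hE
        rwa [← Function.update_self (s.natReg 50 + 1) (s.natReg a) (s.natArr 0), ← h₅] at this
      · have := hr.ext hE
        rwa [← Function.update_self (s.natReg 50 + 1) (s.natReg b) (s.natArr 1), ← h₆] at this
    · intro x hx hx'
      simp [h₁, hx, hx']
  have kb : (EntryTree.node l r).best.idx =
    if r.best.e < l.best.e then r.best.idx else l.best.idx := by
      simp only [EntryTree.best]; split_ifs <;> rfl
  have kh : (EntryTree.node l r).height = if l.height < r.height then r.height + 1 else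
    l.height + 1 := by simp only [EntryTree.height]; split_ifs <;> omega
  rw [kb, kh] at key
  refine ⟨fun c₁ => ⟨fun c₂ => ?_, fun c₂ => ?_⟩, fun c₁ => ⟨fun c₂ => ?_, fun c₂ => ?_⟩⟩ <;>
  · refine ⟨key _ rfl rfl rfl ?_ ?_ ?_ ?_ ?_ ?_, by norm_num⟩
    · intro a ha
      dsimp only
      rw [Function.update_of_ne (by omega), Function.update_of_ne (by omega),
        Function.update_of_ne (by omega), Function.update_of_ne (by omega),
        Function.update_of_ne (by omega)]
    all_goals simp [c₁, c₂]

theorem wp_mkLeaf {o : ℕ} (ho : o ≠ 2) (ho' : o ≠ 50) {s : Store} {r : Entry}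
    (hr : EntryAt s.heap r) (h41 : s.natReg 41 = r.idx) :
    wp (mkLeaf o) s fun s' t => Alloc o (.leaf r) s s' ∧ t ≤ 30 := by
  simp only [mkLeaf, wp_seq, wp_setNat, wp_putNat, NatExpr.eval, NatExpr.cost]
  refine ⟨?_, by norm_num⟩
  have hE : s.heap.Ext { s with
      natReg := Function.update (Function.update s.natReg 50 (s.natReg 50 + 1)) o
        (s.natReg 50 + 1)
      natArr := Function.update (Function.update (Function.update (Function.update s.natArr
        0 (Function.update (s.natArr 0) (s.natReg 50 + 1) 0))
        2 (Function.update (s.natArr 2) (s.natReg 50 + 1) r.idx))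
        3 (Function.update (s.natArr 3) (s.natReg 50 + 1) r.idx))
        4 (Function.update (s.natArr 4) (s.natReg 50 + 1) 0) }.heap := by
    constructor <;> simp [ho.symm, ho'.symm]
    all_goals
      intro p hp
      rw [Function.update_of_ne (by omega)]
  refine ⟨?_, ?_, ?_, rfl, ?_, rfl⟩
  · refine ⟨?_, ?_, ?_, ?_, ?_, ?_, ?_⟩
    all_goals simp [h41, ho'.symm]
    have := hr.ext hE
    simpa [ho'.symm] using this
  · simpa [h41] using hE
  · intro x hx hx'
    simp [hx, hx']
  · intro a ha
    dsimp only
    rw [Function.update_of_ne (by omega), Function.update_of_ne (by omega),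
      Function.update_of_ne (by omega), Function.update_of_ne (by omega)]

/-- Rebalance the node whose subtrees are in the registers `44` and `45`; the address of the
resulting tree goes to the register `42`. -/
def balanceProg : Program :=
  .ite (.natLt (.add (.get 4 (.reg 45)) (.const 1)) (.get 4 (.reg 44)))
    (.setNat 46 (.get 0 (.reg 44)) ;; .setNat 47 (.get 1 (.reg 44)) ;;
      .ite (.natLt (.get 4 (.reg 46)) (.get 4 (.reg 47)))
        (.setNat 48 (.get 0 (.reg 47)) ;; .setNat 49 (.get 1 (.reg 47)) ;;
          mkNode 46 48 46 ;; mkNode 49 45 47 ;; mkNode 46 47 42)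
        (mkNode 47 45 47 ;; mkNode 46 47 42))
    (.ite (.natLt (.add (.get 4 (.reg 44)) (.const 1)) (.get 4 (.reg 45)))
      (.setNat 46 (.get 0 (.reg 45)) ;; .setNat 47 (.get 1 (.reg 45)) ;;
        .ite (.natLt (.get 4 (.reg 47)) (.get 4 (.reg 46)))
          (.setNat 48 (.get 0 (.reg 46)) ;; .setNat 49 (.get 1 (.reg 46)) ;;
            mkNode 44 48 46 ;; mkNode 49 47 47 ;; mkNode 46 47 42)
          (mkNode 44 46 46 ;; mkNode 46 47 42))
      (mkNode 44 45 42))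

/-- The effect of a program that computes the tree `t` in the register `42`, working with the
registers from `44` on. -/
structure Built (t : EntryTree) (s s' : Store) : Prop where
  treeAt : TreeAt s'.heap (s'.natReg 42) t
  ext : s.heap.Ext s'.heap
  nat : ∀ x, x < 44 → x ≠ 42 → s'.natReg x = s.natReg x
  real : s'.realReg = s.realReg
  natArr : ∀ a, 5 ≤ a → s'.natArr a = s.natArr a
  realArr : s'.realArr = s.realArr

theorem Alloc.built {t : EntryTree} {s s₀ s' : Store} (h : Alloc 42 t s s')
    (hE : s₀.heap.Ext s.heap) (hn : ∀ x, x < 44 → x ≠ 42 → s.natReg x = s₀.natReg x)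
    (hr : s.realReg = s₀.realReg) (ha : ∀ a, 5 ≤ a → s.natArr a = s₀.natArr a)
    (hra : s.realArr = s₀.realArr) : Built t s₀ s' :=
  ⟨h.treeAt, hE.trans h.ext,
    fun x hx hx' => (h.nat x hx' (by omega)).trans (hn x hx hx'), h.real.trans hr,
    fun a h5 => (h.natArr a h5).trans (ha a h5), h.realArr.trans hra⟩

/-- Three allocations in a row, the last of which joins the results of the others. -/
theorem wp_mkNode_three {a b c d : ℕ} (ha : a ≠ 50) (hb : b ≠ 50) (hc : c ≠ 50) (hd : d ≠ 50)
    (hc' : c ≠ 46) (hd' : d ≠ 46)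
    {s : Store} {x u v y : EntryTree} (hx : TreeAt s.heap (s.natReg a) x)
    (hu : TreeAt s.heap (s.natReg b) u) (hv : TreeAt s.heap (s.natReg c) v)
    (hy : TreeAt s.heap (s.natReg d) y) :
    wp (mkNode a b 46 ;; mkNode c d 47 ;; mkNode 46 47 42) s fun s' t =>
      Built (.node (.node x u) (.node v y)) s s' ∧ t ≤ 180 := by
  simp only [wp_seq]
  refine (wp_mkNode ha hb (by norm_num) (by norm_num) hx hu).mono ?_
  rintro s₁ t₁ ⟨h₁, ht₁⟩
  refine (wp_mkNode hc hd (by norm_num) (by norm_num) (l := v) (r := y) ?_ ?_).mono ?_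
  · rw [h₁.nat c hc' hc]; exact hv.ext h₁.ext
  · rw [h₁.nat d hd' hd]; exact hy.ext h₁.ext
  rintro s₂ t₂ ⟨h₂, ht₂⟩
  refine (wp_mkNode (by norm_num) (by norm_num) (by norm_num) (by norm_num)
    (l := .node x u) ?_ h₂.treeAt).mono ?_
  · rw [h₂.nat 46 (by norm_num) (by norm_num)]; exact h₁.treeAt.ext h₂.ext
  rintro s₃ t₃ ⟨h₃, ht₃⟩
  refine ⟨h₃.built (h₁.ext.trans h₂.ext) ?_ (h₂.real.trans h₁.real)
    (fun a ha => (h₂.natArr a ha).trans (h₁.natArr a ha)) (h₂.realArr.trans h₁.realArr),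
    by omega⟩
  intro x hx hx'
  rw [h₂.nat x (by omega) (by omega), h₁.nat x (by omega) (by omega)]

theorem wp_balanceProg {s : Store} {l r : EntryTree} (hl : TreeAt s.heap (s.natReg 44) l)
    (hr : TreeAt s.heap (s.natReg 45) r) :
    wp balanceProg s fun s' t => Built (l.balance r) s s' ∧ t ≤ 250 := by
  have e₁ := hl.ht_eq
  have e₂ := hr.ht_eq
  simp only [Store.heap] at e₁ e₂
  unfold balanceProg
  rw [wp_ite]
  simp only [Test.Holds, NatExpr.eval, e₁, e₂, Test.cost, NatExpr.cost]
  refine ⟨fun c₁ => ?_, fun c₁ => ?_⟩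
  · cases l with
    | leaf x => simp [EntryTree.height] at c₁
    | node x y =>
      have hx : TreeAt s.heap (s.natArr 0 (s.natReg 44)) x := hl.2.2.2.2.2.1
      have hy : TreeAt s.heap (s.natArr 1 (s.natReg 44)) y := hl.2.2.2.2.2.2
      have e₃ := hx.ht_eq
      have e₄ := hy.ht_eq
      simp only [Store.heap] at e₃ e₄
      rw [wp_seq, wp_setNat, wp_seq, wp_setNat, wp_ite]
      simp only [Test.Holds, NatExpr.eval, Test.cost, NatExpr.cost]
      refine ⟨fun c₂ => ?_, fun c₂ => ?_⟩
      · simp [e₃, e₄] at c₂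
        cases y with
        | leaf y => simp [EntryTree.height] at c₂
        | node u v =>
          have hu : TreeAt s.heap (s.natArr 0 (s.natArr 1 (s.natReg 44))) u := hy.2.2.2.2.2.1
          have hv : TreeAt s.heap (s.natArr 1 (s.natArr 1 (s.natReg 44))) v := hy.2.2.2.2.2.2
          rw [wp_seq, wp_setNat, wp_seq, wp_setNat]
          refine (wp_mkNode_three (by norm_num) (by norm_num) (by norm_num) (by norm_num)
            (by norm_num) (by norm_num) (a := 46) (b := 48) (c := 49) (d := 45)
            (x := x) (u := u) (v := v) (y := r)
           
            ?_ ?_ ?_ ?_).mono ?_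
          iterate 4 first | exact hx | exact hu | exact hv | exact hr
          rintro s' t ⟨⟨k₁, k₂, k₃, k₄, k₅, k₆⟩, ht⟩
          have hb : (EntryTree.node x (.node u v)).balance r =
            .node (.node x u) (.node v r) := by simp [EntryTree.balance, c₁, c₂]
          rw [hb]
          refine ⟨⟨k₁, k₂, ?_, k₄, k₅, k₆⟩, by simp; omega⟩
          intro a ha ha'
          rw [k₃ a ha ha']
          simp [show a ≠ 46 by omega, show a ≠ 47 by omega, show a ≠ 48 by omega,
            show a ≠ 49 by omega]
      · simp [e₃, e₄] at c₂
        rw [wp_seq]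
        refine (wp_mkNode (by norm_num) (by norm_num) (by norm_num) (by norm_num)
          (a := 47) (b := 45) (o := 47) (l := y) (r := r) ?_ ?_).mono ?_
        iterate 2 first | exact hy | exact hr
        rintro s₁ t₁ ⟨h₁, ht₁⟩
        refine (wp_mkNode (by norm_num) (by norm_num) (by norm_num) (by norm_num)
          (l := x) (r := .node y r) ?_ h₁.treeAt).mono ?_
        · rw [h₁.nat 46 (by norm_num) (by norm_num)]; exact TreeAt.ext h₁.ext hx
        rintro s₂ t₂ ⟨h₂, ht₂⟩
        have hb : (EntryTree.node x y).balance r = .node x (.node y r) := by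
          cases y with
          | leaf y => simp [EntryTree.balance, c₁]
          | node u v => simp [EntryTree.balance, c₁, not_lt.2 c₂]
        rw [hb]
        refine ⟨h₂.built h₁.ext ?_ h₁.real h₁.natArr h₁.realArr, by simp; omega⟩
        intro a ha ha'
        rw [h₁.nat a (by omega) (by omega)]
        simp [show a ≠ 46 by omega, show a ≠ 47 by omega]
  · rw [wp_ite]
    simp only [Test.Holds, NatExpr.eval, e₁, e₂, Test.cost, NatExpr.cost]
    refine ⟨fun c₂ => ?_, fun c₂ => ?_⟩
    · cases r with
      | leaf x => simp [EntryTree.height] at c₂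
      | node x y =>
        have hx : TreeAt s.heap (s.natArr 0 (s.natReg 45)) x := hr.2.2.2.2.2.1
        have hy : TreeAt s.heap (s.natArr 1 (s.natReg 45)) y := hr.2.2.2.2.2.2
        have e₃ := hx.ht_eq
        have e₄ := hy.ht_eq
        simp only [Store.heap] at e₃ e₄
        rw [wp_seq, wp_setNat, wp_seq, wp_setNat, wp_ite]
        simp only [Test.Holds, NatExpr.eval, Test.cost, NatExpr.cost]
        refine ⟨fun c₃ => ?_, fun c₃ => ?_⟩
        · simp [e₃, e₄] at c₃
          cases x with
          | leaf x => simp [EntryTree.height] at c₃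
          | node u v =>
            have hu : TreeAt s.heap (s.natArr 0 (s.natArr 0 (s.natReg 45))) u := hx.2.2.2.2.2.1
            have hv : TreeAt s.heap (s.natArr 1 (s.natArr 0 (s.natReg 45))) v := hx.2.2.2.2.2.2
            rw [wp_seq, wp_setNat, wp_seq, wp_setNat]
            refine (wp_mkNode_three (by norm_num) (by norm_num) (by norm_num) (by norm_num)
              (by norm_num) (by norm_num) (a := 44) (b := 48) (c := 49) (d := 47)
              (x := l) (u := u) (v := v) (y := y)
             
              ?_ ?_ ?_ ?_).mono ?_
            iterate 4 first | exact hl | exact hu | exact hv | exact hy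
            rintro s' t ⟨⟨k₁, k₂, k₃, k₄, k₅, k₆⟩, ht⟩
            have hb : l.balance (EntryTree.node (.node u v) y) =
              .node (.node l u) (.node v y) := by
                simp [EntryTree.balance, c₁, c₂, c₃]
            rw [hb]
            refine ⟨⟨k₁, k₂, ?_, k₄, k₅, k₆⟩, by simp; omega⟩
            intro a ha ha'
            rw [k₃ a ha ha']
            simp [show a ≠ 46 by omega, show a ≠ 47 by omega, show a ≠ 48 by omega,
              show a ≠ 49 by omega]
        · simp [e₃, e₄] at c₃
          rw [wp_seq]
          refine (wp_mkNode (by norm_num) (by norm_num) (by norm_num) (by norm_num)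
            (a := 44) (b := 46) (o := 46) (l := l) (r := x) ?_ ?_).mono ?_
          iterate 2 first | exact hl | exact hx
          rintro s₁ t₁ ⟨h₁, ht₁⟩
          refine (wp_mkNode (by norm_num) (by norm_num) (by norm_num) (by norm_num)
            (l := .node l x) (r := y) h₁.treeAt ?_).mono ?_
          · rw [h₁.nat 47 (by norm_num) (by norm_num)]; exact TreeAt.ext h₁.ext hy
          rintro s₂ t₂ ⟨h₂, ht₂⟩
          have hb : l.balance (EntryTree.node x y) = .node (.node l x) y := by
            cases x with
            | leaf y => simp [EntryTree.balance, c₁, c₂]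
            | node u v => simp [EntryTree.balance, c₁, c₂, not_lt.2 c₃]
          rw [hb]
          refine ⟨h₂.built h₁.ext ?_ h₁.real h₁.natArr h₁.realArr, by simp; omega⟩
          intro a ha ha'
          rw [h₁.nat a (by omega) (by omega)]
          simp [show a ≠ 46 by omega, show a ≠ 47 by omega]
    · refine (wp_mkNode (by norm_num) (by norm_num) (by norm_num) (by norm_num) hl hr).mono ?_
      rintro s₁ t₁ ⟨h₁, ht₁⟩
      have hb : l.balance r = .node l r := by simp only [EntryTree.balance, if_neg c₁, if_neg c₂]
      rw [hb]
      exact ⟨h₁.built (.refl _) (fun _ _ _ => rfl) rfl (fun _ _ => rfl) rfl, by simp; omega⟩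

/-- Does the entry in register `41` have a smaller key than the entry at `q`? -/
def keyLt (q : NatExpr) : Test :=
  .disj (.realLt (.get 0 (.reg 41)) (.get 0 q)) (.conj (.realEq (.get 0 (.reg 41)) (.get 0 q))
    (.disj (.realLt (.get 1 (.reg 41)) (.get 1 q)) (.conj (.realEq (.get 1 (.reg 41)) (.get 1 q))
      (.disj (.realLt (.get 2 (.reg 41)) (.get 2 q)) (.conj (.realEq (.get 2 (.reg 41)) (.get 2 q))
        (.natLt (.get 8 (.reg 41)) (.get 8 q)))))))

/-- Do the entry in register `41` and the entry at `q` have the same key? -/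
def keyEq (q : NatExpr) : Test :=
  .conj (.realEq (.get 0 (.reg 41)) (.get 0 q)) (.conj (.realEq (.get 1 (.reg 41)) (.get 1 q))
    (.conj (.realEq (.get 2 (.reg 41)) (.get 2 q)) (.natEq (.get 8 (.reg 41)) (.get 8 q))))

theorem keyLt_cost (q : NatExpr) : (keyLt q).cost = 7 * q.cost + 34 := by
  simp only [keyLt, Test.cost, RealExpr.cost, NatExpr.cost]; ring

theorem keyEq_cost (q : NatExpr) : (keyEq q).cost = 4 * q.cost + 19 := by
  simp only [keyEq, Test.cost, RealExpr.cost, NatExpr.cost]; ring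

theorem keyLt_holds {s : Store} {r r' : Entry} {q : NatExpr} (hr : EntryAt s.heap r)
    (h41 : s.natReg 41 = r.idx) (hr' : EntryAt s.heap r') (hq : q.eval s = r'.idx) :
    (keyLt q).Holds s ↔ r.key < r'.key := by
  have a₁ := hr.rs
  have a₂ := hr.re
  have a₃ := hr.rw
  have a₄ := hr.rid
  have b₁ := hr'.rs
  have b₂ := hr'.re
  have b₃ := hr'.rw
  have b₄ := hr'.rid
  simp only [Store.heap] at a₁ a₂ a₃ a₄ b₁ b₂ b₃ b₄
  rw [Entry.key_lt]
  simp only [keyLt, Test.Holds, RealExpr.eval, NatExpr.eval, h41, hq, a₁, a₂, a₃, a₄, b₁, b₂, b₃,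
    b₄]

theorem keyEq_holds {s : Store} {r r' : Entry} {q : NatExpr} (hr : EntryAt s.heap r)
    (h41 : s.natReg 41 = r.idx) (hr' : EntryAt s.heap r') (hq : q.eval s = r'.idx) :
    (keyEq q).Holds s ↔ r.key = r'.key := by
  have a₁ := hr.rs
  have a₂ := hr.re
  have a₃ := hr.rw
  have a₄ := hr.rid
  have b₁ := hr'.rs
  have b₂ := hr'.re
  have b₃ := hr'.rw
  have b₄ := hr'.rid
  simp only [Store.heap] at a₁ a₂ a₃ a₄ b₁ b₂ b₃ b₄
  rw [Entry.key_eq]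
  simp only [keyEq, Test.Holds, RealExpr.eval, NatExpr.eval, h41, hq, a₁, a₂, a₃, a₄, b₁, b₂, b₃,
    b₄]

/-- The path `P` is stored on the stack, which consists of the arrays `stk` (the subtrees beside
the path) and `dir` (the turns of the path), and has `d` elements. -/
def StackAt (H : Heap) (stk dir : ℕ → ℕ) : ℕ → EntryTree.Path → Prop
  | d, [] => d = 0
  | d, (b, t) :: P => ∃ d', d = d' + 1 ∧ dir d' = (if b then 0 else 1) ∧ TreeAt H (stk d') t ∧
      StackAt H stk dir d' P

theorem StackAt.congr {H H' : Heap} {stk dir stk' dir' : ℕ → ℕ} {d : ℕ} {P : EntryTree.Path}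
    (h : StackAt H stk dir d P) (hE : H.Ext H') (h₁ : ∀ i < d, stk' i = stk i)
    (h₂ : ∀ i < d, dir' i = dir i) : StackAt H' stk' dir' d P := by
  induction P generalizing d with
  | nil => exact h
  | cons a P ih =>
    obtain ⟨b, t⟩ := a
    obtain ⟨d', rfl, hd, ht, hP⟩ := h
    refine ⟨d', rfl, by rw [h₂ d' (by omega), hd], by rw [h₁ d' (by omega)]; exact ht.ext hE, ?_⟩
    exact ih hP (fun i hi => h₁ i (by omega)) fun i hi => h₂ i (by omega)

/-- Walk from the root of the tree in register `40` to the leaf where the entry in register `41`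
belongs. The leaf is in register `42`, the path on the stack, and its length in register `43`. -/
def descend : Program :=
  .setNat 42 (.get 7 (.reg 40)) ;;
  .setNat 43 (.const 0) ;;
  .loop (.neg (.natEq (.get 0 (.reg 42)) (.const 0)))
    (.ite (keyLt (.get 2 (.get 1 (.reg 42))))
        (.putNat 5 (.reg 43) (.get 1 (.reg 42)) ;;
          .putNat 6 (.reg 43) (.const 0) ;;
          .setNat 42 (.get 0 (.reg 42)))
        (.putNat 5 (.reg 43) (.get 0 (.reg 42)) ;;
          .putNat 6 (.reg 43) (.const 1) ;;
          .setNat 42 (.get 1 (.reg 42))) ;;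
      .setNat 43 (.add (.reg 43) (.const 1)))

/-- The result of `descend` in the tree `T` for an entry with the key of `r`. -/
structure Descended (T : EntryTree) (r : Entry) (P : EntryTree.Path) (q : EntryTree)
    (s s' : Store) : Prop where
  plug : EntryTree.plug P q = T
  treeAt : TreeAt s'.heap (s'.natReg 42) q
  stack : StackAt s'.heap (s'.natArr 5) (s'.natArr 6) (s'.natReg 43) P
  before : ∀ x ∈ EntryTree.before P, x.key < r.key
  after : ∀ x ∈ EntryTree.after P, r.key < x.key
  heap : s'.heap = s.heap
  frame : Frame 42 s s'

/-- The descent compares the key with the first key of the right subtree, so it ends in the only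
leaf where the key can be. -/
theorem wp_descend {s : Store} {T : EntryTree} {r : Entry}
    (hT : TreeAt s.heap (s.heap.root (s.natReg 40)) T) (hS : T.Sorted) (hr : EntryAt s.heap r)
    (h41 : s.natReg 41 = r.idx) :
    wp descend s fun s' t =>
      (∃ P q, Descended T r P (.leaf q) s s') ∧ t ≤ 100 * T.height + 20 := by
  unfold descend
  rw [wp_seq, wp_setNat, wp_seq, wp_setNat]
  refine (wp_loop (fun n t s' => ∃ P q, Descended T r P q s s' ∧ n = q.height ∧
    t + 100 * q.height ≤ 100 * T.height) (n := T.height) ?_ ?_).mono ?_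
  · rintro n t s' ⟨P, q, hD, rfl, ht⟩ hb
    simp only [Test.Holds, NatExpr.eval] at hb
    cases q with
    | leaf q => exact absurd hD.treeAt.2.2.1 hb
    | node u v =>
      obtain ⟨h₁, h₂, h₃, h₄, h₅, h₆, h₇⟩ := hD
      have hu : TreeAt s'.heap (s'.natArr 0 (s'.natReg 42)) u := h₂.2.2.2.2.2.1
      have hv : TreeAt s'.heap (s'.natArr 1 (s'.natReg 42)) v := h₂.2.2.2.2.2.2
      have hlo : (NatExpr.get 2 (.get 1 (.reg 42))).eval s' = v.lo.idx := hv.lo_eq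
      have hr' : EntryAt s'.heap r := h₆ ▸ hr
      have h41' : s'.natReg 41 = r.idx := (h₇.nat 41 (by norm_num)).trans h41
      have hc := keyLt_holds hr' h41' hv.lo_at hlo
      have hS' : (EntryTree.plug P (.node u v)).Sorted := h₁ ▸ hS
      have hS₂ : (EntryTree.node u v).Sorted := by
        simp only [EntryTree.Sorted, EntryTree.toList_plug, List.pairwise_append] at hS' ⊢
        exact hS'.1.2.1
      rw [EntryTree.sorted_node] at hS₂
      rw [wp_seq, wp_ite, hc]
      simp only [wp_seq, wp_setNat, wp_putNat, keyLt_cost, NatExpr.cost]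
      have hframe : ∀ (x y z w : ℕ), Frame 42 s { s' with
          natReg := Function.update (Function.update s'.natReg 42 x) 43 y
          natArr := Function.update (Function.update s'.natArr 5 (Function.update (s'.natArr 5)
            (s'.natReg 43) z)) 6 (Function.update (s'.natArr 6) (s'.natReg 43) w) } := by
        intro x y z w
        refine ⟨?_, h₇.real, ?_, h₇.realArr⟩
        · intro i hi
          dsimp only
          rw [Function.update_of_ne (by omega), Function.update_of_ne (by omega), h₇.nat i hi]
        · intro i hi
          dsimp only
          rw [Function.update_of_ne (by omega), Function.update_of_ne (by omega), h₇.natArr i hi]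
      refine ⟨fun c => ?_, fun c => ?_⟩
      · refine ⟨u.height, by simp only [EntryTree.height]; omega, (true, v) :: P, u, ?_, rfl, ?_⟩
        · refine ⟨h₁, hu, ?_, h₄, ?_, h₆, hframe _ _ _ _⟩
          · refine ⟨s'.natReg 43, by simp, by simp, ?_, ?_⟩
            · change TreeAt s'.heap (Function.update (s'.natArr 5) (s'.natReg 43)
                (s'.natArr 1 (s'.natReg 42)) (s'.natReg 43)) v
              rwa [Function.update_self]
            · refine h₃.congr (.refl _) ?_ ?_ <;> intro i hi <;> simp <;>
                exact Function.update_of_ne (by omega) _ _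
          · intro x hx
            simp only [EntryTree.after, List.mem_append] at hx
            rcases hx with hx | hx
            · exact c.trans_le (EntryTree.lo_key_le hS₂.2.1 hx)
            · exact h₅ x hx
        · simp only [EntryTree.height, Test.cost, NatExpr.cost] at ht ⊢; omega
      · refine ⟨v.height, by simp only [EntryTree.height]; omega, (false, u) :: P, v, ?_, rfl, ?_⟩
        · refine ⟨h₁, hv, ?_, ?_, h₅, h₆, hframe _ _ _ _⟩
          · refine ⟨s'.natReg 43, by simp, by simp, ?_, ?_⟩
            · change TreeAt s'.heap (Function.update (s'.natArr 5) (s'.natReg 43)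
                (s'.natArr 0 (s'.natReg 42)) (s'.natReg 43)) u
              rwa [Function.update_self]
            · refine h₃.congr (.refl _) ?_ ?_ <;> intro i hi <;> simp <;>
                exact Function.update_of_ne (by omega) _ _
          · intro x hx
            simp only [EntryTree.before, List.mem_append] at hx
            rcases hx with hx | hx
            · exact h₄ x hx
            · exact (hS₂.2.2 x hx _ v.lo_mem).trans_le (not_lt.1 c)
        · simp only [EntryTree.height, Test.cost, NatExpr.cost] at ht ⊢; omega
  · refine ⟨[], T, ⟨rfl, hT, rfl, by simp [EntryTree.before], by simp [EntryTree.after], rfl, ?_⟩,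
      rfl, by simp⟩
    refine ⟨fun i hi => ?_, rfl, fun _ _ => rfl, rfl⟩
    dsimp only
    rw [Function.update_of_ne (by omega), Function.update_of_ne (by omega)]
  · rintro s' t ⟨n, t', ⟨P, q, hD, rfl, ht⟩, hb, rfl⟩
    simp only [Test.Holds, NatExpr.eval, not_not] at hb
    cases q with
    | leaf q =>
      refine ⟨⟨P, q, hD⟩, ?_⟩
      simp only [Test.cost, NatExpr.cost]
      omega
    | node u v =>
      have := (hD.treeAt.2.2.2.2.2.1).pos
      simp only [Store.heap, hb] at this
      omega

/-- Rebalance the tree along the path on the stack, from the subtree in register `42` upwards, and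
store the result as the tree in register `40`. -/
def ascend : Program :=
  .loop (.neg (.natEq (.reg 43) (.const 0)))
    (.setNat 43 (.sub (.reg 43) (.const 1)) ;;
      .ite (.natEq (.get 6 (.reg 43)) (.const 0))
        (.setNat 44 (.reg 42) ;; .setNat 45 (.get 5 (.reg 43)))
        (.setNat 44 (.get 5 (.reg 43)) ;; .setNat 45 (.reg 42)) ;;
      balanceProg) ;;
  .putNat 7 (.reg 40) (.reg 42)

/-- The effect of replacing the root of the tree with the number `i` by the tree `T`. -/
structure Replaced (i : ℕ) (T : EntryTree) (s s' : Store) : Prop where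
  treeAt : TreeAt s'.heap (s'.heap.root i) T
  root : ∀ k, k ≠ i → s'.heap.root k = s.heap.root k
  ext : s.heap.Ext s'.heap
  frame : Frame 42 s s'

/-- The nodes on the path are allocated anew; the old ones stay where they are. -/
theorem wp_ascend {s : Store} {P : EntryTree.Path} {t₀ : EntryTree}
    (hP : StackAt s.heap (s.natArr 5) (s.natArr 6) (s.natReg 43) P)
    (ht₀ : TreeAt s.heap (s.natReg 42) t₀) :
    wp ascend s fun s' t =>
      Replaced (s.natReg 40) (EntryTree.rebuild P t₀) s s' ∧ t ≤ 300 * P.length + 20 := by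
  unfold ascend
  rw [wp_seq]
  refine (wp_loop (fun n t s' => ∃ P' t', n = P'.length ∧
    EntryTree.rebuild P' t' = EntryTree.rebuild P t₀ ∧ TreeAt s'.heap (s'.natReg 42) t' ∧
    StackAt s'.heap (s'.natArr 5) (s'.natArr 6) (s'.natReg 43) P' ∧ s.heap.Ext s'.heap ∧
    Frame 42 s s' ∧ s'.natArr 7 = s.natArr 7 ∧
    t + 300 * P'.length ≤ 300 * P.length) (n := P.length) ?_ ?_).mono ?_
  · rintro n t s' ⟨P', t', rfl, h₁, h₂, h₃, h₄, h₅, h₆, ht⟩ hb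
    simp only [Test.Holds, NatExpr.eval] at hb
    cases P' with
    | nil => exact absurd h₃ hb
    | cons a P' =>
      obtain ⟨b, q⟩ := a
      obtain ⟨d, hd, hdir, hq, hP'⟩ := h₃
      rw [wp_seq, wp_setNat, wp_seq, wp_ite]
      simp only [NatExpr.eval, hd, Nat.add_sub_cancel, Test.Holds, Function.update_self,
        wp_seq, wp_setNat, hdir]
      have hfin : ∀ (l r : EntryTree) (x y : ℕ) (u : ℕ), TreeAt s'.heap x l → TreeAt s'.heap y r →
          u ≤ 20 → EntryTree.rebuild P' (l.balance r) = EntryTree.rebuild P t₀ →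
          wp balanceProg { s' with natReg := Function.update (Function.update
              (Function.update s'.natReg 43 d) 44 x) 45 y } fun s₁ t₁ =>
            ∃ n' < ((b, q) :: P').length, ∃ P' t', n' = P'.length ∧
              EntryTree.rebuild P' t' = EntryTree.rebuild P t₀ ∧
              TreeAt s₁.heap (s₁.natReg 42) t' ∧
              StackAt s₁.heap (s₁.natArr 5) (s₁.natArr 6) (s₁.natReg 43) P' ∧
              s.heap.Ext s₁.heap ∧ Frame 42 s s₁ ∧ s₁.natArr 7 = s.natArr 7 ∧
              t + ((Test.neg (.natEq (.reg 43) (.const 0))).cost + (u + t₁) + 1) +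
                300 * P'.length ≤ 300 * P.length := by
        intro l r x y u hx hy hu heq
        refine (wp_balanceProg (l := l) (r := r) hx hy).mono ?_
        rintro s₁ t₁ ⟨⟨k₁, k₂, k₃, k₄, k₅, k₆⟩, ht₁⟩
        refine ⟨P'.length, by simp, P', _, rfl, heq, k₁, ?_, h₄.trans k₂, ?_, ?_, ?_⟩
        · rw [k₃ 43 (by norm_num) (by norm_num), k₅ 5 (by norm_num), k₅ 6 (by norm_num)]
          exact hP'.congr k₂ (fun _ _ => rfl) fun _ _ => rfl
        · refine ⟨fun z hz => ?_, k₄.trans h₅.real, fun a ha => ?_, k₆.trans h₅.realArr⟩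
          · rw [k₃ z (by omega) (by omega)]
            dsimp only
            rw [Function.update_of_ne (by omega), Function.update_of_ne (by omega),
              Function.update_of_ne (by omega), h₅.nat z hz]
          · exact (k₅ a (by omega)).trans (h₅.natArr a ha)
        · exact (k₅ 7 (by norm_num)).trans h₆
        · simp only [List.length_cons] at ht
          simp
          omega
      cases b
      · refine ⟨fun c => absurd c (by simp), fun _ => ?_⟩
        refine (hfin q t' (s'.natArr 5 d) (s'.natReg 42) 20 hq h₂ le_rfl h₁).mono ?_
        rintro s₁ t₁ ⟨n', hn', P'', t'', g₁, g₂, g₃, g₄, g₅, g₆, g₇, g₈⟩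
        refine ⟨n', hn', P'', t'', g₁, g₂, g₃, g₄, g₅, g₆, g₇, ?_⟩
        simp at g₈ ⊢
        omega
      · refine ⟨fun _ => ?_, fun c => absurd rfl c⟩
        refine (hfin t' q (s'.natReg 42) (s'.natArr 5 d) 20 h₂ hq le_rfl h₁).mono ?_
        rintro s₁ t₁ ⟨n', hn', P'', t'', g₁, g₂, g₃, g₄, g₅, g₆, g₇, g₈⟩
        refine ⟨n', hn', P'', t'', g₁, g₂, g₃, g₄, g₅, g₆, g₇, ?_⟩
        simp at g₈ ⊢
        omega
  · exact ⟨P, t₀, rfl, rfl, ht₀, hP, .refl _, .refl _ _, rfl, by simp⟩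
  · rintro s' t ⟨n, u, ⟨P', t', rfl, h₁, h₂, h₃, h₄, h₅, h₆, ht⟩, hb, rfl⟩
    simp only [Test.Holds, NatExpr.eval, not_not] at hb
    cases P' with
    | cons a P' =>
      obtain ⟨d, hd, -⟩ := h₃
      omega
    | nil =>
      rw [wp_putNat]
      have h40 := h₅.nat 40 (by norm_num)
      have hE : s'.heap.Ext (Store.heap { s' with
          natArr :=
            Function.update s'.natArr 7 (Function.update (s'.natArr 7) (s'.natReg 40)
              (s'.natReg 42)) }) := by
        constructor <;> simp
      refine ⟨⟨?_, ?_, h₄.trans hE, ?_⟩, ?_⟩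
      · simp only [EntryTree.rebuild] at h₁
        rw [← h₁]
        have := h₂.ext hE
        simp only [Store.heap, NatExpr.eval, h40, Function.update_self] at this ⊢
        exact this
      · intro k hk
        simp [h40, hk, h₆]
      · refine ⟨h₅.nat, h₅.real, fun a ha => ?_, h₅.realArr⟩
        dsimp only
        rw [Function.update_of_ne (by omega), h₅.natArr a ha]
      · simp
        omega

noncomputable instance : DecidableEq Entry := Classical.decEq _

/-- The tree with the root `p` is a balanced search tree for the set `A`. -/
def Stores (H : Heap) (p : ℕ) (A : Finset Entry) : Prop :=
  p = 0 ∧ A = ∅ ∨ ∃ T : EntryTree, TreeAt H p T ∧ T.Balanced ∧ T.Sorted ∧ ∀ r, r ∈ A ↔ r ∈ T.toList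

/-- For each `i`, the tree with the number `i` is a search tree for the set `C i`. The end of the
entry `0`, which stands for no entry, is `0`; this is the infinity of the internal time scale. -/
structure Trees (H : Heap) (C : ℕ → Finset Entry) : Prop where
  zero : H.re 0 = 0
  stores : ∀ i, Stores H (H.root i) (C i)

theorem Stores.ext {H H' : Heap} {p : ℕ} {A : Finset Entry} (h : Stores H p A) (hE : H.Ext H') :
    Stores H' p A := by
  rcases h with h | ⟨T, h₁, h₂⟩
  · exact .inl h
  · exact .inr ⟨T, h₁.ext hE, h₂⟩

theorem Stores.entryAt {H : Heap} {p : ℕ} {A : Finset Entry} (h : Stores H p A) {r : Entry}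
    (hr : r ∈ A) : EntryAt H r := by
  rcases h with ⟨-, rfl⟩ | ⟨T, h₁, -, -, h₂⟩
  · simp at hr
  · exact h₁.entryAt ((h₂ r).1 hr)

theorem EntryTree.Sorted.eq_of_key {T : EntryTree} (hT : T.Sorted) {r q : Entry}
    (hr : r ∈ T.toList) (hq : q ∈ T.toList) (h : r.key = q.key) : r = q := by
  refine List.Pairwise.forall_of_forall_of_flip (R := fun a b => a.key = b.key → a = b)
    (fun _ _ _ => rfl) (hT.imp ?_) (hT.imp ?_) hr hq h
  · exact fun hlt he => absurd he hlt.ne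
  · exact fun hlt he => absurd he hlt.ne'

theorem Trees.ext {H H' : Heap} {C : ℕ → Finset Entry} (h : Trees H C) (hE : H.Ext H')
    (hroot : H'.root = H.root) : Trees H' C :=
  ⟨(hE.re 0 (by omega)).trans h.zero, fun i => hroot ▸ (h.stores i).ext hE⟩

theorem Trees.entryAt {H : Heap} {C : ℕ → Finset Entry} (h : Trees H C) {i : ℕ} {r : Entry}
    (hr : r ∈ C i) : EntryAt H r := (h.stores i).entryAt hr

theorem Trees.eq_of_key {H : Heap} {C : ℕ → Finset Entry} (h : Trees H C) {i : ℕ} {r q : Entry}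
    (hr : r ∈ C i) (hq : q ∈ C i) (he : r.key = q.key) : r = q := by
  rcases h.stores i with ⟨-, h'⟩ | ⟨T, -, -, h₁, h₂⟩
  · simp [h'] at hr
  · exact h₁.eq_of_key ((h₂ r).1 hr) ((h₂ q).1 hq) he

theorem EntryTree.Sorted.length_eq {T : EntryTree} (hT : T.Sorted) {A : Finset Entry}
    (hA : ∀ r, r ∈ A ↔ r ∈ T.toList) : T.toList.length = A.card := by
  have hn : T.toList.Nodup := List.Pairwise.imp (fun h he => by subst he; exact h.false) hT
  rw [← List.toFinset_card_of_nodup hn]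
  congr 1
  ext r
  simp [hA]

/-- Only the tree with the number `i` changes when its root is replaced. -/
theorem Replaced.trees {s s' : Store} {i : ℕ} {T : EntryTree} {C : ℕ → Finset Entry}
    {A : Finset Entry} (h : Replaced i T s s') (hC : Trees s.heap C) (hb : T.Balanced)
    (hs : T.Sorted) (hA : ∀ r, r ∈ A ↔ r ∈ T.toList) :
    Trees s'.heap (Function.update C i A) := by
  refine ⟨(h.ext.re 0 (by omega)).trans hC.zero, fun k => ?_⟩
  by_cases hk : k = i
  · subst hk
    rw [Function.update_self]
    exact .inr ⟨T, h.treeAt, hb, hs, hA⟩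
  · rw [Function.update_of_ne hk, h.root k hk]
    exact (hC.stores k).ext h.ext

/-- Insert the entry in register `41` into the tree in register `40`. -/
def treeInsert : Program :=
  .ite (.natEq (.get 7 (.reg 40)) (.const 0))
    (mkLeaf 42 ;; .putNat 7 (.reg 40) (.reg 42))
    (descend ;; mkLeaf 46 ;;
      .ite (keyLt (.get 2 (.reg 42))) (mkNode 46 42 42) (mkNode 42 46 42) ;; ascend)

theorem Alloc.frame {o : ℕ} {t : EntryTree} {s s' : Store} (h : Alloc o t s s') (ho : 42 ≤ o) :
    Frame 42 s s' :=
  ⟨fun x hx => h.nat x (by omega) (by omega), h.real, fun a ha => h.natArr a (by omega),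
    h.realArr⟩

theorem wp_treeInsert {s : Store} {C : ℕ → Finset Entry} (hC : Trees s.heap C) {r : Entry}
    (hr : EntryAt s.heap r) (h41 : s.natReg 41 = r.idx) {i : ℕ} (h40 : s.natReg 40 = i)
    (hnew : ∀ q ∈ C i, q.key ≠ r.key) {Λ : ℕ} (hΛ : (C i).card < 2 ^ Λ) :
    wp treeInsert s fun s' t =>
      Trees s'.heap (Function.update C i (insert r (C i))) ∧ s.heap.Ext s'.heap ∧ Frame 42 s s' ∧
        t ≤ 1000 * (Λ + 1) := by
  subst h40
  unfold treeInsert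
  rw [wp_ite]
  refine ⟨fun c => ?_, fun c => ?_⟩ <;>
    simp only [Test.Holds, NatExpr.eval, Test.cost, NatExpr.cost] at c ⊢
  · have hA : C (s.natReg 40) = ∅ := by
      rcases hC.stores (s.natReg 40) with h | ⟨T, h, -⟩
      · exact h.2
      · have := h.pos
        simp only [Store.heap] at this
        omega
    rw [wp_seq]
    refine (wp_mkLeaf (by norm_num) (by norm_num) hr h41).mono ?_
    rintro s₁ t₁ ⟨h₁, ht₁⟩
    rw [wp_putNat]
    have n40 := h₁.nat 40 (by norm_num) (by norm_num)
    have hE : s₁.heap.Ext (Store.heap { s₁ with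
        natArr :=
          Function.update s₁.natArr 7 (Function.update (s₁.natArr 7) (s₁.natReg 40)
            (s₁.natReg 42)) }) := by
      constructor <;> simp
    have hR : Replaced (s.natReg 40) (.leaf r) s { s₁ with
        natArr :=
          Function.update s₁.natArr 7 (Function.update (s₁.natArr 7) (s₁.natReg 40)
            (s₁.natReg 42)) } := by
      refine ⟨?_, ?_, h₁.ext.trans hE, ?_⟩
      · have := h₁.treeAt.ext hE
        simp only [Store.heap, NatExpr.eval, n40, Function.update_self] at this ⊢
        exact this
      · intro k hk
        simp [n40, hk, h₁.natArr 7 (by norm_num)]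
      · refine (h₁.frame (by norm_num)).trans ⟨fun _ _ => rfl, rfl, fun a ha => ?_, rfl⟩
        dsimp only
        rw [Function.update_of_ne (by omega)]
    refine ⟨hR.trees hC trivial (by simp [EntryTree.Sorted, EntryTree.toList]) ?_, hR.ext,
      hR.frame, by simp; omega⟩
    simp [hA, EntryTree.toList]
  · obtain ⟨T, hT, hb, hS, hA⟩ := (hC.stores (s.natReg 40)).resolve_left fun h => c h.1
    have hlen := hS.length_eq hA
    have hh := EntryTree.height_le hb (hlen ▸ hΛ)
    rw [wp_seq]
    refine (wp_descend hT hS hr h41).mono ?_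
    rintro s₁ t₁ ⟨⟨P, q, hD⟩, ht₁⟩
    have hPlen : P.length ≤ T.height := hD.plug ▸ EntryTree.length_path_le P _
    have hr₁ : EntryAt s₁.heap r := hD.heap ▸ hr
    have n41 : s₁.natReg 41 = r.idx := (hD.frame.nat 41 (by norm_num)).trans h41
    have n40 := hD.frame.nat 40 (by norm_num)
    rw [wp_seq]
    refine (wp_mkLeaf (by norm_num) (by norm_num) hr₁ n41).mono ?_
    rintro s₂ t₂ ⟨h₂, ht₂⟩
    have hq₂ : TreeAt s₂.heap (s₂.natReg 42) (.leaf q) := by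
      rw [h₂.nat 42 (by norm_num) (by norm_num)]
      exact hD.treeAt.ext h₂.ext
    have hqT : q ∈ T.toList := by
      rw [← hD.plug, EntryTree.toList_plug]
      simp [EntryTree.toList]
    have hc := keyLt_holds (q := .get 2 (.reg 42)) (hr₁.ext h₂.ext)
      ((h₂.nat 41 (by norm_num) (by norm_num)).trans n41) hq₂.lo_at hq₂.lo_eq
    have hne : q.key ≠ r.key := hnew q ((hA q).2 hqT)
    have hS' := hS
    rw [← hD.plug, EntryTree.Sorted, EntryTree.toList_plug] at hS'
    -- Both cases attach a node with the old and the new leaf, in the order of their keys.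
    have hfin : ∀ u v : Entry, u.key < v.key → (u = r ∧ v = q ∨ u = q ∧ v = r) →
        ∀ s₃ : Store, Alloc 42 (.node (.leaf u) (.leaf v)) s₂ s₃ →
        wp ascend s₃ fun s' t => Trees s'.heap (Function.update C (s.natReg 40)
          (insert r (C (s.natReg 40)))) ∧ s.heap.Ext s'.heap ∧ Frame 42 s s' ∧
          t ≤ 300 * P.length + 20 := by
      intro u v huv hor s₃ h₃
      have n43 : s₃.natReg 43 = s₁.natReg 43 := by
        rw [h₃.nat 43 (by norm_num) (by norm_num), h₂.nat 43 (by norm_num) (by norm_num)]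
      have hst : StackAt s₃.heap (s₃.natArr 5) (s₃.natArr 6) (s₃.natReg 43) P := by
        rw [n43, h₃.natArr 5 (by norm_num), h₃.natArr 6 (by norm_num),
          h₂.natArr 5 (by norm_num), h₂.natArr 6 (by norm_num)]
        exact hD.stack.congr (h₂.ext.trans h₃.ext) (fun _ _ => rfl) fun _ _ => rfl
      refine (wp_ascend hst h₃.treeAt).mono ?_
      rintro s₄ t₄ ⟨h₄, ht₄⟩
      have n40' : s₃.natReg 40 = s.natReg 40 := by
        rw [h₃.nat 40 (by norm_num) (by norm_num), h₂.nat 40 (by norm_num) (by norm_num), n40]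
      rw [n40'] at h₄
      have hE : s.heap.Ext s₃.heap := by
        rw [← hD.heap]
        exact h₂.ext.trans h₃.ext
      have hroot : s₃.heap.root = s.heap.root := by
        rw [← hD.heap]
        exact (h₃.natArr 7 (by norm_num)).trans (h₂.natArr 7 (by norm_num))
      have hR : Replaced (s.natReg 40) (EntryTree.rebuild P (.node (.leaf u) (.leaf v))) s s₄ :=
        ⟨h₄.treeAt, fun k hk => hroot ▸ h₄.root k hk, hE.trans h₄.ext,
          ((hD.frame.trans (h₂.frame (by norm_num))).trans (h₃.frame (by norm_num))).trans
            h₄.frame⟩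
      refine ⟨hR.trees hC ?_ ?_ ?_, hR.ext, hR.frame, ht₄⟩
      · refine EntryTree.balanced_rebuild (t := .leaf q) (hD.plug ▸ hb) ?_ ?_ ?_ <;>
          simp [EntryTree.Balanced, EntryTree.height]
      · rw [EntryTree.Sorted, EntryTree.toList_rebuild]
        simp only [EntryTree.toList, List.pairwise_append, List.mem_append, List.mem_singleton,
          List.singleton_append, List.pairwise_cons, List.mem_cons, List.not_mem_nil, or_false,
          List.Pairwise.nil] at hS' ⊢
        have hb := hD.before
        have ha := hD.after
        grind
      · intro x
        rw [EntryTree.toList_rebuild, Finset.mem_insert, hA, ← hD.plug, EntryTree.toList_plug]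
        simp only [EntryTree.toList, List.mem_append, List.mem_singleton]
        grind
    rw [wp_seq, wp_ite, hc]
    refine ⟨fun c' => ?_, fun c' => ?_⟩
    · refine (wp_mkNode (a := 46) (b := 42) (o := 42) (by norm_num) (by norm_num) (by norm_num)
        (by norm_num) h₂.treeAt hq₂).mono ?_
      rintro s₃ t₃ ⟨h₃, ht₃⟩
      refine (hfin r q c' (.inl ⟨rfl, rfl⟩) s₃ h₃).mono ?_
      rintro s₄ t₄ ⟨k₁, k₂, k₃, k₄⟩
      exact ⟨k₁, k₂, k₃, by rw [keyLt_cost]; simp; omega⟩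
    · refine (wp_mkNode (a := 42) (b := 46) (o := 42) (by norm_num) (by norm_num) (by norm_num)
        (by norm_num) hq₂ h₂.treeAt).mono ?_
      rintro s₃ t₃ ⟨h₃, ht₃⟩
      refine (hfin q r (lt_of_le_of_ne (not_lt.1 c') hne) (.inr ⟨rfl, rfl⟩) s₃ h₃).mono ?_
      rintro s₄ t₄ ⟨k₁, k₂, k₃, k₄⟩
      exact ⟨k₁, k₂, k₃, by rw [keyLt_cost]; simp; omega⟩

/-- Delete the entry with the key of the entry in register `41` from the tree in register `40`. -/
def treeDelete : Program :=
  descend ;;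
  .ite (.natEq (.reg 43) (.const 0))
    (.putNat 7 (.reg 40) (.const 0))
    (.setNat 43 (.sub (.reg 43) (.const 1)) ;; .setNat 42 (.get 5 (.reg 43)) ;; ascend)

theorem wp_treeDelete {s : Store} {C : ℕ → Finset Entry} (hC : Trees s.heap C) {r : Entry}
    (h41 : s.natReg 41 = r.idx) {i : ℕ} (h40 : s.natReg 40 = i)
    (hr : r ∈ C i) {Λ : ℕ} (hΛ : (C i).card < 2 ^ Λ) :
    wp treeDelete s fun s' t =>
      Trees s'.heap (Function.update C i ((C i).erase r)) ∧ s.heap.Ext s'.heap ∧ Frame 42 s s' ∧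
        t ≤ 1000 * (Λ + 1) := by
  subst h40
  have hre := hC.entryAt hr
  obtain ⟨T, hT, hb, hS, hA⟩ := (hC.stores (s.natReg 40)).resolve_left fun h => by
    simp [h.2] at hr
  have hlen := hS.length_eq hA
  have hh := EntryTree.height_le hb (hlen ▸ hΛ)
  unfold treeDelete
  rw [wp_seq]
  refine (wp_descend hT hS hre h41).mono ?_
  rintro s₁ t₁ ⟨⟨P, q, hD⟩, ht₁⟩
  have n40 := hD.frame.nat 40 (by norm_num)
  have hr' := (hA r).1 hr
  have hS' := hS
  rw [← hD.plug, EntryTree.toList_plug] at hr'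
  rw [← hD.plug, EntryTree.Sorted, EntryTree.toList_plug] at hS'
  simp only [EntryTree.toList, List.mem_append, List.mem_singleton] at hr'
  have hqr : r = q := by
    rcases hr' with (h | h) | h
    · exact absurd (hD.before r h) (lt_irrefl _)
    · exact h
    · exact absurd (hD.after r h) (lt_irrefl _)
  subst hqr
  have hmem : ∀ x, x ∈ (C (s.natReg 40)).erase r ↔
      x ∈ EntryTree.before P ∨ x ∈ EntryTree.after P := by
    intro x
    have hb := hD.before
    have ha := hD.after
    rw [Finset.mem_erase, hA, ← hD.plug, EntryTree.toList_plug]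
    simp only [EntryTree.toList, List.mem_append, List.mem_singleton]
    grind
  rw [wp_ite]
  refine ⟨fun c => ?_, fun c => ?_⟩ <;>
    simp only [Test.Holds, NatExpr.eval, Test.cost, NatExpr.cost] at c ⊢
  · have hP : P = [] := by
      cases P with
      | nil => rfl
      | cons a P =>
        obtain ⟨d, hd, -⟩ := hD.stack
        omega
    subst hP
    rw [wp_putNat]
    have hE : s₁.heap.Ext (Store.heap { s₁ with
        natArr :=
          Function.update s₁.natArr 7 (Function.update (s₁.natArr 7) (s₁.natReg 40) 0) }) := by
      constructor <;> simp
    rw [hD.heap] at hE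
    refine ⟨⟨(hE.re 0 (by omega)).trans hC.zero, fun k => ?_⟩, hE, hD.frame.trans ?_, ?_⟩
    · by_cases hk : k = s.natReg 40
      · subst hk
        refine .inl ⟨by simp [n40], ?_⟩
        rw [Function.update_self]
        ext x
        rw [hmem]
        simp [EntryTree.before, EntryTree.after]
      · rw [Function.update_of_ne hk]
        have := (hC.stores k).ext hE
        rw [← hD.heap] at this
        simpa [n40, hk] using this
    · refine ⟨fun _ _ => rfl, rfl, fun a ha => ?_, rfl⟩
      dsimp only
      rw [Function.update_of_ne (by omega)]
    · simp
      omega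
  · cases P with
    | nil => exact absurd hD.stack c
    | cons a P =>
      obtain ⟨b, t₀⟩ := a
      obtain ⟨d, hd, hdir, ht₀, hP⟩ := hD.stack
      have hPlen : P.length + 1 ≤ T.height := by
        have := EntryTree.length_path_le ((b, t₀) :: P) (.leaf r)
        rw [hD.plug] at this
        simpa using this
      rw [wp_seq, wp_setNat, wp_seq, wp_setNat]
      simp only [NatExpr.eval, hd, Nat.add_sub_cancel, Function.update_self]
      refine (wp_ascend (P := P) (t₀ := t₀) ?_ ?_).mono ?_
      · exact hP
      · exact ht₀
      rintro s₄ t₄ ⟨h₄, ht₄⟩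
      have h₄' : Replaced (s.natReg 40) (EntryTree.rebuild P t₀) s s₄ := by
        refine ⟨?_, ?_, ?_, ?_⟩
        · rw [← n40]; exact h₄.treeAt
        · rw [← n40, ← hD.heap]; exact h₄.root
        · rw [← hD.heap]; exact h₄.ext
        · refine hD.frame.trans ⟨fun x hx => ?_, h₄.frame.real, h₄.frame.natArr,
            h₄.frame.realArr⟩
          rw [h₄.frame.nat x hx]
          dsimp only
          rw [Function.update_of_ne (by omega), Function.update_of_ne (by omega)]
      refine ⟨h₄'.trees hC ?_ ?_ ?_, h₄'.ext, h₄'.frame, by simp; omega⟩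
      · have hbp : ((EntryTree.plug ((b, t₀) :: P) (.leaf r))).Balanced := hD.plug ▸ hb
        cases b
        · have hn : (EntryTree.node t₀ (.leaf r)).Balanced :=
            EntryTree.Balanced.of_plug (P := P) hbp
          exact EntryTree.balanced_rebuild (t := .node t₀ (.leaf r)) hbp hn.1
            (by simp [EntryTree.height]) (by simp [EntryTree.height]; omega)
        · have hn : (EntryTree.node (.leaf r) t₀).Balanced :=
            EntryTree.Balanced.of_plug (P := P) hbp
          exact EntryTree.balanced_rebuild (t := .node (.leaf r) t₀) hbp hn.2.1
            (by simp [EntryTree.height]) (by simp [EntryTree.height]; omega)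
      · rw [EntryTree.Sorted, EntryTree.toList_rebuild]
        cases b <;>
        · simp only [EntryTree.before, EntryTree.after, EntryTree.toList, List.pairwise_append,
            List.mem_append, List.mem_singleton] at hS' ⊢
          grind
      · intro x
        rw [EntryTree.toList_rebuild, hmem]
        cases b <;> simp only [EntryTree.before, EntryTree.after, List.mem_append] <;> tauto

/-- Search the tree in register `40` for an entry with the key of the entry in register `41`; its
address, or `0`, goes to the register `41`. -/
def treeFind : Program :=
  .ite (.natEq (.get 7 (.reg 40)) (.const 0)) (.setNat 41 (.const 0))
    (descend ;;
      .ite (keyEq (.get 2 (.reg 42))) (.setNat 41 (.get 2 (.reg 42))) (.setNat 41 (.const 0)))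

theorem wp_treeFind {s : Store} {C : ℕ → Finset Entry} (hC : Trees s.heap C) {r : Entry}
    (hr : EntryAt s.heap r) (h41 : s.natReg 41 = r.idx) {i : ℕ} (h40 : s.natReg 40 = i)
    {Λ : ℕ} (hΛ : (C i).card < 2 ^ Λ) :
    wp treeFind s fun s' t =>
      ((s'.natReg 41 = 0 ∧ ∀ q ∈ C i, q.key ≠ r.key) ∨
        ∃ q ∈ C i, q.key = r.key ∧ s'.natReg 41 = q.idx) ∧
      s'.heap = s.heap ∧ Frame 41 s s' ∧ t ≤ 1000 * (Λ + 1) := by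
  subst h40
  have hset : ∀ (s₁ : Store) (v : ℕ), Frame 42 s s₁ →
      Frame 41 s { s₁ with natReg := Function.update s₁.natReg 41 v } := by
    intro s₁ v h
    refine ⟨fun x hx => ?_, h.real, h.natArr, h.realArr⟩
    dsimp only
    rw [Function.update_of_ne (by omega), h.nat x (by omega)]
  unfold treeFind
  rw [wp_ite]
  refine ⟨fun c => ?_, fun c => ?_⟩ <;>
    simp only [Test.Holds, NatExpr.eval, Test.cost, NatExpr.cost] at c ⊢
  · have hA : C (s.natReg 40) = ∅ := by
      rcases hC.stores (s.natReg 40) with h | ⟨T, h, -⟩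
      · exact h.2
      · have := h.pos
        simp only [Store.heap] at this
        omega
    rw [wp_setNat]
    exact ⟨.inl ⟨by simp, by simp [hA]⟩, rfl, hset _ _ (.refl _ _), by simp; omega⟩
  · obtain ⟨T, hT, hb, hS, hA⟩ := (hC.stores (s.natReg 40)).resolve_left fun h => c h.1
    have hlen := hS.length_eq hA
    have hh := EntryTree.height_le hb (hlen ▸ hΛ)
    rw [wp_seq]
    refine (wp_descend hT hS hr h41).mono ?_
    rintro s₁ t₁ ⟨⟨P, q, hD⟩, ht₁⟩
    have hr₁ : EntryAt s₁.heap r := hD.heap ▸ hr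
    have n41 : s₁.natReg 41 = r.idx := (hD.frame.nat 41 (by norm_num)).trans h41
    have hc := keyEq_holds (q := .get 2 (.reg 42)) hr₁ n41 hD.treeAt.lo_at hD.treeAt.lo_eq
    have hmem : ∀ x, x ∈ C (s.natReg 40) ↔
        (x ∈ EntryTree.before P ∨ x = q) ∨ x ∈ EntryTree.after P := by
      intro x
      rw [hA, ← hD.plug, EntryTree.toList_plug]
      simp [EntryTree.toList, or_assoc]
    rw [wp_ite, hc]
    refine ⟨fun c' => ?_, fun c' => ?_⟩ <;> rw [wp_setNat]
    · refine ⟨.inr ⟨q, (hmem q).2 (.inl (.inr rfl)), c'.symm, ?_⟩, hD.heap, hset _ _ hD.frame, ?_⟩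
      · simpa [EntryTree.lo] using hD.treeAt.lo_eq
      · rw [keyEq_cost]; simp; omega
    · refine ⟨.inl ⟨by simp, fun x hx => ?_⟩, hD.heap, hset _ _ hD.frame, ?_⟩
      · rcases (hmem x).1 hx with (h | rfl) | h
        · exact (hD.before x h).ne
        · exact fun h => c' h.symm
        · exact (hD.after x h).ne'
      · rw [keyEq_cost]; simp; omega

/-- In the set `A`, the entry with the address `i` and the end `e` is one that ends first among
those that do not start before `x`. If there is none, then `i` is `0` and `e` is `0`, which is the
infinity of the internal time scale. -/
def IsFirst (A : Finset Entry) (x : ℝ) (i : ℕ) (e : ℝ) : Prop :=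
  (∀ r ∈ A, x ≤ r.s → e ≤ r.e) ∧ (i = 0 ∧ e = 0 ∨ ∃ r ∈ A, r.idx = i ∧ x ≤ r.s ∧ r.e = e)

/-- Among the entries of the tree in register `40` that do not start before the time in the real
register `40`, find one that ends first; its address, or `0`, goes to the register `41`. -/
def treeFirst : Program :=
  .setNat 41 (.const 0) ;;
  .setNat 42 (.get 7 (.reg 40)) ;;
  .ite (.natEq (.reg 42) (.const 0)) .skip
    (.loop (.neg (.natEq (.get 0 (.reg 42)) (.const 0)))
      (.ite (.realLt (.get 0 (.get 2 (.get 1 (.reg 42)))) (.reg 40))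
        (.setNat 42 (.get 1 (.reg 42)))
        (.ite (.realLt (.get 1 (.get 3 (.get 1 (.reg 42)))) (.get 1 (.reg 41)))
            (.setNat 41 (.get 3 (.get 1 (.reg 42)))) .skip ;;
          .setNat 42 (.get 0 (.reg 42)))) ;;
      .ite (.conj (.neg (.realLt (.get 0 (.get 2 (.reg 42))) (.reg 40)))
          (.realLt (.get 1 (.get 2 (.reg 42))) (.get 1 (.reg 41))))
        (.setNat 41 (.get 2 (.reg 42))) .skip)

/-- The state of `treeFirst` in the tree `T` when it has reached the subtree `q`. -/
structure FirstInv (T : EntryTree) (q : EntryTree) (x : ℝ) (s s' : Store) : Prop where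
  treeAt : TreeAt s'.heap (s'.natReg 42) q
  sorted : q.Sorted
  sub : ∀ r ∈ q.toList, r ∈ T.toList
  done : ∀ r ∈ T.toList, x ≤ r.s → s.heap.re (s'.natReg 41) ≤ r.e ∨ r ∈ q.toList
  cand : s'.natReg 41 = 0 ∨ ∃ r ∈ T.toList, r.idx = s'.natReg 41 ∧ x ≤ r.s
  heap : s'.heap = s.heap
  frame : Frame 41 s s'

/-- If the first entry of the right subtree does not start before `x`, then all of this subtree is
eligible, and its stored earliest end is compared with the best one so far; the search goes on to
the left. Otherwise nothing in the left subtree is eligible, and the search goes on to the right.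
Either way, one path is followed. -/
theorem wp_treeFirst {s : Store} {C : ℕ → Finset Entry} (hC : Trees s.heap C)
    {i : ℕ} (h40 : s.natReg 40 = i) (hneg : ∀ r ∈ C i, r.e < 0)
    {Λ : ℕ} (hΛ : (C i).card < 2 ^ Λ) :
    wp treeFirst s fun s' t =>
      IsFirst (C i) (s.realReg 40) (s'.natReg 41) (s.realArr 1 (s'.natReg 41)) ∧
      s'.heap = s.heap ∧ Frame 41 s s' ∧ t ≤ 200 * (Λ + 1) := by
  subst h40
  have hset : ∀ (s₁ : Store) (u v : ℕ), Frame 41 s s₁ →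
      Frame 41 s { s₁ with natReg := Function.update (Function.update s₁.natReg 41 u) 42 v } := by
    intro s₁ u v h
    refine ⟨fun x hx => ?_, h.real, h.natArr, h.realArr⟩
    dsimp only
    rw [Function.update_of_ne (by omega), Function.update_of_ne (by omega), h.nat x (by omega)]
  have hset' : ∀ (s₁ : Store) (v z : ℕ), 41 ≤ z → Frame 41 s s₁ →
      Frame 41 s { s₁ with natReg := Function.update s₁.natReg z v } := by
    intro s₁ v z hz h
    refine ⟨fun x hx => ?_, h.real, h.natArr, h.realArr⟩
    dsimp only
    rw [Function.update_of_ne (by omega), h.nat x (by omega)]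
  unfold treeFirst
  rw [wp_seq, wp_setNat, wp_seq, wp_setNat, wp_ite]
  refine ⟨fun c => ?_, fun c => ?_⟩ <;>
    simp only [Test.Holds, NatExpr.eval, Test.cost, NatExpr.cost, Function.update_self, ne_eq,
      Nat.reduceEqDiff, not_false_eq_true, Function.update_of_ne] at c ⊢
  · have hA : C (s.natReg 40) = ∅ := by
      rcases hC.stores (s.natReg 40) with h | ⟨T, h, -⟩
      · exact h.2
      · have := h.pos
        simp only [Store.heap] at this
        omega
    have hz := hC.zero
    simp only [Store.heap] at hz
    rw [wp_skip]
    refine ⟨⟨by simp [hA], .inl ?_⟩, rfl, hset s _ _ (.refl _ _), by omega⟩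
    simp [hz]
  · obtain ⟨T, hT, hb, hS, hA⟩ := (hC.stores (s.natReg 40)).resolve_left fun h => c h.1
    have hlen := hS.length_eq hA
    have hh := EntryTree.height_le hb (hlen ▸ hΛ)
    rw [wp_seq]
    -- each node visited costs at most 60 steps
    refine (wp_loop (fun n t s' => ∃ q, FirstInv T q (s.realReg 40) s s' ∧ n = q.height ∧
      t + 60 * q.height ≤ 60 * T.height) (n := T.height) ?_ ?_).mono ?_
    · rintro n t s' ⟨q, hI, rfl, ht⟩ hb'
      simp only [Test.Holds, NatExpr.eval] at hb'
      cases q with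
      | leaf q => exact absurd hI.treeAt.2.2.1 hb'
      | node u v =>
        obtain ⟨h₂, h₁, h₃, h₄, h₅, h₆, h₇⟩ := hI
        rw [EntryTree.sorted_node] at h₁
        have hu : TreeAt s'.heap (s'.natArr 0 (s'.natReg 42)) u := h₂.2.2.2.2.2.1
        have hv : TreeAt s'.heap (s'.natArr 1 (s'.natReg 42)) v := h₂.2.2.2.2.2.2
        have elo := hv.lo_eq
        have eb := hv.best_eq
        have els := hv.lo_at.rs
        have ebe := hv.best_at.re
        have hreal := h₇.real
        have hre : s.heap.re = s'.heap.re := by rw [h₆]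
        simp only [Store.heap] at elo eb els ebe hre
        simp only [EntryTree.toList, List.mem_append] at h₃ h₄
        rw [wp_ite]
        simp only [Test.Holds, RealExpr.eval, NatExpr.eval, elo, els, hreal]
        refine ⟨fun c₁ => ?_, fun c₁ => ?_⟩
        · rw [wp_setNat]
          refine ⟨v.height, by simp only [EntryTree.height]; omega, v,
            ⟨hv, h₁.2.1, fun r hr => h₃ r (.inr hr), ?_, h₅, h₆, hset' _ _ _ (by norm_num) h₇⟩, rfl,
            by simp [EntryTree.height] at ht ⊢; omega⟩
          intro r hr hx
          rcases h₄ r hr hx with h | h | h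
          · exact .inl h
          · have := Entry.s_le_of_key_lt (h₁.2.2 r h _ v.lo_mem)
            linarith
          · exact .inr h
        · have hall : ∀ r ∈ v.toList, s.realReg 40 ≤ r.s := by
            intro r hr
            have := EntryTree.lo_key_le h₁.2.1 hr
            rcases this.eq_or_lt with h | h
            · rw [Entry.key_eq] at h
              linarith [h.1]
            · linarith [Entry.s_le_of_key_lt h]
          rw [wp_seq, wp_ite]
          simp only [Test.Holds, RealExpr.eval, NatExpr.eval, eb, ebe]
          refine ⟨fun c₂ => ?_, fun c₂ => ?_⟩
          · rw [wp_setNat, wp_setNat]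
            refine ⟨u.height, by simp only [EntryTree.height]; omega, u,
              ⟨hu, h₁.1, fun r hr => h₃ r (.inl hr), ?_, .inr ⟨v.best, h₃ _ (.inr v.best_mem),
                ?_, hall _ v.best_mem⟩, h₆, hset _ _ _ h₇⟩, rfl,
              by simp [EntryTree.height] at ht ⊢; omega⟩
            · intro r hr hx
              have e : s.heap.re (s'.natArr 3 (s'.natArr 1 (s'.natReg 42))) = v.best.e := by
                simp only [Store.heap, hre, eb, ebe]
              simp only [NatExpr.eval, ne_eq, Nat.reduceEqDiff, not_false_eq_true,
                Function.update_of_ne, Function.update_self]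
              rw [e]
              rcases h₄ r hr hx with h | h | h
              · left
                simp only [Store.heap, hre] at h
                linarith
              · exact .inr h
              · exact .inl (EntryTree.best_le h)
            · simp [eb]
          · rw [wp_skip, wp_setNat]
            refine ⟨u.height, by simp only [EntryTree.height]; omega, u,
              ⟨hu, h₁.1, fun r hr => h₃ r (.inl hr), ?_, h₅, h₆, hset' _ _ _ (by norm_num) h₇⟩, rfl,
              by simp [EntryTree.height] at ht ⊢; omega⟩
            intro r hr hx
            rcases h₄ r hr hx with h | h | h
            · exact .inl h
            · exact .inr h
            · left
              have := EntryTree.best_le h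
              simp only [Store.heap, hre, ne_eq, Nat.reduceEqDiff, not_false_eq_true,
                Function.update_of_ne]
              linarith
    · refine ⟨T, ⟨hT, hS, fun _ h => h, fun r hr _ => .inr hr, .inl (by simp), rfl,
        hset s _ _ (.refl _ _)⟩, rfl, by simp⟩
    · rintro s' t ⟨n, t', ⟨q, hI, rfl, ht⟩, hb', rfl⟩
      simp only [Test.Holds, NatExpr.eval, not_not] at hb'
      cases q with
      | node u v =>
        have := (hI.treeAt.2.2.2.2.2.1).pos
        simp only [Store.heap, hb'] at this
        omega
      | leaf q =>
        obtain ⟨h₂, -, h₃, h₄, h₅, h₆, h₇⟩ := hI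
        have elo := h₂.lo_eq
        have els := h₂.lo_at.rs
        have ele := h₂.lo_at.re
        have hreal := h₇.real
        have hre : s.heap.re = s'.heap.re := by rw [h₆]
        simp only [Store.heap, EntryTree.lo] at elo els ele hre
        simp only [EntryTree.toList, List.mem_singleton, forall_eq] at h₃ h₄
        have hcand : s'.natReg 41 = 0 ∧ s.realArr 1 (s'.natReg 41) = 0 ∨
            ∃ r ∈ C (s.natReg 40), r.idx = s'.natReg 41 ∧ s.realReg 40 ≤ r.s ∧
              r.e = s.realArr 1 (s'.natReg 41) := by
          rcases h₅ with h | ⟨r, hr, hi, hx⟩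
          · have := hC.zero
            exact .inl ⟨h, by rw [h]; exact this⟩
          · refine .inr ⟨r, (hA r).2 hr, hi, hx, ?_⟩
            have := (hC.entryAt ((hA r).2 hr)).re
            rw [← this, hi]
            rfl
        -- the end stored at the address `0` is `0`, which no entry exceeds; so no case distinction
        -- is needed when there is no candidate yet
        have hle : s.realArr 1 (s'.natReg 41) ≤ 0 := by
          rcases hcand with h | ⟨r, hr, -, -, h⟩
          · exact h.2.le
          · rw [← h]; exact (hneg r hr).le
        rw [wp_ite]
        simp only [Test.Holds, RealExpr.eval, NatExpr.eval, elo, els, ele, hreal]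
        refine ⟨fun c₁ => ?_, fun c₁ => ?_⟩
        · rw [wp_setNat]
          have e : s.realArr 1 q.idx = q.e := by rw [hre]; exact ele
          refine ⟨⟨?_, .inr ⟨q, (hA q).2 h₃, ?_, not_lt.1 c₁.1, ?_⟩⟩, h₆,
            hset' _ _ _ (by norm_num) h₇, by simp; omega⟩
          · intro r hr hx
            simp only [NatExpr.eval, elo, Function.update_self, e]
            rcases h₄ r ((hA r).1 hr) hx with h | h
            · simp only [Store.heap, hre] at h
              linarith [c₁.2]
            · rw [h]
          · simp [elo]
          · simp [elo, e]
        · rw [wp_skip]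
          refine ⟨⟨?_, hcand⟩, h₆, h₇, by simp; omega⟩
          intro r hr hx
          rcases h₄ r ((hA r).1 hr) hx with h | h
          · exact h
          · subst h
            have := not_and.1 c₁ (not_lt.2 hx)
            rw [hre]
            exact not_lt.1 this

/-! ### Schedules of entries on several machines -/

/-- The intervals of `r` and `q` do not overlap. -/
def Apart (r q : Entry) : Prop := r.e ≤ q.s ∨ q.e ≤ r.s

/-- The assignment `f` of entries to the machines `1, …, M` (`0`: not processed) is a schedule
of `A`. -/
def Feasible (M : ℕ) (A : Finset Entry) (f : Entry → ℕ) : Prop :=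
  ∀ r ∈ A, f r ≤ M ∧ ∀ q ∈ A, f q = f r → f r ≠ 0 → q ≠ r → Apart q r

/-- The reward of the assignment `f`. -/
noncomputable def gain (A : Finset Entry) (f : Entry → ℕ) : ℝ := ∑ r ∈ A with f r ≠ 0, r.wt

/-- The greatest reward of a schedule of `A` on `M` machines. -/
noncomputable def opt (M : ℕ) (A : Finset Entry) : ℝ :=
  sSup {x | ∃ f, Feasible M A f ∧ gain A f = x}

/-- The entries of `A` whose intervals lie between `a` and `b`. -/
noncomputable def win (A : Finset Entry) (a b : ℝ) : Finset Entry :=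
  A.filter fun r => a ≤ r.s ∧ r.e ≤ b

/-- What is required of an entry that stands for a job. -/
structure Proper (w : ℝ) (r : Entry) : Prop where
  neg_one_le : -1 ≤ r.s
  lt : r.s < r.e
  neg : r.e < 0
  one_le : 1 ≤ r.wt
  wt_le : r.wt ≤ w

theorem mem_win {A : Finset Entry} {a b : ℝ} {r : Entry} :
    r ∈ win A a b ↔ r ∈ A ∧ a ≤ r.s ∧ r.e ≤ b := by simp [win]

theorem win_subset (A : Finset Entry) (a b : ℝ) : win A a b ⊆ A := Finset.filter_subset _ _

section Opt

variable {M : ℕ} {w : ℝ} {A B : Finset Entry} {f : Entry → ℕ}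

theorem Feasible.mono (h : Feasible M B f) (hAB : A ⊆ B) : Feasible M A f :=
  fun r hr => ⟨(h r (hAB hr)).1, fun q hq => (h r (hAB hr)).2 q (hAB hq)⟩

theorem Feasible.congr {g : Entry → ℕ} (h : Feasible M A f) (hfg : ∀ r ∈ A, g r = f r) :
    Feasible M A g := by
  intro r hr
  rw [hfg r hr]
  refine ⟨(h r hr).1, fun q hq => ?_⟩
  rw [hfg q hq]
  exact (h r hr).2 q hq

theorem gain_congr {g : Entry → ℕ} (hfg : ∀ r ∈ A, g r = f r) : gain A g = gain A f := by
  unfold gain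
  congr 1
  exact Finset.filter_congr fun r hr => by rw [hfg r hr]

theorem gain_nonneg (hA : ∀ r ∈ A, Proper w r) : 0 ≤ gain A f :=
  Finset.sum_nonneg fun r hr => by linarith [(hA r (Finset.mem_filter.1 hr).1).one_le]

theorem gain_le_sum (hA : ∀ r ∈ A, Proper w r) : gain A f ≤ ∑ r ∈ A, r.wt :=
  Finset.sum_le_sum_of_subset_of_nonneg (Finset.filter_subset _ _) fun r hr _ => by
    linarith [(hA r hr).one_le]

theorem card_le_gain (hA : ∀ r ∈ A, Proper w r) :
    ((A.filter fun r => f r ≠ 0).card : ℝ) ≤ gain A f := by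
  rw [gain, Finset.card_eq_sum_ones]
  push_cast
  exact Finset.sum_le_sum fun r hr => (hA r (Finset.mem_filter.1 hr).1).one_le

theorem le_opt (hA : ∀ r ∈ A, Proper w r) (hf : Feasible M A f) : gain A f ≤ opt M A := by
  refine le_csSup ⟨∑ r ∈ A, r.wt, ?_⟩ ⟨f, hf, rfl⟩
  rintro x ⟨g, -, rfl⟩
  exact gain_le_sum hA

theorem opt_le {x : ℝ} (h : ∀ f, Feasible M A f → gain A f ≤ x) : opt M A ≤ x := by
  refine csSup_le ⟨gain A fun _ => 0, fun _ => 0, fun r _ => ⟨by simp, by simp⟩, rfl⟩ ?_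
  rintro x ⟨f, hf, rfl⟩
  exact h f hf

theorem opt_nonneg (hA : ∀ r ∈ A, Proper w r) : 0 ≤ opt M A :=
  (gain_nonneg (f := fun _ => 0) hA).trans (le_opt hA fun r _ => ⟨by simp, by simp⟩)

theorem opt_le_sum (hA : ∀ r ∈ A, Proper w r) : opt M A ≤ ∑ r ∈ A, r.wt :=
  opt_le fun _ _ => gain_le_sum hA

theorem opt_le_card (hA : ∀ r ∈ A, Proper w r) : opt M A ≤ w * A.card := by
  refine (opt_le_sum hA).trans ?_
  rw [mul_comm, ← nsmul_eq_mul]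
  exact Finset.sum_le_card_nsmul _ _ _ fun r hr => (hA r hr).wt_le

theorem opt_mono (hB : ∀ r ∈ B, Proper w r) (hAB : A ⊆ B) : opt M A ≤ opt M B := by
  refine opt_le fun f hf => ?_
  have hf' : Feasible M B fun r => if r ∈ A then f r else 0 := by
    intro r hr
    by_cases hrA : r ∈ A
    · refine ⟨by simp [hrA, (hf r hrA).1], fun q _ he h0 hne => ?_⟩
      simp only [hrA, if_true] at he h0
      by_cases hqA : q ∈ A
      · simp only [hqA, if_true] at he
        exact (hf r hrA).2 q hqA he h0 hne
      · simp only [hqA, if_false] at he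
        exact absurd he.symm h0
    · simp [hrA]
  refine le_trans (le_of_eq ?_) (le_opt hB hf')
  unfold gain
  congr 1
  ext r
  simp only [Finset.mem_filter]
  constructor
  · rintro ⟨h₁, h₂⟩; exact ⟨hAB h₁, by simpa [h₁] using h₂⟩
  · rintro ⟨h₁, h₂⟩
    by_cases hrA : r ∈ A
    · exact ⟨hrA, by simpa [hrA] using h₂⟩
    · simp [hrA] at h₂

/-- A single entry changes the optimum by at most `w`. -/
theorem opt_insert_le {q : Entry} (hA : ∀ r ∈ insert q A, Proper w r) :
    opt M (insert q A) ≤ opt M A + w := by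
  refine opt_le fun f hf => ?_
  have h₁ : gain A f ≤ opt M A :=
    le_opt (fun r hr => hA r (Finset.mem_insert_of_mem hr)) (hf.mono (Finset.subset_insert _ _))
  have h₂ : gain (insert q A) f ≤ gain A f + q.wt := by
    have hq := (hA q (Finset.mem_insert_self _ _)).one_le
    by_cases hqA : q ∈ A
    · rw [Finset.insert_eq_of_mem hqA]; linarith
    · unfold gain
      rw [Finset.filter_insert]
      split_ifs
      · rw [Finset.sum_insert (by simp [hqA])]; linarith
      · linarith
  linarith [(hA q (Finset.mem_insert_self _ _)).wt_le]

/-- A schedule processes at most one entry per machine at the time `c`, or up to the time `c`. -/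
theorem Feasible.sum_crossing_le (hA : ∀ r ∈ A, Proper w r) (hf : Feasible M A f)
    (hw : 0 ≤ w) {X : Finset Entry} (hX : X ⊆ A) {c : ℝ}
    (h : ∀ r ∈ X, f r ≠ 0 ∧ r.s < c ∧ c ≤ r.e) : ∑ r ∈ X, r.wt ≤ M * w := by
  -- entries of `X` on the same machine would overlap at `c`
  have hcard : X.card ≤ M := by
    have : X.card ≤ (Finset.Icc 1 M).card := by
      refine Finset.card_le_card_of_injOn f (fun r hr => ?_) fun r hr q hq he => ?_
      · have := (hf r (hX hr)).1
        have := (h r hr).1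
        simp
        omega
      · by_contra hne
        obtain ⟨h₁, h₂, h₃⟩ := h r hr
        obtain ⟨k₁, k₂, k₃⟩ := h q hq
        rcases (hf q (hX hq)).2 r (hX hr) he k₁ hne with h' | h' <;> linarith
    simpa using this
  calc ∑ r ∈ X, r.wt ≤ X.card • w :=
        Finset.sum_le_card_nsmul _ _ _ fun r hr => (hA r (hX hr)).wt_le
    _ = X.card * w := nsmul_eq_mul _ _
    _ ≤ M * w := by gcongr

theorem win_split_disjoint (hA : ∀ r ∈ A, Proper w r) (a c b : ℝ) :
    Disjoint (win A a c) (win A c b) := by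
  rw [Finset.disjoint_left]
  intro r hr hr'
  rw [mem_win] at hr hr'
  linarith [(hA r hr.1).lt, hr.2.2, hr'.2.1]

theorem win_mono {a b a' b' : ℝ} (ha : a' ≤ a) (hb : b ≤ b') : win A a b ⊆ win A a' b' := by
  intro r
  simp only [mem_win]
  rintro ⟨h₁, h₂, h₃⟩
  exact ⟨h₁, by linarith, by linarith⟩

theorem gain_win_add_le (hA : ∀ r ∈ A, Proper w r) {a c b : ℝ} (hac : a ≤ c) (hcb : c ≤ b) :
    gain (win A a c) f + gain (win A c b) f ≤ gain (win A a b) f := by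
  unfold gain
  rw [← Finset.sum_union (Finset.disjoint_filter_filter (win_split_disjoint hA a c b)),
    ← Finset.filter_union]
  refine Finset.sum_le_sum_of_subset_of_nonneg (Finset.filter_subset_filter _ ?_) fun r hr _ => ?_
  · exact Finset.union_subset (win_mono le_rfl hcb) (win_mono hac le_rfl)
  · linarith [(hA r (win_subset _ _ _ (Finset.mem_filter.1 hr).1)).one_le]

/-- Schedules of two consecutive windows can be combined. -/
theorem opt_win_add_le (hA : ∀ r ∈ A, Proper w r) {a c b : ℝ} (hac : a ≤ c) (hcb : c ≤ b) :
    opt M (win A a c) + opt M (win A c b) ≤ opt M (win A a b) := by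
  have hw : ∀ a b, ∀ r ∈ win A a b, Proper w r := fun a b r hr => hA r (win_subset _ _ _ hr)
  suffices H : ∀ f g, Feasible M (win A a c) f → Feasible M (win A c b) g →
      gain (win A a c) f + gain (win A c b) g ≤ opt M (win A a b) by
    have : opt M (win A a c) ≤ opt M (win A a b) - opt M (win A c b) := by
      refine opt_le fun f hf => ?_
      have : opt M (win A c b) ≤ opt M (win A a b) - gain (win A a c) f :=
        opt_le fun g hg => by linarith [H f g hf hg]
      linarith
    linarith
  intro f g hf hg
  set h : Entry → ℕ := fun r => if r.e ≤ c then f r else if c ≤ r.s then g r else 0 with hh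
  have h₁ : ∀ r ∈ win A a c, h r = f r := fun r hr => by simp [hh, (mem_win.1 hr).2.2]
  have h₂ : ∀ r ∈ win A c b, h r = g r := fun r hr => by
    have := (hA r (win_subset _ _ _ hr)).lt
    have h' := (mem_win.1 hr).2.1
    simp only [hh]
    rw [if_neg (by linarith), if_pos h']
  have hfe : Feasible M (win A a b) h := by
    have hf' := hf.congr h₁
    have hg' := hg.congr h₂
    have hcase : ∀ r ∈ win A a b, h r ≠ 0 → r ∈ win A a c ∨ r ∈ win A c b := by
      intro r hr h0
      simp only [mem_win] at hr ⊢
      simp only [hh] at h0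
      split_ifs at h0 with c₁ c₂
      · exact .inl ⟨hr.1, hr.2.1, c₁⟩
      · exact .inr ⟨hr.1, c₂, hr.2.2⟩
      · exact absurd rfl h0
    intro r hr
    by_cases h0 : h r = 0
    · exact ⟨by omega, fun q _ _ h0' => absurd h0 h0'⟩
    · refine ⟨?_, fun q hq he _ hne => ?_⟩
      · rcases hcase r hr h0 with h' | h'
        · exact (hf' r h').1
        · exact (hg' r h').1
      · have h0q : h q ≠ 0 := by rwa [he]
        rcases hcase r hr h0 with h' | h' <;> rcases hcase q hq h0q with h'' | h''
        · exact (hf' r h').2 q h'' he h0 hne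
        · exact .inr ((mem_win.1 h').2.2.trans (mem_win.1 h'').2.1)
        · exact .inl ((mem_win.1 h'').2.2.trans (mem_win.1 h').2.1)
        · exact (hg' r h').2 q h'' he h0 hne
  have := gain_win_add_le (f := h) hA hac hcb
  rw [gain_congr h₁, gain_congr h₂] at this
  exact this.trans (le_opt (hw a b) hfe)

/-- Cutting a window at `c` costs at most one entry per machine. -/
theorem opt_win_le_add (hA : ∀ r ∈ A, Proper w r) (hw : 0 ≤ w) (a c b : ℝ) :
    opt M (win A a b) ≤ opt M (win A a c) + opt M (win A c b) + M * w := by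
  have hp : ∀ a b, ∀ r ∈ win A a b, Proper w r := fun a b r hr => hA r (win_subset _ _ _ hr)
  refine opt_le fun f hf => ?_
  -- the entries of a schedule that cross `c` are in `X`, and the others are left or right of `c`
  set X := (win A a b).filter fun r => f r ≠ 0 ∧ r.s < c ∧ c ≤ r.e
  have hX : ∑ r ∈ X, r.wt ≤ M * w :=
    hf.sum_crossing_le (hp a b) hw (Finset.filter_subset _ _) fun r hr => (Finset.mem_filter.1 hr).2
  set L := ((win A a b).filter fun r => f r ≠ 0 ∧ r.e < c) with hL
  set R := ((win A a b).filter fun r => f r ≠ 0 ∧ c ≤ r.s) with hR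
  have hpos : ∀ r ∈ win A a b, 0 ≤ r.wt := fun r hr => by linarith [(hp a b r hr).one_le]
  have hsum : gain (win A a b) f ≤ ∑ r ∈ L, r.wt + ∑ r ∈ R, r.wt + ∑ r ∈ X, r.wt := by
    have hdis : Disjoint L R := by
      rw [Finset.disjoint_left]
      intro r hr hr'
      simp only [hL, hR, Finset.mem_filter] at hr hr'
      linarith [(hp a b r hr.1).lt]
    have hdis' : Disjoint (L ∪ R) X := by
      rw [Finset.disjoint_left]
      intro r hr hr'
      simp only [hL, hR, X, Finset.mem_union, Finset.mem_filter] at hr hr'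
      rcases hr with h | h <;> linarith
    rw [← Finset.sum_union hdis, ← Finset.sum_union hdis']
    refine Finset.sum_le_sum_of_subset_of_nonneg ?_ fun r hr _ => ?_
    · intro r hr
      simp only [hL, hR, X, Finset.mem_union, Finset.mem_filter] at hr ⊢
      rcases lt_or_ge r.e c with h | h
      · exact .inl (.inl ⟨hr.1, hr.2, h⟩)
      · rcases lt_or_ge r.s c with h' | h'
        · exact .inr ⟨hr.1, hr.2, h', h⟩
        · exact .inl (.inr ⟨hr.1, hr.2, h'⟩)
    · simp only [hL, hR, X, Finset.mem_union, Finset.mem_filter] at hr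
      exact hpos r (by tauto)
  have hsub : ∀ {Y : Finset Entry} {x y : ℝ}, (∀ r ∈ Y, f r ≠ 0 ∧ r ∈ win A a b ∧ r ∈ win A x y) →
      ∑ r ∈ Y, r.wt ≤ opt M (win A x y) := by
    intro Y x y hY
    have hfY : Feasible M Y f := hf.mono fun r hr => (hY r hr).2.1
    have hYw : Y ⊆ win A x y := fun r hr => (hY r hr).2.2
    have : ∑ r ∈ Y, r.wt = gain Y f := by
      unfold gain
      rw [Finset.filter_true_of_mem fun r hr => (hY r hr).1]
    rw [this]
    exact (le_opt (fun r hr => hp x y r (hYw hr)) hfY).trans (opt_mono (hp x y) hYw)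
  have h₁ : ∑ r ∈ L, r.wt ≤ opt M (win A a c) := hsub fun r hr => by
    simp only [hL, Finset.mem_filter] at hr
    have := mem_win.1 hr.1
    exact ⟨hr.2.1, hr.1, mem_win.2 ⟨this.1, this.2.1, hr.2.2.le⟩⟩
  have h₂ : ∑ r ∈ R, r.wt ≤ opt M (win A c b) := hsub fun r hr => by
    simp only [hR, Finset.mem_filter] at hr
    have := mem_win.1 hr.1
    exact ⟨hr.2.1, hr.1, mem_win.2 ⟨this.1, hr.2.2, this.2.2⟩⟩
  linarith

/-- One round of the greedy algorithm. If, outside of the set `U` of entries already used, a single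
machine earns at most `x`, then `M` machines earn at most `M * x` more than `U`. -/
theorem opt_le_of_chain {U : Finset Entry} {x : ℝ}
    (hA : ∀ r ∈ A, Proper w r) (hU : U ⊆ A)
    (h : ∀ T : Finset Entry, T ⊆ A \ U → (∀ r ∈ T, ∀ q ∈ T, r ≠ q → Apart r q) →
      ∑ r ∈ T, r.wt ≤ x) : opt M A ≤ M * x + ∑ r ∈ U, r.wt := by
  refine opt_le fun f hf => ?_
  have h₁ : gain A f ≤ ∑ r ∈ (A \ U) with f r ≠ 0, r.wt + ∑ r ∈ U, r.wt := by
    unfold gain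
    rw [← Finset.sum_union]
    · refine Finset.sum_le_sum_of_subset_of_nonneg (fun r hr => ?_) fun r hr _ => ?_
      · simp only [Finset.mem_union, Finset.mem_filter, Finset.mem_sdiff] at hr ⊢
        tauto
      · simp only [Finset.mem_union, Finset.mem_filter, Finset.mem_sdiff] at hr
        have : r ∈ A := by
          rcases hr with h | h
          · exact h.1.1
          · exact hU h
        linarith [(hA r this).one_le]
    · rw [Finset.disjoint_left]
      intro r hr
      simp only [Finset.mem_filter, Finset.mem_sdiff] at hr
      exact hr.1.2
  have h₂ : ∑ r ∈ (A \ U) with f r ≠ 0, r.wt =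
      ∑ m ∈ Finset.Icc 1 M, ∑ r ∈ ((A \ U).filter fun r => f r ≠ 0) with f r = m, r.wt := by
    refine (Finset.sum_fiberwise_of_maps_to (fun r hr => ?_) _).symm
    simp only [Finset.mem_filter, Finset.mem_sdiff] at hr
    have := (hf r hr.1.1).1
    simp
    omega
  have h₃ : ∀ m ∈ Finset.Icc 1 M,
      ∑ r ∈ ((A \ U).filter fun r => f r ≠ 0) with f r = m, r.wt ≤ x := by
    intro m _
    refine h _ ((Finset.filter_subset _ _).trans (Finset.filter_subset _ _)) fun r hr q hq hne => ?_
    simp only [Finset.mem_filter, Finset.mem_sdiff] at hr hq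
    exact (hf q hq.1.1.1).2 r hr.1.1.1 (hr.2.trans hq.2.symm) hq.1.2 hne
  have h₄ := Finset.sum_le_card_nsmul _ _ _ h₃
  rw [nsmul_eq_mul, Nat.card_Icc, Nat.add_sub_cancel] at h₄
  linarith

end Opt

/-! ### Borders -/

/-- The regions into which the borders `B` cut the time between `-1` and `0`. -/
def Consec (B : Finset ℝ) (a b : ℝ) : Prop :=
  a ∈ insert (-1) B ∧ b ∈ insert 0 B ∧ a < b ∧ ∀ c ∈ B, c ≤ a ∨ b ≤ c

theorem exists_consec {B : Finset ℝ} (hB : ∀ c ∈ B, -1 < c ∧ c < 0) {a : ℝ}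
    (ha : a ∈ insert (-1) B) : ∃ b, Consec B a b := by
  have ha0 : a < 0 := by
    rcases Finset.mem_insert.1 ha with rfl | h
    · norm_num
    · exact (hB a h).2
  have hne : ((insert 0 B).filter fun b => a < b).Nonempty := ⟨0, by simp [ha0]⟩
  refine ⟨_, ha, (Finset.mem_filter.1 (Finset.min'_mem _ hne)).1,
    (Finset.mem_filter.1 (Finset.min'_mem _ hne)).2, fun c hc => ?_⟩
  rcases le_or_gt c a with h | h
  · exact .inl h
  · exact .inr (Finset.min'_le _ _ (by simp [hc, h]))

/-- Induction from the last region to the first. -/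
theorem consec_induction {B : Finset ℝ} (hB : ∀ c ∈ B, -1 < c ∧ c < 0) {P : ℝ → Prop}
    (h : ∀ a b, Consec B a b → b = 0 ∨ b ∈ B ∧ P b → P a) : ∀ a ∈ insert (-1) B, P a := by
  suffices H : ∀ n, ∀ a ∈ insert (-1) B, (B.filter fun c => a < c).card = n → P a from
    fun a ha => H _ a ha rfl
  intro n
  induction n using Nat.strong_induction_on with
  | _ n ih =>
    intro a ha hn
    obtain ⟨b, hab⟩ := exists_consec hB ha
    refine h a b hab ?_
    rcases Finset.mem_insert.1 hab.2.1 with h0 | hb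
    · exact .inl h0
    · refine .inr ⟨hb, ih _ ?_ b (Finset.mem_insert_of_mem hb) rfl⟩
      rw [← hn]
      refine Finset.card_lt_card ⟨fun c => ?_, fun hs => ?_⟩
      · simp only [Finset.mem_filter]
        exact fun hc => ⟨hc.1, hab.2.2.1.trans hc.2⟩
      · have := hs (Finset.mem_filter.2 ⟨hb, hab.2.2.1⟩)
        simp at this

/-- Regions do not overlap. -/
theorem Consec.eq_or {B : Finset ℝ} {a b x y : ℝ} (h : Consec B a b) (k : Consec B x y)
    (hB : ∀ c ∈ B, -1 < c ∧ c < 0) : (x = a ∧ y = b) ∨ y ≤ a ∨ b ≤ x := by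
  obtain ⟨h₁, h₂, h₃, h₄⟩ := h
  obtain ⟨k₁, k₂, k₃, k₄⟩ := k
  simp only [Finset.mem_insert] at h₁ h₂ k₁ k₂
  have hx1 : -1 ≤ x := by rcases k₁ with rfl | h; exacts [le_rfl, (hB _ h).1.le]
  have ha1 : -1 ≤ a := by rcases h₁ with rfl | h; exacts [le_rfl, (hB _ h).1.le]
  have hy0 : y ≤ 0 := by rcases k₂ with rfl | h; exacts [le_rfl, (hB _ h).2.le]
  have hb0 : b ≤ 0 := by rcases h₂ with rfl | h; exacts [le_rfl, (hB _ h).2.le]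
  by_contra hcon
  push Not at hcon
  obtain ⟨c₁, c₂, c₃⟩ := hcon
  have e₁ : x = a := by
    refine le_antisymm ?_ ?_
    · rcases k₁ with rfl | h
      · exact ha1
      · rcases h₄ x h with h' | h' <;> linarith
    · rcases h₁ with rfl | h
      · exact hx1
      · rcases k₄ a h with h' | h' <;> linarith
  refine c₁ e₁ (le_antisymm ?_ ?_)
  · rcases h₂ with rfl | h
    · exact hy0
    · rcases k₄ b h with h' | h' <;> linarith
  · rcases k₂ with rfl | h
    · exact hb0
    · rcases h₄ y h with h' | h' <;> linarith

section Regions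

variable {M : ℕ} {w : ℝ} {A : Finset Entry} {f : Entry → ℕ} {B : Finset ℝ}

/-- If every region earns enough to pay for the entries lost at its border, then the union of the
schedules of the regions is a good schedule. -/
theorem opt_add_le_of_regions (hA : ∀ r ∈ A, Proper w r) (hw : 0 ≤ w)
    (hB : ∀ c ∈ B, -1 < c ∧ c < 0) {κ : ℝ} (hκ : 0 ≤ κ)
    (h : ∀ a b, Consec B a b → opt M (win A a b) + M * w ≤ κ * gain (win A a b) f) :
    opt M (win A (-1) 0) + M * w ≤ κ * gain (win A (-1) 0) f := by
  refine consec_induction hB (P := fun a => opt M (win A a 0) + M * w ≤ κ * gain (win A a 0) f)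
    (fun a b hab hb => ?_) (-1) (Finset.mem_insert_self _ _)
  rcases hb with rfl | ⟨hb, ih⟩
  · exact h a _ hab
  · have h₁ := h a b hab
    have h₂ := opt_win_le_add (M := M) hA hw a b 0
    have h₃ := mul_le_mul_of_nonneg_left
      (gain_win_add_le (f := f) hA hab.2.2.1.le (hB b hb).2.le) hκ
    linarith

/-- Every region that earns at least `x` accounts for `x` in the total; hence the number of borders
is bounded by the optimum. -/
theorem sum_le_of_regions (hA : ∀ r ∈ A, Proper w r) (hB : ∀ c ∈ B, -1 < c ∧ c < 0) {x : ℝ → ℝ}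
    (h : ∀ a b, Consec B a b → x a ≤ opt M (win A a b)) :
    x (-1) + ∑ c ∈ B, x c ≤ opt M (win A (-1) 0) := by
  have := consec_induction hB (P := fun a =>
    x a + ∑ c ∈ B with a < c, x c ≤ opt M (win A a 0))
    (fun a b hab hb => ?_) (-1) (Finset.mem_insert_self _ _)
  · rwa [Finset.filter_true_of_mem fun c hc => (hB c hc).1] at this
  · have h₁ := h a b hab
    rcases hb with rfl | ⟨hb, ih⟩
    · have : (B.filter fun c => a < c) = ∅ := by
        refine Finset.filter_eq_empty_iff.2 fun c hc => ?_
        rcases hab.2.2.2 c hc with h' | h'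
        · exact not_lt.2 h'
        · linarith [(hB c hc).2]
      simpa [this] using h₁
    · have : (B.filter fun c => a < c) = insert b (B.filter fun c => b < c) := by
        ext c
        simp only [Finset.mem_filter, Finset.mem_insert]
        constructor
        · rintro ⟨hc, hac⟩
          rcases hab.2.2.2 c hc with h' | h'
          · linarith
          · rcases h'.eq_or_lt with e | l
            · exact .inl e.symm
            · exact .inr ⟨hc, l⟩
        · rintro (rfl | ⟨hc, hbc⟩)
          · exact ⟨hb, hab.2.2.1⟩
          · exact ⟨hc, hab.2.2.1.trans hbc⟩
      have h₂ := opt_win_add_le (M := M) hA hab.2.2.1.le (hB b hb).2.le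
      rw [this, Finset.sum_insert (by simp)]
      linarith

end Regions

/-! ### The dictionaries of the algorithm -/

/-- The contents of the trees. The tree `0` holds the entries `A` of all present jobs, the tree `1`
those that are processed, the trees `2` and `3` the borders, and the tree `k + 4` holds the
unprocessed entries of the class `k`. -/
noncomputable def content (A B₂ B₃ : Finset Entry) (cls mach : ℕ → ℕ) : ℕ → Finset Entry
  | 0 => A
  | 1 => A.filter fun r => mach r.idx ≠ 0
  | 2 => B₂
  | 3 => B₃
  | k + 4 => A.filter fun r => mach r.idx = 0 ∧ cls r.idx = k

/-- The machine on which an entry is processed, or `0`. -/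
abbrev Store.mach (s : Store) (r : Entry) : ℕ := s.natArr 10 r.idx

/-- The dictionaries are in order; they hold fewer than `2 ^ Λ` entries each, and the real register
`5` holds the reward of the current schedule. -/
structure Core (w : ℝ) (Λ : ℕ) (s : Store) (A B₂ B₃ : Finset Entry) : Prop where
  trees : Trees s.heap (content A B₂ B₃ (s.natArr 9) (s.natArr 10))
  proper : ∀ r ∈ A, Proper w r
  neg₂ : ∀ r ∈ B₂, r.e < 0
  neg₃ : ∀ r ∈ B₃, r.e < 0
  card : A.card < 2 ^ Λ
  card₂ : B₂.card < 2 ^ Λ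
  card₃ : B₃.card < 2 ^ Λ
  tot : s.realReg 5 = gain A s.mach

theorem content_card {A B₂ B₃ : Finset Entry} {cls mach : ℕ → ℕ} {x : ℕ} (h : A.card < x)
    (h₂ : B₂.card < x) (h₃ : B₃.card < x) (i : ℕ) : (content A B₂ B₃ cls mach i).card < x := by
  match i with
  | 0 => exact h
  | 1 => exact (Finset.card_filter_le _ _).trans_lt h
  | 2 => exact h₂
  | 3 => exact h₃
  | k + 4 => exact (Finset.card_filter_le _ _).trans_lt h

/-- What the programs on schedules leave unchanged: the registers below `n` other than the total
reward, and the arrays other than those of the trees, the machine numbers, and the tables of the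
dynamic program. -/
structure RunFrame (n : ℕ) (s s' : Store) : Prop where
  nat : ∀ x < n, s'.natReg x = s.natReg x
  real : ∀ x < n, x ≠ 5 → s'.realReg x = s.realReg x
  natArr : ∀ a, 8 ≤ a → a ≠ 10 → a ≠ 12 → s'.natArr a = s.natArr a
  realArr : ∀ a, a ≠ 3 → s'.realArr a = s.realArr a
  ext : s.heap.Ext s'.heap

theorem RunFrame.trans {n : ℕ} {s₁ s₂ s₃ : Store} (h : RunFrame n s₁ s₂) (k : RunFrame n s₂ s₃) :
    RunFrame n s₁ s₃ :=
  ⟨fun x hx => (k.nat x hx).trans (h.nat x hx), fun x hx hx' => (k.real x hx hx').trans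
    (h.real x hx hx'), fun a h₁ h₂ h₃ => (k.natArr a h₁ h₂ h₃).trans (h.natArr a h₁ h₂ h₃),
    fun a ha => (k.realArr a ha).trans (h.realArr a ha), h.ext.trans k.ext⟩

theorem RunFrame.refl (n : ℕ) (s : Store) : RunFrame n s s :=
  ⟨by simp, by simp, by simp, by simp, .refl _⟩

theorem Core.entryAt {w : ℝ} {Λ : ℕ} {s : Store} {A B₂ B₃ : Finset Entry}
    (h : Core w Λ s A B₂ B₃) {r : Entry} (hr : r ∈ A) : EntryAt s.heap r :=
  h.trees.entryAt (i := 0) hr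

theorem Core.eq_of_idx {w : ℝ} {Λ : ℕ} {s : Store} {A B₂ B₃ : Finset Entry}
    (h : Core w Λ s A B₂ B₃) {r q : Entry} (hr : r ∈ A) (hq : q ∈ A) (he : r.idx = q.idx) :
    r = q := (h.entryAt hr).eq_of_idx (h.entryAt hq) he

theorem Core.eq_of_key {w : ℝ} {Λ : ℕ} {s : Store} {A B₂ B₃ : Finset Entry}
    (h : Core w Λ s A B₂ B₃) {r q : Entry} (hr : r ∈ A) (hq : q ∈ A) (he : r.key = q.key) :
    r = q := h.trees.eq_of_key (i := 0) hr hq he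

theorem gain_insert_filter {A : Finset Entry} {f g : Entry → ℕ} {r : Entry} (hr : r ∈ A)
    (hf : f r = 0) (hg : g r ≠ 0) (h : ∀ q ∈ A, q ≠ r → g q = f q) :
    gain A g = gain A f + r.wt := by
  unfold gain
  have : (A.filter fun q => g q ≠ 0) = insert r (A.filter fun q => f q ≠ 0) := by
    ext q
    simp only [Finset.mem_filter, Finset.mem_insert]
    by_cases hq : q = r
    · subst hq; simp [hr, hg]
    · constructor
      · rintro ⟨h₁, h₂⟩; exact .inr ⟨h₁, h q h₁ hq ▸ h₂⟩
      · rintro (h' | ⟨h₁, h₂⟩)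
        · exact absurd h' hq
        · exact ⟨h₁, (h q h₁ hq).symm ▸ h₂⟩
  rw [this, Finset.sum_insert (by simp [hf])]
  ring

/-- Process the entry in register `36` on the machine in register `5`. -/
def markProg : Program :=
  .setNat 41 (.reg 36) ;;
  .setNat 40 (.add (.get 9 (.reg 36)) (.const 4)) ;;
  treeDelete ;;
  .setNat 40 (.const 1) ;;
  treeInsert ;;
  .putNat 10 (.reg 36) (.reg 5) ;;
  .setReal 5 (.add (.reg 5) (.get 2 (.reg 36)))

/-- Stop processing the entry in register `36`. -/
def unmarkProg : Program :=
  .setNat 41 (.reg 36) ;;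
  .setNat 40 (.const 1) ;;
  treeDelete ;;
  .setNat 40 (.add (.get 9 (.reg 36)) (.const 4)) ;;
  treeInsert ;;
  .putNat 10 (.reg 36) (.const 0) ;;
  .setReal 5 (.sub (.reg 5) (.get 2 (.reg 36)))

theorem wp_markProg {w : ℝ} {Λ : ℕ} {s : Store} {A B₂ B₃ : Finset Entry}
    (h : Core w Λ s A B₂ B₃) {r : Entry} (hr : r ∈ A) (h36 : s.natReg 36 = r.idx)
    (h0 : s.mach r = 0) (h5 : s.natReg 5 ≠ 0) :
    wp markProg s fun s' t => Core w Λ s' A B₂ B₃ ∧ RunFrame 40 s s' ∧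
      s'.natArr 10 = Function.update (s.natArr 10) r.idx (s.natReg 5) ∧
      s'.natArr 12 = s.natArr 12 ∧ s'.realArr = s.realArr ∧
      t ≤ 2100 * (Λ + 1) := by
  have hrA := h.entryAt hr
  unfold markProg
  rw [wp_seq, wp_setNat, wp_seq, wp_setNat, wp_seq]
  refine (wp_treeDelete (C := content A B₂ B₃ (s.natArr 9) (s.natArr 10)) (r := r)
    (i := s.natArr 9 r.idx + 4) (Λ := Λ) ?_ ?_ ?_ (by simp [content, hr, h0])
    (content_card h.card h.card₂ h.card₃ _)).mono ?_
  · exact h.trees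
  · simp [h36]
  · simp [h36]
  rintro s₁ t₁ ⟨hT₁, hE₁, hF₁, ht₁⟩
  have n41 : s₁.natReg 41 = r.idx := by rw [hF₁.nat 41 (by norm_num)]; simp [h36]
  have n36 : s₁.natReg 36 = r.idx := by rw [hF₁.nat 36 (by norm_num)]; simp [h36]
  have n5 : s₁.natReg 5 = s.natReg 5 := by rw [hF₁.nat 5 (by norm_num)]; simp
  have hE₁' : s.heap.Ext s₁.heap := hE₁
  rw [wp_seq, wp_setNat, wp_seq]
  refine (wp_treeInsert (C := Function.update (content A B₂ B₃ (s.natArr 9) (s.natArr 10))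
    (s.natArr 9 r.idx + 4) ((content A B₂ B₃ (s.natArr 9) (s.natArr 10)
      (s.natArr 9 r.idx + 4)).erase r)) (r := r) (i := 1) (Λ := Λ) ?_ ?_ ?_ ?_ ?_ ?_).mono ?_
  · exact hT₁
  · exact hrA.ext hE₁'
  · simpa using n41
  · simp
  · intro q hq hk
    simp only [ne_eq, OfNat.one_ne_ofNat, Nat.reduceEqDiff, not_false_eq_true,
      Function.update_of_ne, content, Finset.mem_filter, show (1 : ℕ) ≠ s.natArr 9 r.idx + 4 by
        omega] at hq
    have := h.eq_of_key hq.1 hr hk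
    subst this
    exact hq.2 h0
  · rw [Function.update_of_ne (by omega)]
    exact content_card h.card h.card₂ h.card₃ _
  rintro s₂ t₂ ⟨hT₂, hE₂, hF₂, ht₂⟩
  have hE₂' : s₁.heap.Ext s₂.heap := hE₂
  have m36 : s₂.natReg 36 = r.idx := by rw [hF₂.nat 36 (by norm_num)]; simpa using n36
  have m5 : s₂.natReg 5 = s.natReg 5 := by rw [hF₂.nat 5 (by norm_num)]; simpa using n5
  have a9 : s₂.natArr 9 = s.natArr 9 := (hF₂.natArr 9 (by norm_num)).trans (hF₁.natArr 9
    (by norm_num))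
  have a10 : s₂.natArr 10 = s.natArr 10 := (hF₂.natArr 10 (by norm_num)).trans (hF₁.natArr 10
    (by norm_num))
  have a12 : s₂.natArr 12 = s.natArr 12 := (hF₂.natArr 12 (by norm_num)).trans (hF₁.natArr 12
    (by norm_num))
  have hrr : s₂.realReg = s.realReg := hF₂.real.trans hF₁.real
  have hra : s₂.realArr = s.realArr := hF₂.realArr.trans hF₁.realArr
  rw [wp_seq, wp_putNat, wp_setReal]
  have hmach : Function.update s₂.natArr 10 (Function.update (s₂.natArr 10) (s₂.natReg 36)
      (s₂.natReg 5)) 10 = Function.update (s.natArr 10) r.idx (s.natReg 5) := by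
    rw [Function.update_self, m36, m5, a10]
  have hnew : ∀ q ∈ A, q ≠ r → Function.update (s.natArr 10) r.idx (s.natReg 5) q.idx =
      s.natArr 10 q.idx := by
    intro q hq hne
    rw [Function.update_of_ne fun he => hne (h.eq_of_idx hq hr he)]
  have hnew' : Function.update (s.natArr 10) r.idx (s.natReg 5) r.idx = s.natReg 5 :=
    Function.update_self _ _ _
  refine ⟨⟨?_, h.proper, h.neg₂, h.neg₃, h.card, h.card₂, h.card₃, ?_⟩, ?_, hmach, ?_, hra, ?_⟩
  · have e₉ : Function.update s₂.natArr 10 (Function.update (s₂.natArr 10) (s₂.natReg 36)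
      (s₂.natReg 5)) 9 = s.natArr 9 := by rw [Function.update_of_ne (by norm_num), a9]
    simp only [NatExpr.eval]
    rw [hmach, e₉]
    refine Eq.mp (congrArg (Trees _) ?_) hT₂
    funext i
    match i with
    | 0 => rw [Function.update_of_ne (by omega), Function.update_of_ne (by omega)]; rfl
    | 1 =>
      rw [Function.update_self, Function.update_of_ne (by omega)]
      ext q
      simp only [content, Finset.mem_insert, Finset.mem_filter]
      by_cases hq : q = r
      · subst hq; simp [hr, h5]
      · constructor
        · rintro (h' | ⟨h₁, h₂⟩)
          · exact absurd h' hq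
          · exact ⟨h₁, by rwa [hnew q h₁ hq]⟩
        · rintro ⟨h₁, h₂⟩
          exact .inr ⟨h₁, by rwa [hnew q h₁ hq] at h₂⟩
    | 2 => rw [Function.update_of_ne (by omega), Function.update_of_ne (by omega)]; rfl
    | 3 => rw [Function.update_of_ne (by omega), Function.update_of_ne (by omega)]; rfl
    | k + 4 =>
      rw [Function.update_of_ne (by omega)]
      have hgen : ∀ q, q ≠ r → (q ∈ content A B₂ B₃ (s.natArr 9) (s.natArr 10) (k + 4) ↔
          q ∈ content A B₂ B₃ (s.natArr 9)
            (Function.update (s.natArr 10) r.idx (s.natReg 5)) (k + 4)) := by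
        intro q hq
        simp only [content, Finset.mem_filter]
        constructor
        · rintro ⟨h₁, h₂⟩; exact ⟨h₁, by rwa [hnew q h₁ hq]⟩
        · rintro ⟨h₁, h₂⟩; exact ⟨h₁, by rwa [hnew q h₁ hq] at h₂⟩
      by_cases hk : k = s.natArr 9 r.idx
      · subst hk
        rw [Function.update_self]
        ext q
        rw [Finset.mem_erase]
        by_cases hq : q = r
        · subst hq; simp [content, h5]
        · rw [← hgen q hq]; tauto
      · rw [Function.update_of_ne (by omega)]
        ext q
        by_cases hq : q = r
        · subst hq; simp [content, h5, Ne.symm hk]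
        · exact hgen q hq
  · change Function.update s₂.realReg 5 (s₂.realReg 5 + s₂.realArr 2 (s₂.natReg 36)) 5 =
      gain A fun q => Function.update s₂.natArr 10 (Function.update (s₂.natArr 10)
        (s₂.natReg 36) (s₂.natReg 5)) 10 q.idx
    have e := hrA.rw
    simp only [Store.heap] at e
    rw [hmach, Function.update_self, m36, hrr, hra, e, h.tot]
    exact (gain_insert_filter hr h0 (by rwa [hnew']) hnew).symm
  · refine ⟨fun x hx => ?_, fun x hx hx5 => ?_, fun a ha h10 h12 => ?_, fun a _ => ?_, ?_⟩
    · dsimp only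
      rw [hF₂.nat x (by omega)]
      dsimp only
      rw [Function.update_of_ne (by omega), hF₁.nat x (by omega)]
      dsimp only
      rw [Function.update_of_ne (by omega), Function.update_of_ne (by omega)]
    · dsimp only
      rw [Function.update_of_ne hx5, hrr]
    · dsimp only
      rw [Function.update_of_ne h10, hF₂.natArr a ha]
      exact hF₁.natArr a ha
    · dsimp only
      rw [hra]
    · exact hE₁'.trans hE₂'
  · dsimp only
    rw [Function.update_of_ne (by norm_num), a12]
  · simp
    omega

theorem wp_unmarkProg {w : ℝ} {Λ : ℕ} {s : Store} {A B₂ B₃ : Finset Entry}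
    (h : Core w Λ s A B₂ B₃) {r : Entry} (hr : r ∈ A) (h36 : s.natReg 36 = r.idx)
    (h0 : s.mach r ≠ 0) :
    wp unmarkProg s fun s' t => Core w Λ s' A B₂ B₃ ∧ RunFrame 40 s s' ∧
      s'.natArr 10 = Function.update (s.natArr 10) r.idx 0 ∧
      s'.natArr 12 = s.natArr 12 ∧ s'.realArr = s.realArr ∧
      t ≤ 2100 * (Λ + 1) := by
  have hrA := h.entryAt hr
  unfold unmarkProg
  rw [wp_seq, wp_setNat, wp_seq, wp_setNat, wp_seq]
  refine (wp_treeDelete (C := content A B₂ B₃ (s.natArr 9) (s.natArr 10)) (r := r)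
    (i := 1) (Λ := Λ) ?_ ?_ ?_ (by simp [content, hr, h0])
    (content_card h.card h.card₂ h.card₃ _)).mono ?_
  · exact h.trees
  · simp [h36]
  · simp
  rintro s₁ t₁ ⟨hT₁, hE₁, hF₁, ht₁⟩
  have n41 : s₁.natReg 41 = r.idx := by rw [hF₁.nat 41 (by norm_num)]; simp [h36]
  have n36 : s₁.natReg 36 = r.idx := by rw [hF₁.nat 36 (by norm_num)]; simp [h36]
  have hE₁' : s.heap.Ext s₁.heap := hE₁
  have b9 : s₁.natArr 9 = s.natArr 9 := hF₁.natArr 9 (by norm_num)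
  rw [wp_seq, wp_setNat, wp_seq]
  refine (wp_treeInsert (C := Function.update (content A B₂ B₃ (s.natArr 9) (s.natArr 10)) 1
    ((content A B₂ B₃ (s.natArr 9) (s.natArr 10) 1).erase r)) (r := r)
    (i := s.natArr 9 r.idx + 4) (Λ := Λ)
    ?_ ?_ ?_ ?_ ?_ ?_).mono ?_
  · exact hT₁
  · exact hrA.ext hE₁'
  · simpa using n41
  · simp [n36, b9]
  · intro q hq hk
    rw [Function.update_of_ne (by omega)] at hq
    simp only [content, Finset.mem_filter] at hq
    have := h.eq_of_key hq.1 hr hk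
    subst this
    exact h0 hq.2.1
  · rw [Function.update_of_ne (by omega)]
    exact content_card h.card h.card₂ h.card₃ _
  rintro s₂ t₂ ⟨hT₂, hE₂, hF₂, ht₂⟩
  have hE₂' : s₁.heap.Ext s₂.heap := hE₂
  have m36 : s₂.natReg 36 = r.idx := by rw [hF₂.nat 36 (by norm_num)]; simpa using n36
  have a9 : s₂.natArr 9 = s.natArr 9 := (hF₂.natArr 9 (by norm_num)).trans b9
  have a10 : s₂.natArr 10 = s.natArr 10 := (hF₂.natArr 10 (by norm_num)).trans (hF₁.natArr 10
    (by norm_num))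
  have a12 : s₂.natArr 12 = s.natArr 12 := (hF₂.natArr 12 (by norm_num)).trans (hF₁.natArr 12
    (by norm_num))
  have hrr : s₂.realReg = s.realReg := hF₂.real.trans hF₁.real
  have hra : s₂.realArr = s.realArr := hF₂.realArr.trans hF₁.realArr
  rw [wp_seq, wp_putNat, wp_setReal]
  have hmach : Function.update s₂.natArr 10 (Function.update (s₂.natArr 10) (s₂.natReg 36)
      0) 10 = Function.update (s.natArr 10) r.idx 0 := by
    rw [Function.update_self, m36, a10]
  have hnew : ∀ q ∈ A, q ≠ r → Function.update (s.natArr 10) r.idx 0 q.idx =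
      s.natArr 10 q.idx := by
    intro q hq hne
    rw [Function.update_of_ne fun he => hne (h.eq_of_idx hq hr he)]
  have hnew' : Function.update (s.natArr 10) r.idx 0 r.idx = 0 :=
    Function.update_self _ _ _
  refine ⟨⟨?_, h.proper, h.neg₂, h.neg₃, h.card, h.card₂, h.card₃, ?_⟩, ?_, hmach, ?_, hra, ?_⟩
  · have e₉ : Function.update s₂.natArr 10 (Function.update (s₂.natArr 10) (s₂.natReg 36)
      0) 9 = s.natArr 9 := by rw [Function.update_of_ne (by norm_num), a9]
    simp only [NatExpr.eval]
    rw [hmach, e₉]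
    refine Eq.mp (congrArg (Trees _) ?_) hT₂
    funext i
    match i with
    | 0 => rw [Function.update_of_ne (by omega), Function.update_of_ne (by omega)]; rfl
    | 1 =>
      rw [Function.update_of_ne (by omega), Function.update_self]
      ext q
      simp only [content, Finset.mem_erase, Finset.mem_filter]
      by_cases hq : q = r
      · subst hq; simp
      · constructor
        · rintro ⟨-, h₁, h₂⟩
          exact ⟨h₁, by rwa [hnew q h₁ hq]⟩
        · rintro ⟨h₁, h₂⟩
          exact ⟨hq, h₁, by rwa [hnew q h₁ hq] at h₂⟩
    | 2 => rw [Function.update_of_ne (by omega), Function.update_of_ne (by omega)]; rfl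
    | 3 => rw [Function.update_of_ne (by omega), Function.update_of_ne (by omega)]; rfl
    | k + 4 =>
      have hgen : ∀ q, q ≠ r → (q ∈ content A B₂ B₃ (s.natArr 9) (s.natArr 10) (k + 4) ↔
          q ∈ content A B₂ B₃ (s.natArr 9)
            (Function.update (s.natArr 10) r.idx 0) (k + 4)) := by
        intro q hq
        simp only [content, Finset.mem_filter]
        constructor
        · rintro ⟨h₁, h₂⟩; exact ⟨h₁, by rwa [hnew q h₁ hq]⟩
        · rintro ⟨h₁, h₂⟩; exact ⟨h₁, by rwa [hnew q h₁ hq] at h₂⟩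
      by_cases hk : k = s.natArr 9 r.idx
      · subst hk
        rw [Function.update_self, Function.update_of_ne (by omega)]
        ext q
        rw [Finset.mem_insert]
        by_cases hq : q = r
        · subst hq; simp [content, hr]
        · rw [← hgen q hq]; tauto
      · rw [Function.update_of_ne (by omega), Function.update_of_ne (by omega)]
        ext q
        by_cases hq : q = r
        · subst hq; simp [content, Ne.symm hk]
        · exact hgen q hq
  · change Function.update s₂.realReg 5 (s₂.realReg 5 - s₂.realArr 2 (s₂.natReg 36)) 5 =
      gain A fun q => Function.update s₂.natArr 10 (Function.update (s₂.natArr 10)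
        (s₂.natReg 36) 0) 10 q.idx
    have e := hrA.rw
    simp only [Store.heap] at e
    rw [hmach, Function.update_self, m36, hrr, hra, e, h.tot, sub_eq_iff_eq_add]
    exact gain_insert_filter hr hnew' h0 fun q hq hne => (hnew q hq hne).symm
  · refine ⟨fun x hx => ?_, fun x hx hx5 => ?_, fun a ha h10 h12 => ?_, fun a _ => ?_, ?_⟩
    · dsimp only
      rw [hF₂.nat x (by omega)]
      dsimp only
      rw [Function.update_of_ne (by omega), hF₁.nat x (by omega)]
      dsimp only
      rw [Function.update_of_ne (by omega), Function.update_of_ne (by omega)]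
    · dsimp only
      rw [Function.update_of_ne hx5, hrr]
    · dsimp only
      rw [Function.update_of_ne h10, hF₂.natArr a ha]
      exact hF₁.natArr a ha
    · dsimp only
      rw [hra]
    · exact hE₁'.trans hE₂'
  · dsimp only
    rw [Function.update_of_ne (by norm_num), a12]
  · simp
    omega

/-! ### The dynamic program for one machine -/

/-- The values to which rewards are rounded: `N, N + 1, …, 2 N - 1`, then `2 N, 2 N + 2, …`, and so
on, with the distance doubling after every `N` values. -/
def clsVal (N k : ℕ) : ℕ := 2 ^ (k / N) * (N + k % N)

theorem clsVal_pos {N : ℕ} (hN : 1 ≤ N) (k : ℕ) : 1 ≤ clsVal N k :=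
  Nat.mul_pos (by positivity) (by omega)

theorem clsVal_succ {N : ℕ} (hN : 1 ≤ N) (k : ℕ) :
    clsVal N (k + 1) = clsVal N k + 2 ^ (k / N) := by
  unfold clsVal
  have hm := Nat.mod_lt k hN
  have hd := Nat.div_add_mod k N
  rcases Nat.lt_or_ge (k % N + 1) N with h | h
  · have e₁ : (k + 1) / N = k / N := by
      rw [Nat.div_eq_iff hN]
      have := Nat.mul_comm N (k / N)
      omega
    have e₂ : (k + 1) % N = k % N + 1 := by
      have := Nat.div_add_mod (k + 1) N
      rw [e₁] at this
      omega
    rw [e₁, e₂]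
    ring
  · have hN' : k % N + 1 = N := by omega
    have e : k + 1 = N * (k / N + 1) := by
      rw [Nat.mul_add, mul_one]
      omega
    have e₁ : (k + 1) / N = k / N + 1 := by rw [e, Nat.mul_div_cancel_left _ hN]
    have e₂ : (k + 1) % N = 0 := by rw [e, Nat.mul_mod_right]
    rw [e₁, e₂, pow_succ]
    have : N + k % N + 1 = N * 2 := by omega
    calc 2 ^ (k / N) * 2 * (N + 0) = 2 ^ (k / N) * (N * 2) := by ring
      _ = 2 ^ (k / N) * (N + k % N + 1) := by rw [this]
      _ = _ := by ring

theorem clsVal_strictMono {N : ℕ} (hN : 1 ≤ N) : StrictMono (clsVal N) :=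
  strictMono_nat_of_lt_succ fun k => by
    rw [clsVal_succ hN]
    exact Nat.lt_add_of_pos_right (by positivity)

theorem clsVal_zero {N : ℕ} (hN : 1 ≤ N) : clsVal N 0 = N := by
  simp [clsVal, Nat.mod_eq_of_lt hN]

/-- Consecutive class values differ at most by the factor `1 + 1 / N`, which is the loss caused by
the rounding of the rewards. -/
theorem mul_clsVal_succ_le {N : ℕ} (hN : 1 ≤ N) (k : ℕ) :
    N * clsVal N (k + 1) ≤ (N + 1) * clsVal N k := by
  rw [clsVal_succ hN]
  have : N * 2 ^ (k / N) ≤ clsVal N k := by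
    rw [mul_comm]
    exact Nat.mul_le_mul_left _ (by omega)
  nlinarith

/-- Up to rounding, the reward of an entry of class `k` is `clsVal N k / N`. -/
def InClass (N k : ℕ) (r : Entry) : Prop :=
  (clsVal N k : ℝ) ≤ N * r.wt ∧ (N : ℝ) * (N * r.wt) ≤ (N + 1) * clsVal N k

/-- The table of a dynamic program: `F j` is the earliest time at which one machine can have
collected the value `j`, when it processes entries of `V` from the time `a` on, `R` is the greatest
value that can be collected up to the time `b`, and `ch j` is the address of the last entry of a
solution for the value `j`. -/
structure Table (V : Finset Entry) (v : Entry → ℕ) (a b : ℝ) (F : ℕ → ℝ) (ch : ℕ → ℕ) (R : ℕ) :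
    Prop where
  zero : F 0 = a
  step : ∀ j, 1 ≤ j → j ≤ R → ∃ r ∈ V, ch j = r.idx ∧ F (j - v r) ≤ r.s ∧ r.e = F j ∧ F j ≤ b
  min : ∀ j, 1 ≤ j → j ≤ R → ∀ r ∈ V, F (j - v r) ≤ r.s → F j ≤ r.e

theorem Table.le {V : Finset Entry} {v : Entry → ℕ} {a b : ℝ} {F : ℕ → ℝ} {ch : ℕ → ℕ} {R : ℕ}
    (h : Table V v a b F ch R) (hv : ∀ r ∈ V, 1 ≤ v r) (hlt : ∀ r ∈ V, r.s < r.e) :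
    ∀ j ≤ R, a ≤ F j := by
  intro j
  induction j using Nat.strong_induction_on with
  | _ j ih =>
    intro hj
    rcases Nat.eq_zero_or_pos j with rfl | h0
    · exact h.zero.ge
    · obtain ⟨r, hr, -, h₁, h₂, -⟩ := h.step j h0 hj
      have := ih (j - v r) (by have := hv r hr; omega) (by omega)
      linarith [hlt r hr]

/-- The table is optimal: when the value `R + 1` cannot be reached, no chain has a greater value
than `R`. By induction on the chain, whose last entry is removed. -/
theorem Table.sum_le {V : Finset Entry} {v : Entry → ℕ} {a b : ℝ} {F : ℕ → ℝ} {ch : ℕ → ℕ} {R : ℕ}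
    (h : Table V v a b F ch R) (hv : ∀ r ∈ V, 1 ≤ v r) (hlt : ∀ r ∈ V, r.s < r.e)
    (hend : ∀ r ∈ V, F (R + 1 - v r) ≤ r.s → b < r.e) {T : Finset Entry} (hT : T ⊆ V)
    (hch : ∀ r ∈ T, ∀ q ∈ T, r ≠ q → Apart r q) (hwin : ∀ r ∈ T, a ≤ r.s ∧ r.e ≤ b) :
    ∑ r ∈ T, v r ≤ R := by
  suffices H : ∀ n, ∀ T : Finset Entry, T.card = n → T ⊆ V →
      (∀ r ∈ T, ∀ q ∈ T, r ≠ q → Apart r q) → (∀ r ∈ T, a ≤ r.s ∧ r.e ≤ b) →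
      ∑ r ∈ T, v r ≤ R ∧ ∀ y, a ≤ y → (∀ r ∈ T, r.e ≤ y) → ∀ j ≤ ∑ r ∈ T, v r, F j ≤ y from
    (H _ T rfl hT hch hwin).1
  intro n
  induction n with
  | zero =>
    intro T hn _ _ _
    rw [Finset.card_eq_zero] at hn
    subst hn
    simp only [Finset.sum_empty, Nat.zero_le, true_and]
    intro y hy _ j hj
    rw [Nat.le_zero.1 hj, h.zero]
    exact hy
  | succ n ih =>
    intro T hn hT hch hwin
    have hne : T.Nonempty := Finset.card_pos.1 (by omega)
    obtain ⟨r, hr, hmax⟩ := T.exists_max_image (fun r => r.e) hne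
    have hsub := Finset.erase_subset r T
    have hlast : ∀ q ∈ T.erase r, q.e ≤ r.s := by
      intro q hq
      rw [Finset.mem_erase] at hq
      rcases hch q hq.2 r hr hq.1 with h' | h'
      · exact h'
      · have := hmax q hq.2
        have := hlt q (hT hq.2)
        linarith
    obtain ⟨ih₁, ih₂⟩ := ih (T.erase r) (by rw [Finset.card_erase_of_mem hr]; omega)
      (hsub.trans hT) (fun x hx q hq => hch x (hsub hx) q (hsub hq)) fun x hx => hwin x (hsub hx)
    have hsum : ∑ x ∈ T, v x = ∑ x ∈ T.erase r, v x + v r := (Finset.sum_erase_add _ _ hr).symm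
    have hvr := hv r (hT hr)
    have hstart := ih₂ r.s (hwin r hr).1 hlast
    have hR : ∑ x ∈ T, v x ≤ R := by
      by_contra hcon
      have := hend r (hT hr) (hstart _ (by omega))
      linarith [(hwin r hr).2]
    refine ⟨hR, fun y hy hTy j hj => ?_⟩
    rcases Nat.eq_zero_or_pos j with rfl | h0
    · rw [h.zero]; exact hy
    · exact (h.min j h0 (by omega) r (hT hr) (hstart _ (by omega))).trans (hTy r hr)

/-- The value of every cell of the table is collected by some set of entries. -/
theorem Table.exists_le_sum {V : Finset Entry} {v : Entry → ℕ} {a b : ℝ} {F : ℕ → ℝ} {ch : ℕ → ℕ}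
    {R : ℕ} (h : Table V v a b F ch R) (hv : ∀ r ∈ V, 1 ≤ v r) (hlt : ∀ r ∈ V, r.s < r.e) :
    ∀ j ≤ R, ∃ T ⊆ V, (∀ r ∈ T, r.e ≤ F j) ∧ j ≤ ∑ r ∈ T, v r := by
  intro j
  induction j using Nat.strong_induction_on with
  | _ j ih =>
    intro hj
    rcases Nat.eq_zero_or_pos j with rfl | h0
    · exact ⟨∅, by simp, by simp, by simp⟩
    · obtain ⟨r, hr, -, h₁, h₂, -⟩ := h.step j h0 hj
      obtain ⟨T, hT, hT₁, hT₂⟩ := ih (j - v r) (by have := hv r hr; omega) (by omega)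
      have hrT : r ∉ T := fun hrT => by linarith [hT₁ r hrT, hlt r hr]
      refine ⟨insert r T, Finset.insert_subset hr hT, ?_, ?_⟩
      · intro q hq
        rcases Finset.mem_insert.1 hq with rfl | hq
        · exact h₂.le
        · linarith [hT₁ q hq, hlt r hr]
      · rw [Finset.sum_insert hrT]
        omega

theorem Core.congr {w : ℝ} {Λ : ℕ} {s s' : Store} {A B₂ B₃ : Finset Entry}
    (h : Core w Λ s A B₂ B₃) (hh : s'.heap = s.heap) (h9 : s'.natArr 9 = s.natArr 9)
    (h10 : s'.natArr 10 = s.natArr 10) (h5 : s'.realReg 5 = s.realReg 5) :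
    Core w Λ s' A B₂ B₃ := by
  refine ⟨?_, h.proper, h.neg₂, h.neg₃, h.card, h.card₂, h.card₃, ?_⟩
  · rw [hh, h9, h10]; exact h.trees
  · rw [h5, h.tot]
    unfold Store.mach
    rw [h10]

/-- The registers and the table of the class values hold the parameters of the algorithm. -/
structure Setup (M N K : ℕ) (w : ℝ) (s : Store) (A : Finset Entry) : Prop where
  regM : s.natReg 1 = M
  regN : s.natReg 3 = N
  regK : s.natReg 4 = K
  regw : s.realReg 3 = w
  one_le : 1 ≤ N
  table : ∀ k < K, s.natArr 11 k = clsVal N k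
  top : (N : ℝ) * w < clsVal N K
  cls : ∀ r ∈ A, InClass N (s.natArr 9 r.idx) r

theorem Setup.frame {M N K n : ℕ} {w : ℝ} {s s' : Store} {A : Finset Entry}
    (h : Setup M N K w s A) (hF : RunFrame n s s') (hn : 5 ≤ n) : Setup M N K w s' A :=
  ⟨(hF.nat 1 (by omega)).trans h.regM, (hF.nat 3 (by omega)).trans h.regN,
    (hF.nat 4 (by omega)).trans h.regK, (hF.real 3 (by omega) (by omega)).trans h.regw, h.one_le,
    by rw [hF.natArr 11 (by omega) (by omega) (by omega)]; exact h.table, h.top,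
    by rw [hF.natArr 9 (by omega) (by omega) (by omega)]; exact h.cls⟩

theorem Setup.cls_lt {M N K : ℕ} {w : ℝ} {s : Store} {A : Finset Entry}
    (h : Setup M N K w s A) {r : Entry} (hr : r ∈ A) (hp : Proper w r) :
    s.natArr 9 r.idx < K := by
  by_contra hcon
  have h₁ : (clsVal N K : ℝ) ≤ clsVal N (s.natArr 9 r.idx) :=
    Nat.cast_le.2 ((clsVal_strictMono h.one_le).monotone (not_lt.1 hcon))
  have h₂ := (h.cls r hr).1
  have h₃ : (N : ℝ) * r.wt ≤ N * w := by
    have := hp.wt_le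
    gcongr
  linarith [h.top]

/-- What the computation of a cell of the table leaves unchanged. -/
structure Quiet (s s' : Store) : Prop where
  heap : s'.heap = s.heap
  nat : ∀ x < 40, x ≠ 31 → x ≠ 32 → s'.natReg x = s.natReg x
  real : ∀ x < 40, s'.realReg x = s.realReg x
  natArr : ∀ a, 8 ≤ a → s'.natArr a = s.natArr a
  realArr : s'.realArr = s.realArr

/-- Compute the entry that ends the solution for the value that follows the one in register `30`;
its address, or `0`, goes to the register `32`. -/
def cellProg : Program :=
  .setNat 32 (.const 0) ;;
  .setNat 31 (.const 0) ;;
  .loop (.natLt (.reg 31) (.reg 4))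
    (.setNat 40 (.add (.reg 31) (.const 4)) ;;
      .setReal 40 (.get 3 (.sub (.add (.reg 30) (.const 1)) (.get 11 (.reg 31)))) ;;
      treeFirst ;;
      .ite (.realLt (.get 1 (.reg 41)) (.get 1 (.reg 32))) (.setNat 32 (.reg 41)) .skip ;;
      .setNat 31 (.add (.reg 31) (.const 1)))

/-- The entries that are not processed. -/
noncomputable def Store.free (s : Store) (A : Finset Entry) : Finset Entry :=
  A.filter fun r => s.mach r = 0

/-- The value of the class of an entry. -/
abbrev Store.val (s : Store) (N : ℕ) (r : Entry) : ℕ := clsVal N (s.natArr 9 r.idx)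

/-- One search per class finds the entry that ends first among those that can be the last one of a
set of the value in the register `30`, plus one. -/
theorem wp_cellProg {M N K Λ : ℕ} {w : ℝ} {s : Store} {A B₂ B₃ : Finset Entry}
    (h : Core w Λ s A B₂ B₃) (hS : Setup M N K w s A) :
    wp cellProg s fun s' t =>
      (∀ r ∈ s.free A, s.realArr 3 (s.natReg 30 + 1 - s.val N r) ≤ r.s →
        s.realArr 1 (s'.natReg 32) ≤ r.e) ∧
      (s'.natReg 32 = 0 ∧ s.realArr 1 (s'.natReg 32) = 0 ∨
        ∃ r ∈ s.free A, s'.natReg 32 = r.idx ∧ s.realArr 3 (s.natReg 30 + 1 - s.val N r) ≤ r.s ∧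
          r.e = s.realArr 1 (s'.natReg 32)) ∧
      Quiet s s' ∧ t ≤ 270 * (K + 1) * (Λ + 1) := by
  unfold cellProg
  rw [wp_seq, wp_setNat, wp_seq, wp_setNat]
  refine (wp_loop (fun n t s' => ∃ k, s'.natReg 31 = k ∧ k ≤ K ∧ n = K - k ∧
    (∀ r ∈ s.free A, s.natArr 9 r.idx < k → s.realArr 3 (s.natReg 30 + 1 - s.val N r) ≤ r.s →
        s.realArr 1 (s'.natReg 32) ≤ r.e) ∧
      (s'.natReg 32 = 0 ∧ s.realArr 1 (s'.natReg 32) = 0 ∨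
        ∃ r ∈ s.free A, s'.natReg 32 = r.idx ∧ s.realArr 3 (s.natReg 30 + 1 - s.val N r) ≤ r.s ∧
          r.e = s.realArr 1 (s'.natReg 32)) ∧
      Quiet s s' ∧ t ≤ 250 * k * (Λ + 1)) (n := K) ?_ ?_).mono ?_
  · rintro n t s' ⟨k, h31, hkK, rfl, h₁, h₂, hQ, ht⟩ hb
    have n4 : s'.natReg 4 = K := (hQ.nat 4 (by norm_num) (by norm_num) (by norm_num)).trans hS.regK
    have n30 : s'.natReg 30 = s.natReg 30 := hQ.nat 30 (by norm_num) (by norm_num) (by norm_num)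
    simp only [Test.Holds, NatExpr.eval, h31, n4] at hb
    have a11 : s'.natArr 11 k = clsVal N k := by
      rw [hQ.natArr 11 (by norm_num)]; exact hS.table k hb
    have hC : Trees s'.heap (content A B₂ B₃ (s.natArr 9) (s.natArr 10)) := hQ.heap ▸ h.trees
    rw [wp_seq, wp_setNat, wp_seq, wp_setReal, wp_seq]
    refine (wp_treeFirst (C := content A B₂ B₃ (s.natArr 9) (s.natArr 10)) (i := k + 4) (Λ := Λ)
      ?_ ?_ ?_ ?_).mono ?_
    · exact hC
    · simp [h31]
    · intro r hr
      simp only [content, Finset.mem_filter] at hr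
      exact (h.proper r hr.1).neg
    · exact content_card h.card h.card₂ h.card₃ _
    rintro s₁ t₁ ⟨hI, hh₁, hF₁, ht₁⟩
    simp only [RealExpr.eval, NatExpr.eval, Function.update_self, ne_eq, Nat.reduceEqDiff,
      not_false_eq_true, Function.update_of_ne, h31, n30, a11, hQ.realArr] at hI
    have m31 : s₁.natReg 31 = k := by rw [hF₁.nat 31 (by norm_num)]; simp [h31]
    have m32 : s₁.natReg 32 = s'.natReg 32 := by rw [hF₁.nat 32 (by norm_num)]; simp
    have ra₁ : s₁.realArr = s.realArr := hF₁.realArr.trans hQ.realArr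
    have hQ₁ : Quiet s s₁ := by
      refine ⟨?_, fun x hx h31 h32 => ?_, fun x hx => ?_, fun a ha => ?_, ra₁⟩
      · rw [← hQ.heap]; exact hh₁
      · rw [hF₁.nat x (by omega)]
        dsimp only
        rw [Function.update_of_ne (by omega), hQ.nat x hx h31 h32]
      · rw [hF₁.real]
        dsimp only
        rw [Function.update_of_ne (by omega), hQ.real x hx]
      · exact (hF₁.natArr a ha).trans (hQ.natArr a ha)
    have hfin : ∀ (o u : ℕ), u ≤ 20 →
        (o = s₁.natReg 41 ∧ s.realArr 1 (s₁.natReg 41) ≤ s.realArr 1 (s'.natReg 32) ∨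
          o = s'.natReg 32 ∧ s.realArr 1 (s'.natReg 32) ≤ s.realArr 1 (s₁.natReg 41)) →
        ∀ s₂ : Store, s₂ = { s₁ with
          natReg := Function.update (Function.update s₁.natReg 32 o) 31 (k + 1) } →
        ∃ n' < K - k, ∃ k', s₂.natReg 31 = k' ∧ k' ≤ K ∧ n' = K - k' ∧
          (∀ r ∈ s.free A, s.natArr 9 r.idx < k' →
            s.realArr 3 (s.natReg 30 + 1 - s.val N r) ≤ r.s →
            s.realArr 1 (s₂.natReg 32) ≤ r.e) ∧
          (s₂.natReg 32 = 0 ∧ s.realArr 1 (s₂.natReg 32) = 0 ∨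
            ∃ r ∈ s.free A, s₂.natReg 32 = r.idx ∧
              s.realArr 3 (s.natReg 30 + 1 - s.val N r) ≤ r.s ∧
              r.e = s.realArr 1 (s₂.natReg 32)) ∧
          Quiet s s₂ ∧ t + 20 + t₁ + u ≤ 250 * k' * (Λ + 1) := by
      rintro o u hu ho s₂ rfl
      have e32 : Function.update (Function.update s₁.natReg 32 o) 31 (k + 1) 32 = o := by simp
      simp only [e32]
      refine ⟨K - (k + 1), by omega, k + 1, by simp, hb, rfl, ?_, ?_, ?_, ?_⟩
      · intro r hr hk hx
        rcases Nat.lt_succ_iff_lt_or_eq.1 hk with hk | hk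
        · have := h₁ r hr hk hx
          rcases ho with ⟨rfl, h'⟩ | ⟨rfl, h'⟩ <;> linarith
        · have hrk : r ∈ content A B₂ B₃ (s.natArr 9) (s.natArr 10) (k + 4) := by
            simp only [Store.free, Finset.mem_filter] at hr
            simp only [content, Finset.mem_filter]
            exact ⟨hr.1, hr.2, hk⟩
          have := hI.1 r hrk (by simpa only [Store.val, hk] using hx)
          rcases ho with ⟨rfl, h'⟩ | ⟨rfl, h'⟩ <;> linarith
      · rcases ho with ⟨rfl, h'⟩ | ⟨rfl, h'⟩
        · rcases hI.2 with h'' | ⟨r, hr, g₁, g₂, g₃⟩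
          · exact .inl h''
          · simp only [content, Finset.mem_filter] at hr
            refine .inr ⟨r, ?_, g₁.symm, ?_, g₃⟩
            · simp only [Store.free, Finset.mem_filter]
              exact ⟨hr.1, hr.2.1⟩
            · simpa only [Store.val, hr.2.2] using g₂
        · exact h₂
      · refine ⟨hQ₁.heap, fun x hx h31 h32 => ?_, hQ₁.real, hQ₁.natArr, hQ₁.realArr⟩
        dsimp only
        rw [Function.update_of_ne (by omega), Function.update_of_ne (by omega),
          hQ₁.nat x hx h31 h32]
      · nlinarith
    rw [wp_seq, wp_ite]
    simp only [Test.Holds, RealExpr.eval, NatExpr.eval, ra₁, m32]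
    refine ⟨fun c => ?_, fun c => ?_⟩
    · rw [wp_setNat, wp_setNat]
      obtain ⟨n', hn', k', g₁, g₂, g₃, g₄, g₅, g₆, g₇⟩ := hfin (s₁.natReg 41) 20 le_rfl
        (.inl ⟨rfl, c.le⟩) _ rfl
      refine ⟨n', hn', k', by simpa [m31] using g₁, g₂, g₃, by simpa using g₄, by simpa using g₅,
        by simpa [m31] using g₆, ?_⟩
      simp
      omega
    · rw [wp_skip, wp_setNat]
      obtain ⟨n', hn', k', g₁, g₂, g₃, g₄, g₅, g₆, g₇⟩ := hfin (s'.natReg 32) 20 le_rfl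
        (.inr ⟨rfl, not_lt.1 c⟩) _ rfl
      refine ⟨n', hn', k', by simpa [m31] using g₁, g₂, g₃, by simpa [m32] using g₄,
        by simpa [m32] using g₅, ?_, ?_⟩
      · have e : Function.update s₁.natReg 32 (s'.natReg 32) = s₁.natReg := by
          rw [← m32, Function.update_eq_self]
        rw [e] at g₆
        simpa [m31] using g₆
      · simp
        omega
  · have hz : s.realArr 1 0 = 0 := h.trees.zero
    refine ⟨0, by simp, by omega, rfl, by simp, .inl (by simp [hz]), ?_, by simp⟩
    refine ⟨rfl, fun x hx h31 h32 => ?_, fun _ _ => rfl, fun _ _ => rfl, rfl⟩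
    dsimp only
    rw [Function.update_of_ne (by omega), Function.update_of_ne (by omega)]
  · rintro s' t ⟨n, t', ⟨k, h31, hkK, rfl, h₁, h₂, hQ, ht⟩, hb, rfl⟩
    have n4 : s'.natReg 4 = K := (hQ.nat 4 (by norm_num) (by norm_num) (by norm_num)).trans hS.regK
    simp only [Test.Holds, NatExpr.eval, h31, n4] at hb
    have hk : k = K := by omega
    subst hk
    refine ⟨fun r hr => h₁ r hr ?_, h₂, hQ, ?_⟩
    · simp only [Store.free, Finset.mem_filter] at hr
      exact hS.cls_lt hr.1 (h.proper r hr.1)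
    · simp
      nlinarith

/-- The cell `R + 1` is filled with the earliest end of an entry that can be added to a smaller
cell. -/
theorem Table.snoc {V : Finset Entry} {v : Entry → ℕ} {a b : ℝ} {F : ℕ → ℝ} {ch : ℕ → ℕ}
    {R : ℕ} (h : Table V v a b F ch R) (hv : ∀ r ∈ V, 1 ≤ v r) {r : Entry} (hr : r ∈ V)
    (hF : F (R + 1 - v r) ≤ r.s) (hb : r.e ≤ b)
    (hmin : ∀ q ∈ V, F (R + 1 - v q) ≤ q.s → r.e ≤ q.e) :
    Table V v a b (Function.update F (R + 1) r.e) (Function.update ch (R + 1) r.idx) (R + 1) := by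
  have hold : ∀ j ≤ R + 1, ∀ q ∈ V, Function.update F (R + 1) r.e (j - v q) = F (j - v q) :=
    fun j hj q hq => Function.update_of_ne (by have := hv q hq; omega) _ _
  refine ⟨?_, fun j h1 hj => ?_, fun j h1 hj q hq => ?_⟩
  · rw [Function.update_of_ne (by omega), h.zero]
  · rcases Nat.lt_or_ge R j with hR | hR
    · obtain rfl : j = R + 1 := by omega
      refine ⟨r, hr, Function.update_self _ _ _, ?_, ?_, ?_⟩
      · rwa [hold _ hj r hr]
      · rw [Function.update_self]
      · rwa [Function.update_self]
    · obtain ⟨q, hq, k₁, k₂, k₃, k₄⟩ := h.step j h1 hR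
      have hne : j ≠ R + 1 := by omega
      refine ⟨q, hq, ?_, ?_, ?_, ?_⟩
      · rwa [Function.update_of_ne hne]
      · rwa [hold _ hj q hq]
      · rwa [Function.update_of_ne hne]
      · rwa [Function.update_of_ne hne]
  · rw [hold _ hj q hq]
    rcases Nat.lt_or_ge R j with hR | hR
    · obtain rfl : j = R + 1 := by omega
      rw [Function.update_self]
      exact hmin q hq
    · rw [Function.update_of_ne (by omega)]
      exact h.min j h1 hR q hq

theorem Setup.val_eq {M N K : ℕ} {w : ℝ} {s : Store} {A : Finset Entry}
    (h : Setup M N K w s A) {r : Entry} (hr : r ∈ A) (hp : Proper w r) :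
    s.natArr 11 (s.natArr 9 r.idx) = s.val N r := h.table _ (h.cls_lt hr hp)

/-- Fill the table for the window between the registers `6` and `7`; the greatest value goes to the
register `30`. -/
def tableProg : Program :=
  .putReal 3 (.const 0) (.reg 6) ;;
  .setNat 30 (.const 0) ;;
  .setNat 33 (.const 0) ;;
  .loop (.natEq (.reg 33) (.const 0))
    (cellProg ;;
      .ite (.conj (.neg (.natEq (.reg 32) (.const 0))) (.neg (.realLt (.reg 7) (.get 1 (.reg 32)))))
        (.setNat 30 (.add (.reg 30) (.const 1)) ;;
          .putNat 12 (.reg 30) (.reg 32) ;;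
          .putReal 3 (.reg 30) (.get 1 (.reg 32)))
        (.setNat 33 (.const 1)))

/-- What `tableProg` leaves unchanged. -/
structure TableFrame (s s' : Store) : Prop where
  heap : s'.heap = s.heap
  nat : ∀ x < 30, s'.natReg x = s.natReg x
  real : ∀ x < 40, s'.realReg x = s.realReg x
  natArr : ∀ a, 8 ≤ a → a ≠ 12 → s'.natArr a = s.natArr a
  realArr : ∀ a, a ≠ 3 → s'.realArr a = s.realArr a

theorem TableFrame.runFrame {s s' : Store} (h : TableFrame s s') : RunFrame 30 s s' :=
  ⟨h.nat, fun x hx _ => h.real x (by omega), fun a ha _ h12 => h.natArr a ha h12, h.realArr,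
    h.heap ▸ .refl _⟩

/-- The table is filled until a value cannot be reached before the end of the window. This happens,
since no value exceeds the sum of all values. -/
theorem wp_tableProg {M N K Λ : ℕ} {w : ℝ} {s : Store} {A B₂ B₃ : Finset Entry}
    (h : Core w Λ s A B₂ B₃) (hS : Setup M N K w s A) :
    wp tableProg s fun s' t =>
      Table (s.free A) (s.val N) (s.realReg 6) (s.realReg 7) (s'.realArr 3) (s'.natArr 12)
        (s'.natReg 30) ∧
      (∀ r ∈ s.free A, s'.realArr 3 (s'.natReg 30 + 1 - s.val N r) ≤ r.s → s.realReg 7 < r.e) ∧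
      TableFrame s s' ∧ t ≤ 330 * (K + 1) * (Λ + 1) * (s'.natReg 30 + 1) := by
  have hv : ∀ r ∈ s.free A, 1 ≤ s.val N r := fun r _ => clsVal_pos hS.one_le _
  have hneg : ∀ r ∈ s.free A, r.e < 0 := fun r hr =>
    (h.proper r (Finset.filter_subset _ _ hr)).neg
  have hlt : ∀ r ∈ s.free A, r.s < r.e := fun r hr =>
    (h.proper r (Finset.filter_subset _ _ hr)).lt
  have hz : s.realArr 1 0 = 0 := h.trees.zero
  unfold tableProg
  rw [wp_seq, wp_putReal, wp_seq, wp_setNat, wp_seq, wp_setNat]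
  refine (wp_loop (fun n t s' =>
    Table (s.free A) (s.val N) (s.realReg 6) (s.realReg 7) (s'.realArr 3) (s'.natArr 12)
        (s'.natReg 30) ∧
      (s'.natReg 33 ≠ 0 → ∀ r ∈ s.free A,
        s'.realArr 3 (s'.natReg 30 + 1 - s.val N r) ≤ r.s → s.realReg 7 < r.e) ∧
      TableFrame s s' ∧ s'.natReg 33 ≤ 1 ∧
      t ≤ 310 * (K + 1) * (Λ + 1) * (s'.natReg 30 + s'.natReg 33) ∧
      n = (1 - s'.natReg 33) * (∑ r ∈ s.free A, s.val N r + 1 - s'.natReg 30))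
    (n := ∑ r ∈ s.free A, s.val N r + 1) ?_ ?_).mono ?_
  · rintro n t s₁ ⟨hT, hend, hF, h33, ht, rfl⟩ hb
    replace hb : s₁.natReg 33 = 0 := hb
    have hc₁ : Core w Λ s₁ A B₂ B₃ := h.congr hF.heap (hF.natArr 9 (by norm_num) (by norm_num))
      (hF.natArr 10 (by norm_num) (by norm_num)) (hF.real 5 (by norm_num))
    have hS₁ : Setup M N K w s₁ A := hS.frame hF.runFrame (by norm_num)
    have efree : s₁.free A = s.free A := by
      unfold Store.free Store.mach
      rw [hF.natArr 10 (by norm_num) (by norm_num)]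
    have eval : ∀ r, s₁.val N r = s.val N r := by
      intro r
      unfold Store.val
      rw [hF.natArr 9 (by norm_num) (by norm_num)]
    -- the values that can be reached are bounded, which bounds the number of iterations
    have hR : s₁.natReg 30 ≤ ∑ r ∈ s.free A, s.val N r := by
      obtain ⟨T, hTV, -, hle⟩ := hT.exists_le_sum hv hlt _ le_rfl
      exact hle.trans (Finset.sum_le_sum_of_subset hTV)
    have ra1 : s₁.realArr 1 = s.realArr 1 := hF.realArr 1 (by norm_num)
    rw [wp_seq]
    refine (wp_cellProg hc₁ hS₁).mono ?_
    rintro s₂ t₂ ⟨hm₂, hx₂, hQ, ht₂⟩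
    simp only [efree, eval, ra1] at hm₂ hx₂
    have ra1' : s₂.realArr 1 = s.realArr 1 := by rw [hQ.realArr, ra1]
    have m30 : s₂.natReg 30 = s₁.natReg 30 := hQ.nat 30 (by norm_num) (by norm_num) (by norm_num)
    have m33 : s₂.natReg 33 = 0 := (hQ.nat 33 (by norm_num) (by norm_num) (by norm_num)).trans hb
    have m7 : s₂.realReg 7 = s.realReg 7 := by
      rw [hQ.real 7 (by norm_num), hF.real 7 (by norm_num)]
    have ra3 : s₂.realArr 3 = s₁.realArr 3 := by rw [hQ.realArr]
    have na12 : s₂.natArr 12 = s₁.natArr 12 := hQ.natArr 12 (by norm_num)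
    have hpos : 1 ≤ (K + 1) * (Λ + 1) := Nat.mul_pos (by omega) (by omega)
    rw [wp_ite]
    simp only [Test.Holds, NatExpr.eval, RealExpr.eval, m7, ra1']
    refine ⟨fun c => ?_, fun c => ?_⟩
    · obtain ⟨r, hr, e₁, e₂, e₃⟩ := hx₂.resolve_left fun hx => c.1 hx.1
      simp only [wp_seq, wp_setNat, wp_putNat, wp_putReal]
      refine ⟨_, ?_, ?_, ?_, ?_, ?_, ?_, rfl⟩
      · simp [hb, m30, m33]
        omega
      · have := hT.snoc hv hr e₂ (by rw [e₃]; exact not_lt.1 c.2) (fun q hq hx => by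
          rw [e₃]; exact hm₂ q hq hx)
        simpa [m30, ra3, na12, e₁, e₃, ra1'] using this
      · simp [m33]
      · refine ⟨?_, fun x hx => ?_, fun x hx => ?_, fun a ha h12 => ?_, fun a ha => ?_⟩
        · rw [← hF.heap, ← hQ.heap]; simp [Store.heap]
        · dsimp only
          rw [Function.update_of_ne (by omega), hQ.nat x (by omega) (by omega) (by omega),
            hF.nat x hx]
        · dsimp only
          rw [hQ.real x hx, hF.real x hx]
        · dsimp only
          rw [Function.update_of_ne h12, hQ.natArr a ha, hF.natArr a ha h12]
        · dsimp only
          rw [Function.update_of_ne ha, hQ.realArr, hF.realArr a ha]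
      · simp [m33]
      · simp [m33, m30]
        rw [hb] at ht
        linarith
    · rw [wp_setNat]
      refine ⟨_, ?_, ?_, ?_, ?_, ?_, ?_, rfl⟩
      · simp [hb, m30, m33]
        omega
      · simpa [m30, ra3, na12] using hT
      · intro _ r hr hx
        simp [m30, ra3] at hx
        have h₁ := hm₂ r hr hx
        by_contra hcon
        refine c ⟨fun h0 => ?_, ?_⟩
        · rw [h0, hz] at h₁
          linarith [hneg r hr]
        · linarith
      · refine ⟨?_, fun x hx => ?_, fun x hx => ?_, fun a ha h12 => ?_, fun a ha => ?_⟩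
        · rw [← hF.heap, ← hQ.heap]; simp [Store.heap]
        · dsimp only
          rw [Function.update_of_ne (by omega), hQ.nat x (by omega) (by omega) (by omega),
            hF.nat x hx]
        · dsimp only
          rw [hQ.real x hx, hF.real x hx]
        · dsimp only
          rw [hQ.natArr a ha, hF.natArr a ha h12]
        · dsimp only
          rw [hQ.realArr, hF.realArr a ha]
      · simp
      · simp [m30]
        rw [hb] at ht
        linarith
  · refine ⟨⟨by simp, by simp; omega, by simp; omega⟩, by simp, ?_, by simp, by simp, by simp⟩
    refine ⟨by simp [Store.heap], fun x hx => ?_, fun _ _ => rfl, fun _ _ _ => rfl,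
      fun a ha => ?_⟩
    · dsimp only
      rw [Function.update_of_ne (by omega), Function.update_of_ne (by omega)]
    · dsimp only
      rw [Function.update_of_ne ha]
  · rintro s' t ⟨n, t', ⟨hT, hend, hF, h33, ht, rfl⟩, hb, rfl⟩
    replace hb : s'.natReg 33 ≠ 0 := hb
    refine ⟨hT, hend hb, hF, ?_⟩
    have hpos : 1 ≤ (K + 1) * (Λ + 1) * (s'.natReg 30 + 1) :=
      Nat.mul_pos (Nat.mul_pos (by omega) (by omega)) (by omega)
    have e33 : s'.natReg 33 = 1 := by omega
    rw [e33] at ht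
    simp
    linarith

/-- Process, on the machine in register `5`, the solution for the value in register `30`. -/
def traceProg : Program :=
  .loop (.neg (.natEq (.reg 30) (.const 0)))
    (.setNat 36 (.get 12 (.reg 30)) ;;
      .setNat 34 (.get 11 (.get 9 (.reg 36))) ;;
      markProg ;;
      .setNat 30 (.sub (.reg 30) (.reg 34)))

/-- Following the choices back from the last cell yields a set of entries that has the value of this
cell, and takes time for its entries only. -/
theorem wp_traceProg {M N K Λ : ℕ} {w a b : ℝ} {s : Store} {A B₂ B₃ : Finset Entry}
    (h : Core w Λ s A B₂ B₃) (hS : Setup M N K w s A) (h5 : s.natReg 5 ≠ 0)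
    (hT : Table (s.free A) (s.val N) a b (s.realArr 3) (s.natArr 12) (s.natReg 30)) :
    wp traceProg s fun s' t => ∃ T ⊆ win (s.free A) a b,
      (∀ r ∈ T, ∀ q ∈ T, r ≠ q → Apart r q) ∧
      (∀ q ∈ A, s'.mach q = if q ∈ T then s.natReg 5 else s.mach q) ∧
      s.natReg 30 ≤ ∑ r ∈ T, s.val N r ∧
      Core w Λ s' A B₂ B₃ ∧ RunFrame 30 s s' ∧ t ≤ 2130 * (Λ + 1) * (T.card + 1) := by
  have hv : ∀ r ∈ s.free A, 1 ≤ s.val N r := fun r _ => clsVal_pos hS.one_le _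
  have hlt : ∀ r ∈ s.free A, r.s < r.e := fun r hr =>
    (h.proper r (Finset.filter_subset _ _ hr)).lt
  unfold traceProg
  refine (wp_loop (fun n t s' => ∃ T ⊆ win (s.free A) a b,
      (∀ r ∈ T, ∀ q ∈ T, r ≠ q → Apart r q) ∧
      (∀ q ∈ A, s'.mach q = if q ∈ T then s.natReg 5 else s.mach q) ∧
      (∀ q ∈ T, s.realArr 3 (s'.natReg 30) ≤ q.s) ∧
      s'.natReg 30 ≤ s.natReg 30 ∧
      s.natReg 30 ≤ s'.natReg 30 + ∑ r ∈ T, s.val N r ∧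
      s'.natArr 12 = s.natArr 12 ∧
      Core w Λ s' A B₂ B₃ ∧ RunFrame 30 s s' ∧ t ≤ 2130 * (Λ + 1) * T.card ∧ n = s'.natReg 30)
    (n := s.natReg 30) ?_ ?_).mono ?_
  · rintro n t s₁ ⟨T, hTA, hch, hm, hF, hle, hge, h12, hc₁, hR, ht, rfl⟩ hb
    replace hb : s₁.natReg 30 ≠ 0 := hb
    obtain ⟨r, hr, e₁, e₂, e₃, e₄⟩ := hT.step (s₁.natReg 30) (by omega) hle
    have hrA : r ∈ A := Finset.filter_subset _ _ hr
    have hr0 : s.mach r = 0 := (Finset.mem_filter.1 hr).2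
    have hrT : r ∉ T := fun hrT => by linarith [hF r hrT, hlt r hr]
    have hvr := hv r hr
    have n9 : s₁.natArr 9 = s.natArr 9 := hR.natArr 9 (by norm_num) (by norm_num) (by norm_num)
    have n11 : s₁.natArr 11 = s.natArr 11 := hR.natArr 11 (by norm_num) (by norm_num) (by norm_num)
    rw [wp_seq, wp_setNat, wp_seq, wp_setNat, wp_seq]
    refine (wp_markProg (w := w) (Λ := Λ) (A := A) (B₂ := B₂) (B₃ := B₃) (r := r)
      ?_ hrA ?_ ?_ ?_).mono ?_
    · exact hc₁.congr rfl rfl rfl rfl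
    · simp [h12, e₁]
    · change s₁.mach r = 0
      rw [hm r hrA, if_neg hrT, hr0]
    · change s₁.natReg 5 ≠ 0
      rw [hR.nat 5 (by norm_num)]
      exact h5
    rintro s₂ t₂ ⟨hc₂, hR₂, h10, h12₂, hra₂, ht₂⟩
    have m30 : s₂.natReg 30 = s₁.natReg 30 := by rw [hR₂.nat 30 (by norm_num)]; simp
    have m34 : s₂.natReg 34 = s.val N r := by
      rw [hR₂.nat 34 (by norm_num), ← hS.val_eq hrA (h.proper r hrA)]
      simp [h12, e₁, n9, n11]
    have n5 : s₁.natReg 5 = s.natReg 5 := hR.nat 5 (by norm_num)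
    have hstep : s.realArr 3 (s₁.natReg 30 - s.val N r) ≤ r.s := e₂
    have ha : a ≤ r.s := (hT.le hv hlt _ (by omega)).trans hstep
    rw [wp_setNat]
    simp only [NatExpr.eval, m30, m34]
    refine ⟨s₁.natReg 30 - s.val N r, by omega, insert r T, ?_, ?_, ?_, ?_, ?_, ?_, ?_, ?_, ?_, ?_,
      ?_⟩
    · exact Finset.insert_subset (mem_win.2 ⟨hr, ha, by linarith⟩) hTA
    · intro x hx q hq hne
      rcases Finset.mem_insert.1 hx with hxr | hx' <;> rcases Finset.mem_insert.1 hq with hqr | hq'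
      · exact absurd (hxr.trans hqr.symm) hne
      · rw [hxr]; exact .inl (by linarith [hF q hq'])
      · rw [hqr]; exact .inr (by linarith [hF x hx'])
      · exact hch x hx' q hq' hne
    · intro q hq
      change s₂.natArr 10 q.idx = _
      rw [h10]
      change Function.update (s₁.natArr 10) r.idx (s₁.natReg 5) q.idx = _
      by_cases hqr : q = r
      · subst hqr
        simp [n5]
      · rw [Function.update_of_ne fun he => hqr (h.eq_of_idx hq hrA he)]
        have := hm q hq
        simp only [Finset.mem_insert, hqr, false_or]
        exact this
    · intro q hq
      simp only [Function.update_self]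
      rcases Finset.mem_insert.1 hq with rfl | hq
      · exact hstep
      · linarith [hF q hq, hlt r hr]
    · simp only [Function.update_self]
      omega
    · simp only [Function.update_self]
      rw [Finset.sum_insert hrT]
      omega
    · exact h12₂.trans h12
    · exact hc₂.congr rfl rfl rfl rfl
    · refine ⟨fun x hx => ?_, fun x hx hx5 => ?_, fun a ha h10 h12 => ?_, fun a ha => ?_, ?_⟩
      · dsimp only
        rw [Function.update_of_ne (by omega), hR₂.nat x (by omega)]
        dsimp only
        rw [Function.update_of_ne (by omega), Function.update_of_ne (by omega), hR.nat x hx]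
      · exact (hR₂.real x (by omega) hx5).trans (hR.real x hx hx5)
      · exact (hR₂.natArr a ha h10 h12).trans (hR.natArr a ha h10 h12)
      · exact (hR₂.realArr a ha).trans (hR.realArr a ha)
      · exact hR.ext.trans hR₂.ext
    · rw [Finset.card_insert_of_notMem hrT]
      simp
      linarith
    · simp
  · exact ⟨∅, by simp, by simp, by simp, by simp, le_rfl, by simp, rfl, h, .refl _ _, by simp, rfl⟩
  · rintro s' t ⟨n, t', ⟨T, hTA, hch, hm, hF, hle, hge, h12, hc₁, hR, ht, rfl⟩, hb, rfl⟩
    replace hb : s'.natReg 30 = 0 := not_not.1 hb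
    rw [hb] at hge
    refine ⟨T, hTA, hch, hm, by omega, hc₁, hR, ?_⟩
    simp
    linarith

/-- Find an almost optimal set of unprocessed entries for one machine, and process it on the
machine in register `5`. -/
def machineProg : Program := tableProg ;; traceProg

/-- Up to the rounding of the rewards, the machine is used optimally. The time is paid by the reward
that is gained, apart from a constant. -/
theorem wp_machineProg {M N K Λ : ℕ} {w : ℝ} {s : Store} {A B₂ B₃ : Finset Entry}
    (h : Core w Λ s A B₂ B₃) (hS : Setup M N K w s A) (h5 : s.natReg 5 ≠ 0) :
    wp machineProg s fun s' t => ∃ T ⊆ win (s.free A) (s.realReg 6) (s.realReg 7),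
      (∀ r ∈ T, ∀ q ∈ T, r ≠ q → Apart r q) ∧
      (∀ q ∈ A, s'.mach q = if q ∈ T then s.natReg 5 else s.mach q) ∧
      (∀ T' ⊆ win (s.free A) (s.realReg 6) (s.realReg 7),
        (∀ r ∈ T', ∀ q ∈ T', r ≠ q → Apart r q) →
        ∑ r ∈ T', r.wt ≤ (1 + 1 / N) * ∑ r ∈ T, r.wt) ∧
      Core w Λ s' A B₂ B₃ ∧ RunFrame 30 s s' ∧
      (t : ℝ) ≤ 2500 * (K + 1) * (Λ + 1) * (N * ∑ r ∈ T, r.wt + 1) := by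
  have hN : (1 : ℝ) ≤ N := by exact_mod_cast hS.one_le
  have hv : ∀ r ∈ s.free A, 1 ≤ s.val N r := fun r _ => clsVal_pos hS.one_le _
  have hlt : ∀ r ∈ s.free A, r.s < r.e := fun r hr =>
    (h.proper r (Finset.filter_subset _ _ hr)).lt
  unfold machineProg
  rw [wp_seq]
  refine (wp_tableProg h hS).mono ?_
  rintro s₁ t₁ ⟨hT, hend, hF, ht₁⟩
  have hc₁ : Core w Λ s₁ A B₂ B₃ := h.congr hF.heap (hF.natArr 9 (by norm_num) (by norm_num))
    (hF.natArr 10 (by norm_num) (by norm_num)) (hF.real 5 (by norm_num))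
  have hS₁ : Setup M N K w s₁ A := hS.frame hF.runFrame (by norm_num)
  have n10 : s₁.natArr 10 = s.natArr 10 := hF.natArr 10 (by norm_num) (by norm_num)
  have n9 : s₁.natArr 9 = s.natArr 9 := hF.natArr 9 (by norm_num) (by norm_num)
  have efree : s₁.free A = s.free A := by
    unfold Store.free Store.mach
    rw [n10]
  have eval : s₁.val N = s.val N := by
    funext r
    unfold Store.val
    rw [n9]
  have n5 : s₁.natReg 5 = s.natReg 5 := hF.nat 5 (by norm_num)
  have htr := wp_traceProg (a := s.realReg 6) (b := s.realReg 7) hc₁ hS₁ (by rwa [n5])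
    (by rw [efree, eval]; exact hT)
  rw [efree] at htr
  refine htr.mono ?_
  rintro s₂ t₂ ⟨T, hTA, hch, hm, hle, hc₂, hR₂, ht₂⟩
  rw [eval] at hle
  have hsub : ∀ r ∈ T, r ∈ A := fun r hr => Finset.filter_subset _ _ (win_subset _ _ _ (hTA hr))
  have hR : (s₁.natReg 30 : ℝ) ≤ N * ∑ r ∈ T, r.wt := by
    calc (s₁.natReg 30 : ℝ) ≤ ∑ r ∈ T, (s.val N r : ℝ) := by exact_mod_cast hle
      _ ≤ ∑ r ∈ T, N * r.wt := Finset.sum_le_sum fun r hr => (hS.cls r (hsub r hr)).1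
      _ = _ := (Finset.mul_sum _ _ _).symm
  have hcard : (T.card : ℝ) ≤ ∑ r ∈ T, r.wt := by
    rw [Finset.card_eq_sum_ones]
    push_cast
    exact Finset.sum_le_sum fun r hr => (h.proper r (hsub r hr)).one_le
  refine ⟨T, hTA, hch, ?_, ?_, hc₂, hF.runFrame.trans hR₂, ?_⟩
  · intro q hq
    rw [hm q hq, n5]
    unfold Store.mach
    rw [n10]
  · intro T' hT' hch'
    have hsum := hT.sum_le hv hlt hend (hT'.trans (win_subset _ _ _)) hch' fun r hr =>
      (mem_win.1 (hT' hr)).2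
    -- `N * r.wt` lies between the class value and the next one, which is at most `(N + 1) / N`
    -- times as large; the class values are compared by the table
    have h₁ : (N : ℝ) * (N * ∑ r ∈ T', r.wt) ≤ (N + 1) * (N * ∑ r ∈ T, r.wt) := by
      calc (N : ℝ) * (N * ∑ r ∈ T', r.wt) = ∑ r ∈ T', (N : ℝ) * (N * r.wt) := by
            rw [Finset.mul_sum, Finset.mul_sum]
        _ ≤ ∑ r ∈ T', (N + 1) * (s.val N r : ℝ) := Finset.sum_le_sum fun r hr =>
            (hS.cls r (Finset.filter_subset _ _ (win_subset _ _ _ (hT' hr)))).2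
        _ = (N + 1) * ((∑ r ∈ T', s.val N r : ℕ) : ℝ) := by
            push_cast
            rw [Finset.mul_sum]
        _ ≤ (N + 1) * (s₁.natReg 30 : ℝ) := by gcongr
        _ ≤ _ := by gcongr
    have h₂ : (N : ℝ) * ∑ r ∈ T', r.wt ≤ (N + 1) * ∑ r ∈ T, r.wt := by
      refine le_of_mul_le_mul_left ?_ (by linarith : (0 : ℝ) < N)
      linarith
    have h₃ : (1 + 1 / (N : ℝ)) * ∑ r ∈ T, r.wt = (N + 1) * (∑ r ∈ T, r.wt) / N := by
      field_simp
    rw [h₃, le_div_iff₀ (by linarith)]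
    linarith
  · have ht₁' : (t₁ : ℝ) ≤ 330 * (K + 1) * (Λ + 1) * (s₁.natReg 30 + 1) := by exact_mod_cast ht₁
    have ht₂' : (t₂ : ℝ) ≤ 2130 * (Λ + 1) * (T.card + 1) := by exact_mod_cast ht₂
    have hx : (0 : ℝ) ≤ ∑ r ∈ T, r.wt := le_trans (by positivity) hcard
    have hy : ∑ r ∈ T, r.wt ≤ N * ∑ r ∈ T, r.wt := by nlinarith
    have k₁ : (330 : ℝ) * (K + 1) * (Λ + 1) * (s₁.natReg 30 + 1) ≤
        330 * (K + 1) * (Λ + 1) * (N * ∑ r ∈ T, r.wt + 1) := by gcongr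
    have k₂ : (2130 : ℝ) * (Λ + 1) * (T.card + 1) ≤
        2130 * (K + 1) * (Λ + 1) * (N * ∑ r ∈ T, r.wt + 1) := by
      have : (1 : ℝ) ≤ K + 1 := by linarith [Nat.cast_nonneg (α := ℝ) K]
      have k₃ : (T.card : ℝ) + 1 ≤ N * ∑ r ∈ T, r.wt + 1 := by linarith
      calc (2130 : ℝ) * (Λ + 1) * (T.card + 1) ≤
            2130 * (Λ + 1) * (N * ∑ r ∈ T, r.wt + 1) := by gcongr
        _ = 2130 * 1 * (Λ + 1) * (N * ∑ r ∈ T, r.wt + 1) := by ring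
        _ ≤ _ := by gcongr
    have k₄ : (0 : ℝ) ≤ (K + 1) * (Λ + 1) * (N * ∑ r ∈ T, r.wt + 1) := by positivity
    push_cast
    linarith

/-! ### The greedy algorithm -/

theorem gain_add_sum {A T : Finset Entry} {f g : Entry → ℕ} {m : ℕ} (hT : T ⊆ A) (hm : m ≠ 0)
    (hf : ∀ r ∈ T, f r = 0) (hg : ∀ r ∈ A, g r = if r ∈ T then m else f r) :
    gain A g = gain A f + ∑ r ∈ T, r.wt := by
  unfold gain
  rw [← Finset.sum_union]
  · congr 1
    ext r
    simp only [Finset.mem_filter, Finset.mem_union]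
    constructor
    · rintro ⟨h₁, h₂⟩
      rw [hg r h₁] at h₂
      by_cases hr : r ∈ T
      · exact .inr hr
      · rw [if_neg hr] at h₂
        exact .inl ⟨h₁, h₂⟩
    · rintro (⟨h₁, h₂⟩ | h₁)
      · refine ⟨h₁, ?_⟩
        rw [hg r h₁, if_neg fun hr => h₂ (hf r hr)]
        exact h₂
      · refine ⟨hT h₁, ?_⟩
        rw [hg r (hT h₁), if_pos h₁]
        exact hm
  · rw [Finset.disjoint_left]
    intro r hr hrT
    exact (Finset.mem_filter.1 hr).2 (hf r hrT)

theorem Feasible.add {M m : ℕ} {A T : Finset Entry} {f g : Entry → ℕ} (h : Feasible M A f)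
    (hm : m ≤ M) (hch : ∀ r ∈ T, ∀ q ∈ T, r ≠ q → Apart r q)
    (hg : ∀ r ∈ A, g r = if r ∈ T then m else f r)
    (hsep : ∀ r ∈ A, f r = m → f r ≠ 0 → ∀ q ∈ T, Apart r q) : Feasible M A g := by
  intro r hr
  rw [hg r hr]
  refine ⟨by split_ifs; exacts [hm, (h r hr).1], fun q hq => ?_⟩
  rw [hg q hq]
  by_cases hrT : r ∈ T <;> by_cases hqT : q ∈ T
  · intro _ _ hne
    exact hch q hqT r hrT hne
  · simp only [hrT, hqT, if_true, if_false]
    intro he h0 _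
    exact hsep q hq he (by omega) r hrT
  · simp only [hrT, hqT, if_true, if_false]
    intro he h0 _
    exact (hsep r hr he.symm h0 q hqT).symm
  · simp only [hrT, hqT, if_false]
    exact (h r hr).2 q hq

/-- What the main loop of an update can rely on: its own registers, those from `16` to `29`, and the
parameters are left unchanged. -/
structure MainFrame (s s' : Store) : Prop where
  nat : ∀ x < 30, x ≠ 2 → x < 5 ∨ 16 ≤ x → s'.natReg x = s.natReg x
  real : ∀ x < 30, x < 5 ∨ x = 6 ∨ x = 7 ∨ 16 ≤ x → s'.realReg x = s.realReg x
  natArr : ∀ a, 9 ≤ a → a ≠ 10 → a ≠ 12 → s'.natArr a = s.natArr a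
  ext : s.heap.Ext s'.heap

theorem RunFrame.mainFrame {n : ℕ} {s s' : Store} (h : RunFrame n s s') (hn : 30 ≤ n) :
    MainFrame s s' :=
  ⟨fun x hx _ _ => h.nat x (by omega), fun x hx h' => h.real x (by omega) (by omega),
    fun a ha => h.natArr a (by omega), h.ext⟩

theorem MainFrame.refl (s : Store) : MainFrame s s := (RunFrame.refl 30 s).mainFrame le_rfl

theorem MainFrame.trans {s₁ s₂ s₃ : Store} (h : MainFrame s₁ s₂) (k : MainFrame s₂ s₃) :
    MainFrame s₁ s₃ :=
  ⟨fun x hx h' h'' => (k.nat x hx h' h'').trans (h.nat x hx h' h''), fun x hx h' =>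
    (k.real x hx h').trans (h.real x hx h'), fun a h₁ h₂ h₃ =>
    (k.natArr a h₁ h₂ h₃).trans (h.natArr a h₁ h₂ h₃), h.ext.trans k.ext⟩

theorem Setup.mainFrame {M N K : ℕ} {w : ℝ} {s s' : Store} {A : Finset Entry}
    (h : Setup M N K w s A) (hF : MainFrame s s') : Setup M N K w s' A :=
  ⟨(hF.nat 1 (by omega) (by omega) (by omega)).trans h.regM,
    (hF.nat 3 (by omega) (by omega) (by omega)).trans h.regN,
    (hF.nat 4 (by omega) (by omega) (by omega)).trans h.regK,
    (hF.real 3 (by omega) (by omega)).trans h.regw, h.one_le,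
    by rw [hF.natArr 11 (by omega) (by omega) (by omega)]; exact h.table, h.top,
    by rw [hF.natArr 9 (by omega) (by omega) (by omega)]; exact h.cls⟩

/-- Schedule the window between the real registers `6` and `7`, machine after machine. The former
total reward is kept in the real register `8`. -/
def greedyProg : Program :=
  .setReal 8 (.reg 5) ;;
  .setNat 5 (.const 1) ;;
  .loop (.neg (.natLt (.reg 1) (.reg 5)))
    (machineProg ;; .setNat 5 (.add (.reg 5) (.const 1)))

/-- On an empty window, the machines are filled one after the other. In each round, what is missing
to the optimum decreases by the factor `1 - 1 / M`, when the gain is counted with the factor `1 + 1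
/ N` for the rounding. -/
theorem wp_greedyProg {M N K Λ : ℕ} {w a b : ℝ} {s : Store} {A B₂ B₃ : Finset Entry}
    (h : Core w Λ s A B₂ B₃) (hS : Setup M N K w s A) (hM : 1 ≤ M) (ha : s.realReg 6 = a)
    (hb : s.realReg 7 = b) (hf : Feasible M A s.mach) (h0 : ∀ r ∈ win A a b, s.mach r = 0)
    (hcross : ∀ r ∈ A, s.mach r ≠ 0 → r.e ≤ a ∨ b ≤ r.s) :
    wp greedyProg s fun s' t =>
      Feasible M A s'.mach ∧ (∀ r ∈ A, r ∉ win A a b → s'.mach r = s.mach r) ∧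
      (1 - (1 - 1 / (M : ℝ)) ^ M) * opt M (win A a b) ≤ (1 + 1 / N) * gain (win A a b) s'.mach ∧
      s'.realReg 5 = s.realReg 5 + gain (win A a b) s'.mach ∧ s'.realReg 8 = s.realReg 5 ∧
      Core w Λ s' A B₂ B₃ ∧ MainFrame s s' ∧
      (t : ℝ) ≤ 2600 * (K + 1) * (Λ + 1) * (N * gain (win A a b) s'.mach + M) := by
  have hN : (1 : ℝ) ≤ N := by exact_mod_cast hS.one_le
  have hM' : (1 : ℝ) ≤ M := by exact_mod_cast hM
  have hW : ∀ r ∈ win A a b, Proper w r := fun r hr => h.proper r (win_subset _ _ _ hr)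
  set β : ℝ := 1 + 1 / N with hβ
  have hβ1 : 1 ≤ β := by rw [hβ]; linarith [show (0 : ℝ) ≤ 1 / N by positivity]
  set ρ : ℝ := 1 - 1 / M with hρ
  have hρ0 : 0 ≤ ρ := by
    have : 1 / (M : ℝ) ≤ 1 := by rw [div_le_one (by linarith)]; exact hM'
    linarith
  have hg0 : gain (win A a b) s.mach = 0 := by
    unfold gain
    rw [Finset.filter_false_of_mem fun r hr => not_not.2 (h0 r hr), Finset.sum_empty]
  unfold greedyProg
  rw [wp_seq, wp_setReal, wp_seq, wp_setNat]
  refine (wp_loop (fun n t s' => ∃ i, s'.natReg 5 = i + 1 ∧ i ≤ M ∧ n = M - i ∧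
      Feasible M A s'.mach ∧ (∀ r ∈ A, r ∉ win A a b → s'.mach r = s.mach r) ∧
      (∀ r ∈ win A a b, s'.mach r ≤ i) ∧
      opt M (win A a b) - β * gain (win A a b) s'.mach ≤ ρ ^ i * opt M (win A a b) ∧
      gain A s'.mach = s.realReg 5 + gain (win A a b) s'.mach ∧ s'.realReg 8 = s.realReg 5 ∧
      Core w Λ s' A B₂ B₃ ∧ MainFrame s s' ∧
      (t : ℝ) ≤ 2520 * (K + 1) * (Λ + 1) * (N * gain (win A a b) s'.mach + i))
    (n := M) ?_ ?_).mono ?_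
  · rintro n t s₁ ⟨i, h5, hiM, rfl, hf₁, hout, hmi, hopt, hgA, h8, hc₁, hF, ht⟩ hlt
    have n1 : s₁.natReg 1 = M := (hF.nat 1 (by omega) (by omega) (by omega)).trans hS.regM
    replace hlt : ¬ s₁.natReg 1 < s₁.natReg 5 := hlt
    have hS₁ := hS.mainFrame hF
    have m6 : s₁.realReg 6 = a := (hF.real 6 (by omega) (by omega)).trans ha
    have m7 : s₁.realReg 7 = b := (hF.real 7 (by omega) (by omega)).trans hb
    have hwp := wp_machineProg hc₁ hS₁ (by omega)
    rw [m6, m7] at hwp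
    rw [wp_seq]
    refine hwp.mono ?_
    rintro s₂ t₂ ⟨T, hTA, hch, hm, hbest, hc₂, hR, ht₂⟩
    rw [wp_setNat]
    rw [h5] at hm
    have hTA' : T ⊆ A := fun r hr => Finset.filter_subset _ _ (win_subset _ _ _ (hTA hr))
    have hTW : T ⊆ win A a b := fun r hr => mem_win.2 ⟨hTA' hr, (mem_win.1 (hTA hr)).2⟩
    have hT0 : ∀ r ∈ T, s₁.mach r = 0 := fun r hr =>
      (Finset.mem_filter.1 (win_subset _ _ _ (hTA hr))).2
    have hgW : gain (win A a b) s₂.mach = gain (win A a b) s₁.mach + ∑ r ∈ T, r.wt :=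
      gain_add_sum hTW (Nat.succ_ne_zero i) hT0 fun r hr => hm r (win_subset _ _ _ hr)
    have hgA' : gain A s₂.mach = gain A s₁.mach + ∑ r ∈ T, r.wt :=
      gain_add_sum hTA' (Nat.succ_ne_zero i) hT0 hm
    -- the entries gained so far are given away, and the rest is at most `M` times what the next
    -- machine could earn
    have hround : opt M (win A a b) ≤
        M * (β * ∑ r ∈ T, r.wt) + gain (win A a b) s₁.mach := by
      refine opt_le_of_chain (U := (win A a b).filter fun r => s₁.mach r ≠ 0) hW
        (Finset.filter_subset _ _) fun T' hT' hch' => hbest T' (fun r hr => ?_) hch'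
      have := hT' hr
      simp only [Finset.mem_sdiff, Finset.mem_filter, not_and, not_not] at this
      exact mem_win.2 ⟨Finset.mem_filter.2 ⟨win_subset _ _ _ this.1, this.2 this.1⟩,
        (mem_win.1 this.1).2⟩
    have hG0 : 0 ≤ gain (win A a b) s₁.mach := gain_nonneg hW
    refine ⟨M - (i + 1), by omega, i + 1, by simp [hR.nat, h5], by omega, rfl, ?_, ?_, ?_, ?_, ?_,
      ?_, ?_, ?_, ?_⟩
    · refine hf₁.add (by omega) hch hm fun r hr he h0 q hq => ?_
      have hrW : r ∉ win A a b := fun hrW => by have := hmi r hrW; omega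
      have hqW := mem_win.1 (hTA hq)
      rcases hcross r hr (by rw [← hout r hr hrW]; exact h0) with h' | h'
      · exact .inl (by linarith)
      · exact .inr (by linarith)
    · intro r hr hrW
      rw [← hout r hr hrW]
      exact (hm r hr).trans (if_neg fun hrT => hrW (hTW hrT))
    · intro r hr
      have h₁ := hm r (win_subset _ _ _ hr)
      have h₂ := hmi r hr
      change s₂.mach r ≤ i + 1
      rw [h₁]
      split_ifs <;> omega
    · change opt M (win A a b) - β * gain (win A a b) s₂.mach ≤ _
      have hk : opt M (win A a b) - β * gain (win A a b) s₂.mach ≤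
          ρ * (opt M (win A a b) - β * gain (win A a b) s₁.mach) := by
        rw [hgW, hρ]
        have k₁ : (opt M (win A a b) - β * gain (win A a b) s₁.mach) / M ≤ β * ∑ r ∈ T, r.wt := by
          rw [div_le_iff₀ (by linarith)]
          nlinarith
        rw [sub_mul, one_mul, one_div, inv_mul_eq_div]
        linarith
      calc _ ≤ ρ * (opt M (win A a b) - β * gain (win A a b) s₁.mach) := hk
        _ ≤ ρ * (ρ ^ i * opt M (win A a b)) := by gcongr
        _ = _ := by ring
    · change gain A s₂.mach = _ + gain (win A a b) s₂.mach
      rw [hgA', hgA, hgW]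
      ring
    · change s₂.realReg 8 = _
      rw [hR.real 8 (by norm_num) (by norm_num), h8]
    · exact hc₂.congr rfl rfl rfl rfl
    · have hF₂ := hF.trans (hR.mainFrame le_rfl)
      refine ⟨fun x hx h2 h' => ?_, hF₂.real, hF₂.natArr, hF₂.ext⟩
      dsimp only
      rw [Function.update_of_ne (by omega)]
      exact hF₂.nat x hx h2 h'
    · change _ ≤ 2520 * ((K : ℝ) + 1) * (Λ + 1) * (N * gain (win A a b) s₂.mach + (i + 1 : ℕ))
      rw [hgW]
      have hT1 : 0 ≤ ∑ r ∈ T, r.wt := Finset.sum_nonneg fun r hr => by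
        linarith [(h.proper r (hTA' hr)).one_le]
      have k₁ : (0 : ℝ) ≤ (K + 1) * (Λ + 1) * (N * ∑ r ∈ T, r.wt) := by positivity
      have k₂ : (1 : ℝ) ≤ (K + 1) * (Λ + 1) := by
        have : (0 : ℝ) ≤ K := Nat.cast_nonneg _
        have : (0 : ℝ) ≤ Λ := Nat.cast_nonneg _
        nlinarith
      simp
      linarith
  · refine ⟨0, by simp, by simp, by simp, hf, by simp, fun r hr => (h0 r hr).le, ?_, ?_, by simp,
      h.congr rfl rfl rfl rfl, ?_, ?_⟩
    · change _ - β * gain _ s.mach ≤ _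
      rw [hg0]
      simp
    · change gain A s.mach = _ + gain _ s.mach
      rw [hg0, h.tot, add_zero]
    · refine ⟨fun x hx _ h' => ?_, fun x hx h' => ?_, fun _ _ _ _ => rfl, .refl _⟩
      · dsimp only
        rw [Function.update_of_ne (by omega)]
      · dsimp only
        rw [Function.update_of_ne (by omega)]
    · have : 0 ≤ gain (win A a b) s.mach := gain_nonneg hW
      simp
      change 0 ≤ _ * (_ * gain (win A a b) s.mach)
      positivity
  · rintro s' t ⟨n, t', ⟨i, h5, hiM, rfl, hf₁, hout, hmi, hopt, hgA, h8, hc₁, hF, ht⟩, hlt, rfl⟩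
    have n1 : s'.natReg 1 = M := (hF.nat 1 (by omega) (by omega) (by omega)).trans hS.regM
    replace hlt : s'.natReg 1 < s'.natReg 5 := not_not.1 hlt
    obtain rfl : i = M := by omega
    refine ⟨hf₁, hout, by linarith, by rw [hc₁.tot, hgA], h8, hc₁, hF, ?_⟩
    have k₁ : (0 : ℝ) ≤ gain (win A a b) s'.mach := gain_nonneg hW
    have k₂ : (1 : ℝ) ≤ (K + 1) * (Λ + 1) := by
      have : (0 : ℝ) ≤ K := Nat.cast_nonneg _
      have : (0 : ℝ) ≤ Λ := Nat.cast_nonneg _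
      nlinarith
    have k₃ : (1 : ℝ) ≤ N * gain (win A a b) s'.mach + i := by
      have : (0 : ℝ) ≤ N * gain (win A a b) s'.mach := by positivity
      linarith
    have k₄ : (1 : ℝ) ≤ (K + 1) * (Λ + 1) * (N * gain (win A a b) s'.mach + i) := by nlinarith
    simp
    linarith

/-! ### Clearing a window -/

/-- Stop processing the entries between the real registers `6` and `7`, by increasing end. The real
register `10` counts the reward, and the end of the entry by which it reaches the value of the
register `11` is kept in the register `9`. -/
def clearProg : Program :=
  .setReal 9 (.reg 6) ;;
  .setReal 10 (.ofNat (.const 0)) ;;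
  .setNat 6 (.const 0) ;;
  .loop (.natEq (.reg 6) (.const 0))
    (.setNat 40 (.const 1) ;;
      .setReal 40 (.reg 6) ;;
      treeFirst ;;
      .setNat 36 (.reg 41) ;;
      .ite (.conj (.neg (.natEq (.reg 36) (.const 0))) (.neg (.realLt (.reg 7) (.get 1 (.reg 36)))))
        (.ite (.realLt (.reg 10) (.reg 11)) (.setReal 9 (.get 1 (.reg 36))) .skip ;;
          .setReal 10 (.add (.reg 10) (.get 2 (.reg 36))) ;;
          unmarkProg)
        (.setNat 6 (.const 1)))

/-- The state of `clearProg` when it has treated the entries `P`; `U` are the entries to be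
treated, and `c` is the cut. -/
structure ClearInv (U P : Finset Entry) (θ a b c x : ℝ) : Prop where
  subset : P ⊆ U
  le : ∀ r ∈ P, ∀ q ∈ U, q ∉ P → r.e ≤ q.e
  sum : x = ∑ r ∈ P, r.wt
  left : a ≤ c
  right : a ≤ b → c ≤ b
  low : (∀ r ∈ P, r.e ≤ c) ∨ θ ≤ ∑ r ∈ P with r.e ≤ c, r.wt
  high : ∑ r ∈ U with r.e < c, r.wt ≤ θ

/-- The entries are treated in the order of their ends. As long as their reward stays below `θ`, the
cut moves to the end of the entry just treated; after that it stays. -/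
theorem ClearInv.step {U P : Finset Entry} {θ a b c x : ℝ} (h : ClearInv U P θ a b c x)
    (hpos : ∀ r ∈ U, 0 ≤ r.wt) {r : Entry} (hr : r ∈ U) (hrP : r ∉ P)
    (ha : a ≤ r.e) (hb : r.e ≤ b) (hmin : ∀ q ∈ U, q ∉ P → r.e ≤ q.e) {c' : ℝ}
    (hc : x < θ ∧ c' = r.e ∨ ¬ x < θ ∧ c' = c) :
    ClearInv U (insert r P) θ a b c' (x + r.wt) := by
  have hle : ∀ p ∈ insert r P, ∀ q ∈ U, q ∉ insert r P → p.e ≤ q.e := by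
    intro p hp q hq hqP
    rw [Finset.mem_insert, not_or] at hqP
    rcases Finset.mem_insert.1 hp with rfl | hp
    · exact hmin q hq hqP.2
    · exact h.le p hp q hq hqP.2
  have hsum : x + r.wt = ∑ q ∈ insert r P, q.wt := by
    rw [Finset.sum_insert hrP, h.sum, add_comm]
  have hsub := Finset.insert_subset hr h.subset
  rcases hc with ⟨hx, rfl⟩ | ⟨hx, rfl⟩
  · refine ⟨hsub, hle, hsum, ha, fun _ => hb, .inl fun q hq => ?_, ?_⟩
    · rcases Finset.mem_insert.1 hq with rfl | hq
      · exact le_rfl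
      · exact h.le q hq r hr hrP
    · rw [h.sum] at hx
      refine le_trans (Finset.sum_le_sum_of_subset_of_nonneg (fun q hq => ?_) fun q hq _ =>
        hpos q (h.subset hq)) hx.le
      rw [Finset.mem_filter] at hq
      by_contra hqP
      linarith [hmin q hq.1 hqP, hq.2]
  · refine ⟨hsub, hle, hsum, h.left, h.right, .inr ?_, h.high⟩
    rw [not_lt, h.sum] at hx
    have : θ ≤ ∑ q ∈ P with q.e ≤ c', q.wt := by
      rcases h.low with h' | h'
      · rwa [Finset.filter_true_of_mem h']
      · exact h'
    refine this.trans (Finset.sum_le_sum_of_subset_of_nonneg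
      (Finset.filter_subset_filter _ (Finset.subset_insert _ _)) fun q hq _ =>
        hpos q (hsub (Finset.mem_filter.1 hq).1))

/-- The window is cleared, and the register `9` receives a time `c` that cuts it such that the old
schedule earned at least `θ` up to `c` (if it earned `θ` at all) and, after `c`, all but `θ + M *
w`: the entries that end before `c` earned at most `θ`, and those that cross `c` at most `M * w`. -/
theorem wp_clearProg {M Λ : ℕ} {w a b θ : ℝ} {s : Store} {A B₂ B₃ : Finset Entry}
    (h : Core w Λ s A B₂ B₃) (hf : Feasible M A s.mach) (hw : 0 ≤ w)
    (ha : s.realReg 6 = a) (hb : s.realReg 7 = b)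
    (hθ : s.realReg 11 = θ) (hθ0 : 0 ≤ θ) :
    wp clearProg s fun s' t =>
      (∀ r ∈ A, s'.mach r = if r ∈ win A a b then 0 else s.mach r) ∧
      a ≤ s'.realReg 9 ∧ (a ≤ b → s'.realReg 9 ≤ b) ∧
      (θ ≤ gain (win A a b) s.mach → θ ≤ gain (win A a (s'.realReg 9)) s.mach) ∧
      gain (win A a b) s.mach ≤ θ + M * w + gain (win A (s'.realReg 9) b) s.mach ∧
      Core w Λ s' A B₂ B₃ ∧ MainFrame s s' ∧
      (t : ℝ) ≤ 2500 * (Λ + 1) * (gain (win A a b) s.mach + 1) := by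
  have hW : ∀ r ∈ win A a b, Proper w r := fun r hr => h.proper r (win_subset _ _ _ hr)
  set U := (win A a b).filter fun r => s.mach r ≠ 0 with hU
  have hUA : U ⊆ A := (Finset.filter_subset _ _).trans (win_subset _ _ _)
  have hpos : ∀ r ∈ U, 0 ≤ r.wt := fun r hr => by linarith [(h.proper r (hUA hr)).one_le]
  unfold clearProg
  rw [wp_seq, wp_setReal, wp_seq, wp_setReal, wp_seq, wp_setNat]
  refine (wp_loop (fun n t s' => ∃ P, ClearInv U P θ a b (s'.realReg 9) (s'.realReg 10) ∧
      (∀ r ∈ A, s'.mach r = if r ∈ P then 0 else s.mach r) ∧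
      (s'.natReg 6 ≠ 0 → U ⊆ P) ∧ s'.natReg 6 ≤ 1 ∧ s'.realReg 11 = θ ∧
      Core w Λ s' A B₂ B₃ ∧ MainFrame s s' ∧
      t ≤ 2400 * (Λ + 1) * (P.card + s'.natReg 6) ∧
      n = (U.card - P.card) + (1 - s'.natReg 6)) (n := U.card + 1) ?_ ?_).mono ?_
  · rintro n t s₁ ⟨P, hP, hm, hend, h6, h11, hc₁, hF, ht, rfl⟩ hb6
    replace hb6 : s₁.natReg 6 = 0 := hb6
    have m6 : s₁.realReg 6 = a := (hF.real 6 (by omega) (by omega)).trans ha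
    have m7 : s₁.realReg 7 = b := (hF.real 7 (by omega) (by omega)).trans hb
    have hcont : ∀ r, r ∈ content A B₂ B₃ (s₁.natArr 9) (s₁.natArr 10) 1 ↔
        r ∈ A ∧ s₁.mach r ≠ 0 := fun r => Finset.mem_filter
    rw [wp_seq, wp_setNat, wp_seq, wp_setReal, wp_seq]
    refine (wp_treeFirst (C := content A B₂ B₃ (s₁.natArr 9) (s₁.natArr 10)) (i := 1) (Λ := Λ)
      ?_ ?_ ?_ ?_).mono ?_
    · exact hc₁.trees
    · simp
    · exact fun r hr => (h.proper r ((hcont r).1 hr).1).neg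
    · exact content_card hc₁.card hc₁.card₂ hc₁.card₃ _
    rintro s₂ t₂ ⟨hI, hh₂, hF₂, ht₂⟩
    simp only [RealExpr.eval, Function.update_self, m6] at hI
    have hra : s₂.realArr = s₁.realArr := hF₂.realArr
    have hz : s₁.realArr 1 0 = 0 := hc₁.trees.zero
    have k7 : s₂.realReg 7 = b := by rw [hF₂.real]; simpa using m7
    have k10 : s₂.realReg 10 = s₁.realReg 10 := by rw [hF₂.real]; simp
    have k9 : s₂.realReg 9 = s₁.realReg 9 := by rw [hF₂.real]; simp
    have k11 : s₂.realReg 11 = θ := by rw [hF₂.real]; simpa using h11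
    have n6 : s₂.natReg 6 = 0 := by rw [hF₂.nat 6 (by norm_num)]; simpa using hb6
    have a9 : s₂.natArr 9 = s₁.natArr 9 := hF₂.natArr 9 (by norm_num)
    have a10 : s₂.natArr 10 = s₁.natArr 10 := hF₂.natArr 10 (by norm_num)
    have k5 : s₂.realReg 5 = s₁.realReg 5 := by rw [hF₂.real]; simp
    have hc₂ : Core w Λ s₂ A B₂ B₃ := hc₁.congr hh₂ a9 a10 k5
    have hMF : MainFrame s₁ s₂ := by
      refine ⟨fun x hx _ _ => ?_, fun x hx _ => ?_, fun c hc _ _ => hF₂.natArr c (by omega), ?_⟩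
      · rw [hF₂.nat x (by omega)]
        dsimp only
        rw [Function.update_of_ne (by omega)]
      · rw [hF₂.real]
        dsimp only
        rw [Function.update_of_ne (by omega)]
      · rw [hh₂]; exact .refl _
    -- an entry that starts after `a` and has not been treated is found by the search
    have hfirst : ∀ q ∈ U, q ∉ P → s₁.realArr 1 (s₂.natReg 41) ≤ q.e := by
      intro q hq hqP
      have hqU := Finset.mem_filter.1 hq
      refine hI.1 q ((hcont q).2 ⟨hUA hq, ?_⟩) (mem_win.1 hqU.1).2.1
      rw [hm q (hUA hq), if_neg hqP]
      exact hqU.2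
    rw [wp_seq, wp_setNat, wp_ite]
    simp only [Test.Holds, NatExpr.eval, RealExpr.eval, Function.update_self, k7]
    refine ⟨fun c => ?_, fun c => ?_⟩
    · rw [hra] at c
      obtain ⟨r, hr, e₁, e₂, e₃⟩ := hI.2.resolve_left fun hx => c.1 hx.1
      rw [hcont] at hr
      rw [← e₁] at hfirst e₃ c
      rw [← e₃] at hfirst c
      have hrP : r ∉ P := fun hrP => hr.2 (by rw [hm r hr.1, if_pos hrP])
      have hrU : r ∈ U := by
        refine Finset.mem_filter.2 ⟨mem_win.2 ⟨hr.1, e₂, not_lt.1 c.2⟩, ?_⟩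
        have := hr.2
        rwa [hm r hr.1, if_neg hrP] at this
      have hrw : s₁.realArr 2 r.idx = r.wt := (hc₁.entryAt hr.1).rw
      -- the two branches of the program differ only in the new value `c'` of the cut
      have hcut : ∀ (c' : ℝ) (s₃ : Store), s₁.realReg 10 < θ ∧ c' = r.e ∨
          ¬ s₁.realReg 10 < θ ∧ c' = s₁.realReg 9 → ∀ u ≤ 20,
          s₃ = { s₂ with
            natReg := Function.update s₂.natReg 36 r.idx
            realReg := Function.update (Function.update s₂.realReg 9 c') 10
              (s₁.realReg 10 + r.wt) } →
          wp unmarkProg s₃ fun s' t' => ∃ n' < U.card - P.card + 1,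
            ∃ P, ClearInv U P θ a b (s'.realReg 9) (s'.realReg 10) ∧
            (∀ r ∈ A, s'.mach r = if r ∈ P then 0 else s.mach r) ∧
            (s'.natReg 6 ≠ 0 → U ⊆ P) ∧ s'.natReg 6 ≤ 1 ∧ s'.realReg 11 = θ ∧
            Core w Λ s' A B₂ B₃ ∧ MainFrame s s' ∧
            t + (t₂ + t' + u + 40) ≤ 2400 * (Λ + 1) * (P.card + s'.natReg 6) ∧
            n' = (U.card - P.card) + (1 - s'.natReg 6) := by
        rintro c' s₃ hc' u hu rfl
        refine (wp_unmarkProg (w := w) (Λ := Λ) (A := A) (B₂ := B₂) (B₃ := B₃) (r := r)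
          ?_ hr.1 ?_ ?_).mono ?_
        · exact hc₂.congr rfl rfl rfl (by simp)
        · simp
        · change s₂.natArr 10 r.idx ≠ 0
          rw [a10]
          exact hr.2
        rintro s₄ t₄ ⟨hc₄, hR₄, h10, -, hra₄, ht₄⟩
        have l6 : s₄.natReg 6 = 0 := by rw [hR₄.nat 6 (by norm_num)]; simpa using n6
        have l9 : s₄.realReg 9 = c' := by rw [hR₄.real 9 (by norm_num) (by norm_num)]; simp
        have l10 : s₄.realReg 10 = s₁.realReg 10 + r.wt := by
          rw [hR₄.real 10 (by norm_num) (by norm_num)]; simp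
        have l11 : s₄.realReg 11 = θ := by
          rw [hR₄.real 11 (by norm_num) (by norm_num)]; simpa using k11
        have hPU := Finset.card_le_card hP.subset
        have hPlt : P.card < U.card :=
          Finset.card_lt_card ⟨hP.subset, fun hs => hrP (hs hrU)⟩
        rw [l6, l9, l10]
        refine ⟨_, ?_, insert r P, hP.step hpos hrU hrP ?_ (not_lt.1 c.2) hfirst hc', ?_, by simp,
          by simp, l11, hc₄, ?_, ?_, rfl⟩
        · rw [Finset.card_insert_of_notMem hrP]
          omega
        · linarith [(h.proper r hr.1).lt]
        · intro q hq
          unfold Store.mach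
          rw [h10]
          by_cases hqr : q = r
          · subst hqr; simp
          · rw [Function.update_of_ne fun he => hqr (h.eq_of_idx hq hr.1 he)]
            have := hm q hq
            simp only [Finset.mem_insert, hqr, false_or]
            rw [← this]
            change s₂.natArr 10 q.idx = _
            rw [a10]
        · refine (hF.trans hMF).trans ?_
          refine MainFrame.trans ?_ (hR₄.mainFrame (by norm_num))
          refine ⟨fun x hx _ _ => ?_, fun x hx _ => ?_, fun _ _ _ _ => rfl, .refl _⟩
          · dsimp only
            rw [Function.update_of_ne (by omega)]
          · dsimp only
            rw [Function.update_of_ne (by omega), Function.update_of_ne (by omega)]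
        · rw [Finset.card_insert_of_notMem hrP]
          rw [hb6] at ht
          linarith
      rw [wp_seq, wp_ite]
      simp only [Test.Holds, NatExpr.eval, RealExpr.eval, k10, k11]
      refine ⟨fun c' => ?_, fun c' => ?_⟩
      · rw [wp_setReal, wp_seq, wp_setReal]
        refine (hcut r.e _ (.inl ⟨c', rfl⟩) 20 le_rfl ?_).mono ?_
        · simp [hra, ← e₁, ← e₃, k10, hrw]
        · rintro s' t' ⟨n', hn', P', g₁, g₂, g₃, g₄, g₅, g₆, g₇, g₈, g₉⟩
          refine ⟨n', by omega, P', g₁, g₂, g₃, g₄, g₅, g₆, g₇, le_trans ?_ g₈, g₉⟩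
          simp
          omega
      · rw [wp_skip, wp_seq, wp_setReal]
        refine (hcut (s₁.realReg 9) _ (.inr ⟨c', rfl⟩) 20 le_rfl ?_).mono ?_
        · have e : Function.update s₂.realReg 9 (s₁.realReg 9) = s₂.realReg := by
            rw [← k9, Function.update_eq_self]
          rw [e]
          simp [hra, ← e₁, k10, hrw]
        · rintro s' t' ⟨n', hn', P', g₁, g₂, g₃, g₄, g₅, g₆, g₇, g₈, g₉⟩
          refine ⟨n', by omega, P', g₁, g₂, g₃, g₄, g₅, g₆, g₇, le_trans ?_ g₈, g₉⟩
          simp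
          omega
    · rw [hra] at c
      rw [wp_setNat]
      have hmach : ∀ q, s₂.natArr 10 q = s₁.natArr 10 q := fun q => by rw [a10]
      refine ⟨_, ?_, P, ?_, ?_, ?_, ?_, ?_, ?_, ?_, ?_, rfl⟩
      · simp [hb6]
      · simpa [k9, k10] using hP
      · intro q hq
        rw [← hm q hq]
        exact hmach _
      · intro _ q hq
        by_contra hqP
        have h₁ := hfirst q hq hqP
        have h₂ := mem_win.1 (Finset.mem_filter.1 hq).1
        refine c ⟨fun h0 => ?_, not_lt.2 (h₁.trans h₂.2.2)⟩
        rw [h0, hz] at h₁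
        linarith [(h.proper q (hUA hq)).neg]
      · simp
      · exact k11
      · exact hc₂.congr rfl rfl rfl rfl
      · refine (hF.trans hMF).trans ⟨fun x hx _ _ => ?_, fun x hx _ => rfl, fun _ _ _ _ => rfl,
          .refl _⟩
        dsimp only
        rw [Function.update_of_ne (by omega), Function.update_of_ne (by omega)]
      · simp
        rw [hb6] at ht
        linarith
  · refine ⟨∅, ?_, by simp [Store.mach], by simp, by simp, by simpa using hθ,
      h.congr rfl rfl rfl (by simp), ?_, by simp, by simp⟩
    · have : (U.filter fun r => r.e < a) = ∅ := by
        refine Finset.filter_eq_empty_iff.2 fun r hr => ?_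
        have h₁ := mem_win.1 (Finset.mem_filter.1 hr).1
        linarith [(h.proper r h₁.1).lt]
      simp only [RealExpr.eval, ha]
      simp
      exact ⟨by simp, by simp, by simp, le_rfl, id, by simp, by rw [this]; simpa using hθ0⟩
    · refine ⟨fun x hx _ _ => ?_, fun x hx _ => ?_, fun _ _ _ _ => rfl, .refl _⟩
      · dsimp only
        rw [Function.update_of_ne (by omega)]
      · dsimp only
        rw [Function.update_of_ne (by omega), Function.update_of_ne (by omega)]
  · rintro s' t ⟨n, t', ⟨P, hP, hm, hend, h6, h11, hc₁, hF, ht, rfl⟩, hb6, rfl⟩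
    replace hb6 : s'.natReg 6 ≠ 0 := hb6
    obtain rfl : P = U := hP.subset.antisymm (hend hb6)
    have hg : gain (win A a b) s.mach = ∑ r ∈ U, r.wt := rfl
    have hcard : (U.card : ℝ) ≤ gain (win A a b) s.mach := card_le_gain hW
    refine ⟨fun r hr => ?_, hP.left, hP.right, fun hle => ?_, ?_, hc₁, hF, ?_⟩
    · rw [hm r hr]
      by_cases hrW : r ∈ win A a b
      · rw [if_pos hrW]
        split_ifs with hrP
        · rfl
        · by_contra h0
          exact hrP (Finset.mem_filter.2 ⟨hrW, h0⟩)
      · rw [if_neg hrW, if_neg fun hrP => hrW (Finset.mem_filter.1 hrP).1]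
    · have : θ ≤ ∑ r ∈ U with r.e ≤ s'.realReg 9, r.wt := by
        rcases hP.low with h' | h'
        · rwa [Finset.filter_true_of_mem h', ← hg]
        · exact h'
      refine this.trans (Finset.sum_le_sum_of_subset_of_nonneg (fun r hr => ?_) fun r hr _ => ?_)
      · simp only [Finset.mem_filter, hU, mem_win] at hr ⊢
        tauto
      · linarith [(h.proper r (win_subset _ _ _ (Finset.mem_filter.1 hr).1)).one_le]
    · rw [hg, ← Finset.sum_filter_add_sum_filter_not U fun r => r.e < s'.realReg 9]
      have h₁ := hP.high
      rw [← Finset.sum_filter_add_sum_filter_not (U.filter fun r => ¬ r.e < s'.realReg 9)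
        fun r => r.s < s'.realReg 9]
      have h₂ : ∑ r ∈ (U.filter fun r => ¬ r.e < s'.realReg 9) with r.s < s'.realReg 9, r.wt ≤
          M * w := by
        refine hf.sum_crossing_le h.proper hw (c := s'.realReg 9)
          (((Finset.filter_subset _ _).trans (Finset.filter_subset _ _)).trans hUA) fun r hr => ?_
        simp only [Finset.mem_filter, not_lt] at hr
        exact ⟨(Finset.mem_filter.1 hr.1.1).2, hr.2, hr.1.2⟩
      have h₃ : ∑ r ∈ (U.filter fun r => ¬ r.e < s'.realReg 9) with ¬ r.s < s'.realReg 9, r.wt ≤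
          gain (win A (s'.realReg 9) b) s.mach := by
        refine Finset.sum_le_sum_of_subset_of_nonneg (fun r hr => ?_) fun r hr _ => ?_
        · simp only [Finset.mem_filter, hU, mem_win, not_lt] at hr ⊢
          tauto
        · linarith [(h.proper r (win_subset _ _ _ (Finset.mem_filter.1 hr).1)).one_le]
      linarith
    · have e1 : s'.natReg 6 = 1 := by omega
      rw [e1] at ht
      have ht' : (t' : ℝ) ≤ 2400 * (Λ + 1) * (U.card + 1) := by exact_mod_cast ht
      have k₁ : (2400 : ℝ) * (Λ + 1) * (U.card + 1) ≤
          2400 * (Λ + 1) * (gain (win A a b) s.mach + 1) := by gcongr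
      have k₂ : (1 : ℝ) ≤ (Λ + 1) * (gain (win A a b) s.mach + 1) := by
        have : (0 : ℝ) ≤ Λ := Nat.cast_nonneg _
        have : (0 : ℝ) ≤ gain (win A a b) s.mach := gain_nonneg hW
        nlinarith
      simp
      linarith

/-! ### Maintaining the borders -/

/-- Append an entry with the given data to the memory; its address goes to the register `41`. -/
def recordProg (x y z : RealExpr) (i : NatExpr) : Program :=
  .putReal 0 (.add (.reg 2) (.const 1)) x ;;
  .putReal 1 (.add (.reg 2) (.const 1)) y ;;
  .putReal 2 (.add (.reg 2) (.const 1)) z ;;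
  .putNat 8 (.add (.reg 2) (.const 1)) i ;;
  .setNat 2 (.add (.reg 2) (.const 1)) ;;
  .setNat 41 (.reg 2)

/-- What `recordProg` does to the memory when the new entry is `r`. -/
structure Recorded (r : Entry) (s s' : Store) : Prop where
  entryAt : EntryAt s'.heap r
  reg : s'.natReg 41 = r.idx
  ext : s.heap.Ext s'.heap
  root : s'.natArr 7 = s.natArr 7
  nat : ∀ x < 41, x ≠ 2 → s'.natReg x = s.natReg x
  real : s'.realReg = s.realReg
  natArr : ∀ a, 9 ≤ a → s'.natArr a = s.natArr a

theorem wp_recordProg {s : Store} {x y z : RealExpr} {i : NatExpr} {r : Entry}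
    (hx : ∀ s' : Store, s'.natReg = s.natReg → s'.realReg = s.realReg → x.eval s' = r.s)
    (hy : ∀ s' : Store, s'.natReg = s.natReg → s'.realReg = s.realReg → y.eval s' = r.e)
    (hz : ∀ s' : Store, s'.natReg = s.natReg → s'.realReg = s.realReg → z.eval s' = r.wt)
    (hi : ∀ s' : Store, s'.natReg = s.natReg → s'.realReg = s.realReg → i.eval s' = r.id)
    (hr : r.idx = s.natReg 2 + 1) :
    wp (recordProg x y z i) s fun s' t => Recorded r s s' ∧
      t ≤ x.cost + y.cost + z.cost + i.cost + 30 := by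
  unfold recordProg
  simp only [wp_seq, wp_putReal, wp_putNat, wp_setNat]
  have gy : ∀ f g, y.eval ⟨s.natReg, s.realReg, f, g⟩ = r.e := fun f g => hy _ rfl rfl
  have gz : ∀ f g, z.eval ⟨s.natReg, s.realReg, f, g⟩ = r.wt := fun f g => hz _ rfl rfl
  have gi : ∀ f g, i.eval ⟨s.natReg, s.realReg, f, g⟩ = r.id := fun f g => hi _ rfl rfl
  simp only [hx s rfl rfl, gy, gz, gi]
  refine ⟨⟨⟨?_, ?_, ?_, ?_, ?_, ?_⟩, ?_, ?_, ?_, ?_, rfl, ?_⟩, ?_⟩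
  · omega
  · simp [hr]
  · simp [hr]
  · simp [hr]
  · simp [hr]
  · simp [hr]
  · simp [hr]
  · have hne : ∀ p ≤ s.natReg 2, p ≠ s.natReg 2 + 1 := fun p hp => by omega
    constructor <;> simp +contextual [hne]
  · simp
  · intro x hx hx2
    dsimp only
    rw [Function.update_of_ne (by omega), Function.update_of_ne hx2]
  · intro a ha
    dsimp only
    rw [Function.update_of_ne (by omega)]
  · simp
    omega

/-- `B` is the set of borders that the trees `2` and `3` represent. The border `c` is stored as the
entry `[c, c)` in the first one and as `[-1 - c, -1 - c)` in the second one, so that the first entry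
after some time is the next border, or the previous one. -/
structure Borders (B₂ B₃ : Finset Entry) (B : Finset ℝ) : Prop where
  mem₂ : ∀ r ∈ B₂, r.s = r.e ∧ r.wt = 0 ∧ r.id = 0 ∧ r.e ∈ B
  exists₂ : ∀ c ∈ B, ∃ r ∈ B₂, r.e = c
  mem₃ : ∀ r ∈ B₃, r.s = r.e ∧ r.wt = 0 ∧ r.id = 0 ∧ -1 - r.e ∈ B
  exists₃ : ∀ c ∈ B, ∃ r ∈ B₃, r.e = -1 - c
  bounds : ∀ c ∈ B, -1 < c ∧ c < 0

/-- The dictionaries are in order, and `B` is the set of borders. -/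
def State (w : ℝ) (Λ : ℕ) (s : Store) (A : Finset Entry) (B : Finset ℝ) : Prop :=
  ∃ B₂ B₃, Core w Λ s A B₂ B₃ ∧ Borders B₂ B₃ B

theorem Core.borders_card {w : ℝ} {Λ : ℕ} {s : Store} {A B₂ B₃ : Finset Entry} {B : Finset ℝ}
    (h : Core w Λ s A B₂ B₃) (hB : Borders B₂ B₃ B) : B₂.card ≤ B.card ∧ B₃.card ≤ B.card := by
  constructor
  · refine Finset.card_le_card_of_injOn (fun r => r.e) (fun r hr => (hB.mem₂ r hr).2.2.2) ?_
    intro r hr q hq he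
    have h₁ := hB.mem₂ r hr
    have h₂ := hB.mem₂ q hq
    dsimp only at he
    refine h.trees.eq_of_key (i := 2) hr hq (Entry.key_eq.2 ?_)
    rw [h₁.1, h₂.1, h₁.2.1, h₂.2.1, h₁.2.2.1, h₂.2.2.1, he]
    simp
  · refine Finset.card_le_card_of_injOn (fun r => -1 - r.e) (fun r hr => (hB.mem₃ r hr).2.2.2) ?_
    intro r hr q hq he
    have h₁ := hB.mem₃ r hr
    have h₂ := hB.mem₃ q hq
    replace he : r.e = q.e := by
      dsimp only at he
      linarith
    refine h.trees.eq_of_key (i := 3) hr hq (Entry.key_eq.2 ?_)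
    rw [h₁.1, h₂.1, h₁.2.1, h₂.2.1, h₁.2.2.1, h₂.2.2.1, he]
    simp

theorem State.congr {w : ℝ} {Λ : ℕ} {s s' : Store} {A : Finset Entry} {B : Finset ℝ}
    (h : State w Λ s A B) (hh : s'.heap = s.heap) (h9 : s'.natArr 9 = s.natArr 9)
    (h10 : s'.natArr 10 = s.natArr 10) (h5 : s'.realReg 5 = s.realReg 5) :
    State w Λ s' A B := by
  obtain ⟨B₂, B₃, hc, hB⟩ := h
  exact ⟨B₂, B₃, hc.congr hh h9 h10 h5, hB⟩

/-- The time `-1 - x`. -/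
def mirror (x : RealExpr) : RealExpr := .sub (.sub (.ofNat (.const 0)) (.ofNat (.const 1))) x

/-- Find the last border, or `-1`, up to the time in the real register `9`. -/
def prevProg : Program :=
  .setNat 40 (.const 3) ;;
  .setReal 40 (mirror (.reg 9)) ;;
  treeFirst ;;
  .setReal 9 (mirror (.get 1 (.reg 41)))

/-- Find the first border, or `0`, from the time in the real register `9` on. -/
def nextProg : Program :=
  .setNat 40 (.const 2) ;;
  .setReal 40 (.reg 9) ;;
  treeFirst ;;
  .setReal 9 (.get 1 (.reg 41))

theorem wp_prevProg {w : ℝ} {Λ : ℕ} {s : Store} {A : Finset Entry} {B : Finset ℝ}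
    (h : State w Λ s A B) (hx : -1 ≤ s.realReg 9) :
    wp prevProg s fun s' t =>
      s'.realReg 9 ∈ insert (-1) B ∧ s'.realReg 9 ≤ s.realReg 9 ∧
      (∀ c ∈ B, c ≤ s.realReg 9 → c ≤ s'.realReg 9) ∧
      State w Λ s' A B ∧ s'.natArr 10 = s.natArr 10 ∧ MainFrame s s' ∧ t ≤ 300 * (Λ + 1) := by
  obtain ⟨B₂, B₃, hc, hB⟩ := h
  unfold prevProg mirror
  rw [wp_seq, wp_setNat, wp_seq, wp_setReal, wp_seq]
  refine (wp_treeFirst (C := content A B₂ B₃ (s.natArr 9) (s.natArr 10)) (i := 3) (Λ := Λ)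
    ?_ ?_ ?_ ?_).mono ?_
  · exact hc.trees
  · simp
  · exact hc.neg₃
  · exact hc.card₃
  rintro s₁ t₁ ⟨hI, hh, hF, ht⟩
  simp [content] at hI
  have ra : s₁.realArr = s.realArr := hF.realArr
  have m9 : s₁.realReg 9 = s.realReg 9 := by rw [hF.real]; simp
  rw [wp_setReal]
  simp only [RealExpr.eval, NatExpr.eval]
  refine ⟨?_, ?_, fun c hcB hcx => ?_, ⟨B₂, B₃, hc.congr hh (hF.natArr 9 (by norm_num))
    (hF.natArr 10 (by norm_num)) ?_, hB⟩, hF.natArr 10 (by norm_num), ?_, ?_⟩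
  · rw [Function.update_self, ra]
    rcases hI.2 with ⟨-, h'⟩ | ⟨r, hr, -, -, h₃⟩
    · simp [h']
    · rw [← h₃]
      have := (hB.mem₃ r hr).2.2.2
      simp [this]
  · rw [Function.update_self, ra]
    rcases hI.2 with ⟨-, h'⟩ | ⟨r, hr, -, h₂, h₃⟩
    · simp [h', hx]
    · rw [← h₃]
      have := (hB.mem₃ r hr).1
      simp
      linarith
  · obtain ⟨r, hr, he⟩ := hB.exists₃ c hcB
    have h₁ := (hB.mem₃ r hr).1
    have := hI.1 r hr (by linarith)
    simp [ra]
    linarith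
  · dsimp only
    rw [Function.update_of_ne (by norm_num), hF.real]
    simp
  · refine ⟨fun x hx _ _ => ?_, fun x hx _ => ?_, fun a ha _ _ => hF.natArr a (by omega), ?_⟩
    · dsimp only
      rw [hF.nat x (by omega)]
      dsimp only
      rw [Function.update_of_ne (by omega)]
    · dsimp only
      rw [Function.update_of_ne (by omega), hF.real]
      dsimp only
      rw [Function.update_of_ne (by omega)]
    · have : s₁.heap = s.heap := hh
      change s.heap.Ext s₁.heap
      rw [this]
      exact .refl _
  · simp
    omega

theorem wp_nextProg {w : ℝ} {Λ : ℕ} {s : Store} {A : Finset Entry} {B : Finset ℝ}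
    (h : State w Λ s A B) (hx : s.realReg 9 ≤ 0) :
    wp nextProg s fun s' t =>
      s'.realReg 9 ∈ insert 0 B ∧ s.realReg 9 ≤ s'.realReg 9 ∧
      (∀ c ∈ B, s.realReg 9 ≤ c → s'.realReg 9 ≤ c) ∧
      State w Λ s' A B ∧ s'.natArr 10 = s.natArr 10 ∧ MainFrame s s' ∧ t ≤ 300 * (Λ + 1) := by
  obtain ⟨B₂, B₃, hc, hB⟩ := h
  unfold nextProg
  rw [wp_seq, wp_setNat, wp_seq, wp_setReal, wp_seq]
  refine (wp_treeFirst (C := content A B₂ B₃ (s.natArr 9) (s.natArr 10)) (i := 2) (Λ := Λ)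
    ?_ ?_ ?_ ?_).mono ?_
  · exact hc.trees
  · simp
  · exact hc.neg₂
  · exact hc.card₂
  rintro s₁ t₁ ⟨hI, hh, hF, ht⟩
  simp [content] at hI
  have ra : s₁.realArr = s.realArr := hF.realArr
  have m9 : s₁.realReg 9 = s.realReg 9 := by rw [hF.real]; simp
  rw [wp_setReal]
  simp only [RealExpr.eval, NatExpr.eval]
  refine ⟨?_, ?_, fun c hcB hcx => ?_, ⟨B₂, B₃, hc.congr hh (hF.natArr 9 (by norm_num))
    (hF.natArr 10 (by norm_num)) ?_, hB⟩, hF.natArr 10 (by norm_num), ?_, ?_⟩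
  · rw [Function.update_self, ra]
    rcases hI.2 with ⟨-, h'⟩ | ⟨r, hr, -, -, h₃⟩
    · simp [h']
    · rw [← h₃]
      have := (hB.mem₂ r hr).2.2.2
      simp [this]
  · rw [Function.update_self, ra]
    rcases hI.2 with ⟨-, h'⟩ | ⟨r, hr, -, h₂, h₃⟩
    · simp [h', hx]
    · rw [← h₃]
      have := (hB.mem₂ r hr).1
      linarith
  · obtain ⟨r, hr, he⟩ := hB.exists₂ c hcB
    have h₁ := (hB.mem₂ r hr).1
    have := hI.1 r hr (by linarith)
    simp [ra]
    linarith
  · dsimp only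
    rw [Function.update_of_ne (by norm_num), hF.real]
    simp
  · refine ⟨fun x hx _ _ => ?_, fun x hx _ => ?_, fun a ha _ _ => hF.natArr a (by omega), ?_⟩
    · dsimp only
      rw [hF.nat x (by omega)]
      dsimp only
      rw [Function.update_of_ne (by omega)]
    · dsimp only
      rw [Function.update_of_ne (by omega), hF.real]
      dsimp only
      rw [Function.update_of_ne (by omega)]
    · have : s₁.heap = s.heap := hh
      change s.heap.Ext s₁.heap
      rw [this]
      exact .refl _
  · simp
    omega

theorem Core.of_trees {w : ℝ} {Λ : ℕ} {s s' : Store} {A B₂ B₃ B₂' B₃' : Finset Entry}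
    (h : Core w Λ s A B₂ B₃)
    (ht : Trees s'.heap (content A B₂' B₃' (s.natArr 9) (s.natArr 10)))
    (h₂ : ∀ r ∈ B₂', r.e < 0) (h₃ : ∀ r ∈ B₃', r.e < 0) (k₂ : B₂'.card < 2 ^ Λ)
    (k₃ : B₃'.card < 2 ^ Λ) (h9 : s'.natArr 9 = s.natArr 9)
    (h10 : s'.natArr 10 = s.natArr 10) (h5 : s'.realReg 5 = s.realReg 5) :
    Core w Λ s' A B₂' B₃' := by
  refine ⟨by rwa [h9, h10], h.proper, h₂, h₃, h.card, k₂, k₃, ?_⟩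
  rw [h5, h.tot]
  unfold Store.mach
  rw [h10]

theorem update_content_two (A B₂ B₃ X : Finset Entry) (cls mach : ℕ → ℕ) :
    Function.update (content A B₂ B₃ cls mach) 2 X = content A X B₃ cls mach := by
  funext i
  match i with
  | 0 | 1 | 3 | k + 4 => rw [Function.update_of_ne (by omega)]; rfl
  | 2 => rw [Function.update_self]; rfl

theorem update_content_three (A B₂ B₃ X : Finset Entry) (cls mach : ℕ → ℕ) :
    Function.update (content A B₂ B₃ cls mach) 3 X = content A B₂ X cls mach := by
  funext i
  match i with
  | 0 | 1 | 2 | k + 4 => rw [Function.update_of_ne (by omega)]; rfl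
  | 3 => rw [Function.update_self]; rfl

/-- Make the time in the real register `7` a border. -/
def addBorderProg : Program :=
  recordProg (.reg 7) (.reg 7) (.ofNat (.const 0)) (.const 0) ;;
  .setNat 40 (.const 2) ;;
  treeInsert ;;
  recordProg (mirror (.reg 7)) (mirror (.reg 7)) (.ofNat (.const 0)) (.const 0) ;;
  .setNat 40 (.const 3) ;;
  treeInsert

theorem wp_addBorderProg {w : ℝ} {Λ : ℕ} {s : Store} {A : Finset Entry} {B : Finset ℝ}
    (h : State w Λ s A B) (hx : s.realReg 7 ∉ B) (hx₁ : -1 < s.realReg 7) (hx₂ : s.realReg 7 < 0)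
    (hcard : B.card + 1 < 2 ^ Λ) :
    wp addBorderProg s fun s' t =>
      State w Λ s' A (insert (s.realReg 7) B) ∧ s'.natArr 10 = s.natArr 10 ∧ MainFrame s s' ∧
      t ≤ 2200 * (Λ + 1) := by
  obtain ⟨B₂, B₃, hc, hB⟩ := h
  have hBc := hc.borders_card hB
  unfold addBorderProg
  rw [wp_seq]
  refine (wp_recordProg (r := ⟨s.natReg 2 + 1, s.realReg 7, s.realReg 7, 0, 0⟩)
    (fun s' _ hr => by simp [hr]) (fun s' _ hr => by simp [hr]) (fun s' _ _ => by simp)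
    (fun s' _ _ => by simp) rfl).mono ?_
  set r : Entry := ⟨s.natReg 2 + 1, s.realReg 7, s.realReg 7, 0, 0⟩ with hr
  rintro s₁ t₁ ⟨hR₁, ht₁⟩
  rw [wp_seq, wp_setNat, wp_seq]
  refine (wp_treeInsert (C := content A B₂ B₃ (s.natArr 9) (s.natArr 10)) (r := r) (i := 2)
    (Λ := Λ) ?_ ?_ ?_ ?_ ?_ ?_).mono ?_
  · exact hc.trees.ext hR₁.ext hR₁.root
  · exact hR₁.entryAt
  · simpa using hR₁.reg
  · simp
  · intro q hq he
    have h₁ := (hB.mem₂ q hq).2.2.2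
    have h₂ : q.s = s.realReg 7 := (Entry.key_eq.1 he).1
    rw [← (hB.mem₂ q hq).1, h₂] at h₁
    exact hx h₁
  · exact hc.card₂
  rintro s₂ t₂ ⟨hT₂, hE₂, hF₂, ht₂⟩
  rw [update_content_two] at hT₂
  have hE₂' : s₁.heap.Ext s₂.heap := hE₂
  have k₂ : s₂.realReg = s.realReg := hF₂.real.trans hR₁.real
  rw [wp_seq]
  refine (wp_recordProg (r := ⟨s₂.natReg 2 + 1, -1 - s.realReg 7, -1 - s.realReg 7, 0, 0⟩)
    (fun s' _ hr => by simp [hr, mirror, k₂]) (fun s' _ hr => by simp [hr, mirror, k₂])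
    (fun s' _ _ => by simp) (fun s' _ _ => by simp) rfl).mono ?_
  set q : Entry := ⟨s₂.natReg 2 + 1, -1 - s.realReg 7, -1 - s.realReg 7, 0, 0⟩ with hq
  rintro s₃ t₃ ⟨hR₃, ht₃⟩
  rw [wp_seq, wp_setNat]
  refine (wp_treeInsert (C := content A (insert r B₂) B₃ (s.natArr 9) (s.natArr 10)) (r := q)
    (i := 3) (Λ := Λ) ?_ ?_ ?_ ?_ ?_ ?_).mono ?_
  · exact hT₂.ext hR₃.ext hR₃.root
  · exact hR₃.entryAt
  · simpa using hR₃.reg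
  · simp
  · intro p hp he
    have h₁ := (hB.mem₃ p hp).2.2.2
    have h₂ : p.s = -1 - s.realReg 7 := (Entry.key_eq.1 he).1
    rw [← (hB.mem₃ p hp).1, h₂] at h₁
    exact hx (by simpa using h₁)
  · exact hc.card₃
  rintro s₄ t₄ ⟨hT₄, hE₄, hF₄, ht₄⟩
  rw [update_content_three] at hT₄
  have hE₄' : s₃.heap.Ext s₄.heap := hE₄
  have hnat : ∀ a, 9 ≤ a → s₄.natArr a = s.natArr a := fun a ha => by
    rw [hF₄.natArr a (by omega)]
    dsimp only
    rw [hR₃.natArr a ha, hF₂.natArr a (by omega)]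
    exact hR₁.natArr a ha
  have k₄ : s₄.realReg = s.realReg := by
    rw [hF₄.real]
    dsimp only
    rw [hR₃.real, k₂]
  refine ⟨⟨insert r B₂, insert q B₃, hc.of_trees hT₄ ?_ ?_ ?_ ?_ (hnat 9 le_rfl)
    (hnat 10 (by norm_num)) (by rw [k₄]), ⟨?_, ?_, ?_, ?_, ?_⟩⟩, hnat 10 (by norm_num), ?_, ?_⟩
  · simp only [Finset.mem_insert, forall_eq_or_imp]
    exact ⟨hx₂, hc.neg₂⟩
  · simp only [Finset.mem_insert, forall_eq_or_imp]
    exact ⟨by simp only [hq]; linarith, hc.neg₃⟩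
  · exact (Finset.card_insert_le _ _).trans_lt (by omega)
  · exact (Finset.card_insert_le _ _).trans_lt (by omega)
  · simp only [Finset.mem_insert, forall_eq_or_imp]
    exact ⟨⟨rfl, rfl, rfl, .inl rfl⟩, fun p hp => ⟨(hB.mem₂ p hp).1, (hB.mem₂ p hp).2.1,
      (hB.mem₂ p hp).2.2.1, .inr (hB.mem₂ p hp).2.2.2⟩⟩
  · simp only [Finset.mem_insert, forall_eq_or_imp, exists_eq_or_imp]
    exact ⟨.inl rfl, fun c hc => .inr (hB.exists₂ c hc)⟩
  · simp only [Finset.mem_insert, forall_eq_or_imp]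
    exact ⟨⟨rfl, rfl, rfl, .inl (by simp [hq])⟩, fun p hp => ⟨(hB.mem₃ p hp).1,
      (hB.mem₃ p hp).2.1, (hB.mem₃ p hp).2.2.1, .inr (hB.mem₃ p hp).2.2.2⟩⟩
  · simp only [Finset.mem_insert, forall_eq_or_imp, exists_eq_or_imp]
    exact ⟨.inl rfl, fun c hc => .inr (hB.exists₃ c hc)⟩
  · simp only [Finset.mem_insert, forall_eq_or_imp]
    exact ⟨⟨hx₁, hx₂⟩, hB.bounds⟩
  · refine ⟨fun x hx h2 _ => ?_, fun x _ _ => by rw [k₄], fun a ha _ _ => hnat a ha, ?_⟩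
    · rw [hF₄.nat x (by omega)]
      dsimp only
      rw [Function.update_of_ne (by omega), hR₃.nat x (by omega) h2, hF₂.nat x (by omega)]
      dsimp only
      rw [Function.update_of_ne (by omega), hR₁.nat x (by omega) h2]
    · exact ((hR₁.ext.trans hE₂').trans hR₃.ext).trans hE₄'
  · simp [mirror] at ht₁ ht₃ ⊢
    omega

/-- Unless it is `-1` or `0`, the time in the real register `9` ceases to be a border. -/
def removeBorderProg : Program :=
  .ite (.conj (.realLt (mirror (.ofNat (.const 0))) (.reg 9))
      (.realLt (.reg 9) (.ofNat (.const 0))))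
    (.setNat 40 (.const 2) ;;
      .setReal 40 (.reg 9) ;;
      treeFirst ;;
      treeDelete ;;
      .setNat 40 (.const 3) ;;
      .setReal 40 (mirror (.reg 9)) ;;
      treeFirst ;;
      treeDelete)
    .skip

theorem wp_removeBorderProg {w : ℝ} {Λ : ℕ} {s : Store} {A : Finset Entry} {B : Finset ℝ}
    (h : State w Λ s A B) (hx : s.realReg 9 = -1 ∨ s.realReg 9 = 0 ∨ s.realReg 9 ∈ B) :
    wp removeBorderProg s fun s' t =>
      State w Λ s' A (B.erase (s.realReg 9)) ∧ s'.natArr 10 = s.natArr 10 ∧ MainFrame s s' ∧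
      t ≤ 2500 * (Λ + 1) := by
  obtain ⟨B₂, B₃, hc, hB⟩ := h
  unfold removeBorderProg
  rw [wp_ite]
  simp only [Test.Holds, mirror, RealExpr.eval, NatExpr.eval]
  refine ⟨fun hcond => ?_, fun hcond => ?_⟩
  · have hxB : s.realReg 9 ∈ B := by
      rcases hx with h' | h' | h'
      · rw [h'] at hcond; norm_num at hcond
      · rw [h'] at hcond; norm_num at hcond
      · exact h'
    rw [wp_seq, wp_setNat, wp_seq, wp_setReal, wp_seq]
    refine (wp_treeFirst (C := content A B₂ B₃ (s.natArr 9) (s.natArr 10)) (i := 2) (Λ := Λ)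
      ?_ ?_ ?_ ?_).mono ?_
    · exact hc.trees
    · simp
    · exact hc.neg₂
    · exact hc.card₂
    rintro s₁ t₁ ⟨hI₁, hh₁, hF₁, ht₁⟩
    simp [content] at hI₁
    obtain ⟨p, hp, hpe⟩ := hB.exists₂ _ hxB
    have hple := hI₁.1 p hp (by rw [(hB.mem₂ p hp).1, hpe])
    have hx0 := (hB.bounds _ hxB).2
    obtain ⟨r, hr, hr41, hrs, hre⟩ := hI₁.2.resolve_left fun hx => by linarith [hx.2]
    have hrx : r.e = s.realReg 9 := le_antisymm (by linarith) (by
      rw [← (hB.mem₂ r hr).1]; exact hrs)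
    rw [wp_seq]
    refine (wp_treeDelete (C := content A B₂ B₃ (s.natArr 9) (s.natArr 10)) (i := 2) (Λ := Λ)
      (r := r) ?_ hr41.symm ?_ hr hc.card₂).mono ?_
    · rw [hh₁]; exact hc.trees
    · rw [hF₁.nat 40 (by norm_num)]; simp
    rintro s₂ t₂ ⟨hT₂, hE₂, hF₂, ht₂⟩
    rw [update_content_two] at hT₂
    have k₂ : s₂.realReg 9 = s.realReg 9 := by rw [hF₂.real, hF₁.real]; simp
    rw [wp_seq, wp_setNat, wp_seq, wp_setReal, wp_seq]
    refine (wp_treeFirst (C := content A ((content A B₂ B₃ (s.natArr 9) (s.natArr 10) 2).erase r)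
      B₃ (s.natArr 9) (s.natArr 10)) (i := 3) (Λ := Λ) ?_ ?_ ?_ ?_).mono ?_
    · exact hT₂
    · simp
    · exact hc.neg₃
    · exact hc.card₃
    rintro s₃ t₃ ⟨hI₃, hh₃, hF₃, ht₃⟩
    simp [content, k₂] at hI₃
    obtain ⟨p', hp', hpe'⟩ := hB.exists₃ _ hxB
    have hple' := hI₃.1 p' hp' (by rw [(hB.mem₃ p' hp').1, hpe'])
    have hx1 := (hB.bounds _ hxB).1
    obtain ⟨q, hq, hq41, hqs, hqe⟩ := hI₃.2.resolve_left fun hx => by linarith [hx.2]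
    have hqx : q.e = -1 - s.realReg 9 := le_antisymm (by linarith) (by
      rw [← (hB.mem₃ q hq).1]; exact hqs)
    refine (wp_treeDelete (C := content A ((content A B₂ B₃ (s.natArr 9) (s.natArr 10) 2).erase r)
      B₃ (s.natArr 9) (s.natArr 10)) (i := 3) (Λ := Λ)
      (r := q) ?_ hq41.symm ?_ hq hc.card₃).mono ?_
    · rw [hh₃]; exact hT₂
    · rw [hF₃.nat 40 (by norm_num)]; simp
    rintro s₄ t₄ ⟨hT₄, hE₄, hF₄, ht₄⟩
    rw [update_content_three] at hT₄
    have hnat : ∀ a, 9 ≤ a → s₄.natArr a = s.natArr a := fun a ha => by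
      rw [hF₄.natArr a (by omega), hF₃.natArr a (by omega)]
      dsimp only
      rw [hF₂.natArr a (by omega), hF₁.natArr a (by omega)]
    have hreal : ∀ x < 30, s₄.realReg x = s.realReg x := fun x hx => by
      rw [hF₄.real, hF₃.real]
      dsimp only
      rw [Function.update_of_ne (by omega), hF₂.real, hF₁.real]
      dsimp only
      rw [Function.update_of_ne (by omega)]
    have hkey : ∀ p ∈ B₂, p ≠ r → p.e ≠ s.realReg 9 := by
      intro p hp hne he
      have h₁ := hB.mem₂ p hp
      have h₂ := hB.mem₂ r hr
      refine hne (hc.trees.eq_of_key (i := 2) hp hr (Entry.key_eq.2 ?_))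
      rw [h₁.1, h₂.1, h₁.2.1, h₂.2.1, h₁.2.2.1, h₂.2.2.1, he, hrx]
      simp
    have hkey' : ∀ p ∈ B₃, p ≠ q → p.e ≠ -1 - s.realReg 9 := by
      intro p hp hne he
      have h₁ := hB.mem₃ p hp
      have h₂ := hB.mem₃ q hq
      refine hne (hc.trees.eq_of_key (i := 3) hp hq (Entry.key_eq.2 ?_))
      rw [h₁.1, h₂.1, h₁.2.1, h₂.2.1, h₁.2.2.1, h₂.2.2.1, he, hqx]
      simp
    refine ⟨⟨B₂.erase r, B₃.erase q, hc.of_trees hT₄ ?_ ?_ ?_ ?_ (hnat 9 le_rfl)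
      (hnat 10 (by norm_num)) (hreal 5 (by norm_num)), ⟨?_, ?_, ?_, ?_, ?_⟩⟩,
      hnat 10 (by norm_num), ?_, ?_⟩
    · exact fun p hp => hc.neg₂ p (Finset.mem_of_mem_erase hp)
    · exact fun p hp => hc.neg₃ p (Finset.mem_of_mem_erase hp)
    · exact (Finset.card_le_card (Finset.erase_subset _ _)).trans_lt hc.card₂
    · exact (Finset.card_le_card (Finset.erase_subset _ _)).trans_lt hc.card₃
    · intro p hp
      obtain ⟨h₁, h₂⟩ := Finset.mem_erase.1 hp
      have h₃ := hB.mem₂ p h₂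
      exact ⟨h₃.1, h₃.2.1, h₃.2.2.1, Finset.mem_erase.2 ⟨hkey p h₂ h₁, h₃.2.2.2⟩⟩
    · intro c hcB
      obtain ⟨h₁, h₂⟩ := Finset.mem_erase.1 hcB
      obtain ⟨p, hp, he⟩ := hB.exists₂ c h₂
      exact ⟨p, Finset.mem_erase.2 ⟨fun hpr => h₁ (by rw [← he, hpr, hrx]), hp⟩, he⟩
    · intro p hp
      obtain ⟨h₁, h₂⟩ := Finset.mem_erase.1 hp
      have h₃ := hB.mem₃ p h₂
      exact ⟨h₃.1, h₃.2.1, h₃.2.2.1, Finset.mem_erase.2 ⟨fun he => hkey' p h₂ h₁ (by linarith),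
        h₃.2.2.2⟩⟩
    · intro c hcB
      obtain ⟨h₁, h₂⟩ := Finset.mem_erase.1 hcB
      obtain ⟨p, hp, he⟩ := hB.exists₃ c h₂
      exact ⟨p, Finset.mem_erase.2 ⟨fun hpr => h₁ (by rw [hpr] at he; linarith), hp⟩, he⟩
    · exact fun c hcB => hB.bounds c (Finset.mem_of_mem_erase hcB)
    · refine ⟨fun x hx h2 _ => ?_, fun x hx _ => hreal x hx, fun a ha _ _ => hnat a ha, ?_⟩
      · rw [hF₄.nat x (by omega), hF₃.nat x (by omega)]
        dsimp only
        rw [Function.update_of_ne (by omega), hF₂.nat x (by omega), hF₁.nat x (by omega)]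
        dsimp only
        rw [Function.update_of_ne (by omega)]
      · have e₁ : s.heap.Ext s₂.heap := by
          have : s₁.heap = s.heap := hh₁
          rw [← this]
          exact hE₂
        have e₃ : s₃.heap = s₂.heap := hh₃
        exact e₁.trans (e₃ ▸ hE₄)
    · simp
      omega
  · rw [wp_skip, Finset.erase_eq_of_notMem]
    · refine ⟨⟨B₂, B₃, hc, hB⟩, rfl, .refl _, ?_⟩
      simp
      omega
    · intro hxB
      have := hB.bounds _ hxB
      exact hcond ⟨by norm_num; exact this.1, by simpa using this.2⟩

/-! ### Splitting a window into regions -/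

section Split

variable {M : ℕ} {w L β q : ℝ} {A : Finset Entry} {f f' : Entry → ℕ} {B : Finset ℝ} {a b c z : ℝ}

/-- The schedule `f` is good enough between the borders `x` and `y`, and this region is neither too
poor, unless it is the only one, nor too rich. -/
structure Good (M : ℕ) (L β q : ℝ) (A : Finset Entry) (f : Entry → ℕ) (x y : ℝ) : Prop where
  low : x = -1 ∧ y = 0 ∨ L ≤ opt M (win A x y)
  high : opt M (win A x y) ≤ 16 * L
  ratio : (1 - q) * opt M (win A x y) ≤ β * gain (win A x y) f

/-- The schedule `f` respects the borders `B` and is good enough in all regions. -/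
structure Sched (M : ℕ) (L β q : ℝ) (A : Finset Entry) (f : Entry → ℕ) (B : Finset ℝ) : Prop where
  feas : Feasible M A f
  noCross : ∀ r ∈ A, f r ≠ 0 → ∀ c ∈ B, r.e ≤ c ∨ c ≤ r.s
  bounds : ∀ c ∈ B, -1 < c ∧ c < 0
  good : ∀ x y, Consec B x y → Good M L β q A f x y

/-- The schedule `f` is good enough outside of the region from `a` to `z`, where it is empty. The
part from `a` to `b` is the next one to be scheduled. -/
structure Split (M : ℕ) (L β q : ℝ) (A : Finset Entry) (f : Entry → ℕ) (B : Finset ℝ)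
    (a b z : ℝ) : Prop where
  feas : Feasible M A f
  noCross : ∀ r ∈ A, f r ≠ 0 → ∀ c ∈ B, r.e ≤ c ∨ c ≤ r.s
  bounds : ∀ c ∈ B, -1 < c ∧ c < 0
  clear : ∀ r ∈ win A a z, f r = 0
  consec : Consec B a z
  others : ∀ x y, Consec B x y → x ≠ a → Good M L β q A f x y
  lt : a < b
  le : b ≤ z
  low : a = -1 ∧ b = 0 ∨ L ≤ opt M (win A a b)
  rest : b = z ∨ L ≤ opt M (win A b z)

theorem opt_win_self (hA : ∀ r ∈ A, Proper w r) : opt M (win A a a) ≤ 0 := by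
  have : win A a a = ∅ := by
    refine Finset.filter_eq_empty_iff.2 fun r hr h => ?_
    linarith [(hA r hr).lt, h.1, h.2]
  rw [this]
  exact (opt_le_sum (w := w) (by simp)).trans (by simp)

theorem Consec.bounds_of (h : Consec B a b) (hB : ∀ c ∈ B, -1 < c ∧ c < 0) : -1 ≤ a ∧ b ≤ 0 := by
  obtain ⟨h₁, h₂, -, -⟩ := h
  constructor
  · rcases Finset.mem_insert.1 h₁ with rfl | h
    exacts [le_rfl, (hB _ h).1.le]
  · rcases Finset.mem_insert.1 h₂ with rfl | h
    exacts [le_rfl, (hB _ h).2.le]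

/-- Used entries do not overlap a cleared region. -/
theorem Split.outside (h : Split M L β q A f B a b z) {r : Entry} (hA : ∀ r ∈ A, Proper w r)
    (hr : r ∈ A) (h0 : f r ≠ 0) : r.e ≤ a ∨ z ≤ r.s := by
  have ha : r.e ≤ a ∨ a ≤ r.s := by
    rcases Finset.mem_insert.1 h.consec.1 with e | h'
    · rw [e]; exact .inr (hA r hr).neg_one_le
    · exact h.noCross r hr h0 a h'
  have hz : r.e ≤ z ∨ z ≤ r.s := by
    rcases Finset.mem_insert.1 h.consec.2.1 with e | h'
    · rw [e]; exact .inl (hA r hr).neg.le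
    · exact h.noCross r hr h0 z h'
  rcases ha with ha | ha
  · exact .inl ha
  · rcases hz with hz | hz
    · exact absurd (h.clear r (mem_win.2 ⟨hr, ha, hz⟩)) h0
    · exact .inr hz

/-- If the next part of the window turns out to be too rich, its end moves from `b` back to `c`,
provided that both pieces remain rich enough. The optimum of the next part drops by at
least `2 * L`. -/
theorem Split.cut (h : Split M L β q A f B a b z) (hA : ∀ r ∈ A, Proper w r) (hL : 0 < L)
    (hf : ∀ r ∈ A, f' r = f r) (hac : a ≤ c) (hcb : c ≤ b) (h₁ : L ≤ opt M (win A a c))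
    (h₂ : 2 * L ≤ opt M (win A c b)) :
    Split M L β q A f' B a c z ∧ opt M (win A a c) + 2 * L ≤ opt M (win A a b) := by
  refine ⟨⟨h.feas.congr hf, fun r hr => by rw [hf r hr]; exact h.noCross r hr, h.bounds,
    fun r hr => by rw [hf r (win_subset _ _ _ hr)]; exact h.clear r hr, h.consec,
    fun x y hxy hx => ?_, ?_, hcb.trans h.le, .inr h₁, .inr ?_⟩, ?_⟩
  · obtain ⟨k₁, k₂, k₃⟩ := h.others x y hxy hx
    refine ⟨k₁, k₂, ?_⟩
    rwa [gain_congr fun r hr => hf r (win_subset _ _ _ hr)]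
  · refine lt_of_le_of_ne hac fun e => ?_
    subst e
    linarith [opt_win_self (M := M) (a := a) hA]
  · have := opt_mono (M := M) (fun r hr => hA r (win_subset _ _ _ hr))
      (win_mono (A := A) (le_refl c) h.le)
    linarith
  · linarith [opt_win_add_le (M := M) hA hac hcb]

/-- What the greedy algorithm achieves when it is applied to the next part of the window. -/
structure Scheduled (M : ℕ) (L β q : ℝ) (A : Finset Entry) (f f' : Entry → ℕ) (a b : ℝ) :
    Prop where
  feas : Feasible M A f'
  eq : ∀ r ∈ A, r ∉ win A a b → f' r = f r
  ratio : (1 - q) * opt M (win A a b) ≤ β * gain (win A a b) f'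
  small : gain (win A a b) f' ≤ 4 * L

/-- The bound `16 * L` on the optimum comes from the gain of at most `4 * L`, the factor `β ≤ 2`,
and `1 - q ≥ 1 / 2`. -/
theorem Split.good (h : Split M L β q A f B a b z) (hA : ∀ r ∈ A, Proper w r) (hβ : β ≤ 2)
    (hq : q ≤ 1 / 2) (hs : Scheduled M L β q A f f' a b) : Good M L β q A f' a b := by
  refine ⟨h.low, ?_, hs.ratio⟩
  have hp : ∀ r ∈ win A a b, Proper w r := fun r hr => hA r (win_subset _ _ _ hr)
  have h₁ : 0 ≤ opt M (win A a b) := opt_nonneg hp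
  have h₂ : 0 ≤ gain (win A a b) f' := gain_nonneg hp
  have h₃ := hs.ratio
  have h₄ := hs.small
  nlinarith

/-- The other regions are not affected when a part of the window is scheduled. -/
theorem Split.others' (h : Split M L β q A f B a b z) (hA : ∀ r ∈ A, Proper w r)
    (hs : Scheduled M L β q A f f' a b) {x y : ℝ} (hxy : Consec B x y) (hx : x ≠ a) :
    Good M L β q A f' x y := by
  obtain ⟨k₁, k₂, k₃⟩ := h.others x y hxy hx
  refine ⟨k₁, k₂, ?_⟩
  rwa [gain_congr (f := f) fun r hr => hs.eq r (win_subset _ _ _ hr) fun hr' => ?_]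
  have hr₁ := mem_win.1 hr
  have hr₂ := mem_win.1 hr'
  have := (hA r hr₁.1).lt
  rcases h.consec.eq_or hxy h.bounds with h' | h' | h'
  · exact hx h'.1
  · linarith
  · linarith [h.le]

theorem Split.noCross' (h : Split M L β q A f B a b z) (hs : Scheduled M L β q A f f' a b)
    {r : Entry} (hr : r ∈ A) (h0 : f' r ≠ 0) {c : ℝ} (hc : c ∈ B) : r.e ≤ c ∨ c ≤ r.s := by
  by_cases hrW : r ∈ win A a b
  · have hr₁ := mem_win.1 hrW
    rcases h.consec.2.2.2 c hc with h' | h'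
    · exact .inr (h'.trans hr₁.2.1)
    · exact .inl (hr₁.2.2.trans (h.le.trans h'))
  · exact h.noCross r hr (by rwa [← hs.eq r hr hrW]) c hc

/-- When the next part of the window has been scheduled, and is not all of the rest, a border is put
at its end, and the rest becomes the window. The optimum of the window drops by at least `L`. -/
theorem Split.advance (h : Split M L β q A f B a b z) (hA : ∀ r ∈ A, Proper w r) (hβ : β ≤ 2)
    (hq : q ≤ 1 / 2) (hs : Scheduled M L β q A f f' a b) (hbz : b ≠ z) :
    b ∉ B ∧ -1 < b ∧ b < 0 ∧ Split M L β q A f' (insert b B) b z z ∧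
      opt M (win A b z) + L ≤ opt M (win A a z) := by
  have hlt : b < z := lt_of_le_of_ne h.le hbz
  obtain ⟨ha, hz⟩ := h.consec.bounds_of h.bounds
  have hbB : b ∉ B := fun hb => by
    rcases h.consec.2.2.2 b hb with h' | h'
    · linarith [h.lt]
    · linarith
  have hlow : L ≤ opt M (win A a b) := h.low.resolve_left fun h' => by linarith [h'.2]
  have hb₁ : -1 < b := by linarith [h.lt]
  have hb₂ : b < 0 := by linarith
  refine ⟨hbB, hb₁, hb₂, ⟨hs.feas, ?_, ?_, ?_, ?_, ?_, hlt, le_rfl,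
    .inr (h.rest.resolve_left hbz), .inl rfl⟩, ?_⟩
  · intro r hr h0 c hc
    rcases Finset.mem_insert.1 hc with rfl | hc
    · by_cases hrW : r ∈ win A a c
      · exact .inl (mem_win.1 hrW).2.2
      · rcases h.outside hA hr (by rwa [← hs.eq r hr hrW]) with h' | h'
        · exact .inl (by linarith [h.lt])
        · exact .inr (by linarith)
    · exact h.noCross' hs hr h0 hc
  · intro c hc
    rcases Finset.mem_insert.1 hc with rfl | hc
    exacts [⟨hb₁, hb₂⟩, h.bounds c hc]
  · intro r hr
    have hr₁ := mem_win.1 hr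
    rw [hs.eq r hr₁.1 fun hr₂ => by
      linarith [(mem_win.1 hr₂).2.2, (hA r hr₁.1).lt]]
    exact h.clear r (mem_win.2 ⟨hr₁.1, by linarith [h.lt], hr₁.2.2⟩)
  · refine ⟨by simp, ?_, hlt, fun c hc => ?_⟩
    · rcases Finset.mem_insert.1 h.consec.2.1 with e | h'
      · simp [e]
      · simp [h']
    · rcases Finset.mem_insert.1 hc with rfl | hc
      · exact .inl le_rfl
      · rcases h.consec.2.2.2 c hc with h' | h'
        · exact .inl (by linarith [h.lt])
        · exact .inr h'
  · rintro x y ⟨h₁, h₂, h₃, h₄⟩ hx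
    have hxB : x ∈ insert (-1) B := by
      simp only [Finset.mem_insert] at h₁ ⊢
      tauto
    by_cases hy : y = b
    · -- the region that ends at the new border is the one that has just been scheduled
      subst hy
      have : x = a := by
        refine le_antisymm ?_ ?_
        · rcases Finset.mem_insert.1 hxB with e | h'
          · linarith
          · rcases h.consec.2.2.2 x h' with k | k
            · exact k
            · linarith
        · rcases Finset.mem_insert.1 h.consec.1 with e | h'
          · rcases Finset.mem_insert.1 hxB with e' | k
            · linarith
            · linarith [(h.bounds x k).1]
          · rcases h₄ a (Finset.mem_insert_of_mem h') with k | k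
            · exact k
            · linarith [h.lt]
      subst this
      exact h.good hA hβ hq hs
    · have hyB : y ∈ insert 0 B := by
        simp only [Finset.mem_insert] at h₂ ⊢
        tauto
      refine h.others' hA hs ⟨hxB, hyB, h₃, fun c hc => h₄ c (Finset.mem_insert_of_mem hc)⟩ ?_
      rintro rfl
      rcases h₄ b (Finset.mem_insert_self _ _) with k | k
      · linarith [h.lt]
      · have : z ≤ y := by
          rcases Finset.mem_insert.1 hyB with e | h'
          · linarith
          · rcases h.consec.2.2.2 y h' with k' | k'
            · linarith
            · exact k'
        linarith
  · linarith [opt_win_add_le (M := M) hA h.lt.le h.le]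

/-- When the next part is all of the rest of the window, the window is done. -/
theorem Split.finish (h : Split M L β q A f B a z z) (hA : ∀ r ∈ A, Proper w r) (hβ : β ≤ 2)
    (hq : q ≤ 1 / 2) (hs : Scheduled M L β q A f f' a z) : Sched M L β q A f' B := by
  refine ⟨hs.feas, fun r hr h0 c hc => h.noCross' hs hr h0 hc, h.bounds, fun x y hxy => ?_⟩
  by_cases hx : x = a
  · subst hx
    have : y = z := by
      rcases h.consec.eq_or hxy h.bounds with h' | h' | h'
      · exact h'.2
      · linarith [hxy.2.2.1]
      · linarith [h.lt]
    subst this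
    exact h.good hA hβ hq hs
  · exact h.others' hA hs hxy hx

/-- Every region but the open one earns at least `L ≥ w`, while a job earns at most `w`. Hence there
are no more borders than jobs, and the trees of the borders are not deeper than those of the jobs.
-/
theorem Split.card_le (h : Split M L β q A f B a b z) (hA : ∀ r ∈ A, Proper w r) (hL : w ≤ L)
    (hw : 0 < w) : B.card ≤ A.card := by
  rcases B.eq_empty_or_nonempty with rfl | hne
  · simp
  have hlow : ∀ x y, Consec B x y → (if x = a then 0 else L) ≤ opt M (win A x y) := by
    intro x y hxy
    split_ifs with hx
    · exact opt_nonneg fun r hr => hA r (win_subset _ _ _ hr)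
    · refine (h.others x y hxy hx).low.resolve_left ?_
      rintro ⟨rfl, rfl⟩
      obtain ⟨c, hc⟩ := hne
      have := h.bounds c hc
      rcases hxy.2.2.2 c hc with h' | h' <;> linarith
  have h₁ := sum_le_of_regions (M := M) hA h.bounds hlow
  have h₂ : opt M (win A (-1) 0) ≤ w * A.card :=
    (opt_mono hA (win_subset _ _ _)).trans (opt_le_card hA)
  have hn : (-1 : ℝ) ∉ B := fun hc => by linarith [(h.bounds _ hc).1]
  rw [← Finset.sum_insert (f := fun x => if x = a then 0 else L) hn, Finset.sum_ite,
    Finset.sum_const_zero, zero_add, Finset.sum_const, nsmul_eq_mul, Finset.filter_ne',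
    Finset.card_erase_of_mem h.consec.1,
    Finset.card_insert_of_notMem hn, Nat.add_sub_cancel] at h₁
  have h₃ : (B.card : ℝ) * w ≤ A.card * w := by
    calc (B.card : ℝ) * w ≤ B.card * L := by gcongr
      _ ≤ w * A.card := h₁.trans h₂
      _ = _ := mul_comm _ _
  exact_mod_cast le_of_mul_le_mul_right h₃ hw

end Split

/-- Make the schedule good enough between the times in the real registers `6` and `16`. The register
`18` holds the least reward for which a region is worth its borders. -/
def splitProg : Program :=
  .setNat 16 (.const 0) ;;
  .setReal 7 (.reg 16) ;;
  .loop (.natEq (.reg 16) (.const 0))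
    (greedyProg ;;
      .ite (.realLt (.mul (.ofNat (.const 4)) (.reg 18)) (.sub (.reg 5) (.reg 8)))
        (.setReal 11 (.reg 18) ;;
          clearProg ;;
          .setReal 7 (.reg 9))
        (.ite (.realEq (.reg 7) (.reg 16))
          (.setNat 16 (.const 1))
          (addBorderProg ;;
            .setReal 6 (.reg 7) ;;
            .setReal 7 (.reg 16))))

/-- What the steps of an update leave unchanged: the parameters, the input, the registers from `17`
to `29`, and the constant tables. -/
structure ParamFrame (s s' : Store) : Prop where
  nat : ∀ x < 30, x ≠ 2 → x < 5 ∨ 17 ≤ x → s'.natReg x = s.natReg x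
  real : ∀ x < 30, x < 5 ∨ 17 ≤ x → s'.realReg x = s.realReg x
  natArr : ∀ a, 9 ≤ a → a ≠ 10 → a ≠ 12 → s'.natArr a = s.natArr a
  ext : s.heap.Ext s'.heap

theorem MainFrame.paramFrame {s s' : Store} (h : MainFrame s s') : ParamFrame s s' :=
  ⟨fun x hx h2 h' => h.nat x hx h2 (by omega), fun x hx h' => h.real x hx (by omega),
    h.natArr, h.ext⟩

theorem ParamFrame.trans {s₁ s₂ s₃ : Store} (h : ParamFrame s₁ s₂) (k : ParamFrame s₂ s₃) :
    ParamFrame s₁ s₃ :=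
  ⟨fun x hx h2 h' => (k.nat x hx h2 h').trans (h.nat x hx h2 h'), fun x hx h' =>
    (k.real x hx h').trans (h.real x hx h'), fun a h₁ h₂ h₃ =>
    (k.natArr a h₁ h₂ h₃).trans (h.natArr a h₁ h₂ h₃), h.ext.trans k.ext⟩

theorem ParamFrame.of_regs {s : Store} {f : ℕ → ℕ} {g : ℕ → ℝ}
    (hf : ∀ x < 30, x < 5 ∨ 17 ≤ x → f x = s.natReg x)
    (hg : ∀ x < 30, x < 5 ∨ 17 ≤ x → g x = s.realReg x) (h50 : f 50 = s.natReg 50) :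
    ParamFrame s { s with
      natReg := f
      realReg := g } := by
  refine ⟨fun x hx _ h' => hf x hx h', hg, fun _ _ _ _ => rfl, ?_⟩
  have : Store.heap { s with
      natReg := f
      realReg := g } = s.heap := by
    simp [h50, hf]
  rw [this]
  exact .refl _

theorem Setup.paramFrame {M N K : ℕ} {w : ℝ} {s s' : Store} {A : Finset Entry}
    (h : Setup M N K w s A) (hF : ParamFrame s s') : Setup M N K w s' A :=
  ⟨(hF.nat 1 (by omega) (by omega) (by omega)).trans h.regM,
    (hF.nat 3 (by omega) (by omega) (by omega)).trans h.regN,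
    (hF.nat 4 (by omega) (by omega) (by omega)).trans h.regK,
    (hF.real 3 (by omega) (by omega)).trans h.regw, h.one_le,
    by rw [hF.natArr 11 (by omega) (by omega) (by omega)]; exact h.table, h.top,
    by rw [hF.natArr 9 (by omega) (by omega) (by omega)]; exact h.cls⟩

/-- The fraction of the optimum that the greedy algorithm may lose on `M` machines. -/
noncomputable abbrev loss (M : ℕ) : ℝ := (1 - 1 / (M : ℝ)) ^ M

theorem floor_lt_floor_of_add_one_le {x y : ℝ} (hx : 0 ≤ x) (h : x + 1 ≤ y) : ⌊x⌋₊ < ⌊y⌋₊ := by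
  have := Nat.floor_mono h
  rw [Nat.floor_add_one hx] at this
  omega

/-- The number of iterations is bounded by a constant. To see this, consider the potential `60 * opt
(a, z) / L + opt (a, b) / L + 1`, where the window is from `a` to `z`, and its next part from `a` to
`b`. Moving `b` back lowers the second summand by `2`. A new border lowers the first summand by
`60`, while the second one becomes at most `51`. -/
theorem wp_splitProg {M N K Λ : ℕ} {w L a z : ℝ} {s : Store} {A : Finset Entry} {B : Finset ℝ}
    (h : State w Λ s A B) (hS : Setup M N K w s A) (hM : 1 ≤ M) (hw : 1 ≤ w)
    (hq : loss M ≤ 1 / 2) (hL : L = N * M * w) (hcard : A.card + 1 < 2 ^ Λ)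
    (ha : s.realReg 6 = a) (hz : s.realReg 16 = z) (h18 : s.realReg 18 = L)
    (hsp : Split M L (1 + 1 / N) (loss M) A s.mach B a z z)
    (hrich : opt M (win A a z) ≤ 51 * L) :
    wp splitProg s fun s' t => ∃ B', State w Λ s' A B' ∧
      Sched M L (1 + 1 / N) (loss M) A s'.mach B' ∧ ParamFrame s s' ∧
      (t : ℝ) ≤ 10 ^ 9 * (K + 1) * (Λ + 1) * (N * L) := by
  have hA : ∀ r ∈ A, Proper w r := by
    obtain ⟨B₂, B₃, hc, -⟩ := h
    exact hc.proper
  have hN : (1 : ℝ) ≤ N := by exact_mod_cast hS.one_le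
  have hM' : (1 : ℝ) ≤ M := by exact_mod_cast hM
  have hβ : 1 + 1 / (N : ℝ) ≤ 2 := by
    have : 1 / (N : ℝ) ≤ 1 := by rw [div_le_one (by linarith)]; exact hN
    linarith
  have hMw : M * w ≤ L := by
    rw [hL, mul_assoc]
    exact le_mul_of_one_le_left (by positivity) hN
  have hML : (M : ℝ) ≤ L := le_trans (le_mul_of_one_le_right (by linarith) hw) hMw
  have hwL : w ≤ L := le_trans (le_mul_of_one_le_left (by linarith) hM') hMw
  have hL1 : 1 ≤ L := hw.trans hwL
  have hL0 : 0 < L := by linarith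
  have hX : (1 : ℝ) ≤ (K + 1) * (Λ + 1) := by
    have : (0 : ℝ) ≤ K := Nat.cast_nonneg _
    have : (0 : ℝ) ≤ Λ := Nat.cast_nonneg _
    nlinarith
  have hΛ : ((Λ : ℝ) + 1) ≤ (K + 1) * (Λ + 1) := by
    have : (0 : ℝ) ≤ K := Nat.cast_nonneg _
    have : (0 : ℝ) ≤ Λ := Nat.cast_nonneg _
    nlinarith
  have hLN : L ≤ N * L := le_mul_of_one_le_left hL0.le hN
  have hopt : ∀ x y, 0 ≤ opt M (win A x y) := fun x y =>
    opt_nonneg fun r hr => hA r (win_subset _ _ _ hr)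
  have hunit : (1 : ℝ) ≤ (K + 1) * (Λ + 1) * (N * L) :=
    one_le_mul_of_one_le_of_one_le hX (by linarith)
  -- a bound for the time of one iteration
  set Z : ℝ := 300000 * ((K + 1) * (Λ + 1)) * (N * L) with hZ
  have hZ0 : 0 ≤ Z := by positivity
  -- a bound for the initial potential, where `b = z` and the optimum is at most `51 * L`
  set ψ₀ : ℝ := 61 * 51 + 1 with hψ₀
  unfold splitProg
  rw [wp_seq, wp_setNat, wp_seq, wp_setReal]
  refine (wp_loop (fun n t s' => ∃ (B : Finset ℝ) (a b ψ : ℝ), State w Λ s' A B ∧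
      ParamFrame s s' ∧ 0 ≤ ψ ∧ n = ⌊ψ⌋₊ ∧ (t : ℝ) ≤ (ψ₀ - ψ) * Z ∧
      (s'.natReg 16 = 0 → s'.realReg 6 = a ∧ s'.realReg 7 = b ∧ s'.realReg 16 = z ∧
        s'.realReg 18 = L ∧ Split M L (1 + 1 / N) (loss M) A s'.mach B a b z ∧
        opt M (win A a z) ≤ 51 * L ∧
        ψ = 60 * (opt M (win A a z) / L) + opt M (win A a b) / L + 1) ∧
      (s'.natReg 16 ≠ 0 → Sched M L (1 + 1 / N) (loss M) A s'.mach B))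
    (n := ⌊61 * (opt M (win A a z) / L) + 1⌋₊) ?_ ?_).mono ?_
  · rintro n t s₁ ⟨B, a, b, ψ, hst, hF, hψ0, rfl, ht, hsp, -⟩ hb16
    replace hb16 : s₁.natReg 16 = 0 := hb16
    obtain ⟨m6, m7, m16, m18, hsp, hrich, hψ⟩ := hsp hb16
    obtain ⟨B₂, B₃, hc, hB⟩ := hst
    have hwin : win A a b ⊆ win A a z := win_mono le_rfl hsp.le
    have hrich' : opt M (win A a b) ≤ 51 * L :=
      (opt_mono (fun r hr => hA r (win_subset _ _ _ hr)) hwin).trans hrich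
    rw [wp_seq]
    refine (wp_greedyProg hc (hS.paramFrame hF) hM m6 m7 hsp.feas
      (fun r hr => hsp.clear r (hwin hr)) fun r hr h0 => ?_).mono ?_
    · rcases hsp.outside hA hr h0 with h' | h'
      · exact .inl h'
      · exact .inr (hsp.le.trans h')
    rintro s₂ t₂ ⟨hf₂, hout, hratio, h5, h8, hc₂, hF₂, ht₂⟩
    have hgO : gain (win A a b) s₂.mach ≤ opt M (win A a b) :=
      le_opt (fun r hr => hA r (win_subset _ _ _ hr)) (hf₂.mono (win_subset _ _ _))
    have hg0 : 0 ≤ gain (win A a b) s₂.mach := gain_nonneg fun r hr => hA r (win_subset _ _ _ hr)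
    have k6 : s₂.realReg 6 = a := (hF₂.real 6 (by omega) (by omega)).trans m6
    have k7 : s₂.realReg 7 = b := (hF₂.real 7 (by omega) (by omega)).trans m7
    have k16 : s₂.realReg 16 = z := (hF₂.real 16 (by omega) (by omega)).trans m16
    have k18 : s₂.realReg 18 = L := (hF₂.real 18 (by omega) (by omega)).trans m18
    have n16 : s₂.natReg 16 = 0 :=
      (hF₂.nat 16 (by omega) (by omega) (by omega)).trans hb16
    have hgreedy : (t₂ : ℝ) ≤ 2600 * 52 * ((K + 1) * (Λ + 1)) * (N * L) := by
      refine ht₂.trans ?_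
      have : N * gain (win A a b) s₂.mach + M ≤ 52 * (N * L) := by
        have : N * gain (win A a b) s₂.mach ≤ N * (51 * L) := by
          gcongr
          linarith
        linarith
      calc _ ≤ 2600 * ((K : ℝ) + 1) * (Λ + 1) * (52 * (N * L)) := by gcongr
        _ = _ := by ring
    have hclear : 2500 * ((Λ : ℝ) + 1) * (gain (win A a b) s₂.mach + 1) ≤
        2500 * 52 * ((K + 1) * (Λ + 1)) * (N * L) := by
      have : gain (win A a b) s₂.mach + 1 ≤ 52 * (N * L) := by linarith
      calc _ ≤ 2500 * (((K : ℝ) + 1) * (Λ + 1)) * (52 * (N * L)) := by gcongr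
        _ = _ := by ring
    have hborder : 2200 * ((Λ : ℝ) + 1) ≤ 2200 * (((K + 1) * (Λ + 1)) * (N * L)) := by
      have : ((Λ : ℝ) + 1) * 1 ≤ (K + 1) * (Λ + 1) * (N * L) := by gcongr; linarith
      linarith
    -- the time of an iteration, in which the potential decreases to `ψ'`
    have htime : ∀ (u : ℕ) (ψ' : ℝ), ψ' + 1 ≤ ψ →
        (u : ℝ) ≤ t₂ + 2500 * ((Λ : ℝ) + 1) * (gain (win A a b) s₂.mach + 1) +
          2200 * ((Λ : ℝ) + 1) + 50 → ((t + u : ℕ) : ℝ) ≤ (ψ₀ - ψ') * Z := by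
      intro u ψ' hψ' hu
      have : (u : ℝ) ≤ Z := by rw [hZ]; linarith
      have := mul_le_mul_of_nonneg_right hψ' hZ0
      push_cast
      linarith
    rw [wp_ite]
    simp only [Test.Holds, RealExpr.eval, NatExpr.eval, k18, h5, h8]
    refine ⟨fun hbig => ?_, fun hsmall => ?_⟩
    · replace hbig : 4 * L < gain (win A a b) s₂.mach := by
        push_cast at hbig
        linarith
      rw [wp_seq, wp_setReal, wp_seq]
      refine (wp_clearProg (M := M) (Λ := Λ) (w := w) (a := a) (b := b) (θ := L) (A := A)
        (B₂ := B₂) (B₃ := B₃) ?_ ?_ (by linarith) ?_ ?_ ?_ hL0.le).mono ?_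
      · exact hc₂.congr rfl rfl rfl (by simp)
      · exact hf₂
      · simp [k6]
      · simp [k7]
      · simp [k18]
      rintro s₃ t₃ ⟨hm₃, hac, hcb, hl, hr, hc₃, hF₃, ht₃⟩
      have hl' := hl (by change L ≤ gain (win A a b) s₂.mach; linarith)
      have ht₃' : (t₃ : ℝ) ≤ 2500 * ((Λ : ℝ) + 1) * (gain (win A a b) s₂.mach + 1) := ht₃
      have hgain : ∀ x y, gain (win A x y) s₂.mach ≤ opt M (win A x y) := fun x y =>
        le_opt (fun r hr => hA r (win_subset _ _ _ hr)) (hf₂.mono (win_subset _ _ _))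
      -- the schedule of this iteration has been discarded completely
      have hback : ∀ r ∈ A, s₃.mach r = s₁.mach r := by
        intro r hr
        rw [hm₃ r hr]
        split_ifs with hrW
        · exact (hsp.clear r (hwin hrW)).symm
        · exact hout r hr hrW
      set c := s₃.realReg 9
      have h₂ : 2 * L ≤ opt M (win A c b) := by
        change gain (win A a b) s₂.mach ≤ L + M * w + gain (win A c b) s₂.mach at hr
        have := hgain c b
        linarith
      have h₁ : L ≤ opt M (win A a c) := hl'.trans (hgain a c)
      obtain ⟨hsp', hdec⟩ := hsp.cut hA hL0 hback hac (hcb hsp.lt.le) h₁ h₂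
      have hdec' : opt M (win A a c) / L + 2 ≤ opt M (win A a b) / L := by
        rw [le_div_iff₀ hL0, add_mul, div_mul_cancel₀ _ hL0.ne']
        exact hdec
      have hψ' : 60 * (opt M (win A a z) / L) + opt M (win A a c) / L + 1 + 1 ≤ ψ := by
        rw [hψ]
        linarith
      have hψ'0 : 0 ≤ 60 * (opt M (win A a z) / L) + opt M (win A a c) / L + 1 := by
        have := hopt a z
        have := hopt a c
        positivity
      rw [wp_setReal]
      have l16 : s₃.natReg 16 = 0 := by
        rw [hF₃.nat 16 (by omega) (by omega) (by omega)]; exact n16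
      refine ⟨_, floor_lt_floor_of_add_one_le hψ'0 hψ', B, a, c, _, ⟨B₂, B₃, hc₃.congr rfl rfl rfl
        (by simp), hB⟩, ?_, hψ'0, rfl, ?_, fun _ => ⟨?_, ?_, ?_, ?_, hsp', hrich, rfl⟩,
        fun h' => absurd l16 h'⟩
      · have e₁ : ParamFrame s₂ s₃ := (ParamFrame.of_regs (s := s₂) (f := s₂.natReg)
          (fun _ _ _ => rfl) (fun x hx _ => Function.update_of_ne (by omega) _ _) rfl).trans
          hF₃.paramFrame
        refine ((hF.trans hF₂.paramFrame).trans e₁).trans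
          (ParamFrame.of_regs (s := s₃) (f := s₃.natReg) (fun _ _ _ => rfl)
          (fun x hx _ => Function.update_of_ne (by omega) _ _) rfl)
      · rw [add_assoc]
        refine htime _ _ hψ' ?_
        simp
        have : (0 : ℝ) ≤ 2200 * ((Λ : ℝ) + 1) := by positivity
        linarith
      · dsimp only
        rw [Function.update_of_ne (by norm_num), hF₃.real 6 (by omega) (by omega)]
        simp [k6]
      · simp [c]
      · dsimp only
        rw [Function.update_of_ne (by norm_num), hF₃.real 16 (by omega) (by omega)]
        simp [k16]
      · dsimp only
        rw [Function.update_of_ne (by norm_num), hF₃.real 18 (by omega) (by omega)]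
        simp [k18]
    · have hs : Scheduled M L (1 + 1 / N) (loss M) A s₁.mach s₂.mach a b := by
        refine ⟨hf₂, hout, hratio, ?_⟩
        push_cast at hsmall
        linarith
      have hgpos : (0 : ℝ) ≤ 2500 * ((Λ : ℝ) + 1) * (gain (win A a b) s₂.mach + 1) := by
        positivity
      rw [wp_ite]
      simp only [Test.Holds, RealExpr.eval, NatExpr.eval, k7, k16]
      refine ⟨fun hbz => ?_, fun hbz => ?_⟩
      · subst hbz
        rw [wp_setNat]
        have hψ1 : 0 + 1 ≤ ψ := by
          have := hopt a b
          have : 0 ≤ opt M (win A a b) / L := by positivity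
          rw [hψ]
          linarith
        refine ⟨⌊(0 : ℝ)⌋₊, floor_lt_floor_of_add_one_le le_rfl hψ1, B, a, b, 0, ⟨B₂, B₃,
          hc₂.congr rfl rfl rfl rfl, hB⟩, ?_, le_rfl, rfl, ?_, fun h' => ?_, fun _ => ?_⟩
        · exact (hF.trans hF₂.paramFrame).trans (ParamFrame.of_regs (s := s₂) (g := s₂.realReg)
            (fun x hx _ => Function.update_of_ne (by omega) _ _) (fun _ _ _ => rfl) (by simp))
        · rw [add_assoc]
          refine htime _ _ hψ1 ?_
          simp
          have : (0 : ℝ) ≤ 2200 * ((Λ : ℝ) + 1) := by positivity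
          linarith
        · simp at h'
        · exact hsp.finish hA hβ hq hs
      · obtain ⟨hbB, hb₁, hb₂, hsp', hdec⟩ := hsp.advance hA hβ hq hs hbz
        have hcB := hsp.card_le hA hwL (by linarith)
        rw [wp_seq]
        refine (wp_addBorderProg ⟨B₂, B₃, hc₂, hB⟩ (by rwa [k7]) (by rwa [k7]) (by rwa [k7])
          (by omega)).mono ?_
        rintro s₃ t₃ ⟨hst₃, h10, hF₃, ht₃⟩
        rw [k7] at hst₃
        have l7 : s₃.realReg 7 = b := (hF₃.real 7 (by omega) (by omega)).trans k7
        have l16 : s₃.realReg 16 = z := (hF₃.real 16 (by omega) (by omega)).trans k16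
        have l18 : s₃.realReg 18 = L := (hF₃.real 18 (by omega) (by omega)).trans k18
        have l16' : s₃.natReg 16 = 0 :=
          (hF₃.nat 16 (by omega) (by omega) (by omega)).trans n16
        have ht₃' : (t₃ : ℝ) ≤ 2200 * (Λ + 1) := by exact_mod_cast ht₃
        have hrich₂ : opt M (win A b z) ≤ 51 * L := by linarith
        have hψ'0 : 0 ≤ 60 * (opt M (win A b z) / L) + opt M (win A b z) / L + 1 := by
          have := hopt b z
          positivity
        have hψ' : 60 * (opt M (win A b z) / L) + opt M (win A b z) / L + 1 + 1 ≤ ψ := by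
          have e₁ : opt M (win A b z) / L + 1 ≤ opt M (win A a z) / L := by
            rw [le_div_iff₀ hL0, add_mul, div_mul_cancel₀ _ hL0.ne', one_mul]
            exact hdec
          have e₂ : opt M (win A b z) / L ≤ 51 := by rwa [div_le_iff₀ hL0]
          have e₃ : 0 ≤ opt M (win A a b) / L := by
            have := hopt a b
            positivity
          rw [hψ]
          linarith
        rw [wp_seq, wp_setReal, wp_setReal]
        have hm : Store.mach { s₃ with
            realReg := Function.update (Function.update s₃.realReg 6 (s₃.realReg 7)) 7
              (Function.update s₃.realReg 6 (s₃.realReg 7) 16) } = s₂.mach := by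
          funext r
          change s₃.natArr 10 r.idx = s₂.natArr 10 r.idx
          rw [h10]
        refine ⟨_, floor_lt_floor_of_add_one_le hψ'0 hψ', insert b B, b, z, _,
          hst₃.congr rfl rfl rfl (by simp), ?_, hψ'0, rfl, ?_, fun _ => ⟨?_, ?_, ?_, ?_, ?_,
          hrich₂, rfl⟩, fun h' => absurd l16' h'⟩
        · refine ((hF.trans hF₂.paramFrame).trans hF₃.paramFrame).trans
            (ParamFrame.of_regs (s := s₃) (f := s₃.natReg) (fun _ _ _ => rfl)
              (fun x hx _ => ?_) rfl)
          exact (Function.update_of_ne (by omega) _ _).trans (Function.update_of_ne (by omega) _ _)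
        · rw [add_assoc]
          refine htime _ _ hψ' ?_
          simp
          linarith
        · simp [l7]
        · simp [l16]
        · simp [l16]
        · simp [l18]
        · simp only [RealExpr.eval]
          rw [hm]
          exact hsp'
  · have hψ0 : 0 ≤ 61 * (opt M (win A a z) / L) + 1 := by
      have := hopt a z
      positivity
    refine ⟨B, a, z, 61 * (opt M (win A a z) / L) + 1, h.congr (by simp) rfl rfl (by simp), ?_,
      hψ0, rfl, ?_, fun _ => ⟨?_, ?_, ?_, ?_, hsp, hrich, by ring⟩, fun h' => ?_⟩
    · exact ParamFrame.of_regs (s := s)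
        (fun x hx _ => Function.update_of_ne (by omega) _ _)
        (fun x hx _ => Function.update_of_ne (by omega) _ _) (by simp)
    · have : opt M (win A a z) / L ≤ 51 := by rwa [div_le_iff₀ hL0]
      simp only [Nat.cast_zero]
      refine mul_nonneg ?_ hZ0
      rw [hψ₀]
      linarith
    · simp [ha]
    · simp [hz]
    · simp [hz]
    · simp [h18]
    · simp at h'
  · rintro s' t ⟨n, t', ⟨B, a, b, ψ, hst, hF, hψ0, rfl, ht, -, hend⟩, hb16, rfl⟩
    refine ⟨B, hst, hend hb16, hF, ?_⟩
    have h₁ := mul_nonneg hψ0 hZ0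
    rw [hψ₀, hZ] at ht
    rw [hZ] at h₁
    simp
    linarith

/-! ### The window around a job -/

/-- The border before the time `x` and the one after it are `a` and `b`; when these two have been
removed, they are `y` and `z`. -/
structure Around (B : Finset ℝ) (x a b y z : ℝ) : Prop where
  mem_a : a ∈ insert (-1) B
  a_le : a ≤ x
  le_a : ∀ c ∈ B, c ≤ x → c ≤ a
  mem_b : b ∈ insert 0 (B.erase a)
  le_b : x ≤ b
  b_le : ∀ c ∈ B.erase a, x ≤ c → b ≤ c
  mem_y : y ∈ insert (-1) ((B.erase a).erase b)
  y_le : y ≤ x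
  le_y : ∀ c ∈ (B.erase a).erase b, c ≤ x → c ≤ y
  mem_z : z ∈ insert 0 ((B.erase a).erase b)
  le_z : x ≤ z
  z_le : ∀ c ∈ (B.erase a).erase b, x ≤ c → z ≤ c

namespace Around

variable {B : Finset ℝ} {x a b y z : ℝ}

theorem mid (h : Around B x a b y z) (hx : x < 0) : Consec B a b := by
  refine ⟨h.mem_a, ?_, lt_of_le_of_ne (h.a_le.trans h.le_b) ?_, fun c hc => ?_⟩
  · rcases Finset.mem_insert.1 h.mem_b with e | h'
    · simp [e]
    · simp [Finset.mem_of_mem_erase h']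
  · rintro rfl
    rcases Finset.mem_insert.1 h.mem_b with e | h'
    · linarith [h.a_le]
    · simp at h'
  · rcases le_total c x with h' | h'
    · exact .inl (h.le_a c hc h')
    · by_cases hca : c = a
      · exact .inl hca.le
      · exact .inr (h.b_le c (Finset.mem_erase.2 ⟨hca, hc⟩) h')

theorem left (h : Around B x a b y z) (hB : ∀ c ∈ B, -1 < c ∧ c < 0) (hx : x < 0) :
    (y = a ∧ a = -1) ∨ (a ∈ B ∧ Consec B y a) := by
  have hab := (h.mid hx).2.2.1
  rcases Finset.mem_insert.1 h.mem_a with e | ha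
  · left
    refine ⟨?_, e⟩
    rcases Finset.mem_insert.1 h.mem_y with e' | h'
    · rw [e, e']
    · have hy : y ∈ B := Finset.mem_of_mem_erase (Finset.mem_of_mem_erase h')
      have := h.le_a y hy h.y_le
      linarith [(hB y hy).1]
  · right
    refine ⟨ha, ?_, by simp [ha], ?_, fun c hc => ?_⟩
    · rcases Finset.mem_insert.1 h.mem_y with e' | h'
      · simp [e']
      · simp [Finset.mem_of_mem_erase (Finset.mem_of_mem_erase h')]
    · rcases Finset.mem_insert.1 h.mem_y with e' | h'
      · linarith [(hB a ha).1]
      · have h₁ := Finset.mem_of_mem_erase h'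
        exact lt_of_le_of_ne (h.le_a y (Finset.mem_of_mem_erase h₁) h.y_le)
          (Finset.mem_erase.1 h₁).1
    · rcases lt_or_ge c a with h' | h'
      · exact .inl (h.le_y c (Finset.mem_erase.2 ⟨by linarith, Finset.mem_erase.2
          ⟨h'.ne, hc⟩⟩) (by linarith [h.a_le]))
      · exact .inr h'

theorem right (h : Around B x a b y z) (hB : ∀ c ∈ B, -1 < c ∧ c < 0) (hx : x < 0) :
    (b = z ∧ b = 0) ∨ (b ∈ B ∧ Consec B b z) := by
  have hab := (h.mid hx).2.2.1
  rcases Finset.mem_insert.1 h.mem_b with e | hb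
  · left
    refine ⟨?_, e⟩
    rcases Finset.mem_insert.1 h.mem_z with e' | h'
    · rw [e, e']
    · have hz := Finset.mem_of_mem_erase h'
      have := h.b_le z hz h.le_z
      linarith [(hB z (Finset.mem_of_mem_erase hz)).2]
  · have hbB := Finset.mem_of_mem_erase hb
    right
    refine ⟨hbB, by simp [hbB], ?_, ?_, fun c hc => ?_⟩
    · rcases Finset.mem_insert.1 h.mem_z with e' | h'
      · simp [e']
      · simp [Finset.mem_of_mem_erase (Finset.mem_of_mem_erase h')]
    · rcases Finset.mem_insert.1 h.mem_z with e' | h'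
      · linarith [(hB b hbB).2]
      · obtain ⟨h₁, h₂⟩ := Finset.mem_erase.1 h'
        exact lt_of_le_of_ne (h.b_le z h₂ h.le_z) (Ne.symm h₁)
    · rcases le_or_gt c b with h' | h'
      · exact .inl h'
      · exact .inr (h.z_le c (Finset.mem_erase.2 ⟨h'.ne', Finset.mem_erase.2
          ⟨by linarith, hc⟩⟩) (by linarith [h.le_b]))

theorem le_left (h : Around B x a b y z) (hB : ∀ c ∈ B, -1 < c ∧ c < 0) (hx : x < 0) : y ≤ a := by
  rcases h.left hB hx with h' | h'
  · exact h'.1.le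
  · exact h'.2.2.2.1.le

theorem le_right (h : Around B x a b y z) (hB : ∀ c ∈ B, -1 < c ∧ c < 0) (hx : x < 0) :
    b ≤ z := by
  rcases h.right hB hx with h' | h'
  · exact h'.1.le
  · exact h'.2.2.2.1.le

theorem lt_z (h : Around B x a b y z) (hx : x < 0) : x < z := by
  refine lt_of_le_of_ne h.le_z ?_
  rintro rfl
  rcases Finset.mem_insert.1 h.mem_z with e | h'
  · linarith
  · have h₁ := Finset.mem_of_mem_erase h'
    have h₂ := h.le_a x (Finset.mem_of_mem_erase h₁) le_rfl
    exact (Finset.mem_erase.1 h₁).1 (le_antisymm h₂ h.a_le)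

theorem consec (h : Around B x a b y z) (hx : x < 0) : Consec ((B.erase a).erase b) y z := by
  refine ⟨h.mem_y, h.mem_z, h.y_le.trans_lt (h.lt_z hx), fun c hc => ?_⟩
  rcases le_total c x with h' | h'
  · exact .inl (h.le_y c hc h')
  · exact .inr (h.z_le c hc h')

/-- The other regions are not affected when the two borders are removed. -/
theorem consec_of_erase (h : Around B x a b y z) (hB : ∀ c ∈ B, -1 < c ∧ c < 0) (hx : x < 0)
    {u v : ℝ} (huv : Consec ((B.erase a).erase b) u v) (hu : u ≠ y) :
    Consec B u v ∧ (v ≤ y ∨ z ≤ u) := by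
  have hB' : ∀ c ∈ (B.erase a).erase b, -1 < c ∧ c < 0 := fun c hc =>
    hB c (Finset.mem_of_mem_erase (Finset.mem_of_mem_erase hc))
  have hdis : v ≤ y ∨ z ≤ u := by
    rcases (h.consec hx).eq_or huv hB' with h' | h'
    · exact absurd h'.1 hu
    · exact h'
  have h₁ := h.le_left hB hx
  have h₂ := h.le_right hB hx
  have h₃ := (h.mid hx).2.2.1
  refine ⟨⟨?_, ?_, huv.2.2.1, fun c hc => ?_⟩, hdis⟩
  · have := huv.1
    simp only [Finset.mem_insert, Finset.mem_erase] at this ⊢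
    tauto
  · have := huv.2.1
    simp only [Finset.mem_insert, Finset.mem_erase] at this ⊢
    tauto
  · by_cases hca : c = a
    · rcases hdis with h' | h'
      · exact .inr (by linarith)
      · exact .inl (by linarith)
    · by_cases hcb : c = b
      · rcases hdis with h' | h'
        · exact .inr (by linarith)
        · exact .inl (by linarith)
      · exact huv.2.2.2 c (Finset.mem_erase.2 ⟨hcb, Finset.mem_erase.2 ⟨hca, hc⟩⟩)

end Around

section Window

variable {M : ℕ} {w L β q : ℝ} {A A' : Finset Entry} {f f' : Entry → ℕ} {B : Finset ℝ}
  {x a b y z : ℝ} {j : Entry}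

/-- The window consists of at most three regions of at most `16 * L` each, separated by two borders,
each of which costs at most `M * w ≤ L`. -/
theorem Sched.opt_window_le (h : Sched M L β q A f B) (hA : ∀ r ∈ A, Proper w r) (hw : 0 ≤ w)
    (hL : M * w ≤ L) (ha : Around B x a b y z) (hx : x < 0) : opt M (win A y z) ≤ 50 * L := by
  have hL0 : 0 ≤ L := le_trans (by positivity) hL
  have h₁ := opt_win_le_add (M := M) hA hw y a z
  have h₂ := opt_win_le_add (M := M) hA hw a b z
  have h₃ := (h.good a b (ha.mid hx)).high
  have h₄ : opt M (win A y a) ≤ 16 * L := by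
    rcases ha.left h.bounds hx with h' | h'
    · rw [h'.1]
      linarith [opt_win_self (M := M) (a := a) hA]
    · exact (h.good y a h'.2).high
  have h₅ : opt M (win A b z) ≤ 16 * L := by
    rcases ha.right h.bounds hx with h' | h'
    · rw [h'.1]
      linarith [opt_win_self (M := M) (a := z) hA]
    · exact (h.good b z h'.2).high
  linarith

/-- The window contains at least two regions unless it is everything; so it remains worth `L` when a
job is deleted. -/
theorem Sched.le_opt_window (h : Sched M L β q A f B) (hA : ∀ r ∈ A, Proper w r)
    (ha : Around B x a b y z) (hx : x < 0) :
    y = -1 ∧ z = 0 ∨ 2 * L ≤ opt M (win A y z) := by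
  have hmid := ha.mid hx
  have h₁ := opt_win_add_le (M := M) hA (ha.le_left h.bounds hx)
    (hmid.2.2.1.le.trans (ha.le_right h.bounds hx))
  have h₂ := opt_win_add_le (M := M) hA hmid.2.2.1.le (ha.le_right h.bounds hx)
  have h₃ := (h.good a b hmid).low
  have hnn : ∀ u v, 0 ≤ opt M (win A u v) := fun u v =>
    opt_nonneg fun r hr => hA r (win_subset _ _ _ hr)
  have := hnn y a
  have := hnn b z
  rcases ha.left h.bounds hx with ⟨e₁, e₂⟩ | ⟨haB, hya⟩
  · rcases ha.right h.bounds hx with ⟨e₃, e₄⟩ | ⟨hbB, hbz⟩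
    · exact .inl ⟨e₁.trans e₂, e₃ ▸ e₄⟩
    · right
      have hb := h.bounds b hbB
      have k₁ := h₃.resolve_left fun h' => by linarith [h'.2]
      have k₂ := (h.good b z hbz).low.resolve_left fun h' => by linarith [h'.1]
      linarith
  · right
    have ha' := h.bounds a haB
    have k₁ := h₃.resolve_left fun h' => by linarith [h'.1]
    have k₂ := (h.good y a hya).low.resolve_left fun h' => by linarith [h'.2]
    linarith

/-- When the entry `j` is inserted or deleted, and the window around its start is cleared, the
schedule remains good enough outside of the window, and the window is not too rich. -/
theorem Sched.split (h : Sched M L β q A f B) (hA : ∀ r ∈ A, Proper w r)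
    (hA' : ∀ r ∈ A', Proper w r) (hj : Proper w j) (hw : 0 ≤ w) (hL : M * w ≤ L) (hwL : w ≤ L)
    (hsub : A' ⊆ insert j A) (hsub' : A ⊆ insert j A') (ha : Around B j.s a b y z)
    (hf : ∀ r ∈ A', f' r = if r = j ∨ r ∈ win A y z then 0 else f r) :
    Split M L β q A' f' ((B.erase a).erase b) y z z ∧ opt M (win A' y z) ≤ 51 * L := by
  have hx : j.s < 0 := hj.lt.trans hj.neg
  have hL0 : 0 ≤ L := hw.trans hwL
  have hused : ∀ r ∈ A', f' r ≠ 0 → r ∈ A ∧ f' r = f r := by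
    intro r hr h0
    have := hf r hr
    split_ifs at this with hc
    · exact absurd this h0
    · exact ⟨(Finset.mem_insert.1 (hsub hr)).resolve_left fun e => hc (.inl e), this⟩
  have hwin : ∀ {X Y : Finset Entry}, X ⊆ insert j Y → win X y z ⊆ insert j (win Y y z) := by
    intro X Y hXY r hr
    have := mem_win.1 hr
    rcases Finset.mem_insert.1 (hXY this.1) with e | h'
    · simp [e]
    · exact Finset.mem_insert_of_mem (mem_win.2 ⟨h', this.2⟩)
  have hopt : ∀ {X Y : Finset Entry}, (∀ r ∈ X, Proper w r) → (∀ r ∈ Y, Proper w r) →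
      X ⊆ insert j Y → opt M (win X y z) ≤ opt M (win Y y z) + w := by
    intro X Y hX hY hXY
    have hp : ∀ r ∈ insert j (win Y y z), Proper w r := by
      intro r hr
      rcases Finset.mem_insert.1 hr with rfl | h'
      · exact hj
      · exact hY r (win_subset _ _ _ h')
    exact (opt_mono hp (hwin hXY)).trans (opt_insert_le hp)
  refine ⟨⟨?_, ?_, ?_, ?_, ha.consec hx, ?_, ?_, le_rfl, ?_, .inl rfl⟩, ?_⟩
  · intro r hr
    by_cases h0 : f' r = 0
    · exact ⟨by omega, fun q _ _ h0' => absurd h0 h0'⟩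
    · obtain ⟨hrA, e⟩ := hused r hr h0
      have := h.feas r hrA
      rw [e]
      refine ⟨this.1, fun p hp he h0' hne => ?_⟩
      obtain ⟨hpA, e'⟩ := hused p hp (by rw [he]; exact h0')
      exact this.2 p hpA (by rw [← e', he]) h0' hne
  · intro r hr h0 c hc
    obtain ⟨hrA, e⟩ := hused r hr h0
    exact h.noCross r hrA (by rwa [← e]) c (Finset.mem_of_mem_erase (Finset.mem_of_mem_erase hc))
  · exact fun c hc => h.bounds c (Finset.mem_of_mem_erase (Finset.mem_of_mem_erase hc))
  · intro r hr
    have := mem_win.1 hr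
    rw [hf r this.1, if_pos]
    rcases Finset.mem_insert.1 (hsub this.1) with e | h'
    · exact .inl e
    · exact .inr (mem_win.2 ⟨h', this.2⟩)
  · intro u v huv hu
    obtain ⟨huv', hdis⟩ := ha.consec_of_erase h.bounds hx huv hu
    -- the job starts inside the window, so it is not contained in any other region
    have hjw : ∀ r, u ≤ r.s → r.e ≤ v → r.s < r.e → r ≠ j := by
      rintro r h₁ h₂ h₃ rfl
      rcases hdis with h' | h'
      · linarith [ha.y_le]
      · linarith [ha.lt_z hx]
    have hwe : win A' u v = win A u v := by
      ext r
      simp only [mem_win]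
      constructor
      · rintro ⟨h₁, h₂, h₃⟩
        exact ⟨(Finset.mem_insert.1 (hsub h₁)).resolve_left (hjw r h₂ h₃ (hA' r h₁).lt), h₂, h₃⟩
      · rintro ⟨h₁, h₂, h₃⟩
        exact ⟨(Finset.mem_insert.1 (hsub' h₁)).resolve_left (hjw r h₂ h₃ (hA r h₁).lt), h₂, h₃⟩
    obtain ⟨k₁, k₂, k₃⟩ := h.good u v huv'
    refine ⟨by rwa [hwe], by rwa [hwe], ?_⟩
    rw [hwe, gain_congr (f := f) fun r hr => ?_]
    · exact k₃
    · rw [← hwe] at hr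
      have hr' := mem_win.1 hr
      have hlt := (hA' r hr'.1).lt
      rw [hf r hr'.1, if_neg]
      rintro (e | h')
      · exact hjw r hr'.2.1 hr'.2.2 hlt e
      · have := mem_win.1 h'
        rcases hdis with h' | h' <;> linarith
  · exact ha.y_le.trans_lt (ha.lt_z hx)
  · rcases h.le_opt_window hA ha hx with h' | h'
    · exact .inl h'
    · right
      linarith [hopt hA hA' hsub']
  · linarith [hopt hA' hA hsub, h.opt_window_le hA hw hL ha hx]

end Window

/-- Find the window around the time in the real register `20`, remove the two borders inside, and
clear it. Its ends go to the real registers `6` and `16`. -/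
def windowProg : Program :=
  .setReal 9 (.reg 20) ;;
  prevProg ;;
  removeBorderProg ;;
  .setReal 9 (.reg 20) ;;
  nextProg ;;
  removeBorderProg ;;
  .setReal 9 (.reg 20) ;;
  prevProg ;;
  .setReal 6 (.reg 9) ;;
  .setReal 9 (.reg 20) ;;
  nextProg ;;
  .setReal 16 (.reg 9) ;;
  .setReal 7 (.reg 9) ;;
  .setReal 11 (.ofNat (.const 0)) ;;
  clearProg

theorem State.setReal {w : ℝ} {Λ : ℕ} {s : Store} {A : Finset Entry} {B : Finset ℝ}
    (h : State w Λ s A B) {x : ℕ} (hx : x ≠ 5) (v : ℝ) :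
    State w Λ { s with realReg := Function.update s.realReg x v } A B :=
  h.congr rfl rfl rfl (Function.update_of_ne hx.symm _ _)

theorem ParamFrame.setReal (s : Store) {x : ℕ} (hx : 5 ≤ x) (hx' : x < 17) (v : ℝ) :
    ParamFrame s { s with realReg := Function.update s.realReg x v } :=
  ParamFrame.of_regs (s := s) (f := s.natReg) (fun _ _ _ => rfl)
    (fun y _ hy => Function.update_of_ne (by omega) _ _) rfl

theorem wp_windowProg {M Λ : ℕ} {w x : ℝ} {s : Store} {A : Finset Entry} {B : Finset ℝ}
    (h : State w Λ s A B) (hf : Feasible M A s.mach) (hw : 0 ≤ w) (h20 : s.realReg 20 = x)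
    (hx : -1 ≤ x) (hx' : x < 0) :
    wp windowProg s fun s' t => ∃ a b y z, Around B x a b y z ∧
      s'.realReg 6 = y ∧ s'.realReg 16 = z ∧ State w Λ s' A ((B.erase a).erase b) ∧
      (∀ r ∈ A, s'.mach r = if r ∈ win A y z then 0 else s.mach r) ∧ ParamFrame s s' ∧
      (t : ℝ) ≤ 10000 * (Λ + 1) * (gain (win A y z) s.mach + 1) := by
  unfold windowProg
  rw [wp_seq, wp_setReal, wp_seq]
  refine (wp_prevProg (h.setReal (x := 9) (by norm_num) _) (by simp [h20, hx])).mono ?_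
  rintro s₁ t₁ ⟨ma, a_le, le_a, hs₁, e₁, hF₁, ht₁⟩
  set a := s₁.realReg 9 with ha
  simp [h20] at a_le le_a
  have hF₁' := (ParamFrame.setReal s (x := 9) (by norm_num) (by norm_num) _).trans hF₁.paramFrame
  rw [wp_seq]
  refine (wp_removeBorderProg hs₁ ?_).mono ?_
  · rcases Finset.mem_insert.1 ma with h' | h'
    · exact .inl h'
    · exact .inr (.inr h')
  rintro s₂ t₂ ⟨hs₂, e₂, hF₂, ht₂⟩
  have hF₂' := hF₁'.trans hF₂.paramFrame
  have k₂ : s₂.realReg 20 = x := (hF₂'.real 20 (by norm_num) (by norm_num)).trans h20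
  rw [← ha] at hs₂
  rw [wp_seq, wp_setReal, wp_seq]
  refine (wp_nextProg (hs₂.setReal (x := 9) (by norm_num) _) (by simp [k₂, hx'.le])).mono ?_
  rintro s₃ t₃ ⟨mb, le_b, b_le, hs₃, e₃, hF₃, ht₃⟩
  set b := s₃.realReg 9 with hb
  simp only [RealExpr.eval, Function.update_self, k₂] at le_b b_le
  have hF₃' := (hF₂'.trans (ParamFrame.setReal s₂ (x := 9) (by norm_num) (by norm_num) _)).trans
    hF₃.paramFrame
  rw [wp_seq]
  refine (wp_removeBorderProg hs₃ ?_).mono ?_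
  · rcases Finset.mem_insert.1 mb with h' | h'
    · exact .inr (.inl h')
    · exact .inr (.inr h')
  rintro s₄ t₄ ⟨hs₄, e₄, hF₄, ht₄⟩
  have hF₄' := hF₃'.trans hF₄.paramFrame
  have k₄ : s₄.realReg 20 = x := (hF₄'.real 20 (by norm_num) (by norm_num)).trans h20
  rw [← hb] at hs₄
  rw [wp_seq, wp_setReal, wp_seq]
  refine (wp_prevProg (hs₄.setReal (x := 9) (by norm_num) _) (by simp [k₄, hx])).mono ?_
  rintro s₅ t₅ ⟨my, y_le, le_y, hs₅, e₅, hF₅, ht₅⟩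
  set y := s₅.realReg 9 with hy
  simp only [RealExpr.eval, Function.update_self, k₄] at y_le le_y
  have hF₅' := (hF₄'.trans (ParamFrame.setReal s₄ (x := 9) (by norm_num) (by norm_num) _)).trans
    hF₅.paramFrame
  have k₅ : s₅.realReg 20 = x := (hF₅'.real 20 (by norm_num) (by norm_num)).trans h20
  rw [wp_seq, wp_setReal, wp_seq, wp_setReal, wp_seq]
  refine (wp_nextProg ((hs₅.setReal (x := 6) (by norm_num) _).setReal (x := 9) (by norm_num) _)
    (by simp [k₅, hx'.le])).mono ?_
  rintro s₆ t₆ ⟨mz, le_z, z_le, hs₆, e₆, hF₆, ht₆⟩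
  set z := s₆.realReg 9 with hz
  have k₅' : Function.update s₅.realReg 6 (s₅.realReg 9) 20 = x := by simp [k₅]
  simp only [RealExpr.eval, Function.update_self, k₅'] at le_z z_le
  have hF₆' := ((hF₅'.trans (ParamFrame.setReal s₅ (x := 6) (by norm_num) (by norm_num) _)).trans
    (ParamFrame.setReal _ (x := 9) (by norm_num) (by norm_num) _)).trans hF₆.paramFrame
  have k₆ : s₆.realReg 6 = y := by
    rw [hF₆.real 6 (by omega) (by omega)]
    simp [hy]
  have hm : s₆.natArr 10 = s.natArr 10 := by rw [e₆, e₅, e₄, e₃, e₂, e₁]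
  have haround : Around B x a b y z :=
    ⟨ma, a_le, le_a, mb, le_b, b_le, my, y_le, le_y, mz, le_z, z_le⟩
  rw [wp_seq, wp_setReal, wp_seq, wp_setReal, wp_seq, wp_setReal]
  obtain ⟨B₂, B₃, hc, hB⟩ := ((hs₆.setReal (x := 16) (by norm_num) z).setReal (x := 7)
    (by norm_num) z).setReal (x := 11) (by norm_num) 0
  have hmach : s₆.mach = s.mach := by
    funext r
    unfold Store.mach
    rw [hm]
  refine (wp_clearProg (M := M) (Λ := Λ) (w := w) (a := y) (b := z) (θ := 0) (A := A)
    (B₂ := B₂) (B₃ := B₃) ?_ ?_ hw ?_ ?_ ?_ le_rfl).mono ?_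
  · exact hc.congr rfl rfl rfl (by simp)
  · change Feasible M A s₆.mach
    rw [hmach]
    exact hf
  · simp [k₆]
  · simp [← hz]
  · simp
  rintro s₇ t₇ ⟨hm₇, -, -, -, -, hc₇, hF₇, ht₇⟩
  refine ⟨a, b, y, z, haround, ?_, ?_, ⟨B₂, B₃, hc₇, hB⟩, ?_, ?_, ?_⟩
  · rw [hF₇.real 6 (by omega) (by omega)]
    simp [k₆]
  · rw [hF₇.real 16 (by omega) (by omega)]
    simp [← hz]
  · intro r hr
    rw [hm₇ r hr]
    change (if r ∈ win A y z then 0 else s₆.mach r) = _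
    rw [hmach]
  · exact (((hF₆'.trans (ParamFrame.setReal s₆ (x := 16) (by norm_num) (by norm_num) _)).trans
      (ParamFrame.setReal _ (x := 7) (by norm_num) (by norm_num) _)).trans
      (ParamFrame.setReal _ (x := 11) (by norm_num) (by norm_num) _)).trans hF₇.paramFrame
  · replace ht₇ : (t₇ : ℝ) ≤ 2500 * (Λ + 1) * (gain (win A y z) s₆.mach + 1) := ht₇
    rw [hmach] at ht₇
    have hg : 0 ≤ gain (win A y z) s.mach := gain_nonneg fun r hr =>
      hc.proper r (win_subset _ _ _ hr)
    have hs : t₁ + t₂ + t₃ + t₄ + t₅ + t₆ + 100 ≤ 7000 * (Λ + 1) := by omega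
    have hs' : (t₁ : ℝ) + t₂ + t₃ + t₄ + t₅ + t₆ + 100 ≤ 7000 * (Λ + 1) := by exact_mod_cast hs
    have k : (Λ + 1 : ℝ) ≤ (Λ + 1) * (gain (win A y z) s.mach + 1) :=
      le_mul_of_one_le_right (by positivity) (by linarith)
    simp
    linarith

/-! ### Parameters and classes -/

/-- The number of class values from one power of two to the next. -/
noncomputable def accuracy (ε : ℝ) : ℕ := ⌈3 / ε⌉₊

theorem one_le_accuracy {ε : ℝ} (hε : 0 < ε) : 1 ≤ accuracy ε :=
  Nat.one_le_ceil_iff.2 (by positivity)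

/-- Compute the accuracy, and the table of the class values up to the first one that exceeds all
rewards. The registers `8`, `6` and `7` hold the class value of the class in register `4`, the
remainder of the class modulo the accuracy, and the distance to the next class value. -/
def setupProg : Program :=
  .setNat 3 (.const 1) ;;
  .loop (.realLt (.mul (.ofNat (.reg 3)) (.reg 4)) (.ofNat (.const 3)))
    (.setNat 3 (.add (.reg 3) (.const 1))) ;;
  .setNat 4 (.const 0) ;;
  .setNat 6 (.const 0) ;;
  .setNat 7 (.const 1) ;;
  .setNat 8 (.reg 3) ;;
  .putNat 11 (.const 0) (.reg 8) ;;
  .loop (.neg (.realLt (.mul (.ofNat (.reg 3)) (.reg 3)) (.ofNat (.reg 8))))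
    (.setNat 8 (.add (.reg 8) (.reg 7)) ;;
      .setNat 6 (.add (.reg 6) (.const 1)) ;;
      .ite (.natEq (.reg 6) (.reg 3))
        (.setNat 6 (.const 0) ;; .setNat 7 (.add (.reg 7) (.reg 7))) .skip ;;
      .setNat 4 (.add (.reg 4) (.const 1)) ;;
      .putNat 11 (.reg 4) (.reg 8))

/-- What `setupProg` leaves unchanged. -/
structure SetupFrame (s s' : Store) : Prop where
  nat : ∀ x, x ≠ 3 → x ≠ 4 → x ≠ 6 → x ≠ 7 → x ≠ 8 → s'.natReg x = s.natReg x
  real : s'.realReg = s.realReg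
  natArr : ∀ a, a ≠ 11 → s'.natArr a = s.natArr a
  realArr : s'.realArr = s.realArr

theorem SetupFrame.heap {s s' : Store} (h : SetupFrame s s') : s'.heap = s.heap := by
  simp [h.nat, h.natArr, h.realArr]

theorem mod_div_succ {N : ℕ} (hN : 1 ≤ N) (k : ℕ) :
    (k % N + 1 = N → (k + 1) % N = 0 ∧ (k + 1) / N = k / N + 1) ∧
    (k % N + 1 ≠ N → (k + 1) % N = k % N + 1 ∧ (k + 1) / N = k / N) := by
  have hm := Nat.mod_lt k hN
  have h := Nat.div_add_mod k N
  constructor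
  · intro e
    have : k + 1 = N * (k / N + 1) := by
      rw [Nat.mul_add, mul_one]
      omega
    rw [this, Nat.mul_mod_right, Nat.mul_div_cancel_left _ hN]
    exact ⟨rfl, rfl⟩
  · intro e
    have hlt : k % N + 1 < N := by omega
    have : ∀ x, x < N → (N * (k / N) + x) % N = x ∧ (N * (k / N) + x) / N = k / N := by
      intro x hx
      rw [Nat.mul_add_mod, Nat.mul_add_div hN, Nat.mod_eq_of_lt hx, Nat.div_eq_of_lt hx]
      simp
    rw [show k + 1 = N * (k / N) + (k % N + 1) by omega]
    exact this _ hlt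

/-- The class values grow at least linearly, so that the computation of their table ends. -/
theorem add_le_clsVal {N : ℕ} (hN : 1 ≤ N) (k : ℕ) : k + N ≤ clsVal N k := by
  have := (clsVal_strictMono hN).add_le_nat k 0
  rwa [clsVal_zero hN, add_zero] at this

theorem wp_setupProg {w ε : ℝ} {s : Store} (h3 : s.realReg 3 = w) (h4 : s.realReg 4 = ε)
    (hε : 0 < ε) :
    wp setupProg s fun s' t => ∃ K, s'.natReg 3 = accuracy ε ∧ s'.natReg 4 = K ∧
      (∀ k ≤ K, s'.natArr 11 k = clsVal (accuracy ε) k) ∧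
      (accuracy ε : ℝ) * w < clsVal (accuracy ε) K ∧
      (∀ k < K, (clsVal (accuracy ε) k : ℝ) ≤ accuracy ε * w) ∧
      SetupFrame s s' ∧ t ≤ 50 * (accuracy ε + K + 1) := by
  have hN := one_le_accuracy hε
  set N := accuracy ε with hNd
  unfold setupProg
  rw [wp_seq, wp_setNat, wp_seq]
  refine (wp_loop (fun n t s' => ∃ k, s' = { s with natReg := Function.update s.natReg 3 k } ∧
    1 ≤ k ∧ k ≤ N ∧ n = N - k ∧ t ≤ 20 * k) (n := N - 1) ?_ ?_).mono ?_
  · rintro n t s' ⟨k, rfl, h1, hk, rfl, ht⟩ hb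
    simp [Test.Holds, h4] at hb
    have hlt : k < N := by
      rw [hNd, accuracy, Nat.lt_ceil, lt_div_iff₀ hε]
      exact hb
    rw [wp_setNat]
    refine ⟨N - (k + 1), by omega, k + 1, by simp, by omega, by omega, rfl, ?_⟩
    simp
    omega
  · exact ⟨1, rfl, le_rfl, hN, rfl, by simp⟩
  rintro s' t ⟨n, t', ⟨k, rfl, h1, hk, rfl, ht⟩, hb, rfl⟩
  simp [Test.Holds, h4] at hb
  obtain rfl : k = N := by
    refine le_antisymm hk ?_
    rw [hNd, accuracy, Nat.ceil_le, div_le_iff₀ hε]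
    exact hb
  clear hk h1 hb
  rw [wp_seq, wp_setNat, wp_seq, wp_setNat, wp_seq, wp_setNat, wp_seq, wp_setNat, wp_seq,
    wp_putNat]
  refine (wp_loop (fun n t s' => ∃ k, s'.natReg 3 = N ∧ s'.natReg 4 = k ∧ s'.natReg 6 = k % N ∧
    s'.natReg 7 = 2 ^ (k / N) ∧ s'.natReg 8 = clsVal N k ∧
    (∀ i ≤ k, s'.natArr 11 i = clsVal N i) ∧ (∀ i < k, (clsVal N i : ℝ) ≤ N * w) ∧
    SetupFrame s s' ∧ n = ⌊N * w⌋₊ + 1 - k ∧ t ≤ 48 * k) (n := ⌊N * w⌋₊ + 1) ?_ ?_).mono ?_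
  · rintro n u s' ⟨k, g3, g4, g6, g7, g8, hcv, hle, hF, rfl, hu⟩ hb
    simp [Test.Holds, g3, g8, hF.real, h3] at hb
    have hkw : k ≤ ⌊N * w⌋₊ := by
      refine Nat.le_floor (le_trans ?_ hb)
      have := add_le_clsVal hN k
      exact_mod_cast (by omega : k ≤ clsVal N k)
    -- the two cases, with and without a new power of two, lead to the same invariant
    have hstep : ∀ r₆ r₇ : ℕ, r₆ = (k + 1) % N → r₇ = 2 ^ ((k + 1) / N) → ∀ v u' : ℕ, u' ≤ 48 →
        v = clsVal N (k + 1) →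
        ∀ s₂ : Store, s₂ = { s' with
          natReg := Function.update (Function.update (Function.update (Function.update s'.natReg
            8 v) 6 r₆) 7 r₇) 4 (k + 1)
          natArr := Function.update s'.natArr 11 (Function.update (s'.natArr 11) (k + 1) v) } →
        ∃ n' < ⌊N * w⌋₊ + 1 - k, ∃ k, s₂.natReg 3 = N ∧ s₂.natReg 4 = k ∧ s₂.natReg 6 = k % N ∧
          s₂.natReg 7 = 2 ^ (k / N) ∧ s₂.natReg 8 = clsVal N k ∧
          (∀ i ≤ k, s₂.natArr 11 i = clsVal N i) ∧ (∀ i < k, (clsVal N i : ℝ) ≤ N * w) ∧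
          SetupFrame s s₂ ∧ n' = ⌊N * w⌋₊ + 1 - k ∧ u + u' ≤ 48 * k := by
      rintro r₆ r₇ e₆ e₇ v u' hu' rfl s₂ rfl
      refine ⟨_, ?_, k + 1, ?_, ?_, ?_, ?_, ?_, fun i hi => ?_, fun i hi => ?_,
        ⟨fun x x3 x4 x6 x7 x8 => ?_, hF.real, fun a ha => ?_, hF.realArr⟩, rfl, by omega⟩
      · omega
      · simp [g3]
      · simp
      · simp [e₆]
      · simp [e₇]
      · simp
      · rcases Nat.lt_or_ge k i with h' | h'
        · obtain rfl : i = k + 1 := by omega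
          simp
        · simp [hcv i h', show i ≠ k + 1 by omega]
      · rcases Nat.lt_or_ge i k with h' | h'
        · exact hle i h'
        · obtain rfl : i = k := by omega
          exact hb
      · simp [x4, x6, x7, x8, hF.nat x x3 x4 x6 x7 x8]
      · simp [ha, hF.natArr a ha]
    have hval := clsVal_succ hN k
    rw [wp_seq, wp_setNat, wp_seq, wp_setNat, wp_seq, wp_ite]
    simp only [Test.Holds, NatExpr.eval]
    refine ⟨fun c => ?_, fun c => ?_⟩
    · rw [wp_seq, wp_setNat, wp_setNat, wp_seq, wp_setNat, wp_putNat]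
      simp [g6, g3] at c
      obtain ⟨e₁, e₂⟩ := (mod_div_succ hN k).1 c
      refine hstep 0 (2 ^ (k / N) + 2 ^ (k / N)) e₁.symm ?_ (clsVal N k + 2 ^ (k / N)) _ ?_
        hval.symm _ ?_
      · rw [e₂, pow_succ]; ring
      · simp
      · simp [g4, g7, g8]
    · rw [wp_skip, wp_seq, wp_setNat, wp_putNat]
      simp [g6, g3] at c
      obtain ⟨e₁, e₂⟩ := (mod_div_succ hN k).2 c
      refine hstep (k % N + 1) (2 ^ (k / N)) e₁.symm ?_ (clsVal N k + 2 ^ (k / N)) _ ?_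
        hval.symm _ ?_
      · rw [e₂]
      · simp
      · have : Function.update (Function.update (Function.update s'.natReg 8 (clsVal N k +
            2 ^ (k / N))) 6 (k % N + 1)) 7 (2 ^ (k / N)) =
            Function.update (Function.update s'.natReg 8 (clsVal N k + 2 ^ (k / N))) 6
              (k % N + 1) := by
          rw [Function.update_eq_self_iff]
          simp [g7]
        rw [this]
        simp [g4, g6, g7, g8]
  · refine ⟨0, by simp, by simp, by simp, by simp, by simp [clsVal_zero hN], fun i hi => ?_,
      by simp, ⟨fun x x3 x4 x6 x7 x8 => ?_, rfl, fun a ha => ?_, rfl⟩, by simp, by simp⟩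
    · obtain rfl : i = 0 := by omega
      simp [clsVal_zero hN]
    · simp [x3, x4, x6, x7, x8]
    · simp [ha]
  · rintro s' u ⟨n, u', ⟨k, g3, g4, g6, g7, g8, hcv, hle, hF, rfl, hu⟩, hb, rfl⟩
    simp [Test.Holds, g3, g8, hF.real, h3] at hb
    refine ⟨k, g3, g4, hcv, hb, hle, hF, ?_⟩
    simp
    omega

/-- The number of classes is logarithmic in the greatest reward. -/
theorem classes_mul_log_le {N K : ℕ} {w : ℝ} (hN : 1 ≤ N) (hw : 1 ≤ w)
    (h : ∀ k < K, (clsVal N k : ℝ) ≤ N * w) :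
    (K : ℝ) * Real.log 2 ≤ N * (Real.log w + Real.log 2) := by
  have hl2 : 0 < Real.log 2 := Real.log_pos (by norm_num)
  have hlw : 0 ≤ Real.log w := Real.log_nonneg hw
  rcases Nat.eq_zero_or_pos K with rfl | hK
  · simp only [Nat.cast_zero, zero_mul]
    positivity
  have hN' : (0 : ℝ) < N := by exact_mod_cast hN
  have h₁ := h (K - 1) (by omega)
  -- the class value `K - 1` is at least `N * 2 ^ ((K - 1) / N)`, and it does not exceed `N * w`
  have h₂ : (2 : ℝ) ^ ((K - 1) / N) ≤ w := by
    have : (N : ℝ) * 2 ^ ((K - 1) / N) ≤ N * w := by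
      refine le_trans ?_ h₁
      have : N * 2 ^ ((K - 1) / N) ≤ clsVal N (K - 1) := by
        rw [mul_comm]
        exact Nat.mul_le_mul_left _ (by omega)
      exact_mod_cast this
    exact le_of_mul_le_mul_left this hN'
  have h₃ : (((K - 1) / N : ℕ) : ℝ) * Real.log 2 ≤ Real.log w := by
    rw [← Real.log_pow]
    exact Real.log_le_log (by positivity) h₂
  have h₄ : K ≤ N * ((K - 1) / N + 1) := by
    have := Nat.div_add_mod (K - 1) N
    have := Nat.mod_lt (K - 1) hN
    rw [Nat.mul_add]
    omega
  calc (K : ℝ) * Real.log 2 ≤ (N * ((K - 1) / N + 1) : ℕ) * Real.log 2 := by gcongr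
    _ = N * ((((K - 1) / N : ℕ) : ℝ) * Real.log 2 + Real.log 2) := by push_cast; ring
    _ ≤ _ := by gcongr

/-- Find the class of the reward in the real register `2`. -/
def classProg : Program :=
  .setNat 17 (.const 0) ;;
  .loop (.neg (.realLt (.mul (.ofNat (.reg 3)) (.reg 2))
      (.ofNat (.get 11 (.add (.reg 17) (.const 1))))))
    (.setNat 17 (.add (.reg 17) (.const 1)))

theorem wp_classProg {N K : ℕ} {w x : ℝ} {s : Store} (h3 : s.natReg 3 = N) (hN : 1 ≤ N)
    (h11 : ∀ k ≤ K, s.natArr 11 k = clsVal N k) (htop : (N : ℝ) * w < clsVal N K)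
    (h2 : s.realReg 2 = x) (hx : 1 ≤ x) (hxw : x ≤ w) :
    wp classProg s fun s' t => ∃ k, s' = { s with natReg := Function.update s.natReg 17 k } ∧
      (clsVal N k : ℝ) ≤ N * x ∧ (N : ℝ) * (N * x) ≤ (N + 1) * clsVal N k ∧
      t ≤ 30 * (K + 1) := by
  have hN' : (0 : ℝ) < N := by exact_mod_cast hN
  have hKx : ∀ k, (clsVal N k : ℝ) ≤ N * x → k < K := by
    intro k hk
    by_contra hcon
    have h₁ : (clsVal N K : ℝ) ≤ clsVal N k :=
      Nat.cast_le.2 ((clsVal_strictMono hN).monotone (not_lt.1 hcon))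
    have h₂ : (N : ℝ) * x ≤ N * w := by gcongr
    linarith
  unfold classProg
  rw [wp_seq, wp_setNat]
  refine (wp_loop (fun n t s' => ∃ k, s' = { s with natReg := Function.update s.natReg 17 k } ∧
      (clsVal N k : ℝ) ≤ N * x ∧ n = K - k ∧ t ≤ 20 * k) (n := K) ?_ ?_).mono ?_
  · rintro n t s' ⟨k, rfl, hk, rfl, ht⟩ hb
    have hkK := hKx k hk
    simp [Test.Holds, h3, h2, h11 (k + 1) hkK] at hb
    have hkK' := hKx (k + 1) hb
    rw [wp_setNat]
    refine ⟨K - (k + 1), by omega, k + 1, by simp, hb, rfl, ?_⟩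
    simp
    omega
  · refine ⟨0, rfl, ?_, rfl, by simp⟩
    rw [clsVal_zero hN]
    exact le_mul_of_one_le_right hN'.le hx
  · rintro s' t ⟨n, t', ⟨k, rfl, hk, rfl, ht⟩, hb, rfl⟩
    have hkK := hKx k hk
    simp [Test.Holds, h3, h2, h11 (k + 1) hkK] at hb
    refine ⟨k, rfl, hk, ?_, ?_⟩
    · have h₁ : (N : ℝ) * clsVal N (k + 1) ≤ (N + 1) * clsVal N k := by
        exact_mod_cast mul_clsVal_succ_le hN k
      have h₂ : (N : ℝ) * (N * x) ≤ N * clsVal N (k + 1) := by gcongr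
      linarith
    · simp
      omega

/-! ### The dictionary of the present jobs -/

/-- The entry with the address `i` of a job. The internal time of `t ≥ 0` is `-1 / (1 + t)`. -/
noncomputable def jobEntry (i : ℕ) (j : Job) : Entry :=
  ⟨i, -1 / (1 + j.start), -1 / (1 + (j.start + j.length)), j.weight, j.id⟩

theorem inner_time_lt_iff {x y : ℝ} (hx : 0 ≤ x) (hy : 0 ≤ y) :
    -1 / (1 + x) < -1 / (1 + y) ↔ x < y := by
  rw [div_lt_div_iff₀ (by linarith) (by linarith)]
  constructor <;> intro h <;> linarith

theorem inner_time_le_iff {x y : ℝ} (hx : 0 ≤ x) (hy : 0 ≤ y) :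
    -1 / (1 + x) ≤ -1 / (1 + y) ↔ x ≤ y := by
  rw [← not_lt, inner_time_lt_iff hy hx, not_lt]

theorem inner_time_eq_iff {x y : ℝ} (hx : 0 ≤ x) (hy : 0 ≤ y) :
    -1 / (1 + x) = -1 / (1 + y) ↔ x = y := by
  rw [le_antisymm_iff, le_antisymm_iff, inner_time_le_iff hx hy, inner_time_le_iff hy hx]

theorem Job.Valid.proper {w : ℝ} {j : Job} (h : j.Valid w) (i : ℕ) : Proper w (jobEntry i j) := by
  obtain ⟨h₁, h₂, h₃, h₄⟩ := h
  refine ⟨?_, (inner_time_lt_iff h₁ (by linarith)).2 (by linarith), ?_, h₃, h₄⟩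
  · change -1 ≤ -1 / (1 + j.start)
    rw [le_div_iff₀ (by linarith)]
    linarith
  · exact div_neg_of_neg_of_pos (by norm_num) (by linarith)

/-- The key of an entry determines the data of its job, since the internal time is injective on
times `t ≥ 0`. So the job of a request can be found by its key. -/
theorem jobEntry_key_eq {i i' : ℕ} {j j' : Job} (h : 0 ≤ j.start) (hl : 1 ≤ j.length)
    (h' : 0 ≤ j'.start) (hl' : 1 ≤ j'.length) :
    (jobEntry i j).key = (jobEntry i' j').key ↔ j = j' := by
  rw [Entry.key_eq, Job.ext_iff]
  simp only [jobEntry]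
  rw [inner_time_eq_iff h h', inner_time_eq_iff (by linarith) (by linarith)]
  constructor
  · rintro ⟨h₁, h₂, h₃, h₄⟩
    exact ⟨h₄, h₁, by linarith, h₃⟩
  · rintro ⟨h₁, h₂, h₃, h₄⟩
    exact ⟨h₂, by rw [h₂, h₃], h₄, h₁⟩

/-- The input registers hold the data of the job. -/
structure Store.HasInput (s : Store) (j : Job) : Prop where
  id : s.natReg 0 = j.id
  start : s.realReg 0 = j.start
  length : s.realReg 1 = j.length
  weight : s.realReg 2 = j.weight

/-- The internal time. -/
def timeExpr (x : RealExpr) : RealExpr :=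
  .div (.sub (.ofNat (.const 0)) (.ofNat (.const 1))) (.add (.ofNat (.const 1)) x)

/-- Record the job in the input registers. -/
def recordJobProg : Program :=
  recordProg (timeExpr (.reg 0)) (timeExpr (.add (.reg 0) (.reg 1))) (.reg 2) (.reg 0)

theorem wp_recordJobProg {s : Store} {j : Job} (h : s.HasInput j) :
    wp recordJobProg s fun s' t => Recorded (jobEntry (s.natReg 2 + 1) j) s s' ∧ t ≤ 60 := by
  refine (wp_recordProg (r := jobEntry (s.natReg 2 + 1) j)
    (fun s' _ hr => ?_) (fun s' _ hr => ?_) (fun s' _ hr => ?_) (fun s' hn _ => ?_) rfl).mono ?_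
  · simp [timeExpr, jobEntry, hr, h.start]
  · simp [timeExpr, jobEntry, hr, h.start, h.length]
  · simp [jobEntry, hr, h.weight]
  · simp [jobEntry, hn, h.id]
  · rintro s' t ⟨hR, ht⟩
    refine ⟨hR, ?_⟩
    simp [timeExpr] at ht
    omega

theorem content_congr {A B₂ B₃ : Finset Entry} {cls cls' mach mach' : ℕ → ℕ}
    (h : ∀ r ∈ A, cls' r.idx = cls r.idx ∧ mach' r.idx = mach r.idx) :
    content A B₂ B₃ cls' mach' = content A B₂ B₃ cls mach := by
  funext i
  match i with
  | 0 | 2 | 3 => rfl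
  | 1 => exact Finset.filter_congr fun r hr => by rw [(h r hr).2]
  | k + 4 => exact Finset.filter_congr fun r hr => by rw [(h r hr).1, (h r hr).2]

theorem content_insert {A B₂ B₃ : Finset Entry} {cls mach : ℕ → ℕ} {r : Entry}
    (h0 : mach r.idx = 0) :
    Function.update (Function.update (content A B₂ B₃ cls mach) 0 (insert r A)) (cls r.idx + 4)
      (insert r (content A B₂ B₃ cls mach (cls r.idx + 4))) =
    content (insert r A) B₂ B₃ cls mach := by
  funext i
  match i with
  | 0 => rw [Function.update_of_ne (by omega), Function.update_self]; rfl
  | 1 =>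
    rw [Function.update_of_ne (by omega), Function.update_of_ne (by omega)]
    simp [content, Finset.filter_insert, h0]
  | 2 | 3 => rw [Function.update_of_ne (by omega), Function.update_of_ne (by omega)]; rfl
  | k + 4 =>
    by_cases hk : k = cls r.idx
    · subst hk
      rw [Function.update_self]
      simp [content, Finset.filter_insert, h0]
    · rw [Function.update_of_ne (by omega), Function.update_of_ne (by omega)]
      simp [content, Finset.filter_insert, h0, Ne.symm hk]

theorem content_erase {A B₂ B₃ : Finset Entry} {cls mach : ℕ → ℕ} {r : Entry}
    (h0 : mach r.idx = 0) :
    Function.update (Function.update (content A B₂ B₃ cls mach) 0 (A.erase r)) (cls r.idx + 4)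
      ((content A B₂ B₃ cls mach (cls r.idx + 4)).erase r) =
    content (A.erase r) B₂ B₃ cls mach := by
  funext i
  match i with
  | 0 => rw [Function.update_of_ne (by omega), Function.update_self]; rfl
  | 1 =>
    rw [Function.update_of_ne (by omega), Function.update_of_ne (by omega)]
    ext q
    simp only [content, Finset.mem_filter, Finset.mem_erase]
    refine ⟨fun h => ⟨⟨?_, h.1⟩, h.2⟩, fun h => ⟨h.1.2, h.2⟩⟩
    rintro rfl
    exact h.2 h0
  | 2 | 3 => rw [Function.update_of_ne (by omega), Function.update_of_ne (by omega)]; rfl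
  | k + 4 =>
    by_cases hk : k = cls r.idx
    · subst hk
      rw [Function.update_self]
      simp only [content, Finset.filter_erase]
    · rw [Function.update_of_ne (by omega), Function.update_of_ne (by omega)]
      ext q
      simp only [content, Finset.mem_filter, Finset.mem_erase]
      refine ⟨fun h => ⟨⟨?_, h.1⟩, h.2⟩, fun h => ⟨h.1.2, h.2⟩⟩
      rintro rfl
      exact hk h.2.2.symm

theorem State.of_ext {w : ℝ} {Λ : ℕ} {s s' : Store} {A : Finset Entry} {B : Finset ℝ}
    (h : State w Λ s A B) (hE : s.heap.Ext s'.heap) (h7 : s'.natArr 7 = s.natArr 7)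
    (h9 : s'.natArr 9 = s.natArr 9) (h10 : s'.natArr 10 = s.natArr 10)
    (h5 : s'.realReg 5 = s.realReg 5) : State w Λ s' A B := by
  obtain ⟨B₂, B₃, hc, hB⟩ := h
  exact ⟨B₂, B₃, hc.of_trees (hc.trees.ext hE h7) hc.neg₂ hc.neg₃ hc.card₂ hc.card₃ h9 h10 h5, hB⟩

/-- The bound `2 ^ Λ` on the sizes of the trees may be chosen anew for each request. It suffices to
bound the number of jobs. -/
theorem State.resize {w : ℝ} {Λ Λ' : ℕ} {s : Store} {A : Finset Entry} {B : Finset ℝ}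
    (h : State w Λ s A B) (hA : A.card < 2 ^ Λ') (hBA : B.card ≤ A.card) : State w Λ' s A B := by
  obtain ⟨B₂, B₃, hc, hB⟩ := h
  have := hc.borders_card hB
  exact ⟨B₂, B₃, ⟨hc.trees, hc.proper, hc.neg₂, hc.neg₃, hA, by omega, by omega, hc.tot⟩, hB⟩

/-- Every region earns at least `L ≥ w`, so there are no more borders than jobs. -/
theorem Sched.card_le {M : ℕ} {w L β q : ℝ} {A : Finset Entry} {f : Entry → ℕ} {B : Finset ℝ}
    (h : Sched M L β q A f B) (hA : ∀ r ∈ A, Proper w r) (hL : w ≤ L) (hw : 0 < w) :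
    B.card ≤ A.card := by
  rcases B.eq_empty_or_nonempty with rfl | ⟨c, hc⟩
  · simp
  have hlow : ∀ x y, Consec B x y → L ≤ opt M (win A x y) := by
    intro x y hxy
    refine (h.good x y hxy).low.resolve_left ?_
    rintro ⟨rfl, rfl⟩
    have := h.bounds c hc
    rcases hxy.2.2.2 c hc with h' | h' <;> linarith
  have h₁ := sum_le_of_regions (M := M) (x := fun _ => L) hA h.bounds hlow
  have h₂ : opt M (win A (-1) 0) ≤ w * A.card :=
    (opt_mono hA (win_subset _ _ _)).trans (opt_le_card hA)
  rw [Finset.sum_const, nsmul_eq_mul] at h₁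
  have h₃ : (B.card : ℝ) * w ≤ A.card * w := by
    have : (B.card : ℝ) * w ≤ B.card * L := by gcongr
    linarith
  exact_mod_cast le_of_mul_le_mul_right h₃ hw

/-- Add the entry with the address in the register `18`, of the class in the register `17`. -/
def addEntryProg : Program :=
  .putNat 9 (.reg 18) (.reg 17) ;;
  .putNat 10 (.reg 18) (.const 0) ;;
  .setNat 41 (.reg 18) ;;
  .setNat 40 (.const 0) ;;
  treeInsert ;;
  .setNat 41 (.reg 18) ;;
  .setNat 40 (.add (.reg 17) (.const 4)) ;;
  treeInsert

theorem wp_addEntryProg {w : ℝ} {Λ : ℕ} {s : Store} {A : Finset Entry} {B : Finset ℝ} {r : Entry}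
    (h : State w Λ s A B) (hr : EntryAt s.heap r) (h18 : s.natReg 18 = r.idx)
    (hidx : ∀ q ∈ A, q.idx ≠ r.idx) (hkey : ∀ q ∈ A, q.key ≠ r.key) (hp : Proper w r)
    (hcard : A.card + 1 < 2 ^ Λ) :
    wp addEntryProg s fun s' t => State w Λ s' (insert r A) B ∧
      s'.natArr 9 = Function.update (s.natArr 9) r.idx (s.natReg 17) ∧
      s'.natArr 10 = Function.update (s.natArr 10) r.idx 0 ∧
      (∀ x < 40, s'.natReg x = s.natReg x) ∧ s'.realReg = s.realReg ∧
      (∀ a, 11 ≤ a → s'.natArr a = s.natArr a) ∧ t ≤ 2100 * (Λ + 1) := by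
  obtain ⟨B₂, B₃, hc, hB⟩ := h
  have hcg := content_congr (A := A) (B₂ := B₂) (B₃ := B₃) (cls := s.natArr 9)
    (cls' := Function.update (s.natArr 9) r.idx (s.natReg 17)) (mach := s.natArr 10)
    (mach' := Function.update (s.natArr 10) r.idx 0) fun q hq =>
      ⟨Function.update_of_ne (hidx q hq) _ _, Function.update_of_ne (hidx q hq) _ _⟩
  have hci := content_insert (A := A) (B₂ := B₂) (B₃ := B₃) (r := r)
    (cls := Function.update (s.natArr 9) r.idx (s.natReg 17))
    (mach := Function.update (s.natArr 10) r.idx 0) (Function.update_self _ _ _)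
  rw [hcg, Function.update_self] at hci
  set C := content A B₂ B₃ (s.natArr 9) (s.natArr 10) with hC
  have hCc : ∀ i, (C i).card < 2 ^ Λ := content_card hc.card hc.card₂ hc.card₃
  unfold addEntryProg
  rw [wp_seq, wp_putNat, wp_seq, wp_putNat, wp_seq, wp_setNat, wp_seq, wp_setNat, wp_seq]
  refine (wp_treeInsert (C := C) (r := r) (i := 0) (Λ := Λ) ?_ ?_ ?_ ?_ hkey (hCc 0)).mono ?_
  · exact hc.trees
  · exact hr
  · simp [h18]
  · simp
  rintro s₁ t₁ ⟨hT₁, hE₁, hF₁, ht₁⟩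
  have hE₁' : s.heap.Ext s₁.heap := hE₁
  have n₁ : ∀ x < 40, s₁.natReg x = s.natReg x := fun x hx => by
    rw [hF₁.nat x (by omega)]
    dsimp only
    rw [Function.update_of_ne (by omega), Function.update_of_ne (by omega)]
  rw [wp_seq, wp_setNat, wp_seq, wp_setNat]
  refine (wp_treeInsert (C := Function.update C 0 (insert r (C 0))) (r := r)
    (i := s.natReg 17 + 4) (Λ := Λ) ?_ ?_ ?_ ?_ ?_ ?_).mono ?_
  · exact hT₁
  · exact hr.ext hE₁'
  · simp [n₁, h18]
  · simp [n₁]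
  · intro q hq
    rw [Function.update_of_ne (by omega)] at hq
    exact hkey q (Finset.mem_filter.1 hq).1
  · rw [Function.update_of_ne (by omega)]
    exact hCc _
  rintro s₂ t₂ ⟨hT₂, hE₂, hF₂, ht₂⟩
  have n₂ : ∀ x < 40, s₂.natReg x = s.natReg x := fun x hx => by
    rw [hF₂.nat x (by omega)]
    dsimp only
    rw [Function.update_of_ne (by omega), Function.update_of_ne (by omega), n₁ x hx]
  have a₂ : ∀ a, 8 ≤ a → s₂.natArr a = Function.update (Function.update s.natArr
      9 (Function.update (s.natArr 9) r.idx (s.natReg 17)))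
      10 (Function.update (s.natArr 10) r.idx 0) a := fun a ha => by
    rw [hF₂.natArr a ha]
    dsimp only
    rw [hF₁.natArr a ha]
    simp [h18]
  have r₂ : s₂.realReg = s.realReg := hF₂.real.trans hF₁.real
  have e9 : s₂.natArr 9 = Function.update (s.natArr 9) r.idx (s.natReg 17) := by
    rw [a₂ 9 (by norm_num), Function.update_of_ne (by norm_num), Function.update_self]
  have e10 : s₂.natArr 10 = Function.update (s.natArr 10) r.idx 0 := by
    rw [a₂ 10 (by norm_num), Function.update_self]
  refine ⟨⟨B₂, B₃, ⟨?_, ?_, hc.neg₂, hc.neg₃, ?_, hc.card₂, hc.card₃, ?_⟩, hB⟩, e9, e10, n₂, r₂,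
    fun a ha => ?_, ?_⟩
  · rw [e9, e10, ← hci]
    rw [Function.update_of_ne (by omega)] at hT₂
    exact hT₂
  · simp only [Finset.mem_insert, forall_eq_or_imp]
    exact ⟨hp, hc.proper⟩
  · exact (Finset.card_insert_le _ _).trans_lt hcard
  · rw [r₂, hc.tot]
    unfold gain Store.mach
    rw [e10, Finset.filter_insert, if_neg (by simp)]
    refine Finset.sum_congr (Finset.filter_congr fun q hq => ?_) fun _ _ => rfl
    rw [Function.update_of_ne (hidx q hq)]
  · rw [a₂ a (by omega), Function.update_of_ne (by omega), Function.update_of_ne (by omega)]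
  · simp
    omega

/-- Remove the entry with the address in the register `18`. -/
def removeEntryProg : Program :=
  .setNat 41 (.reg 18) ;;
  .setNat 40 (.const 0) ;;
  treeDelete ;;
  .setNat 41 (.reg 18) ;;
  .setNat 40 (.add (.get 9 (.reg 18)) (.const 4)) ;;
  treeDelete

theorem wp_removeEntryProg {w : ℝ} {Λ : ℕ} {s : Store} {A : Finset Entry} {B : Finset ℝ} {r : Entry}
    (h : State w Λ s A B) (hr : r ∈ A) (h18 : s.natReg 18 = r.idx) (h0 : s.mach r = 0) :
    wp removeEntryProg s fun s' t => State w Λ s' (A.erase r) B ∧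
      (∀ x < 40, s'.natReg x = s.natReg x) ∧ s'.realReg = s.realReg ∧
      (∀ a, 8 ≤ a → s'.natArr a = s.natArr a) ∧ t ≤ 2100 * (Λ + 1) := by
  obtain ⟨B₂, B₃, hc, hB⟩ := h
  have hce := content_erase (A := A) (B₂ := B₂) (B₃ := B₃) (cls := s.natArr 9)
    (mach := s.natArr 10) (r := r) h0
  set C := content A B₂ B₃ (s.natArr 9) (s.natArr 10) with hC
  have hCc : ∀ i, (C i).card < 2 ^ Λ := content_card hc.card hc.card₂ hc.card₃
  unfold removeEntryProg
  rw [wp_seq, wp_setNat, wp_seq, wp_setNat, wp_seq]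
  refine (wp_treeDelete (C := C) (r := r) (i := 0) (Λ := Λ) ?_ ?_ ?_ hr (hCc 0)).mono ?_
  · exact hc.trees
  · simp [h18]
  · simp
  rintro s₁ t₁ ⟨hT₁, hE₁, hF₁, ht₁⟩
  have n₁ : ∀ x < 40, s₁.natReg x = s.natReg x := fun x hx => by
    rw [hF₁.nat x (by omega)]
    dsimp only
    rw [Function.update_of_ne (by omega), Function.update_of_ne (by omega)]
  rw [wp_seq, wp_setNat, wp_seq, wp_setNat]
  refine (wp_treeDelete (C := Function.update C 0 ((C 0).erase r)) (r := r)
    (i := s.natArr 9 r.idx + 4) (Λ := Λ) ?_ ?_ ?_ ?_ ?_).mono ?_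
  · exact hT₁
  · simp [n₁, h18]
  · simp [n₁, h18, hF₁.natArr]
  · rw [Function.update_of_ne (by omega)]
    simp [hC, content, hr, h0]
  · rw [Function.update_of_ne (by omega)]
    exact hCc _
  rintro s₂ t₂ ⟨hT₂, hE₂, hF₂, ht₂⟩
  have n₂ : ∀ x < 40, s₂.natReg x = s.natReg x := fun x hx => by
    rw [hF₂.nat x (by omega)]
    dsimp only
    rw [Function.update_of_ne (by omega), Function.update_of_ne (by omega), n₁ x hx]
  have a₂ : ∀ a, 8 ≤ a → s₂.natArr a = s.natArr a := fun a ha =>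
    (hF₂.natArr a ha).trans (hF₁.natArr a ha)
  have r₂ : s₂.realReg = s.realReg := hF₂.real.trans hF₁.real
  refine ⟨⟨B₂, B₃, ⟨?_, ?_, hc.neg₂, hc.neg₃, ?_, hc.card₂, hc.card₃, ?_⟩, hB⟩, n₂, r₂, a₂, ?_⟩
  · rw [a₂ 9 (by norm_num), a₂ 10 (by norm_num), ← hce]
    rw [Function.update_of_ne (by omega)] at hT₂
    exact hT₂
  · exact fun q hq => hc.proper q (Finset.mem_of_mem_erase hq)
  · exact (Finset.card_le_card (Finset.erase_subset _ _)).trans_lt hc.card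
  · rw [r₂, hc.tot]
    unfold gain Store.mach
    rw [a₂ 10 (by norm_num), Finset.filter_erase, Finset.erase_eq_of_notMem]
    simp [h0]
  · simp
    omega

/-! ### Updates -/

/-- What holds between the requests: the present entries are `A`, and `B` is the set of borders. -/
structure Maintained (M : ℕ) (w ε : ℝ) (s : Store) (A : Finset Entry) (B : Finset ℝ) : Prop where
  state : ∃ Λ, State w Λ s A B
  sched : Sched M (accuracy ε * M * w) (1 + 1 / accuracy ε) (loss M) A s.mach B
  regM : s.natReg 1 = M
  regw : s.realReg 3 = w
  regε : s.realReg 4 = ε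
  cls : ∀ r ∈ A, InClass (accuracy ε) (s.natArr 9 r.idx) r

theorem loss_le_half {M : ℕ} (hM : 1 ≤ M) : loss M ≤ 1 / 2 := by
  have h := Real.one_sub_div_pow_le_exp_neg (n := M) (t := 1) (by exact_mod_cast hM)
  exact h.trans (Real.exp_neg_one_lt_d9.le.trans (by norm_num))

/-- Schedule the open window again. -/
def rescheduleProg : Program :=
  .setReal 18 (.mul (.mul (.ofNat (.reg 3)) (.ofNat (.reg 1))) (.reg 3)) ;; splitProg

theorem wp_rescheduleProg {M K Λ : ℕ} {w ε : ℝ} {s : Store} {A : Finset Entry} {B : Finset ℝ}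
    (h : State w Λ s A B) (hS : Setup M (accuracy ε) K w s A) (h4 : s.realReg 4 = ε) (hM : 1 ≤ M)
    (hw : 1 ≤ w) (hcard : A.card + 1 < 2 ^ Λ)
    (hsp : Split M (accuracy ε * M * w) (1 + 1 / accuracy ε) (loss M) A s.mach B (s.realReg 6)
      (s.realReg 16) (s.realReg 16))
    (hrich : opt M (win A (s.realReg 6) (s.realReg 16)) ≤ 51 * (accuracy ε * M * w)) :
    wp rescheduleProg s fun s' t => ∃ B', Maintained M w ε s' A B' ∧
      (t : ℝ) ≤ 10 ^ 9 * (K + 1) * (Λ + 1) * (accuracy ε * (accuracy ε * M * w)) + 10 := by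
  unfold rescheduleProg
  rw [wp_seq, wp_setReal]
  have e : (RealExpr.mul (.mul (.ofNat (.reg 3)) (.ofNat (.reg 1))) (.reg 3)).eval s =
      accuracy ε * M * w := by
    simp [hS.regN, hS.regM, hS.regw]
  rw [e]
  refine (wp_splitProg (M := M) (N := accuracy ε) (K := K) (Λ := Λ) (w := w)
    (L := accuracy ε * M * w) (A := A) (B := B)
    (h.setReal (x := 18) (by norm_num) (accuracy ε * M * w)) ?_ hM hw
    (loss_le_half hM) rfl hcard ?_ ?_ ?_ hsp hrich).mono ?_
  · refine ⟨hS.regM, hS.regN, hS.regK, ?_, hS.one_le, hS.table, hS.top, hS.cls⟩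
    exact (Function.update_of_ne (show 3 ≠ 18 by norm_num)
      (accuracy ε * M * w : ℝ) s.realReg).trans hS.regw
  · simp
  · simp
  · simp
  rintro s' t ⟨B', hst, hsch, hF, ht⟩
  refine ⟨B', ⟨⟨Λ, hst⟩, hsch, ?_, ?_, ?_, ?_⟩, ?_⟩
  · exact (hF.nat 1 (by norm_num) (by norm_num) (by norm_num)).trans hS.regM
  · refine (hF.real 3 (by norm_num) (by norm_num)).trans ?_
    exact (Function.update_of_ne (show 3 ≠ 18 by norm_num)
      (accuracy ε * M * w : ℝ) s.realReg).trans hS.regw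
  · refine (hF.real 4 (by norm_num) (by norm_num)).trans ?_
    exact (Function.update_of_ne (show 4 ≠ 18 by norm_num)
      (accuracy ε * M * w : ℝ) s.realReg).trans h4
  · rw [hF.natArr 9 (by norm_num) (by norm_num) (by norm_num)]
    exact hS.cls
  · simp
    linarith

/-- Insert the job in the input registers. -/
def insertProg : Program :=
  setupProg ;;
  classProg ;;
  recordJobProg ;;
  .setNat 18 (.reg 41) ;;
  .setReal 20 (timeExpr (.reg 0)) ;;
  windowProg ;;
  addEntryProg ;;
  rescheduleProg

/-- Delete the job in the input registers. -/
def deleteProg : Program :=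
  setupProg ;;
  recordJobProg ;;
  .setNat 40 (.const 0) ;;
  treeFind ;;
  .setNat 18 (.reg 41) ;;
  .setReal 20 (timeExpr (.reg 0)) ;;
  windowProg ;;
  removeEntryProg ;;
  rescheduleProg

/-- The times of the parts of an update: parameters (`t₁`), class (`t₂`), window (`t₃`), trees
(`t₄`), and new schedule (`t₅`), which dominates. -/
theorem update_time_le {N L : ℝ} {K Λ g t₁ t₂ t₃ t₄ t₅ : ℝ} (hN : 1 ≤ N) (hL : 1 ≤ L) (hK : 0 ≤ K)
    (hΛ : 0 ≤ Λ) (hg : g ≤ 50 * L) (h₁ : t₁ ≤ 50 * (N + K + 1)) (h₂ : t₂ ≤ 30 * (K + 1))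
    (h₃ : t₃ ≤ 10000 * (Λ + 1) * (g + 1)) (h₄ : t₄ ≤ 3100 * (Λ + 1))
    (h₅ : t₅ ≤ 10 ^ 9 * (K + 1) * (Λ + 1) * (N * L) + 10) :
    t₁ + t₂ + t₃ + t₄ + t₅ + 200 ≤ 2 * 10 ^ 9 * ((K + 1) * (Λ + 1) * (N * L)) := by
  have hNL : 1 ≤ N * L := one_le_mul_of_one_le_of_one_le hN hL
  have hKΛ : 1 ≤ (K + 1) * (Λ + 1) := one_le_mul_of_one_le_of_one_le (by linarith) (by linarith)
  set X := (K + 1) * (Λ + 1) * (N * L) with hX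
  have a₁ : N ≤ X := by
    calc N = 1 * (N * 1) := by ring
      _ ≤ (K + 1) * (Λ + 1) * (N * L) := by gcongr
  have a₂ : K + 1 ≤ X := by
    calc K + 1 = (K + 1) * (0 + 1) * 1 := by ring
      _ ≤ (K + 1) * (Λ + 1) * (N * L) := by gcongr
  have a₃ : (Λ + 1) * L ≤ X := by
    calc (Λ + 1) * L = (0 + 1) * (Λ + 1) * (1 * L) := by ring
      _ ≤ (K + 1) * (Λ + 1) * (N * L) := by gcongr
  have a₄ : Λ + 1 ≤ (Λ + 1) * L := le_mul_of_one_le_right (by linarith) hL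
  have a₅ : (Λ + 1) * (g + 1) ≤ (Λ + 1) * (51 * L) := by
    gcongr
    linarith
  linarith

section Updates

variable {M Λ : ℕ} {w ε : ℝ} {s : Store} {A : Finset Entry} {B : Finset ℝ} {j : Job}

theorem Maintained.proper (h : Maintained M w ε s A B) : ∀ r ∈ A, Proper w r := by
  obtain ⟨_, _, _, hc, _⟩ := h.state
  exact hc.proper

theorem le_base {N M : ℕ} {w : ℝ} (hN : 1 ≤ N) (hM : 1 ≤ M) (hw : 1 ≤ w) :
    M * w ≤ N * M * w ∧ w ≤ N * M * w ∧ 1 ≤ N * M * w := by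
  have hN' : (1 : ℝ) ≤ N := by exact_mod_cast hN
  have hM' : (1 : ℝ) ≤ M := by exact_mod_cast hM
  have h₁ : w ≤ M * w := le_mul_of_one_le_left (by linarith) hM'
  have h₂ : M * w ≤ N * (M * w) := le_mul_of_one_le_left (by linarith) hN'
  rw [mul_assoc]
  exact ⟨h₂, h₁.trans h₂, by linarith⟩

theorem Maintained.state_of_card (h : Maintained M w ε s A B) (hM : 1 ≤ M) (hw : 1 ≤ w)
    (hε : 0 < ε) (hcard : A.card < 2 ^ Λ) : State w Λ s A B := by
  obtain ⟨_, hst⟩ := h.state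
  exact hst.resize hcard (h.sched.card_le h.proper (le_base (one_le_accuracy hε) hM hw).2.1
    (by linarith))

/-- The new entry gets an address that has never been used; addresses of deleted entries are not
reused. -/
theorem wp_insertProg (h : Maintained M w ε s A B) (hin : s.HasInput j) (hj : j.Valid w)
    (hM : 1 ≤ M) (hw : 1 ≤ w) (hε : 0 < ε) (hnew : ∀ i, ∀ q ∈ A, q.key ≠ (jobEntry i j).key)
    (hcard : A.card + 2 < 2 ^ Λ) :
    wp insertProg s fun s' t => ∃ (i K : ℕ) (B' : Finset ℝ),
      Maintained M w ε s' (insert (jobEntry i j) A) B' ∧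
      (K : ℝ) * Real.log 2 ≤ accuracy ε * (Real.log w + Real.log 2) ∧
      (t : ℝ) ≤ 2 * 10 ^ 9 * ((K + 1) * (Λ + 1) * (accuracy ε * (accuracy ε * M * w))) := by
  have hN := one_le_accuracy hε
  obtain ⟨hML, hwL, h1L⟩ := le_base hN hM hw
  have hst := h.state_of_card (Λ := Λ) hM hw hε (by omega)
  unfold insertProg
  rw [wp_seq]
  refine (wp_setupProg h.regw h.regε hε).mono ?_
  rintro s₁ t₁ ⟨K, hN₁, hK₁, hcv, htop, hKle, hF₁, ht₁⟩
  have hs₁ : State w Λ s₁ A B := hst.congr hF₁.heap (hF₁.natArr 9 (by norm_num))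
    (hF₁.natArr 10 (by norm_num)) (by rw [hF₁.real])
  rw [wp_seq]
  refine (wp_classProg hN₁ hN hcv htop (by rw [hF₁.real, hin.weight]) hj.2.2.1 hj.2.2.2).mono ?_
  rintro s₂ t₂ ⟨k, rfl, hk₁, hk₂, ht₂⟩
  rw [wp_seq]
  refine (wp_recordJobProg (j := j) ?_).mono ?_
  · refine ⟨?_, ?_, ?_, ?_⟩
    · change Function.update s₁.natReg 17 k 0 = _
      rw [Function.update_of_ne (by norm_num), hF₁.nat 0 (by norm_num) (by norm_num) (by norm_num)
        (by norm_num) (by norm_num), hin.id]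
    · exact (congrFun hF₁.real 0).trans hin.start
    · exact (congrFun hF₁.real 1).trans hin.length
    · exact (congrFun hF₁.real 2).trans hin.weight
  -- the new entry; its address is the number of entries recorded so far, plus one
  generalize hr : jobEntry _ j = r
  rintro s₃ t₃ ⟨hR, ht₃⟩
  have hri : r.idx = s₁.natReg 2 + 1 := by
    rw [← hr]
    simp [jobEntry]
  have hrp : Proper w r := hr ▸ hj.proper _
  have hrs : r.s = -1 / (1 + j.start) := by
    rw [← hr]
    rfl
  have hs₂ : State w Λ { s₁ with natReg := Function.update s₁.natReg 17 k } A B :=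
    hs₁.congr (by simp) rfl rfl rfl
  have hs₃ : State w Λ s₃ A B := hs₂.of_ext hR.ext hR.root (hR.natArr 9 le_rfl)
    (hR.natArr 10 (by norm_num)) (by rw [hR.real])
  -- the address is beyond those of all present entries
  have hidx : ∀ q ∈ A, q.idx ≠ r.idx := by
    intro q hq
    obtain ⟨_, _, hc, _⟩ := hs₁
    have := (hc.entryAt hq).le
    simp only [Store.heap] at this
    omega
  have n₃ : ∀ x < 17, x ≠ 2 → s₃.natReg x = s₁.natReg x := fun x hx h2 => by
    rw [hR.nat x (by omega) h2]
    dsimp only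
    rw [Function.update_of_ne (by omega)]
  have k₃ : s₃.natReg 17 = k := by
    rw [hR.nat 17 (by norm_num) (by norm_num)]
    simp
  have r₃ : s₃.realReg = s.realReg := hR.real.trans hF₁.real
  have a₃ : ∀ a, 9 ≤ a → a ≠ 11 → s₃.natArr a = s.natArr a := fun a ha h11 =>
    (hR.natArr a ha).trans (hF₁.natArr a h11)
  have c₃ : s₃.natArr 11 = s₁.natArr 11 := hR.natArr 11 (by norm_num)
  have hm₃ : s₃.mach = s.mach := by
    funext q
    unfold Store.mach
    rw [a₃ 10 (by norm_num) (by norm_num)]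
  rw [wp_seq, wp_setNat, wp_seq, wp_setReal, wp_seq]
  refine (wp_windowProg (M := M) (Λ := Λ) (w := w) (x := r.s) (A := A) (B := B)
    ?_ ?_ (by linarith) ?_ hrp.neg_one_le (hrp.lt.trans hrp.neg)).mono ?_
  · exact hs₃.congr (by simp) rfl rfl (by simp)
  · change Feasible M A s₃.mach
    rw [hm₃]
    exact h.sched.feas
  · simp [timeExpr, hrs, r₃, hin.start]
  rintro s₄ t₄ ⟨a, b, y, z, hAr, h6, h16, hs₄, hm₄, hF₄, ht₄⟩
  have hg : gain (win A y z) s.mach ≤ 50 * (accuracy ε * M * w) :=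
    (le_opt (fun r hr => h.proper r (win_subset _ _ _ hr))
      (h.sched.feas.mono (win_subset _ _ _))).trans
      (h.sched.opt_window_le h.proper (by linarith) hML hAr (hrp.lt.trans hrp.neg))
  have n₄ : ∀ x < 5, x ≠ 2 → s₄.natReg x = s₁.natReg x := fun x hx h2 => by
    rw [hF₄.nat x (by omega) h2 (by omega)]
    dsimp only
    rw [Function.update_of_ne (by omega), n₃ x (by omega) h2]
  have e17 : s₄.natReg 17 = k := by
    rw [hF₄.nat 17 (by norm_num) (by norm_num) (by norm_num)]
    simp [k₃]
  have e18 : s₄.natReg 18 = r.idx := by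
    rw [hF₄.nat 18 (by norm_num) (by norm_num) (by norm_num)]
    simp [hR.reg]
  have r₄ : ∀ x < 5, s₄.realReg x = s.realReg x := fun x hx => by
    rw [hF₄.real x (by omega) (by omega)]
    dsimp only
    rw [Function.update_of_ne (by omega), r₃]
  have e9 : s₄.natArr 9 = s.natArr 9 := by
    rw [hF₄.natArr 9 (by norm_num) (by norm_num) (by norm_num)]
    exact a₃ 9 (by norm_num) (by norm_num)
  have e11 : s₄.natArr 11 = s₁.natArr 11 := by
    rw [hF₄.natArr 11 (by norm_num) (by norm_num) (by norm_num)]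
    exact c₃
  rw [wp_seq]
  refine (wp_addEntryProg hs₄ (r := r) ?_ e18 hidx ?_ hrp (by omega)).mono ?_
  · exact hR.entryAt.ext hF₄.ext
  · rw [← hr]
    exact hnew _
  rintro s₅ t₅ ⟨hs₅, f9, f10, n₅, r₅, a₅, ht₅⟩
  rw [e17, e9] at f9
  have hS : Setup M (accuracy ε) K w s₅ (insert r A) := by
    refine ⟨?_, ?_, ?_, ?_, hN, ?_, htop, ?_⟩
    · rw [n₅ 1 (by norm_num), n₄ 1 (by norm_num) (by norm_num), hF₁.nat 1 (by norm_num)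
        (by norm_num) (by norm_num) (by norm_num) (by norm_num), h.regM]
    · rw [n₅ 3 (by norm_num), n₄ 3 (by norm_num) (by norm_num), hN₁]
    · rw [n₅ 4 (by norm_num), n₄ 4 (by norm_num) (by norm_num), hK₁]
    · rw [r₅, r₄ 3 (by norm_num), h.regw]
    · rw [a₅ 11 (by norm_num), e11]
      exact fun i hi => hcv i hi.le
    · intro q hq
      rw [f9]
      rcases Finset.mem_insert.1 hq with rfl | hq
      · rw [Function.update_self]
        have : q.wt = j.weight := by
          rw [← hr]
          rfl
        rw [InClass, this]
        exact ⟨hk₁, hk₂⟩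
      · rw [Function.update_of_ne (hidx q hq)]
        exact h.cls q hq
  have hpA : ∀ q ∈ insert r A, Proper w q := by
    simp only [Finset.mem_insert, forall_eq_or_imp]
    exact ⟨hrp, h.proper⟩
  have hf₅ : ∀ q ∈ insert r A, s₅.mach q = if q = r ∨ q ∈ win A y z then 0 else s.mach q := by
    intro q hq
    unfold Store.mach
    rw [f10]
    by_cases hqr : q = r
    · simp [hqr]
    · have hqA := Finset.mem_of_mem_insert_of_ne hq hqr
      rw [Function.update_of_ne (hidx q hqA)]
      refine (hm₄ q hqA).trans ?_
      simp only [hqr, false_or]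
      exact congrArg _ (congrFun hm₃ q)
  obtain ⟨hsp, hrich⟩ := h.sched.split (A' := insert r A) h.proper hpA hrp (by linarith) hML hwL
    subset_rfl ((Finset.subset_insert _ _).trans (Finset.subset_insert _ _)) hAr hf₅
  rw [← h6, ← h16, ← r₅] at hsp hrich
  refine (wp_rescheduleProg hs₅ hS (by rw [r₅, r₄ 4 (by norm_num), h.regε]) hM hw ?_
    hsp hrich).mono ?_
  · have := Finset.card_insert_le r A
    omega
  rintro s₆ t₆ ⟨B', hI, ht₆⟩
  refine ⟨s₁.natReg 2 + 1, K, B', ?_, classes_mul_log_le hN hw hKle, ?_⟩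
  · have : jobEntry (s₁.natReg 2 + 1) j = r := by
      rw [← hr]
      simp
    rw [this]
    exact hI
  · refine le_trans ?_ (update_time_le (t₁ := t₁) (t₂ := t₂) (t₃ := t₄) (t₄ := t₅) (t₅ := t₆)
      (g := gain (win A y z) s.mach) (by exact_mod_cast hN) h1L
      (Nat.cast_nonneg K) (Nat.cast_nonneg Λ) hg ?_ ?_ ?_ ?_ ht₆)
    · have : (t₃ : ℝ) ≤ 60 := by exact_mod_cast ht₃
      simp [timeExpr]
      linarith
    · exact_mod_cast ht₁
    · exact_mod_cast ht₂
    · refine ht₄.trans_eq ?_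
      congr 3
    · have : (t₅ : ℝ) ≤ 2100 * (Λ + 1) := by exact_mod_cast ht₅
      linarith [(Nat.cast_nonneg Λ : (0 : ℝ) ≤ Λ)]

end Updates

section Deletions

variable {M Λ : ℕ} {w ε : ℝ} {s : Store} {A : Finset Entry} {B : Finset ℝ} {j : Job}

/-- The job is recorded as an entry for the sake of the search only, which finds the entry that was
recorded at its insertion. -/
theorem wp_deleteProg (h : Maintained M w ε s A B) (hin : s.HasInput j)
    (hM : 1 ≤ M) (hw : 1 ≤ w) (hε : 0 < ε) {i : ℕ} (hj : jobEntry i j ∈ A)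
    (hcard : A.card + 2 < 2 ^ Λ) :
    wp deleteProg s fun s' t => ∃ (K : ℕ) (B' : Finset ℝ),
      Maintained M w ε s' (A.erase (jobEntry i j)) B' ∧
      (K : ℝ) * Real.log 2 ≤ accuracy ε * (Real.log w + Real.log 2) ∧
      (t : ℝ) ≤ 2 * 10 ^ 9 * ((K + 1) * (Λ + 1) * (accuracy ε * (accuracy ε * M * w))) := by
  have hN := one_le_accuracy hε
  obtain ⟨hML, hwL, h1L⟩ := le_base hN hM hw
  have hst := h.state_of_card (Λ := Λ) hM hw hε (by omega)
  have hrp := h.proper _ hj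
  have hrs : (jobEntry i j).s = -1 / (1 + j.start) := rfl
  have hkey : ∀ i', (jobEntry i' j).key = (jobEntry i j).key := fun i' => rfl
  generalize jobEntry i j = r at hj hrp hrs hkey
  unfold deleteProg
  rw [wp_seq]
  refine (wp_setupProg h.regw h.regε hε).mono ?_
  rintro s₁ t₁ ⟨K, hN₁, hK₁, hcv, htop, hKle, hF₁, ht₁⟩
  have hs₁ : State w Λ s₁ A B := hst.congr hF₁.heap (hF₁.natArr 9 (by norm_num))
    (hF₁.natArr 10 (by norm_num)) (by rw [hF₁.real])
  rw [wp_seq]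
  refine (wp_recordJobProg (j := j) ?_).mono ?_
  · refine ⟨?_, ?_, ?_, ?_⟩
    · rw [hF₁.nat 0 (by norm_num) (by norm_num) (by norm_num) (by norm_num) (by norm_num), hin.id]
    · exact (congrFun hF₁.real 0).trans hin.start
    · exact (congrFun hF₁.real 1).trans hin.length
    · exact (congrFun hF₁.real 2).trans hin.weight
  rintro s₂ t₂ ⟨hR, ht₂⟩
  have hs₂ : State w Λ s₂ A B := hs₁.of_ext hR.ext hR.root (hR.natArr 9 le_rfl)
    (hR.natArr 10 (by norm_num)) (by rw [hR.real])
  rw [wp_seq, wp_setNat, wp_seq]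
  have hs₂' : State w Λ { s₂ with natReg := Function.update s₂.natReg 40 0 } A B :=
    hs₂.congr (by simp) rfl rfl rfl
  obtain ⟨B₂, B₃, hc₂, hB₂⟩ := hs₂'
  refine (wp_treeFind (C := content A B₂ B₃ (s₂.natArr 9) (s₂.natArr 10))
    (r := jobEntry (s₁.natReg 2 + 1) j) (i := 0) (Λ := Λ) ?_ ?_ ?_ ?_ ?_).mono ?_
  · exact hc₂.trees
  · exact hR.entryAt
  · simp [hR.reg]
  · simp
  · exact hc₂.card
  rintro s₃ t₃ ⟨hfind, hh₃, hF₃, ht₃⟩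
  have e41 : s₃.natReg 41 = r.idx := by
    rcases hfind with ⟨-, hno⟩ | ⟨q, hq, hqk, hqi⟩
    · exact absurd (hkey _).symm (hno r hj)
    · rw [hqi, hc₂.eq_of_key hq hj (hqk.trans (hkey _))]
  have n₃ : ∀ x < 40, x ≠ 2 → s₃.natReg x = s₁.natReg x := fun x hx h2 => by
    rw [hF₃.nat x (by omega)]
    dsimp only
    rw [Function.update_of_ne (by omega), hR.nat x (by omega) h2]
  have r₃ : s₃.realReg = s.realReg := hF₃.real.trans (hR.real.trans hF₁.real)
  have a₃ : ∀ a, 9 ≤ a → s₃.natArr a = s₁.natArr a := fun a ha =>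
    (hF₃.natArr a (by omega)).trans (hR.natArr a ha)
  have e10 : s₃.natArr 10 = s.natArr 10 := (a₃ 10 (by norm_num)).trans (hF₁.natArr 10 (by norm_num))
  have hs₃ : State w Λ s₃ A B := by
    have := (hs₂.congr (s' := { s₂ with natReg := Function.update s₂.natReg 40 0 }) (by simp)
      rfl rfl rfl)
    exact this.congr hh₃ (hF₃.natArr 9 (by norm_num)) (hF₃.natArr 10 (by norm_num))
      (by rw [hF₃.real])
  have hm₃ : s₃.mach = s.mach := by
    funext q
    unfold Store.mach
    rw [e10]
  rw [wp_seq, wp_setNat, wp_seq, wp_setReal, wp_seq]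
  refine (wp_windowProg (M := M) (Λ := Λ) (w := w) (x := r.s) (A := A) (B := B)
    ?_ ?_ (by linarith) ?_ hrp.neg_one_le (hrp.lt.trans hrp.neg)).mono ?_
  · exact hs₃.congr (by simp) rfl rfl (by simp)
  · change Feasible M A s₃.mach
    rw [hm₃]
    exact h.sched.feas
  · simp [timeExpr, hrs, r₃, hin.start]
  rintro s₄ t₄ ⟨a, b, y, z, hAr, h6, h16, hs₄, hm₄, hF₄, ht₄⟩
  replace hm₄ : ∀ q ∈ A, s₄.mach q = if q ∈ win A y z then 0 else s.mach q := by
    intro q hq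
    rw [hm₄ q hq, ← hm₃]
  have hg : gain (win A y z) s.mach ≤ 50 * (accuracy ε * M * w) :=
    (le_opt (fun r hr => h.proper r (win_subset _ _ _ hr))
      (h.sched.feas.mono (win_subset _ _ _))).trans
      (h.sched.opt_window_le h.proper (by linarith) hML hAr (hrp.lt.trans hrp.neg))
  have n₄ : ∀ x < 5, x ≠ 2 → s₄.natReg x = s₁.natReg x := fun x hx h2 => by
    rw [hF₄.nat x (by omega) h2 (by omega)]
    dsimp only
    rw [Function.update_of_ne (by omega), n₃ x (by omega) h2]
  have e18 : s₄.natReg 18 = r.idx := by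
    rw [hF₄.nat 18 (by norm_num) (by norm_num) (by norm_num)]
    simp [e41]
  have r₄ : ∀ x < 5, s₄.realReg x = s.realReg x := fun x hx => by
    rw [hF₄.real x (by omega) (by omega)]
    dsimp only
    rw [Function.update_of_ne (by omega), r₃]
  have e9 : s₄.natArr 9 = s.natArr 9 := by
    rw [hF₄.natArr 9 (by norm_num) (by norm_num) (by norm_num)]
    exact (a₃ 9 le_rfl).trans (hF₁.natArr 9 (by norm_num))
  have e11 : s₄.natArr 11 = s₁.natArr 11 := by
    rw [hF₄.natArr 11 (by norm_num) (by norm_num) (by norm_num)]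
    exact a₃ 11 (by norm_num)
  -- A processed job that starts at the time of the update ends before the next border.
  have h0 : s₄.mach r = 0 := by
    rw [hm₄ r hj]
    split_ifs with hwin
    · rfl
    by_contra hne
    refine hwin (mem_win.2 ⟨hj, hAr.y_le, ?_⟩)
    rcases Finset.mem_insert.1 hAr.mem_z with hz | hz
    · rw [hz]
      exact hrp.neg.le
    · refine (h.sched.noCross r hj hne z
        (Finset.mem_of_mem_erase (Finset.mem_of_mem_erase hz))).resolve_right ?_
      exact not_le.2 (hAr.lt_z (hrp.lt.trans hrp.neg))
  rw [wp_seq]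
  refine (wp_removeEntryProg hs₄ hj e18 h0).mono ?_
  rintro s₅ t₅ ⟨hs₅, n₅, r₅, a₅, ht₅⟩
  have hS : Setup M (accuracy ε) K w s₅ (A.erase r) := by
    refine ⟨?_, ?_, ?_, ?_, hN, ?_, htop, ?_⟩
    · rw [n₅ 1 (by norm_num), n₄ 1 (by norm_num) (by norm_num), hF₁.nat 1 (by norm_num)
        (by norm_num) (by norm_num) (by norm_num) (by norm_num), h.regM]
    · rw [n₅ 3 (by norm_num), n₄ 3 (by norm_num) (by norm_num), hN₁]
    · rw [n₅ 4 (by norm_num), n₄ 4 (by norm_num) (by norm_num), hK₁]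
    · rw [r₅, r₄ 3 (by norm_num), h.regw]
    · rw [a₅ 11 (by norm_num), e11]
      exact fun i hi => hcv i hi.le
    · rw [a₅ 9 (by norm_num), e9]
      exact fun q hq => h.cls q (Finset.mem_of_mem_erase hq)
  have hpA : ∀ q ∈ A.erase r, Proper w q := fun q hq => h.proper q (Finset.mem_of_mem_erase hq)
  have hf₅ : ∀ q ∈ A.erase r, s₅.mach q = if q = r ∨ q ∈ win A y z then 0 else s.mach q := by
    intro q hq
    obtain ⟨hqr, hqA⟩ := Finset.mem_erase.1 hq
    unfold Store.mach
    rw [a₅ 10 (by norm_num)]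
    refine (hm₄ q hqA).trans ?_
    simp only [hqr, false_or]
  obtain ⟨hsp, hrich⟩ := h.sched.split (A' := A.erase r) h.proper hpA hrp (by linarith) hML hwL
    ((Finset.erase_subset _ _).trans (Finset.subset_insert _ _))
    (by rw [Finset.insert_erase hj]) hAr hf₅
  rw [← h6, ← h16, ← r₅] at hsp hrich
  refine (wp_rescheduleProg hs₅ hS (by rw [r₅, r₄ 4 (by norm_num), h.regε]) hM hw ?_
    hsp hrich).mono ?_
  · have := Finset.card_erase_le (s := A) (a := r)
    omega
  rintro s₆ t₆ ⟨B', hI, ht₆⟩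
  refine ⟨K, B', hI, classes_mul_log_le hN hw hKle, ?_⟩
  refine le_trans ?_ (update_time_le (t₁ := t₁) (t₂ := 0) (t₃ := t₄) (t₄ := t₃ + t₅) (t₅ := t₆)
    (g := gain (win A y z) s.mach) (by exact_mod_cast hN) h1L
    (Nat.cast_nonneg K) (Nat.cast_nonneg Λ) hg ?_ ?_ ?_ ?_ ht₆)
  · have : (t₂ : ℝ) ≤ 60 := by exact_mod_cast ht₂
    simp [timeExpr]
    linarith
  · exact_mod_cast ht₁
  · positivity
  · refine ht₄.trans_eq ?_
    congr 3
  · have h₁ : (t₅ : ℝ) ≤ 2100 * (Λ + 1) := by exact_mod_cast ht₅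
    have h₂ : (t₃ : ℝ) ≤ 1000 * (Λ + 1) := by exact_mod_cast ht₃
    linarith

end Deletions

/-! ### Queries -/

/-- Look up the job in the input registers. Data that cannot belong to a valid job
are rejected, since for them the key need not determine the job. -/
def lookupProg : Program :=
  .ite (.conj (.neg (.realLt (.reg 0) (.ofNat (.const 0))))
      (.neg (.realLt (.reg 1) (.ofNat (.const 1)))))
    (recordJobProg ;;
      .setNat 40 (.const 0) ;;
      treeFind ;;
      .ite (.natEq (.reg 41) (.const 0)) (.setNat 0 (.const 0)) (.setNat 0 (.get 10 (.reg 41))))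
    (.setNat 0 (.const 0))

/-- Report the total reward. -/
def totalProg : Program := .setReal 0 (.reg 5)

section Queries

variable {M Λ : ℕ} {w ε : ℝ} {s : Store} {A : Finset Entry} {B : Finset ℝ} {j : Job}

theorem Maintained.of_ext {s' : Store} (h : Maintained M w ε s A B) (hE : s.heap.Ext s'.heap)
    (h1 : s'.natReg 1 = s.natReg 1) (h3 : s'.realReg 3 = s.realReg 3)
    (h4 : s'.realReg 4 = s.realReg 4) (h5 : s'.realReg 5 = s.realReg 5)
    (h7 : s'.natArr 7 = s.natArr 7) (h9 : s'.natArr 9 = s.natArr 9)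
    (h10 : s'.natArr 10 = s.natArr 10) : Maintained M w ε s' A B := by
  obtain ⟨Λ, hst⟩ := h.state
  have hm : s'.mach = s.mach := by
    funext q
    unfold Store.mach
    rw [h10]
  exact ⟨⟨Λ, hst.of_ext hE h7 h9 h10 h5⟩, hm ▸ h.sched, h1.trans h.regM, h3.trans h.regw,
    h4.trans h.regε, h9 ▸ h.cls⟩

theorem wp_lookupProg (h : Maintained M w ε s A B) (hin : s.HasInput j) (hM : 1 ≤ M) (hw : 1 ≤ w)
    (hε : 0 < ε) (hcard : A.card < 2 ^ Λ) :
    wp lookupProg s fun s' t => Maintained M w ε s' A B ∧ s'.natArr 10 = s.natArr 10 ∧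
      (s'.natReg 0 = 0 ∧ ¬ (0 ≤ j.start ∧ 1 ≤ j.length ∧ ∃ q ∈ A, q.key = (jobEntry 0 j).key) ∨
        ∃ q ∈ A, q.key = (jobEntry 0 j).key ∧ 0 ≤ j.start ∧ 1 ≤ j.length ∧
          s'.natReg 0 = s.mach q) ∧ t ≤ 1100 * (Λ + 1) := by
  unfold lookupProg
  rw [wp_ite]
  simp only [Test.Holds, RealExpr.eval, NatExpr.eval, hin.start, hin.length, Nat.cast_zero,
    Nat.cast_one, not_lt]
  refine ⟨fun hcond => ?_, fun hcond => ?_⟩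
  · rw [wp_seq]
    refine (wp_recordJobProg hin).mono ?_
    rintro s₁ t₁ ⟨hR, ht₁⟩
    have h₁ := h.of_ext hR.ext (hR.nat 1 (by norm_num) (by norm_num)) (by rw [hR.real])
      (by rw [hR.real]) (by rw [hR.real]) hR.root (hR.natArr 9 le_rfl) (hR.natArr 10 (by norm_num))
    obtain ⟨B₂, B₃, hc, hB⟩ := h₁.state_of_card (Λ := Λ) hM hw hε hcard
    rw [wp_seq, wp_setNat, wp_seq]
    refine (wp_treeFind (C := content A B₂ B₃ (s₁.natArr 9) (s₁.natArr 10))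
      (r := jobEntry (s.natReg 2 + 1) j) (i := 0) (Λ := Λ) ?_ ?_ ?_ ?_ ?_).mono ?_
    · exact hc.trees
    · exact hR.entryAt
    · simp [hR.reg]
    · simp
    · exact hc.card
    rintro s₂ t₂ ⟨hfind, hh₂, hF₂, ht₂⟩
    have h₂ : ∀ v, Maintained M w ε { s₂ with natReg := Function.update s₂.natReg 0 v } A B := by
      intro v
      have hE : s₁.heap.Ext s₂.heap := by
        have : s₂.heap = s₁.heap := hh₂
        rw [this]
        exact .refl _
      refine h₁.of_ext hE ?_ ?_ ?_ ?_ ?_ ?_ ?_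
      · dsimp only
        rw [Function.update_of_ne (by norm_num), hF₂.nat 1 (by norm_num)]
        rfl
      · exact congrFun hF₂.real 3
      · exact congrFun hF₂.real 4
      · exact congrFun hF₂.real 5
      · exact congrArg Heap.root hh₂
      · exact hF₂.natArr 9 (by norm_num)
      · exact hF₂.natArr 10 (by norm_num)
    have e10 : s₂.natArr 10 = s.natArr 10 :=
      (hF₂.natArr 10 (by norm_num)).trans (hR.natArr 10 (by norm_num))
    have hk : (jobEntry (s.natReg 2 + 1) j).key = (jobEntry 0 j).key := rfl
    rw [hk] at hfind
    rw [wp_ite, wp_setNat, wp_setNat]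
    refine ⟨fun h41 => ⟨h₂ _, e10, .inl ⟨by simp, ?_⟩, ?_⟩,
      fun h41 => ⟨h₂ _, e10, .inr ?_, ?_⟩⟩
    · rintro ⟨-, -, q, hq, hqk⟩
      rcases hfind with ⟨-, hno⟩ | ⟨q', hq', -, hi⟩
      · exact hno q hq hqk
      · simp only [Test.Holds, NatExpr.eval] at h41
        have := (hc.entryAt hq').pos
        omega
    · simp
      omega
    · rcases hfind with ⟨h0, -⟩ | ⟨q, hq, hqk, hi⟩
      · exact absurd h0 h41
      · refine ⟨q, hq, hqk, hcond.1, hcond.2, ?_⟩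
        simp [hi, e10]
    · simp
      omega
  · rw [wp_setNat]
    refine ⟨h.of_ext ?_ ?_ rfl rfl rfl rfl rfl rfl, rfl, .inl ⟨by simp, fun hcon => ?_⟩, ?_⟩
    · exact .refl _
    · simp
    · exact hcond ⟨hcon.1, hcon.2.1⟩
    · simp
      omega

theorem wp_totalProg (h : Maintained M w ε s A B) :
    wp totalProg s fun s' t => Maintained M w ε s' A B ∧ s'.natArr 10 = s.natArr 10 ∧
      s'.realReg 0 = gain A s.mach ∧ t ≤ 2 := by
  unfold totalProg
  rw [wp_setReal]
  obtain ⟨Λ, B₂, B₃, hc, hB⟩ := h.state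
  refine ⟨h.of_ext ?_ rfl ?_ ?_ ?_ rfl rfl rfl, rfl, ?_, ?_⟩
  · exact .refl _
  · simp
  · simp
  · simp
  · simp [hc.tot]
  · simp

end Queries

/-! ### From entries to jobs -/

section Jobs

variable {M : ℕ} {w ε : ℝ} {s : Store} {J : Finset Job} {B : Finset ℝ} {addr : Job → ℕ}

/-- The entries of the jobs in `J`, when `addr j` is the address of the entry of the job `j`. -/
noncomputable def entries (addr : Job → ℕ) (J : Finset Job) : Finset Entry :=
  J.image fun j => jobEntry (addr j) j

theorem mem_entries {r : Entry} :
    r ∈ entries addr J ↔ ∃ j ∈ J, jobEntry (addr j) j = r := Finset.mem_image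

theorem jobEntry_injOn (hJ : ∀ j ∈ J, j.Valid w) (addr : Job → ℕ) :
    Set.InjOn (fun j => jobEntry (addr j) j) (J : Set Job) := fun j hj k hk he =>
  (jobEntry_key_eq (hJ j hj).1 (hJ j hj).2.1 (hJ k hk).1 (hJ k hk).2.1).1 (congrArg Entry.key he)

theorem entries_card (hJ : ∀ j ∈ J, j.Valid w) : (entries addr J).card = J.card :=
  Finset.card_image_of_injOn (jobEntry_injOn hJ addr)

theorem sum_entries (hJ : ∀ j ∈ J, j.Valid w) (x : Entry → ℝ) :
    ∑ r ∈ entries addr J, x r = ∑ j ∈ J, x (jobEntry (addr j) j) :=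
  Finset.sum_image (jobEntry_injOn hJ addr)

theorem entries_proper (hJ : ∀ j ∈ J, j.Valid w) : ∀ r ∈ entries addr J, Proper w r := by
  intro r hr
  obtain ⟨j, hj, rfl⟩ := mem_entries.1 hr
  exact (hJ j hj).proper _

open Classical in
theorem entries_insert {j : Job} (hj : j ∉ J) (i : ℕ) :
    entries (Function.update addr j i) (insert j J) = insert (jobEntry i j) (entries addr J) := by
  unfold entries
  rw [Finset.image_insert, Function.update_self]
  congr 1
  refine Finset.image_congr fun k hk => ?_
  have : k ≠ j := fun he => hj (he ▸ hk)
  simp only [Function.update_of_ne this]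

open Classical in
theorem entries_erase (hJ : ∀ j ∈ J, j.Valid w) {j : Job} (hj : j ∈ J) :
    entries addr (J.erase j) = (entries addr J).erase (jobEntry (addr j) j) := by
  ext r
  simp only [mem_entries, Finset.mem_erase]
  constructor
  · rintro ⟨k, ⟨hkj, hk⟩, rfl⟩
    exact ⟨fun he => hkj (jobEntry_injOn hJ addr hk hj he), k, hk, rfl⟩
  · rintro ⟨hne, k, hk, rfl⟩
    exact ⟨k, ⟨fun he => hne (by rw [he]), hk⟩, rfl⟩

/-- Entries overlap if and only if the half-open intervals of their jobs intersect. -/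
theorem not_apart_iff {j k : Job} (hj : j.Valid w) (hk : k.Valid w) (i i' : ℕ) :
    ¬ Apart (jobEntry i j) (jobEntry i' k) ↔
      ∃ t, t ∈ Set.Ico j.start (j.start + j.length) ∧ t ∈ Set.Ico k.start (k.start + k.length) := by
  obtain ⟨hj₁, hj₂, -⟩ := hj
  obtain ⟨hk₁, hk₂, -⟩ := hk
  unfold Apart jobEntry
  dsimp only
  rw [inner_time_le_iff (by linarith) hk₁, inner_time_le_iff (by linarith) hj₁]
  push Not
  constructor
  · rintro ⟨h₁, h₂⟩
    exact ⟨max j.start k.start, ⟨le_max_left _ _, max_lt (by linarith) h₁⟩,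
      le_max_right _ _, max_lt h₂ (by linarith)⟩
  · rintro ⟨t, ⟨h₁, h₂⟩, h₃, h₄⟩
    constructor <;> linarith

open Classical in
/-- The schedule that an array represents: the number of the machine that processes an entry is
stored at its address, counted from `1`, and `0` stands for no machine. -/
noncomputable def scheduleOf (M : ℕ) (J : Finset Job) (mach : ℕ → ℕ) (addr : Job → ℕ) (j : Job) :
    Option (Fin M) :=
  if h : j ∈ J ∧ mach (addr j) - 1 < M ∧ mach (addr j) ≠ 0 then
    some ⟨mach (addr j) - 1, h.2.1⟩ else none

theorem scheduleOf_eq_some {mach : ℕ → ℕ} {j : Job} {m : Fin M} :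
    scheduleOf M J mach addr j = some m ↔ j ∈ J ∧ mach (addr j) = m + 1 := by
  unfold scheduleOf
  split_ifs with h
  · rw [Option.some_inj, Fin.ext_iff]
    dsimp only
    constructor
    · intro he
      exact ⟨h.1, by omega⟩
    · intro he
      omega
  · simp only [reduceCtorEq, false_iff]
    rintro ⟨hj, he⟩
    exact h ⟨hj, by omega, by omega⟩

theorem scheduleOf_isSome (hf : Feasible M (entries addr J) s.mach) {j : Job} (hj : j ∈ J) :
    (scheduleOf M J (s.natArr 10) addr j).isSome ↔ s.natArr 10 (addr j) ≠ 0 := by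
  have h₁ : s.natArr 10 (addr j) ≤ M := (hf _ (mem_entries.2 ⟨j, hj, rfl⟩)).1
  rw [Option.isSome_iff_exists]
  simp only [scheduleOf_eq_some]
  constructor
  · rintro ⟨m, -, h⟩
    omega
  · intro h
    exact ⟨⟨s.natArr 10 (addr j) - 1, by omega⟩, hj, by dsimp only; omega⟩

theorem isSchedule_scheduleOf (hJ : ∀ j ∈ J, j.Valid w)
    (hf : Feasible M (entries addr J) s.mach) :
    IsSchedule J (scheduleOf M J (s.natArr 10) addr) := by
  refine ⟨fun j hj => ?_, fun m t => ?_⟩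
  · obtain ⟨m, hm⟩ := Option.ne_none_iff_exists'.1 hj
    exact (scheduleOf_eq_some.1 hm).1
  · rintro j ⟨hj, htj⟩ k ⟨hk, htk⟩
    obtain ⟨hjJ, hj⟩ := scheduleOf_eq_some.1 hj
    obtain ⟨hkJ, hk⟩ := scheduleOf_eq_some.1 hk
    by_contra hne
    refine (not_apart_iff (hJ j hjJ) (hJ k hkJ) (addr j) (addr k)).2 ⟨t, htj, htk⟩ ?_
    refine (hf _ (mem_entries.2 ⟨k, hkJ, rfl⟩)).2 _ (mem_entries.2 ⟨j, hjJ, rfl⟩) (hj.trans hk.symm)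
      ?_ fun he => hne (jobEntry_injOn hJ addr hjJ hkJ he)
    change s.natArr 10 (addr k) ≠ 0
    omega

theorem reward_scheduleOf (hJ : ∀ j ∈ J, j.Valid w)
    (hf : Feasible M (entries addr J) s.mach) :
    reward J (scheduleOf M J (s.natArr 10) addr) = gain (entries addr J) s.mach := by
  unfold reward gain
  rw [Finset.sum_filter, Finset.sum_filter, sum_entries hJ]
  refine Finset.sum_congr rfl fun j hj => ?_
  exact if_congr (scheduleOf_isSome hf hj) rfl rfl

/-- Schedules of the jobs are schedules of the entries, with the machines counted from `1`. -/
theorem reward_le_opt (hJ : ∀ j ∈ J, j.Valid w) {τ : Job → Option (Fin M)}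
    (hτ : IsSchedule J τ) : reward J τ ≤ opt M (entries addr J) := by
  have : Nonempty Job := ⟨⟨0, 0, 0, 0⟩⟩
  have hinv := (jobEntry_injOn hJ addr).leftInvOn_invFunOn
  set g := Function.invFunOn (fun j => jobEntry (addr j) j) (J : Set Job) with hg
  let f : Entry → ℕ := fun r => (τ (g r)).elim 0 fun m => (m : ℕ) + 1
  have hfj : ∀ j ∈ J, f (jobEntry (addr j) j) = (τ j).elim 0 fun m => (m : ℕ) + 1 := by
    intro j hj
    change (τ (g _)).elim 0 _ = _
    rw [hinv hj]
  have hfeas : Feasible M (entries addr J) f := by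
    intro r hr
    obtain ⟨j, hj, rfl⟩ := mem_entries.1 hr
    refine ⟨?_, fun q hq he h0 hne => ?_⟩
    · rw [hfj j hj]
      cases h : τ j with
      | none => exact Nat.zero_le _
      | some m => exact m.2
    · obtain ⟨k, hk, rfl⟩ := mem_entries.1 hq
      rw [hfj j hj] at he h0
      rw [hfj k hk] at he
      cases hτj : τ j with
      | none => simp [hτj] at h0
      | some m =>
        cases hτk : τ k with
        | none => simp [hτj, hτk] at he
        | some m' =>
          simp [hτj, hτk] at he
          have hm : m' = m := Fin.ext he
          subst hm
          by_contra hap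
          obtain ⟨t, htk, htj⟩ := (not_apart_iff (hJ k hk) (hJ j hj) (addr k) (addr j)).1 hap
          exact hne (by rw [hτ.2 m' t ⟨hτk, htk⟩ ⟨hτj, htj⟩])
  refine le_trans (le_of_eq ?_) (le_opt (entries_proper hJ) hfeas)
  unfold reward gain
  rw [Finset.sum_filter, Finset.sum_filter, sum_entries hJ]
  refine Finset.sum_congr rfl fun j hj => if_congr ?_ rfl rfl
  rw [hfj j hj]
  cases τ j <;> simp

end Jobs

/-! ### The approximation ratio -/

theorem win_neg_one_zero {w : ℝ} {A : Finset Entry} (hA : ∀ r ∈ A, Proper w r) :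
    win A (-1) 0 = A :=
  Finset.filter_true_of_mem fun r hr => ⟨(hA r hr).neg_one_le, (hA r hr).neg.le⟩

/-- The factor `1 + 1 / N` is lost twice: once for the rounding of the rewards, and once for the
entries that cross the borders, of which each border loses at most `M * w`. -/
theorem Sched.opt_le {M N : ℕ} {w : ℝ} {A : Finset Entry} {f : Entry → ℕ} {B : Finset ℝ}
    (h : Sched M (N * M * w) (1 + 1 / N) (loss M) A f B) (hA : ∀ r ∈ A, Proper w r)
    (hN : 1 ≤ N) (hM : 1 ≤ M) (hw : 1 ≤ w) :
    opt M A ≤ (1 + 1 / N) ^ 2 / (1 - loss M) * gain A f := by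
  have hN' : (0 : ℝ) < N := by exact_mod_cast hN
  have hq := loss_le_half hM
  have hq' : 0 < 1 - loss M := by linarith
  have hβ : (0 : ℝ) ≤ 1 + 1 / N := by positivity
  have hMw : 0 ≤ M * w := by positivity
  rw [div_mul_eq_mul_div, le_div_iff₀ hq']
  -- if there is only one region, it may be poor, but then nothing is lost at borders
  by_cases hc : Consec B (-1) 0
  · have h₁ := (h.good _ _ hc).ratio
    rw [win_neg_one_zero hA] at h₁
    have h₂ : 0 ≤ gain A f := gain_nonneg hA
    have h₃ : (1 + 1 / N : ℝ) * gain A f ≤ (1 + 1 / N : ℝ) ^ 2 * gain A f := by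
      gcongr
      rw [sq]
      exact le_mul_of_one_le_left hβ (by linarith [show (0 : ℝ) ≤ 1 / N by positivity])
    linarith
  · have h₁ := opt_add_le_of_regions (M := M) (f := f) (κ := (1 + 1 / N) ^ 2 / (1 - loss M)) hA
      (by linarith) h.bounds (by positivity) fun a b hab => ?_
    · rw [win_neg_one_zero hA, div_mul_eq_mul_div, le_div_iff₀ hq'] at h₁
      have : 0 ≤ M * w * (1 - loss M) := by positivity
      linarith
    · have hg := h.good a b hab
      have hlow : N * (M * w) ≤ opt M (win A a b) := by
        rw [← mul_assoc]
        refine hg.low.resolve_left ?_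
        rintro ⟨rfl, rfl⟩
        exact hc hab
      rw [div_mul_eq_mul_div, le_div_iff₀ hq']
      have h₂ : M * w ≤ 1 / N * opt M (win A a b) := by
        rw [one_div, inv_mul_eq_div, le_div_iff₀ hN']
        linarith
      calc (opt M (win A a b) + M * w) * (1 - loss M)
          ≤ (opt M (win A a b) + 1 / N * opt M (win A a b)) * (1 - loss M) := by gcongr
        _ = (1 + 1 / N) * ((1 - loss M) * opt M (win A a b)) := by ring
        _ ≤ (1 + 1 / N) * ((1 + 1 / N) * gain (win A a b) f) :=
            mul_le_mul_of_nonneg_left hg.ratio hβ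
        _ = _ := by ring

/-- The left side is what the algorithm achieves with `N = ⌈3 / ε⌉`: since `1 / N ≤ 1`, `(1 + 1 / N)
^ 2 ≤ 1 + 3 / N ≤ 1 + ε`. -/
theorem ratio_le {M : ℕ} {ε : ℝ} (hM : 1 ≤ M) (hε : 0 < ε) :
    (1 + 1 / accuracy ε : ℝ) ^ 2 / (1 - loss M) ≤
      (M : ℝ) ^ M / ((M : ℝ) ^ M - ((M : ℝ) - 1) ^ M) * (1 + ε) := by
  have hN := one_le_accuracy hε
  have hN' : (1 : ℝ) ≤ accuracy ε := by exact_mod_cast hN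
  have hM' : (0 : ℝ) < M := by exact_mod_cast hM
  have hq := loss_le_half hM
  have hq' : 0 < 1 - loss M := by linarith
  have h₁ : (3 : ℝ) / accuracy ε ≤ ε := by
    rw [div_le_iff₀ (by linarith)]
    have := Nat.le_ceil (3 / ε)
    rw [div_le_iff₀ hε] at this
    rw [accuracy]
    linarith
  have h₂ : (1 + 1 / accuracy ε : ℝ) ^ 2 ≤ 1 + ε := by
    have h₃ : (1 / accuracy ε : ℝ) ≤ 1 := by
      rw [div_le_one (by linarith)]
      exact hN'
    have h₄ : (0 : ℝ) ≤ 1 / accuracy ε := by positivity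
    have h₅ : (3 : ℝ) / accuracy ε = 3 * (1 / accuracy ε) := by ring
    nlinarith
  have h₃ : (M : ℝ) ^ M / ((M : ℝ) ^ M - ((M : ℝ) - 1) ^ M) = 1 / (1 - loss M) := by
    have : ((M : ℝ) - 1) ^ M = (M : ℝ) ^ M * loss M := by
      rw [loss, ← mul_pow]
      congr 1
      field_simp
    rw [this]
    have h0 : (M : ℝ) ^ M ≠ 0 := by positivity
    rw [show (M : ℝ) ^ M - (M : ℝ) ^ M * loss M = (M : ℝ) ^ M * (1 - loss M) by ring,
      div_mul_eq_div_div, div_self h0]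
  rw [h₃, div_mul_eq_mul_div, one_mul]
  gcongr

/-! ### The time bounds -/

/-- An exponent with `n + 2 < 2 ^ depth n`, which bounds the depth of the trees, up to a constant
factor, when there are `n` jobs. -/
def depth (n : ℕ) : ℕ := Nat.log 2 (n + 2) + 1

theorem lt_two_pow_depth (n : ℕ) : n + 2 < 2 ^ depth n := Nat.lt_pow_succ_log_self (by norm_num) _

theorem half_lt_log_two : 1 / 2 < Real.log 2 := by linarith [Real.log_two_gt_d9]

theorem depth_le (n : ℕ) : (depth n + 1 : ℝ) ≤ 6 * Real.log (n + 2) := by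
  have h₁ : (Nat.log 2 (n + 2) : ℝ) * Real.log 2 ≤ Real.log (n + 2) := by
    rw [← Real.log_pow]
    refine Real.log_le_log (by positivity) ?_
    exact_mod_cast Nat.pow_log_le_self 2 (by omega : n + 2 ≠ 0)
  have h₂ : Real.log 2 ≤ Real.log (n + 2) :=
    Real.log_le_log (by norm_num) (by linarith [(Nat.cast_nonneg n : (0 : ℝ) ≤ n)])
  have h₃ := half_lt_log_two
  have h₄ : (0 : ℝ) ≤ Nat.log 2 (n + 2) := Nat.cast_nonneg _
  have h₅ : (Nat.log 2 (n + 2) : ℝ) * (1 / 2) ≤ Nat.log 2 (n + 2) * Real.log 2 := by gcongr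
  rw [depth]
  push_cast
  linarith

theorem accuracy_pow_le {ε : ℝ} (hε : 0 < ε) :
    (accuracy ε : ℝ) ^ 3 ≤ 64 * max 1 (1 / ε ^ 3) := by
  have h₁ : (accuracy ε : ℝ) < 3 / ε + 1 := Nat.ceil_lt_add_one (by positivity)
  rcases le_total ε 1 with h | h
  · have h₂ : 1 ≤ 1 / ε := (one_le_div hε).2 h
    have h₃ : (accuracy ε : ℝ) ≤ 4 * (1 / ε) := by
      rw [show (3 : ℝ) / ε = 3 * (1 / ε) by ring] at h₁
      linarith
    calc (accuracy ε : ℝ) ^ 3 ≤ (4 * (1 / ε)) ^ 3 := by gcongr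
      _ = 64 * (1 / ε ^ 3) := by ring
      _ ≤ _ := by gcongr; exact le_max_right _ _
  · have h₂ : 3 / ε ≤ 3 := div_le_self (by norm_num) h
    have h₃ : (accuracy ε : ℝ) ≤ 4 := by linarith
    calc (accuracy ε : ℝ) ^ 3 ≤ 4 ^ 3 := by gcongr
      _ = 64 * 1 := by norm_num
      _ ≤ _ := by gcongr; exact le_max_left _ _

/-- One factor `N` comes from the number of classes, and two come from the number of cells. -/
theorem update_bound {M K n : ℕ} {w ε : ℝ} (hw : 1 ≤ w) (hε : 0 < ε)
    (hK : (K : ℝ) * Real.log 2 ≤ accuracy ε * (Real.log w + Real.log 2)) :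
    2 * 10 ^ 9 * (((K : ℝ) + 1) * (depth n + 1) * (accuracy ε * (accuracy ε * M * w))) ≤
      10 ^ 13 * (M * w * Real.log (w + 1) * Real.log (n + 2) * max 1 (1 / ε ^ 3)) := by
  have hN : (1 : ℝ) ≤ accuracy ε := by exact_mod_cast one_le_accuracy hε
  have hl := half_lt_log_two
  have h₁ : Real.log w ≤ Real.log (w + 1) := Real.log_le_log (by linarith) (by linarith)
  have h₂ : Real.log 2 ≤ Real.log (w + 1) := Real.log_le_log (by norm_num) (by linarith)
  have hlw : 0 ≤ Real.log (w + 1) := by linarith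
  have hln : 0 ≤ Real.log ((n : ℝ) + 2) :=
    Real.log_nonneg (by linarith [(Nat.cast_nonneg n : (0 : ℝ) ≤ n)])
  have h₃ : (K : ℝ) + 1 ≤ 6 * (accuracy ε * Real.log (w + 1)) := by
    have h₄ : (K : ℝ) * (1 / 2) ≤ K * Real.log 2 := by gcongr
    have h₅ : accuracy ε * (Real.log w + Real.log 2) ≤
        accuracy ε * (Real.log (w + 1) + Real.log (w + 1)) := by gcongr
    have h₆ : Real.log (w + 1) ≤ accuracy ε * Real.log (w + 1) := le_mul_of_one_le_left hlw hN
    linarith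
  calc 2 * 10 ^ 9 * (((K : ℝ) + 1) * (depth n + 1) * (accuracy ε * (accuracy ε * M * w)))
      ≤ 2 * 10 ^ 9 * ((6 * (accuracy ε * Real.log (w + 1))) * (6 * Real.log (n + 2)) *
        (accuracy ε * (accuracy ε * M * w))) := by
        gcongr
        exact depth_le n
    _ = 72 * 10 ^ 9 * (M * w * Real.log (w + 1) * Real.log (n + 2)) * accuracy ε ^ 3 := by ring
    _ ≤ 72 * 10 ^ 9 * (M * w * Real.log (w + 1) * Real.log (n + 2)) *
        (64 * max 1 (1 / ε ^ 3)) := by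
        gcongr
        exact accuracy_pow_le hε
    _ = 4608 * 10 ^ 9 * (M * w * Real.log (w + 1) * Real.log (n + 2) * max 1 (1 / ε ^ 3)) := by
        ring
    _ ≤ _ := by
        gcongr
        norm_num

/-! ### The dynamic algorithm -/

/-- The algorithm, with one program for each kind of request. -/
def algorithm : DynamicAlgorithm := ⟨insertProg, deleteProg, lookupProg, totalProg⟩

theorem maintained_initialStore {M : ℕ} {w : ℝ} (ε : ℝ) (hM : 1 ≤ M)
    (hw : 1 ≤ w) :
    Maintained M w ε (initialStore M w ε) ∅ ∅ := by
  have hopt : opt M ∅ ≤ 0 := opt_le fun f _ => by simp [gain]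
  refine ⟨⟨0, ∅, ∅, ⟨⟨rfl, fun i => .inl ⟨rfl, ?_⟩⟩, by simp, by simp, by simp, by simp, by simp,
    by simp, ?_⟩, by simp, by simp, by simp, by simp, by simp⟩, ⟨?_, by simp, by simp, ?_⟩, ?_, ?_,
    ?_, by simp⟩
  · match i with
    | 0 | 1 | 2 | 3 | k + 4 => simp [content]
  · simp [gain, initialStore]
  · intro r hr
    simp at hr
  · intro x y hxy
    have h₁ : x = -1 := by simpa using hxy.1
    have h₂ : y = 0 := by simpa using hxy.2.1
    have h₃ : win ∅ x y = ∅ := Finset.filter_empty _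
    refine ⟨.inl ⟨h₁, h₂⟩, ?_, ?_⟩
    · rw [h₃]
      refine hopt.trans ?_
      positivity
    · rw [h₃]
      have : gain ∅ (initialStore M w ε).mach = 0 := by simp [gain]
      rw [this, mul_zero]
      have hl := loss_le_half hM
      exact mul_nonpos_of_nonneg_of_nonpos (by linarith) hopt
  · simp [initialStore]
  · simp [initialStore]
  · simp [initialStore]

open Classical in
theorem valid_of_legalHistory {w : ℝ} {h : List Request} (hh : LegalHistory w h) :
    ∀ j ∈ jobsAfter h, j.Valid w := by
  induction h with
  | nil => simp [jobsAfter]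
  | cons r h ih =>
    obtain ⟨hr, hh⟩ := hh
    cases r with
    | insert j =>
      simp only [jobsAfter, Finset.mem_insert, forall_eq_or_imp]
      exact ⟨hr.1, ih hh⟩
    | delete j => exact fun k hk => ih hh k (Finset.mem_of_mem_erase hk)
    | lookup j => exact ih hh
    | total => exact ih hh

/-- Serving the request `r` after the requests `h` takes the memory `s` to `s'`, and the addresses
`addr` of the entries of the present jobs to `addr'`. -/
structure Serves (M : ℕ) (w ε : ℝ) (h : List Request) (r : Request) (s : Store) (addr : Job → ℕ)
    (s' : Store) (addr' : Job → ℕ) : Prop where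
  run : ∃ t : ℕ, Run (algorithm.code r) (s.load r) s' t ∧
    (r.IsUpdate → (t : ℝ) ≤ 10 ^ 13 * (M * w * Real.log (w + 1) *
      Real.log ((jobsAfter h).card + 2) * max 1 (1 / ε ^ 3))) ∧
    (¬ r.IsUpdate → (t : ℝ) ≤ 10 ^ 13 * Real.log ((jobsAfter h).card + 2))
  kept : ¬ r.IsUpdate → addr' = addr ∧ s'.natArr 10 = s.natArr 10
  maintained : ∃ B, Maintained M w ε s' (entries addr' (jobsAfter (r :: h))) B
  answer : CorrectAnswer (jobsAfter h) (scheduleOf M (jobsAfter h) (s.natArr 10) addr) s' r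

section Requests

variable {M : ℕ} {w ε : ℝ} {h : List Request} {s : Store} {addr : Job → ℕ}

theorem Store.hasInput_loadJob (s : Store) (j : Job) : (s.loadJob j).HasInput j := by
  constructor <;> simp [Store.loadJob]

theorem Maintained.loadJob {A : Finset Entry} {B : Finset ℝ} (hI : Maintained M w ε s A B)
    (j : Job) : Maintained M w ε (s.loadJob j) A B := by
  refine hI.of_ext ?_ ?_ ?_ ?_ ?_ rfl rfl rfl
  · have : (s.loadJob j).heap = s.heap := by simp [Store.loadJob]
    rw [this]
    exact .refl _
  all_goals simp [Store.loadJob]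

theorem query_bound {n t : ℕ} (ht : t ≤ 1100 * (depth n + 1)) :
    (t : ℝ) ≤ 10 ^ 13 * Real.log (n + 2) := by
  have h₁ : (t : ℝ) ≤ 1100 * (depth n + 1) := by exact_mod_cast ht
  have h₂ := depth_le n
  have h₃ : 0 ≤ Real.log ((n : ℝ) + 2) :=
    Real.log_nonneg (by linarith [(Nat.cast_nonneg n : (0 : ℝ) ≤ n)])
  linarith

open Classical in
theorem exists_serves_insert {B : Finset ℝ} (hM : 1 ≤ M) (hw : 1 ≤ w) (hε : 0 < ε)
    (hh : LegalHistory w h) (hI : Maintained M w ε s (entries addr (jobsAfter h)) B) {j : Job}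
    (hj : j.Valid w) (hnew : j ∉ jobsAfter h) :
    ∃ s' addr', Serves M w ε h (.insert j) s addr s' addr' := by
  have hJ := valid_of_legalHistory hh
  have hkey : ∀ i, ∀ q ∈ entries addr (jobsAfter h), q.key ≠ (jobEntry i j).key := by
    intro i q hq he
    obtain ⟨k, hk, rfl⟩ := mem_entries.1 hq
    have := (jobEntry_key_eq (hJ k hk).1 (hJ k hk).2.1 hj.1 hj.2.1).1 he
    exact hnew (this ▸ hk)
  obtain ⟨s', t, hrun, i, K, B', hI', hK, ht⟩ := wp_insertProg (Λ := depth (jobsAfter h).card)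
    (hI.loadJob j) (s.hasInput_loadJob j) hj hM hw hε hkey
    (by rw [entries_card hJ]; exact lt_two_pow_depth _)
  refine ⟨s', Function.update addr j i, ⟨t, hrun, fun _ => ht.trans (update_bound hw hε hK),
    fun hn => absurd trivial hn⟩, fun hn => absurd trivial hn, ⟨B', ?_⟩, trivial⟩
  rw [jobsAfter, entries_insert hnew]
  exact hI'

theorem exists_serves_delete {B : Finset ℝ} (hM : 1 ≤ M) (hw : 1 ≤ w) (hε : 0 < ε)
    (hh : LegalHistory w h) (hI : Maintained M w ε s (entries addr (jobsAfter h)) B) {j : Job}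
    (hj : j ∈ jobsAfter h) : ∃ s' addr', Serves M w ε h (.delete j) s addr s' addr' := by
  have hJ := valid_of_legalHistory hh
  obtain ⟨s', t, hrun, K, B', hI', hK, ht⟩ := wp_deleteProg (Λ := depth (jobsAfter h).card)
    (hI.loadJob j) (s.hasInput_loadJob j) hM hw hε (mem_entries.2 ⟨j, hj, rfl⟩)
    (by rw [entries_card hJ]; exact lt_two_pow_depth _)
  refine ⟨s', addr, ⟨t, hrun, fun _ => ht.trans (update_bound hw hε hK),
    fun hn => absurd trivial hn⟩, fun hn => absurd trivial hn, ⟨B', ?_⟩, trivial⟩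
  rw [jobsAfter, entries_erase hJ hj]
  exact hI'

theorem exists_serves_lookup {B : Finset ℝ} (hM : 1 ≤ M) (hw : 1 ≤ w) (hε : 0 < ε)
    (hh : LegalHistory w h) (hI : Maintained M w ε s (entries addr (jobsAfter h)) B) (j : Job) :
    ∃ s' addr', Serves M w ε h (.lookup j) s addr s' addr' := by
  have hJ := valid_of_legalHistory hh
  obtain ⟨s', t, hrun, hI', h10, hans, ht⟩ := wp_lookupProg (Λ := depth (jobsAfter h).card)
    (hI.loadJob j) (s.hasInput_loadJob j) hM hw hε
    (by rw [entries_card hJ]; have := lt_two_pow_depth (jobsAfter h).card; omega)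
  refine ⟨s', addr, ⟨t, hrun, fun hu => hu.elim, fun _ => query_bound ht⟩, fun _ => ⟨rfl, h10⟩,
    ⟨B, hI'⟩, ?_⟩
  change s'.natReg 0 = (scheduleOf M (jobsAfter h) (s.natArr 10) addr j).elim 0 fun m => (m : ℕ) + 1
  rcases hans with ⟨h0, hno⟩ | ⟨q, hq, hqk, hj₁, hj₂, h0⟩
  · have : scheduleOf M (jobsAfter h) (s.natArr 10) addr j = none := by
      rw [Option.eq_none_iff_forall_ne_some]
      intro m hm
      obtain ⟨hj, -⟩ := scheduleOf_eq_some.1 hm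
      exact hno ⟨(hJ j hj).1, (hJ j hj).2.1, _, mem_entries.2 ⟨j, hj, rfl⟩, rfl⟩
    rw [this, h0]
    rfl
  · obtain ⟨k, hk, rfl⟩ := mem_entries.1 hq
    obtain rfl := (jobEntry_key_eq (hJ k hk).1 (hJ k hk).2.1 hj₁ hj₂).1 hqk
    have h0' : s'.natReg 0 = s.natArr 10 (addr k) := h0
    rw [h0']
    cases hσ : scheduleOf M (jobsAfter h) (s.natArr 10) addr k with
    | none =>
      have := scheduleOf_isSome hI.sched.feas hk
      rw [hσ] at this
      simpa using this
    | some m => exact (scheduleOf_eq_some.1 hσ).2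

theorem exists_serves_total {B : Finset ℝ}
    (hh : LegalHistory w h) (hI : Maintained M w ε s (entries addr (jobsAfter h)) B) :
    ∃ s' addr', Serves M w ε h .total s addr s' addr' := by
  obtain ⟨s', t, hrun, hI', h10, hans, ht⟩ := wp_totalProg hI
  refine ⟨s', addr, ⟨t, hrun, fun hu => hu.elim, fun _ => query_bound (by omega)⟩,
    fun _ => ⟨rfl, h10⟩, ⟨B, hI'⟩, ?_⟩
  exact hans.trans (reward_scheduleOf (valid_of_legalHistory hh) hI.sched.feas).symm

theorem exists_serves (hM : 1 ≤ M) (hw : 1 ≤ w) (hε : 0 < ε) {r : Request}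
    (hh : LegalHistory w (r :: h)) (hI : ∃ B, Maintained M w ε s (entries addr (jobsAfter h)) B) :
    ∃ s' addr', Serves M w ε h r s addr s' addr' := by
  obtain ⟨hr, hh⟩ := hh
  obtain ⟨B, hI⟩ := hI
  cases r with
  | insert j => exact exists_serves_insert hM hw hε hh hI hr.1 hr.2
  | delete j => exact exists_serves_delete hM hw hε hh hI hr
  | lookup j => exact exists_serves_lookup hM hw hε hh hI j
  | total => exact exists_serves_total hh hI

end Requests

open Classical in
/-- The memory after the given requests, and the addresses of the entries of the present jobs.
Programs are deterministic; the choice only names the memory that the run produces. -/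
noncomputable def memoryAfter (M : ℕ) (w ε : ℝ) : List Request → Store × (Job → ℕ)
  | [] => (initialStore M w ε, fun _ => 0)
  | r :: h =>
    if H : ∃ D : Store × (Job → ℕ),
        Serves M w ε h r (memoryAfter M w ε h).1 (memoryAfter M w ε h).2 D.1 D.2 then
      H.choose else memoryAfter M w ε h

theorem memoryAfter_cons {M : ℕ} {w ε : ℝ} {r : Request} {h : List Request}
    (H : ∃ s' addr', Serves M w ε h r (memoryAfter M w ε h).1 (memoryAfter M w ε h).2 s' addr') :
    Serves M w ε h r (memoryAfter M w ε h).1 (memoryAfter M w ε h).2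
      (memoryAfter M w ε (r :: h)).1 (memoryAfter M w ε (r :: h)).2 := by
  obtain ⟨s', addr', H⟩ := H
  have H' : ∃ D : Store × (Job → ℕ),
      Serves M w ε h r (memoryAfter M w ε h).1 (memoryAfter M w ε h).2 D.1 D.2 :=
    ⟨(s', addr'), H⟩
  rw [memoryAfter, dif_pos H']
  exact H'.choose_spec

theorem maintained_memoryAfter {M : ℕ} {w ε : ℝ} (hM : 1 ≤ M) (hw : 1 ≤ w) (hε : 0 < ε)
    {h : List Request} (hh : LegalHistory w h) :
    ∃ B, Maintained M w ε (memoryAfter M w ε h).1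
      (entries (memoryAfter M w ε h).2 (jobsAfter h)) B := by
  induction h with
  | nil => exact ⟨∅, maintained_initialStore ε hM hw⟩
  | cons r h ih => exact (memoryAfter_cons (exists_serves hM hw hε hh (ih hh.2))).maintained

/-- One algorithm and one constant `C` serve all `M`, `w`, `ε`. For `w ≥ 2`, `n ≥ 2` and `ε ≤ 1`
the update bound is `O(M w log w log n / ε^3)` and the query bound is `O(log n)`. -/
theorem mainTheorem6 :
    ∃ (A : DynamicAlgorithm) (C : ℝ), 0 < C ∧
      ∀ (M : ℕ) (w ε : ℝ), 1 ≤ M → 1 ≤ w → 0 < ε →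
        A.Maintains M w ε
          ((M : ℝ) ^ M / ((M : ℝ) ^ M - ((M : ℝ) - 1) ^ M) * (1 + ε))
          (fun n => C * (M * w * Real.log (w + 1) * Real.log (n + 2) * max 1 (1 / ε ^ 3)))
          (fun n => C * Real.log (n + 2)) := by
  refine ⟨algorithm, 10 ^ 13, by norm_num, fun M w ε hM hw hε =>
    ⟨fun h => (memoryAfter M w ε h).1, fun h => scheduleOf M (jobsAfter h)
      ((memoryAfter M w ε h).1.natArr 10) (memoryAfter M w ε h).2, rfl, fun h hh => ?_,
    fun r h hh => ?_⟩⟩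
  · obtain ⟨B, hI⟩ := maintained_memoryAfter hM hw hε hh
    have hJ := valid_of_legalHistory hh
    refine ⟨isSchedule_scheduleOf hJ hI.sched.feas, fun τ hτ => ?_⟩
    rw [reward_scheduleOf hJ hI.sched.feas]
    refine (reward_le_opt (addr := (memoryAfter M w ε h).2) hJ hτ).trans ?_
    refine (hI.sched.opt_le hI.proper (one_le_accuracy hε) hM hw).trans ?_
    exact mul_le_mul_of_nonneg_right (ratio_le hM hε) (gain_nonneg hI.proper)
  · have H := memoryAfter_cons (exists_serves hM hw hε hh (maintained_memoryAfter hM hw hε hh.2))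
    refine ⟨H.run, fun hq => ?_, H.answer⟩
    obtain ⟨h₁, h₂⟩ := H.kept hq
    have h₃ : jobsAfter (r :: h) = jobsAfter h := by
      cases r with
      | insert j => exact absurd trivial hq
      | delete j => exact absurd trivial hq
      | lookup j => rfl
      | total => rfl
    dsimp only
    rw [h₁, h₂, h₃]
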